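/- **Conventions.** An operad is a symmetric operad $\mathcal C$ in sets, with operations $\mathcal C(n)$, $n\ge 0$, composition $\gamma$, unit $1\in\mathcal C(1)$ and permutation action. A *lax $\mathcal C$-algebra* is a category $\Gamma$ with a functor $\underline\mu:\Gamma^{n}\to\Gamma$ for every $\mu\in\mathcal C(n)$, and natural *coherence isomorphisms* $$\phi:\underline\mu(\underline\mu_1,\dots,\underline\mu_n)\to\underline{\gamma(\mu,\mu_1,\dots,\mu_n)},\qquad \phi:\underline 1\to \mathrm{Id},\qquad \phi:\underline{\kappa\mu}\to\underline\mu\,\kappa^*$$ ($\kappa$ a permutation), such that the coherence diagrams corresponding to the operad axioms commute: associativity of $\gamma$ for threefold compositions, the two unit axioms, functoriality of the permutation action (product and identity), and compatibility of $\gamma$ with permutations. $Op(\mathcal C)$ is the free operad on the sets $\mathcal C(n)$, $n\ge0$, and $Op(\mathcal C)\to\mathcal C$ is the canonical map of operads. The *coherence category* $G(n)$ has object set $Op(\mathcal C)(n)$, exactly one morphism (an isomorphism) between two objects with the same image in $\mathcal C(n)$, and no other morphisms. The operad structure of $Op(\mathcal C)$, applied vertexwise, makes the nerves $\overline{\mathcal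 C}(n)=BG(n)$ into a simplicial operad $\overline{\mathcal C}$, with a projection $\overline{\mathcal C}\to\mathcal C$. If $\mathcal C$ is a simplicial operad, $\overline{\mathcal C}$ denotes the diagonal of the bisimplicial operad obtained by applying this construction in each simplicial degree. An *equivalence* is a map of simplicial sets whose geometric realization is a homotopy equivalence. Let $(\mathcal B,\boxtimes)$ be a symmetric monoidal category with pullbacks. A *category enhanced in $\mathcal B$* is a category object $\Gamma=(Obj,Mor,S,T,Id,\circ)$ in $\mathcal B$; its nerve is the simplicial object $B\Gamma$ of $\mathcal B$ with $B\Gamma_k=Mor\times_{Obj}\cdots\times_{Obj}Mor$ ($k$ factors; $B\Gamma_0=Obj$). A *lax $\mathcal C$-algebra enhanced over $\mathcal B$* is such a $\Gamma$ with, for every $\mu\in\mathcal C(n)$, maps $Obj^{\boxtimes n}\to Obj$ and $Mor^{\boxtimes n}\to Mor$ compatible with $S,T,Id,\circ$, and with invertible coherence maps $Obj^{\boxtimes\sum k_i}\to Mor$ (composition), $Obj\to Mor$ (unit), $Obj^{\boxtimes n}\to Mor$ (permutations), having the sources and targets analogous to those above, natural, and satisfying the analogous coherence diagrams. An algebra over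 a simplicial operad $\mathcal D$ in $\mathcal B$ is a simplicial object $X$ of $\mathcal B$ with structure maps $X_k^{\boxtimes n}\to X_k$ for each element of $\mathcal D(n)_k$, satisfying the usual unit, associativity and equivariance axioms and natural in $k$. (For $\mathcal B$ the category of sets with $\boxtimes=\times$ this is the ordinary notion.) A $\overline{\mathcal C}$-algebra structure on $B\Gamma$ is said to *extend the lax structure* if every $\mu\in\mathcal C(n)$, viewed as a generator of $Op(\mathcal C)(n)$ and as a degenerate simplex of $\overline{\mathcal C}(n)$ in each degree, acts by (the map induced on nerves by) $\underline\mu$, and if the $1$-simplices of $\overline{\mathcal C}$ given by the morphisms $\mu(\mu_1,\dots,\mu_n)\to\gamma(\mu,\mu_1,\dots,\mu_n)$, $\mu_{1}\to \mathrm{id}$ (from the generator given by $1\in\mathcal C(1)$ to the unit of $Op(\mathcal C)$), and $\kappa\mu\to\mu\kappa^*$ of the coherence categories act on objects of $\Gamma$ (viewed as identity morphisms) by the corresponding coherence isomorphisms $\phi$. **Proposition.** 1. For every operad $\mathcal C$ and every $n$, the arity $n$ term of $\overline{\mathcal C}$ is the nerve of $G(n)$, and the projection of (simplicial) operads $\overline{\mathcal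 C}\to\mathcal C$ is an equivalence $\overline{\mathcal C}(n)\to\mathcal C(n)$ in each arity. The latter also holds for every simplicial operad $\mathcal C$. 2. If $\Gamma$ is a lax $\mathcal C$-algebra, then $B\Gamma$ carries exactly one $\overline{\mathcal C}$-algebra structure extending the lax structure. 3. If $\mathcal B$ is a symmetric monoidal category with pullbacks and $\Gamma$ is a lax $\mathcal C$-algebra enhanced over $\mathcal B$, then $B\Gamma$ carries exactly one structure of a $\overline{\mathcal C}$-algebra in $\mathcal B$ extending the lax structure. 4. More generally, let $\mathcal C_\bullet$ be a simplicial operad and $\Gamma_\bullet$ a simplicial category enhanced in $\mathcal B$, with the structure of a lax $\mathcal C_k$-algebra on $\Gamma_k$ for every $k$, strictly compatible with the simplicial structure. Then the diagonal $k\mapsto (B\Gamma_k)_k$ carries exactly one $\overline{\mathcal C_\bullet}$-algebra structure which in each degree $k$ is given by the degree $k$ part of the structure of 3. on $B\Gamma_k$. -/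

import Mathlib

open CategoryTheory CategoryTheory.Limits MonoidalCategory Opposite

/-- The lexicographic bijection between pairs `(i, j)`, `j < k i`, and `{0, …, ∑ i, k i - 1}`:
the `j`-th input of the `i`-th block. -/
abbrev blk {n : ℕ} {k : Fin n → ℕ} (i : Fin n) (j : Fin (k i)) : Fin (∑ i, k i) :=
  finSigmaFinEquiv ⟨i, j⟩

theorem blk_val {n : ℕ} {k : Fin n → ℕ} (i : Fin n) (j : Fin (k i)) :
    (blk i j : ℕ) = ∑ x ∈ Finset.range i, (if h : x < n then k ⟨x, h⟩ else 0) + j := by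
  rw [finSigmaFinEquiv_apply, Finset.sum_range]
  congr 1
  refine Finset.sum_congr rfl fun x _ => ?_
  rw [dif_pos (x.2.trans i.2)]
  rfl

theorem blk_lt {n : ℕ} {k : Fin n → ℕ} {i i' : Fin n} (j : Fin (k i)) (j' : Fin (k i'))
    (h : i < i') : blk i j < blk i' j' := by
  rw [Fin.lt_def, blk_val, blk_val]
  have h1 := Finset.sum_le_sum_of_subset (f := fun x => if h : x < n then k ⟨x, h⟩ else 0)
    (Finset.range_subset_range.2 (Nat.succ_le_of_lt h))
  rw [Nat.succ_eq_add_one, Finset.sum_range_succ, dif_pos i.2] at h1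
  have := j.2
  simp only [Fin.eta] at h1
  omega

theorem blk_lt_same {n : ℕ} {k : Fin n → ℕ} {i : Fin n} {j j' : Fin (k i)}
    (h : j < j') : blk i j < blk i j' := by
  rw [Fin.lt_def, blk_val, blk_val]
  exact Nat.add_lt_add_left h _

theorem blk_ind {n : ℕ} {k : Fin n → ℕ} {P : Fin (∑ i, k i) → Prop}
    (h : ∀ i j, P (blk i j)) (p) : P p := by
  obtain ⟨⟨i, j⟩, rfl⟩ := finSigmaFinEquiv.surjective p
  exact h i j

theorem blk_lt_iff {n : ℕ} {k : Fin n → ℕ} {i i' : Fin n} {j : Fin (k i)} {j' : Fin (k i')} :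
    blk i j < blk i' j' ↔ i < i' ∨ ∃ h : i = i', Fin.cast (by rw [h]) j < j' := by
  constructor
  · intro h
    rcases lt_trichotomy i i' with h1 | rfl | h1
    · exact Or.inl h1
    · refine Or.inr ⟨rfl, ?_⟩
      by_contra h2
      rcases (not_lt.1 h2).lt_or_eq with h3 | h3
      · exact lt_asymm h (blk_lt_same h3)
      · exact h.ne (by rw [h3]; rfl)
    · exact absurd (blk_lt j' j h1) (lt_asymm h)
  · rintro (h | ⟨rfl, h⟩)
    · exact blk_lt _ _ h
    · exact blk_lt_same h

theorem sum_sum_blk {n : ℕ} {k : Fin n → ℕ} (l : Fin (∑ i, k i) → ℕ) :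
    ∑ i, ∑ j, l (blk i j) = ∑ p, l p := by
  rw [← Equiv.sum_comp finSigmaFinEquiv l, ← Finset.univ_sigma_univ, Finset.sum_sigma]

/-- Lexicographic order on triples: both ways of flattening agree. -/
theorem cast_blk_blk {n : ℕ} {k : Fin n → ℕ} (l : Fin (∑ i, k i) → ℕ) (i : Fin n)
    (j : Fin (k i)) (q : Fin (l (blk i j))) :
    Fin.cast (sum_sum_blk l) (blk i (blk (k := fun j => l (blk i j)) j q)) = blk (blk i j) q := by
  let f : (Σ i, Σ j, Fin (l (blk i j))) → Fin (∑ p, l p) := fun x => blk (blk x.1 x.2.1) x.2.2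
  let u : Fin (∑ i, ∑ j, l (blk i j)) → Σ i, Σ j, Fin (l (blk i j)) := fun x =>
    ⟨(finSigmaFinEquiv.symm x).1, finSigmaFinEquiv.symm (finSigmaFinEquiv.symm x).2⟩
  have hu : ∀ i j q, u (blk i (blk (k := fun j => l (blk i j)) j q)) = ⟨i, j, q⟩ := by
    intro i j q
    simp only [u]
    rw [Equiv.symm_apply_apply]
    dsimp only
    rw [Equiv.symm_apply_apply]
  have hmono : StrictMono (f ∘ u) := by
    intro a b
    induction a using blk_ind with | h i a => ?_
    induction a using blk_ind with | h j q => ?_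
    induction b using blk_ind with | h i' a' => ?_
    induction a' using blk_ind with | h j' q' => ?_
    intro h
    simp only [Function.comp, hu, f]
    rw [blk_lt_iff] at h
    rcases h with h | ⟨rfl, h⟩
    · exact blk_lt _ _ (blk_lt _ _ h)
    · change blk (k := fun j => l (blk i j)) j q < blk (k := fun j => l (blk i j)) j' q' at h
      rw [blk_lt_iff] at h
      rcases h with h | ⟨rfl, h⟩
      · exact blk_lt _ _ (blk_lt_same h)
      · exact blk_lt_same h
  have hsurj : Set.range (f ∘ u) = Set.range (Fin.cast (sum_sum_blk l)) := by
    rw [Function.Surjective.range_eq (f := f ∘ u), Function.Surjective.range_eq]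
    · exact (finCongr (sum_sum_blk l)).surjective
    · intro p
      induction p using blk_ind with | h p q => ?_
      induction p using blk_ind with | h i j => ?_
      exact ⟨blk i (blk (k := fun j => l (blk i j)) j q), by simp only [Function.comp, hu, f]⟩
  have h2 := congrFun ((hmono.range_inj (Fin.cast_strictMono (sum_sum_blk l))).1 hsurj) (blk i (blk (k := fun j => l (blk i j)) j q))
  rw [← h2]
  simp only [Function.comp, hu, f]

/-- The bijection `λ ≀ (κ 1, …, κ m)` of blocks. -/
def blockEquiv {n m : ℕ} {k k' : Fin m → ℕ} (lam : Fin n ≃ Fin m)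
    (κ : ∀ i, Fin (k i) ≃ Fin (k' i)) :
    Fin (∑ j : Fin n, k (lam j)) ≃ Fin (∑ i : Fin m, k' i) :=
  finSigmaFinEquiv.symm.trans
    ((Equiv.sigmaCongr lam (fun j => κ (lam j))).trans finSigmaFinEquiv)

@[simp]
theorem blockEquiv_blk {n m : ℕ} {k k' : Fin m → ℕ} (lam : Fin n ≃ Fin m)
    (κ : ∀ i, Fin (k i) ≃ Fin (k' i)) (j : Fin n) (p : Fin (k (lam j))) :
    blockEquiv lam κ (blk (k := fun j => k (lam j)) j p) = blk (lam j) (κ (lam j) p) := by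
  simp [blockEquiv, Equiv.sigmaCongr]

theorem sum_one_fin (n : ℕ) : n = ∑ _i : Fin 1, n := by simp
theorem sum_fin_one (n : ℕ) : n = ∑ _i : Fin n, 1 := by simp

theorem blk_fin_one (n : ℕ) (i : Fin 1) (j : Fin n) :
    blk (k := fun _ : Fin 1 => n) i j = Fin.cast (sum_one_fin n) j := by
  ext
  rw [finSigmaFinEquiv_one]; rfl

theorem blk_one_fin (n : ℕ) (i : Fin n) (j : Fin 1) :
    blk (k := fun _ : Fin n => 1) i j = Fin.cast (sum_fin_one n) i := by
  ext
  rw [finSigmaFinEquiv_apply]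
  simp

universe w

/-- A symmetric operad in sets. -/
structure Operad where
  /-- the set of `n`-ary operations -/
  Ops : ℕ → Type w
  /-- the action of permutations (a bijection between `Fin n` and `Fin m` forces `n = m`, so this
  is a functor on the groupoid of the sets `Fin n`) -/
  act : ∀ {n m : ℕ}, (Fin n ≃ Fin m) → Ops n → Ops m
  /-- the unit -/
  one : Ops 1
  /-- the composition `γ(μ, ν 1, …, ν n)` -/
  comp : ∀ {n : ℕ} {k : Fin n → ℕ}, Ops n → (∀ i, Ops (k i)) → Ops (∑ i, k i)
  act_refl : ∀ {n : ℕ} (μ : Ops n), act (Equiv.refl _) μ = μ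
  act_trans : ∀ {n m l : ℕ} (κ : Fin n ≃ Fin m) (lam : Fin m ≃ Fin l) (μ : Ops n),
    act (κ.trans lam) μ = act lam (act κ μ)
  one_comp : ∀ {n : ℕ} (μ : Ops n),
    comp one (fun _ => μ) = act (finCongr (sum_one_fin n)) μ
  comp_one : ∀ {n : ℕ} (μ : Ops n),
    comp μ (fun _ => one) = act (finCongr (sum_fin_one n)) μ
  comp_assoc : ∀ {n : ℕ} {k : Fin n → ℕ} {l : Fin (∑ i, k i) → ℕ} (μ : Ops n)
    (ν : ∀ i, Ops (k i)) (ρ : ∀ p, Ops (l p)),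
    comp (comp μ ν) ρ =
      act (finCongr (sum_sum_blk l)) (comp μ (fun i => comp (ν i) (fun j => ρ (blk i j))))
  comp_act : ∀ {n m : ℕ} {k k' : Fin m → ℕ} (lam : Fin n ≃ Fin m)
    (κ : ∀ i, Fin (k i) ≃ Fin (k' i)) (μ : Ops n) (ν : ∀ i, Ops (k i)),
    comp (act lam μ) (fun i => act (κ i) (ν i)) =
      act (blockEquiv lam κ) (comp μ (fun j => ν (lam j)))

namespace Operad

variable (C D E : Operad.{w})

/-- A map of operads. -/
@[ext]
structure Hom where
  /-- the map on operations -/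
  map : ∀ {n : ℕ}, C.Ops n → D.Ops n
  map_act : ∀ {n m : ℕ} (κ : Fin n ≃ Fin m) (μ : C.Ops n), map (C.act κ μ) = D.act κ (map μ)
  map_one : map C.one = D.one
  map_comp : ∀ {n : ℕ} {k : Fin n → ℕ} (μ : C.Ops n) (ν : ∀ i, C.Ops (k i)),
    map (C.comp μ ν) = D.comp (map μ) (fun i => map (ν i))

instance : Category Operad.{w} where
  Hom := Hom
  id C := ⟨fun μ => μ, fun _ _ => rfl, rfl, fun _ _ => rfl⟩
  comp f g := ⟨fun μ => g.map (f.map μ), fun κ μ => by rw [f.map_act, g.map_act],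
    by rw [f.map_one, g.map_one], fun μ ν => by rw [f.map_comp, g.map_comp]⟩

/-- The functor `C ↦ C(n)`. -/
def opsFunctor (n : ℕ) : Operad.{w} ⥤ Type w where
  obj C := C.Ops n
  map f := ↾(fun μ => f.map μ)

variable {C D E}

/-! ### The free operad -/

variable (C) in
/-- Formal iterated operations: planar trees whose inner vertices are labelled by operations of
`C` of the right arity, and whose leaves are labelled by elements of `α`. -/
inductive Tree (α : Type) : Type w
  | leaf (a : α) : Tree α
  | node {n : ℕ} (μ : C.Ops n) (c : Fin n → Tree α) : Tree α

namespace Tree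

variable {α β δ : Type}

/-- The number of leaves. -/
def arity : Tree C α → ℕ
  | leaf _ => 1
  | node _ c => ∑ i, (c i).arity

/-- The label of the `p`-th leaf, in planar order. -/
def lab : (t : Tree C α) → Fin t.arity → α
  | leaf a => fun _ => a
  | node _ c => fun p => (c (finSigmaFinEquiv.symm p).1).lab (finSigmaFinEquiv.symm p).2

/-- The composite in `C` of the operations in the tree, with inputs in planar order. -/
def eval : (t : Tree C α) → C.Ops t.arity
  | leaf _ => C.one
  | node μ c => C.comp μ (fun i => (c i).eval)

/-- Relabelling of leaves. -/
def map (f : α → β) : Tree C α → Tree C β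
  | leaf a => leaf (f a)
  | node μ c => node μ (fun i => (c i).map f)

/-- Grafting: substitution of trees for the leaves. -/
def bind : Tree C α → (α → Tree C β) → Tree C β
  | leaf a, f => f a
  | node μ c, f => node μ (fun i => (c i).bind f)

/-- The image of a tree under a map on operations. -/
def mapOps (f : C ⟶ D) : Tree C α → Tree D α
  | leaf a => leaf a
  | node μ c => node (f.map μ) (fun i => (c i).mapOps f)

theorem map_id (t : Tree C α) : t.map id = t := by
  induction t with
  | leaf a => rfl
  | node μ c ih => simp only [map, ih]

theorem map_map (f : α → β) (g : β → δ) (t : Tree C α) : (t.map f).map g = t.map (g ∘ f) := by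
  induction t with
  | leaf a => rfl
  | node μ c ih => simp only [map, ih]

theorem bind_leaf (t : Tree C α) : t.bind leaf = t := by
  induction t with
  | leaf a => rfl
  | node μ c ih => simp only [bind, ih]

theorem bind_leaf_comp (f : α → β) (t : Tree C α) : t.bind (fun a => leaf (f a)) = t.map f := by
  induction t with
  | leaf a => rfl
  | node μ c ih => simp only [bind, map, ih]

theorem bind_bind (f : α → Tree C β) (g : β → Tree C δ) (t : Tree C α) :
    (t.bind f).bind g = t.bind (fun a => (f a).bind g) := by
  induction t with
  | leaf a => rfl
  | node μ c ih => simp only [bind, ih]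

theorem map_bind (f : α → β) (g : β → Tree C δ) (t : Tree C α) :
    (t.map f).bind g = t.bind (fun a => g (f a)) := by
  induction t with
  | leaf a => rfl
  | node μ c ih => simp only [bind, map, ih]

theorem bind_map (f : α → Tree C β) (g : β → δ) (t : Tree C α) :
    (t.bind f).map g = t.bind (fun a => (f a).map g) := by
  induction t with
  | leaf a => rfl
  | node μ c ih => simp only [bind, map, ih]

/-- The labels of a forest, in planar order. -/
def famLab {m : ℕ} (g : Fin m → Tree C α) (p : Fin (∑ i, (g i).arity)) : α :=
  (g (finSigmaFinEquiv.symm p).1).lab (finSigmaFinEquiv.symm p).2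

theorem famLab_blk {m : ℕ} (g : Fin m → Tree C α) (i : Fin m) (j : Fin (g i).arity) :
    famLab g (blk i j) = (g i).lab j := by
  simp only [famLab]
  rw [Equiv.symm_apply_apply]

theorem lab_blk {n : ℕ} (μ : C.Ops n) (c : Fin n → Tree C α) (i : Fin n)
    (j : Fin (c i).arity) : (node μ c).lab (blk i j) = (c i).lab j :=
  famLab_blk c i j

/-- Two labelled operations agree up to a reordering of the inputs. -/
def Rel {m m' : ℕ} (c : C.Ops m) (f : Fin m → α) (c' : C.Ops m') (f' : Fin m' → α) : Prop :=
  ∃ e : Fin m ≃ Fin m', C.act e c = c' ∧ ∀ p, f' (e p) = f p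

theorem rel_node {n : ℕ} {k : Fin n → ℕ} (μ : C.Ops n) (g : Fin n → Tree C α)
    (c' : ∀ i, C.Ops (k i)) (f' : ∀ i, Fin (k i) → α)
    (h : ∀ i, Rel (g i).eval (g i).lab (c' i) (f' i)) :
    ∃ e : Fin (∑ i, (g i).arity) ≃ Fin (∑ i, k i),
      C.act e (C.comp μ (fun i => (g i).eval)) = C.comp μ c' ∧
      ∀ i j, ∃ j', e (blk i j) = blk i j' ∧ f' i j' = (g i).lab j := by
  choose e he1 he2 using h
  refine ⟨blockEquiv (Equiv.refl _) e, ?_, fun i j => ⟨e i j, ?_, he2 i j⟩⟩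
  · have := C.comp_act (Equiv.refl _) e μ (fun i => (g i).eval)
    simp only [he1, C.act_refl] at this
    exact this.symm
  · exact blockEquiv_blk (Equiv.refl _) e i j

theorem rel_bind (t : Tree C α) (f : α → Tree C β) :
    Rel (t.bind f).eval (t.bind f).lab (C.comp t.eval (fun p => (f (t.lab p)).eval))
      (famLab (fun p => f (t.lab p))) := by
  induction t with
  | leaf a =>
    exact ⟨finCongr (sum_one_fin _), (C.one_comp _).symm, fun p =>
      (congrArg (famLab (fun _ : Fin 1 => f a)) (blk_fin_one _ 0 p).symm).trans
        (famLab_blk (fun _ : Fin 1 => f a) 0 p)⟩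
  | node μ c ih =>
    have hl : ∀ i, (c i).lab = fun j => (node μ c).lab (blk i j) :=
      fun i => funext fun j => (lab_blk μ c i j).symm
    have ih2 : ∀ i (L : Fin (c i).arity → α), (c i).lab = L →
        Rel ((c i).bind f).eval ((c i).bind f).lab
          (C.comp (c i).eval (fun p => (f (L p)).eval)) (famLab (fun p => f (L p))) := by
      rintro i _ rfl
      exact ih i
    obtain ⟨e, he1, he2⟩ := rel_node μ (fun i => (c i).bind f) _ _ (fun i => ih2 i _ (hl i))
    have ha := C.comp_assoc μ (fun i => (c i).eval) (fun p => (f ((node μ c).lab p)).eval)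
    rw [← he1, ← C.act_trans] at ha
    refine ⟨_, ha.symm, fun p => ?_⟩
    induction p using blk_ind with | h i q => ?_
    obtain ⟨j', h1, h2⟩ := he2 i q
    refine Eq.trans ?_ (h2.trans (lab_blk μ (fun i => (c i).bind f) i q).symm)
    refine (congrArg (fun x => famLab (fun p => f ((node μ c).lab p))
      (Fin.cast (sum_sum_blk _) x)) h1).trans ?_
    induction j' using blk_ind with | h j r => ?_
    refine (congrArg (famLab (fun p => f ((node μ c).lab p))) (cast_blk_blk _ i j r)).trans ?_
    exact (famLab_blk (fun p => f ((node μ c).lab p)) (blk i j) r).trans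
      (famLab_blk (fun j => f ((node μ c).lab (blk i j))) j r).symm

theorem rel_map (t : Tree C α) (f : α → β) :
    Rel (t.map f).eval (t.map f).lab t.eval (f ∘ t.lab) := by
  induction t with
  | leaf a => exact ⟨Equiv.refl _, C.act_refl _, fun _ => rfl⟩
  | node μ c ih =>
    obtain ⟨e, he1, he2⟩ := rel_node μ (fun i => (c i).map f) _ _ ih
    refine ⟨e, he1, fun p => ?_⟩
    induction p using blk_ind with | h i q => ?_
    obtain ⟨j', h1, h2⟩ := he2 i q
    exact (congrArg (fun x => f ((node μ c).lab x)) h1).trans <|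
      (congrArg f (lab_blk μ c i j')).trans
      (h2.trans (lab_blk μ (fun i => (c i).map f) i q).symm)

theorem rel_mapOps (F : C ⟶ D) (t : Tree C α) :
    Rel (t.mapOps F).eval (t.mapOps F).lab (F.map t.eval) t.lab := by
  induction t with
  | leaf a => exact ⟨Equiv.refl _, (D.act_refl _).trans F.map_one.symm, fun _ => rfl⟩
  | node μ c ih =>
    obtain ⟨e, he1, he2⟩ := rel_node (F.map μ) (fun i => (c i).mapOps F) _ _ ih
    refine ⟨e, he1.trans (F.map_comp μ (fun i => (c i).eval)).symm, fun p => ?_⟩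
    induction p using blk_ind with | h i q => ?_
    obtain ⟨j', h1, h2⟩ := he2 i q
    exact (congrArg (node μ c).lab h1).trans <| (lab_blk μ c i j').trans (h2.trans (lab_blk _ (fun i => (c i).mapOps F) i q).symm)

theorem Rel.bijective {m m' : ℕ} {c : C.Ops m} {f : Fin m → α} {c' : C.Ops m'}
    {f' : Fin m' → α} (h : Rel c f c' f') (hf' : Function.Bijective f') :
    Function.Bijective f := by
  obtain ⟨e, -, he⟩ := h
  have : f = f' ∘ e := funext fun p => (he p).symm
  rw [this]
  exact hf'.comp e.bijective

theorem Rel.act_eq {m m' n : ℕ} {c : C.Ops m} {f : Fin m → Fin n} {c' : C.Ops m'}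
    {f' : Fin m' → Fin n} (h : Rel c f c' f') (hf : Function.Bijective f)
    (hf' : Function.Bijective f') :
    C.act (Equiv.ofBijective f hf) c = C.act (Equiv.ofBijective f' hf') c' := by
  obtain ⟨e, he1, he⟩ := h
  rw [← he1, ← C.act_trans]
  congr 1
  ext p
  simp [he]

end Tree

variable (C) in
/-- The formal operations of arity `n`: trees with leaves labelled bijectively by `Fin n`. -/
def FreeOps (n : ℕ) : Type w := {t : Tree C (Fin n) // Function.Bijective t.lab}

/-- The operation of `C` obtained by carrying out the composition described by a formal
operation. -/
noncomputable def FreeOps.image {n : ℕ} (σ : FreeOps C n) : C.Ops n :=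
  C.act (Equiv.ofBijective _ σ.2) σ.1.eval

namespace FreeOps

theorem exists_relabel {n m : ℕ} (τ : FreeOps C n) (f : Fin n → Fin m) :
    ∃ κ : Fin (τ.1.map f).arity ≃ Fin n, (∀ p, f (κ p) = (τ.1.map f).lab p) ∧
      C.act κ (τ.1.map f).eval = τ.image := by
  obtain ⟨e, he1, he2⟩ := Tree.rel_map τ.1 f
  refine ⟨e.trans (Equiv.ofBijective _ τ.2), he2, ?_⟩
  rw [C.act_trans, he1]
  rfl

theorem exists_comp {n : ℕ} {k : Fin n → ℕ} (σ : FreeOps C n) (τ : ∀ i, FreeOps C (k i)) :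
    ∃ h : Function.Bijective (σ.1.bind (fun i => (τ i).1.map (blk i))).lab,
      image ⟨σ.1.bind (fun i => (τ i).1.map (blk i)), h⟩ =
        C.comp σ.image (fun i => (τ i).image) := by
  choose κ h1 h2 using fun i => exists_relabel (τ i) (blk i)
  have hr := Tree.rel_bind σ.1 (fun i => (τ i).1.map (blk i))
  have hl : Tree.famLab (fun p => (τ (σ.1.lab p)).1.map (blk (σ.1.lab p))) =
      blockEquiv (Equiv.ofBijective _ σ.2) κ := by
    funext P
    induction P using blk_ind with | h p r => ?_
    rw [Tree.famLab_blk]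
    exact (h1 _ r).symm.trans (blockEquiv_blk (Equiv.ofBijective _ σ.2) κ p r).symm
  have hb : Function.Bijective
      (Tree.famLab (fun p => (τ (σ.1.lab p)).1.map (blk (σ.1.lab p)))) := by
    rw [hl]; exact Equiv.bijective _
  refine ⟨hr.bijective hb, (hr.act_eq _ hb).trans ?_⟩
  have he : Equiv.ofBijective _ hb = blockEquiv (Equiv.ofBijective _ σ.2) κ :=
    Equiv.ext fun p => congrFun hl p
  rw [he]
  refine (C.comp_act (Equiv.ofBijective _ σ.2) κ σ.1.eval
    (fun i => ((τ i).1.map (blk i)).eval)).symm.trans ?_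
  simp only [h2]
  rfl

end FreeOps

variable (C) in
/-- The free operad `Op(C)` on the sets `C(n)`, `n ≥ 0`: permutations relabel the leaves, the unit
is the tree without inner vertices, and composition is grafting. -/
def free : Operad.{w} where
  Ops := FreeOps C
  act κ σ := ⟨σ.1.map κ, (Tree.rel_map σ.1 κ).bijective (κ.bijective.comp σ.2)⟩
  one := ⟨.leaf 0, Function.bijective_iff_has_inverse.2
    ⟨id, fun _ => Subsingleton.elim (α := Fin 1) _ _, fun _ => Subsingleton.elim (α := Fin 1) _ _⟩⟩
  comp σ τ := ⟨σ.1.bind (fun i => (τ i).1.map (blk i)), (FreeOps.exists_comp σ τ).1⟩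
  act_refl σ := Subtype.ext (Tree.map_id σ.1)
  act_trans κ lam σ := Subtype.ext (Tree.map_map κ lam σ.1).symm
  one_comp σ := Subtype.ext <| congrArg (fun f => σ.1.map f) <| funext fun j => blk_fin_one _ 0 j
  comp_one σ := Subtype.ext <| (Tree.bind_leaf_comp (fun i => blk i 0) σ.1).trans <|
    congrArg (fun f => σ.1.map f) <| funext fun i => blk_one_fin _ i 0
  comp_assoc {n k l} σ τ ρ := Subtype.ext <| by
    dsimp only
    rw [Tree.bind_bind, Tree.bind_map]
    congr 1
    funext i
    rw [Tree.map_map, Tree.map_bind, Tree.bind_map]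
    congr 1
    funext j
    rw [Tree.map_map]
    congr 1
    funext q
    exact (cast_blk_blk l i j q).symm
  comp_act lam κ σ τ := Subtype.ext <| by
    dsimp only
    rw [Tree.map_bind, Tree.bind_map]
    congr 1
    funext j
    rw [Tree.map_map, Tree.map_map]
    congr 1
    funext p
    exact (blockEquiv_blk lam κ j p).symm

variable (C) in
/-- The canonical map of operads `Op(C) → C`. -/
noncomputable def freeCounit : free C ⟶ C where
  map := FreeOps.image
  map_act κ σ := by
    refine ((Tree.rel_map σ.1 κ).act_eq _ (κ.bijective.comp σ.2)).trans ?_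
    change _ = C.act κ (C.act _ _)
    rw [← C.act_trans]
    exact congrArg (fun e => C.act e σ.1.eval) (Equiv.ext fun _ => rfl)
  map_one := (congrArg (fun e => C.act e C.one) (Subsingleton.elim _ (Equiv.refl _))).trans
    (C.act_refl _)
  map_comp σ τ := (FreeOps.exists_comp σ τ).2

theorem lab_gen {n : ℕ} (μ : C.Ops n) :
    (Tree.node μ Tree.leaf).lab = (finCongr (sum_fin_one n)).symm := by
  funext p
  induction p using blk_ind (k := fun _ : Fin n => 1) with | h i j => ?_
  refine (Tree.lab_blk μ Tree.leaf i j).trans ?_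
  rw [blk_one_fin]
  rfl

/-- The operation `μ` of `C` as a generator of `Op(C)`: the tree with one inner vertex. -/
def gen {n : ℕ} (μ : C.Ops n) : (free C).Ops n :=
  ⟨.node μ .leaf, by rw [lab_gen]; exact Equiv.bijective _⟩

theorem freeCounit_gen {n : ℕ} (μ : C.Ops n) : (freeCounit C).map (gen μ) = μ := by
  change C.act (Equiv.ofBijective _ (gen μ).2) (C.comp μ (fun _ => C.one)) = μ
  refine (congrArg _ (C.comp_one μ)).trans ((C.act_trans _ _ _).symm.trans ?_)
  refine (congrArg (fun e => C.act e μ) (Equiv.ext fun p => ?_)).trans (C.act_refl μ)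
  exact congrFun (lab_gen μ) _

namespace Tree

variable {α β : Type}

theorem mapOps_map (F : C ⟶ D) (f : α → β) (t : Tree C α) :
    (t.map f).mapOps F = (t.mapOps F).map f := by
  induction t with
  | leaf a => rfl
  | node μ c ih => simp only [map, mapOps, ih]

theorem mapOps_bind (F : C ⟶ D) (f : α → Tree C β) (t : Tree C α) :
    (t.bind f).mapOps F = (t.mapOps F).bind (fun a => (f a).mapOps F) := by
  induction t with
  | leaf a => rfl
  | node μ c ih => simp only [bind, mapOps, ih]

theorem mapOps_id (t : Tree C α) : t.mapOps (𝟙 C) = t := by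
  induction t with
  | leaf a => rfl
  | node μ c ih => simp only [mapOps, ih]; rfl

theorem mapOps_comp (F : C ⟶ D) (G : D ⟶ E) (t : Tree C α) :
    t.mapOps (F ≫ G) = (t.mapOps F).mapOps G := by
  induction t with
  | leaf a => rfl
  | node μ c ih => simp only [mapOps, ih]; rfl

end Tree

/-- The effect of a map of operads on formal operations. -/
def freeMap (F : C ⟶ D) : free C ⟶ free D where
  map σ := ⟨σ.1.mapOps F, (Tree.rel_mapOps F σ.1).bijective σ.2⟩
  map_act κ σ := Subtype.ext (Tree.mapOps_map F κ σ.1)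
  map_one := rfl
  map_comp σ τ := Subtype.ext <| (Tree.mapOps_bind F _ σ.1).trans <| by
    simp only [Tree.mapOps_map]
    rfl

theorem freeCounit_freeMap (F : C ⟶ D) {n : ℕ} (σ : (free C).Ops n) :
    (freeCounit D).map ((freeMap F).map σ) = F.map ((freeCounit C).map σ) :=
  ((Tree.rel_mapOps F σ.1).act_eq _ σ.2).trans (F.map_act _ _).symm

/-! ### The coherence categories and the simplicial operad -/

variable (C) in
/-- The coherence category `G(n)`: its objects are the formal operations of arity `n`, and there
is exactly one morphism (an isomorphism) between two formal operations with the same image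
in `C(n)`, and none otherwise. -/
@[ext]
structure Coh (n : ℕ) : Type w where
  /-- the underlying formal operation -/
  op : (free C).Ops n

/-- The operation of `C` underlying an object of the coherence category. -/
noncomputable def Coh.image {n : ℕ} (σ : Coh C n) : C.Ops n := (freeCounit C).map σ.op

instance (n : ℕ) : Category.{0} (Coh C n) where
  Hom σ τ := PLift (σ.image = τ.image)
  id _ := ⟨rfl⟩
  comp f g := ⟨f.down.trans g.down⟩

/-- The canonical isomorphism between two formal operations with the same image. -/
def Coh.homMk {n : ℕ} {σ τ : Coh C n} (h : σ.image = τ.image) : σ ⟶ τ := ⟨h⟩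

theorem Coh.image_eq {n : ℕ} {σ τ : Coh C n} (f : σ ⟶ τ) : σ.image = τ.image := f.down

instance (n : ℕ) : Quiver.IsThin (Coh C n) := fun _ _ => ⟨fun ⟨_⟩ ⟨_⟩ => rfl⟩

theorem Coh.chain_ext {J : Type*} [Category J] {n : ℕ} {c c' : J ⥤ Coh C n}
    (h : ∀ j, (c.obj j).op = (c'.obj j).op) : c = c' :=
  CategoryTheory.Functor.ext (fun j => Coh.ext (h j)) (fun _ _ _ => Subsingleton.elim _ _)

variable (C) in
/-- The operad whose operations are the diagrams of shape `J` in the coherence categories, with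
the operad structure of `Op(C)` applied pointwise. -/
def diagrams (J : Type) [Category.{0} J] : Operad.{w} where
  Ops n := J ⥤ Coh C n
  act κ c :=
    { obj := fun j => ⟨(free C).act κ (c.obj j).op⟩
      map := fun f => Coh.homMk <| ((freeCounit C).map_act κ _).trans <|
        (congrArg (C.act κ) (Coh.image_eq (c.map f))).trans ((freeCounit C).map_act κ _).symm }
  one := (Functor.const J).obj ⟨(free C).one⟩
  comp c d :=
    { obj := fun j => ⟨(free C).comp (c.obj j).op (fun i => ((d i).obj j).op)⟩
      map := fun f => Coh.homMk <| ((freeCounit C).map_comp _ _).trans <|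
        (congrArg₂ C.comp (Coh.image_eq (c.map f))
          (funext fun i => Coh.image_eq ((d i).map f))).trans
          ((freeCounit C).map_comp _ _).symm }
  act_refl _ := Coh.chain_ext fun _ => (free C).act_refl _
  act_trans κ lam _ := Coh.chain_ext fun _ => (free C).act_trans κ lam _
  one_comp _ := Coh.chain_ext fun _ => (free C).one_comp _
  comp_one _ := Coh.chain_ext fun _ => (free C).comp_one _
  comp_assoc _ _ _ := Coh.chain_ext fun _ => (free C).comp_assoc _ _ _
  comp_act lam κ _ _ := Coh.chain_ext fun _ => (free C).comp_act lam κ _ _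

variable (C) in
/-- The simplicial operad `C̄`: in simplicial degree `k`, its operations of arity `n` are
the chains of `k` composable morphisms in `G(n)`. -/
def bar : SimplicialObject Operad.{w} where
  obj Δ := diagrams C (Fin (Δ.unop.len + 1))
  map θ :=
    { map := fun {n} c => (nerve (Coh C n)).map θ c
      map_act := fun _ _ => rfl
      map_one := rfl
      map_comp := fun _ _ => rfl }
  map_id _ := rfl
  map_comp _ _ := rfl

/-- The arity `n` term of `C̄` is the nerve of the coherence category `G(n)`. -/
theorem bar_comp_opsFunctor (n : ℕ) : bar C ⋙ opsFunctor n = nerve (Coh C n) := rfl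

/-- The effect of a map of operads on coherence categories. -/
def cohMap (F : C ⟶ D) (n : ℕ) : Coh C n ⥤ Coh D n where
  obj σ := ⟨(freeMap F).map σ.op⟩
  map f := Coh.homMk <| (freeCounit_freeMap F _).trans <|
    (congrArg F.map (Coh.image_eq f)).trans (freeCounit_freeMap F _).symm

/-- The functor `C ↦ C̄`. -/
def barFunctor : Operad.{w} ⥤ SimplicialObject Operad.{w} where
  obj C := bar C
  map F :=
    { app := fun _ =>
        { map := fun {n} c => c ⋙ cohMap F n
          map_act := fun κ c => Coh.chain_ext fun j => (freeMap F).map_act κ _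
          map_one := Coh.chain_ext fun j => (freeMap F).map_one
          map_comp := fun c d => Coh.chain_ext fun j => (freeMap F).map_comp _ _ }
      naturality := fun _ _ _ => rfl }
  map_id C := by
    apply NatTrans.ext
    funext Δ
    apply Hom.ext
    funext n c
    exact Coh.chain_ext (C := C) (c' := c) fun j => Subtype.ext (Tree.mapOps_id (c.obj j).op.1)
  map_comp {C D E} F G := by
    apply NatTrans.ext
    funext Δ
    apply Hom.ext
    funext n c
    exact Coh.chain_ext (C := E) (c := c ⋙ cohMap (F ≫ G) n)
      (c' := (c ⋙ cohMap F n) ⋙ cohMap G n)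
      fun j => Subtype.ext (Tree.mapOps_comp F G (c.obj j).op.1)

variable (C) in
/-- The canonical projection from `C̄` to `C`, viewed as a constant simplicial operad. -/
noncomputable def barProj : bar C ⟶ (Functor.const _).obj C where
  app _ :=
    { map := fun {n} (c : ComposableArrows (Coh C n) _) => (c.obj 0).image
      map_act := fun κ c => (freeCounit C).map_act κ _
      map_one := (freeCounit C).map_one
      map_comp := fun c d => (freeCounit C).map_comp _ _ }
  naturality _ _ θ := by
    apply Hom.ext
    funext n (c : ComposableArrows (Coh C n) _)
    exact (Coh.image_eq (c.map (homOfLE (Fin.zero_le _)))).symm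

/-- For a simplicial operad `C`, the diagonal of the bisimplicial operad obtained by applying
`C ↦ C̄` in each simplicial degree. -/
def barDiag (C : SimplicialObject Operad.{w}) : SimplicialObject Operad.{w} :=
  Functor.diag _ ⋙ Functor.uncurry.obj (C ⋙ barFunctor)

/-- The canonical projection from (the diagonal of) `C̄` to `C`. -/
noncomputable def barDiagProj (C : SimplicialObject Operad.{w}) : barDiag C ⟶ C where
  app Δ := (barProj (C.obj Δ)).app Δ
  naturality _ _ θ := by
    apply Hom.ext
    funext n (c : ComposableArrows (Coh _ n) _)
    refine (freeCounit_freeMap (C.map θ) _).trans ?_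
    exact congrArg (C.map θ).map (Coh.image_eq (c.map (homOfLE (Fin.zero_le _)))).symm

end Operad

/-- An equivalence of simplicial sets: a map whose geometric realization is a homotopy
equivalence. -/
def IsEquivalence {X Y : SSet.{w}} (f : X ⟶ Y) : Prop :=
  ∃ e : ContinuousMap.HomotopyEquiv (SSet.toTop.obj X) (SSet.toTop.obj Y),
    e.toFun = (SSet.toTop.map f).hom

universe v u

/-! ### Lax algebras and algebras in sets -/

/-- The structure of a lax `C`-algebra on a category `Γ`. -/
structure LaxAlgebra (C : Operad.{w}) (Γ : Type u) [Category.{v} Γ] where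
  /-- the functor `Γ^n ⥤ Γ` of an `n`-ary operation -/
  op : ∀ {n : ℕ}, C.Ops n → (Fin n → Γ) ⥤ Γ
  /-- the coherence `μ(ν 1, …, ν n) ≅ γ(μ, ν 1, …, ν n)` -/
  compIso : ∀ {n : ℕ} {k : Fin n → ℕ} (μ : C.Ops n) (ν : ∀ i, C.Ops (k i)),
    Functor.pi' (fun i => Pi.comap (fun _ => Γ) (blk i) ⋙ op (ν i)) ⋙ op μ ≅ op (C.comp μ ν)
  /-- the coherence `1 ≅ Id` -/
  oneIso : op C.one ≅ Pi.eval (fun _ => Γ) 0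
  /-- the coherence `κ μ ≅ μ κ^*` -/
  actIso : ∀ {n m : ℕ} (κ : Fin n ≃ Fin m) (μ : C.Ops n),
    op (C.act κ μ) ≅ Pi.comap (fun _ => Γ) κ ⋙ op μ
  comp_assoc : ∀ {n : ℕ} {k : Fin n → ℕ} {l : Fin (∑ i, k i) → ℕ} (μ : C.Ops n)
    (ν : ∀ i, C.Ops (k i)) (ρ : ∀ p, C.Ops (l p)) (x : Fin (∑ p, l p) → Γ),
    Arrow.mk ((op μ).map (X := fun i => (op (ν i)).obj fun j => (op (ρ (blk i j))).obj
            fun q => x (Fin.cast (sum_sum_blk l) (blk i (blk j q))))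
          (fun i => (compIso (ν i) (fun j => ρ (blk i j))).hom.app
            (fun q => x (Fin.cast (sum_sum_blk l) (blk i q)))) ≫
        (compIso μ (fun i => C.comp (ν i) (fun j => ρ (blk i j)))).hom.app
          (fun q => x (Fin.cast (sum_sum_blk l) q))) =
      Arrow.mk ((compIso μ ν).hom.app (fun p => (op (ρ p)).obj (fun q => x (blk p q))) ≫
        (compIso (C.comp μ ν) ρ).hom.app x)
  one_comp : ∀ {n : ℕ} (μ : C.Ops n) (x : Fin (∑ _i : Fin 1, n) → Γ),
    Arrow.mk ((compIso C.one (fun _ => μ)).hom.app x) =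
      Arrow.mk (oneIso.hom.app (fun i => (op μ).obj (fun j => x (blk i j))))
  comp_one : ∀ {n : ℕ} (μ : C.Ops n) (x : Fin (∑ _i : Fin n, 1) → Γ),
    Arrow.mk ((compIso μ (fun _ => C.one)).hom.app x) =
      Arrow.mk ((op μ).map (X := fun i => (op C.one).obj fun j => x (blk i j))
        (fun i => oneIso.hom.app (fun j => x (blk i j))))
  act_refl : ∀ {n : ℕ} (μ : C.Ops n) (x : Fin n → Γ),
    Arrow.mk ((actIso (Equiv.refl _) μ).hom.app x) = Arrow.mk (𝟙 ((op μ).obj x))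
  act_trans : ∀ {n m l : ℕ} (κ : Fin n ≃ Fin m) (lam : Fin m ≃ Fin l) (μ : C.Ops n)
    (x : Fin l → Γ),
    Arrow.mk ((actIso (κ.trans lam) μ).hom.app x) =
      Arrow.mk ((actIso lam (C.act κ μ)).hom.app x ≫ (actIso κ μ).hom.app (fun j => x (lam j)))
  comp_act : ∀ {n m : ℕ} {k k' : Fin m → ℕ} (lam : Fin n ≃ Fin m)
    (κ : ∀ i, Fin (k i) ≃ Fin (k' i)) (μ : C.Ops n) (ν : ∀ i, C.Ops (k i))
    (x : Fin (∑ i, k' i) → Γ),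
    (compIso (C.act lam μ) (fun i => C.act (κ i) (ν i))).hom.app x ≫
        eqToHom (by rw [C.comp_act]) ≫
        (actIso (blockEquiv lam κ) (C.comp μ (fun j => ν (lam j)))).hom.app x =
      (op (C.act lam μ)).map (fun i => (actIso (κ i) (ν i)).hom.app (fun p => x (blk i p))) ≫
        (actIso lam μ).hom.app (fun i => (op (ν i)).obj (fun p => x (blk i (κ i p)))) ≫
        eqToHom (congrArg (op μ).obj (funext fun j => congrArg (op (ν (lam j))).obj
          (funext fun p => congrArg x (blockEquiv_blk lam κ j p).symm))) ≫
        (compIso μ (fun j => ν (lam j))).hom.app (fun q => x (blockEquiv lam κ q))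

/-- An algebra over an operad in sets. -/
@[ext]
structure OperadAlgebra (C : Operad.{w}) (X : Type u) where
  /-- the structure maps `C(n) × X^n → X` -/
  act : ∀ {n : ℕ}, C.Ops n → (Fin n → X) → X
  act_one : ∀ x, act C.one x = x 0
  act_comp : ∀ {n : ℕ} {k : Fin n → ℕ} (μ : C.Ops n) (ν : ∀ i, C.Ops (k i))
    (x : Fin (∑ i, k i) → X),
    act (C.comp μ ν) x = act μ (fun i => act (ν i) (fun j => x (blk i j)))
  act_act : ∀ {n m : ℕ} (κ : Fin n ≃ Fin m) (μ : C.Ops n) (x : Fin m → X),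
    act (C.act κ μ) x = act μ (fun j => x (κ j))

/-- An algebra over a simplicial operad in simplicial sets: algebras in each simplicial degree,
natural with respect to the simplicial structure. -/
@[ext]
structure SimplicialAlgebra (D : SimplicialObject Operad.{w}) (X : SSet.{u}) where
  /-- the algebra structure in each degree -/
  alg : ∀ Δ, OperadAlgebra (D.obj Δ) (X.obj Δ)
  map_act : ∀ {Δ Δ'} (θ : Δ ⟶ Δ') {n : ℕ} (c : (D.obj Δ).Ops n) (x : Fin n → X.obj Δ),
    X.map θ ((alg Δ).act c x) = (alg Δ').act ((D.map θ).map c) (fun i => X.map θ (x i))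

namespace Operad

variable {C : Operad.{w}}

/-- The generator of `Op(C)` given by `μ`, as an object of the coherence category. -/
def Coh.gen {n : ℕ} (μ : C.Ops n) : Coh C n := ⟨Operad.gen μ⟩

theorem Coh.image_gen {n : ℕ} (μ : C.Ops n) : (Coh.gen μ).image = μ := freeCounit_gen μ

/-- The operation `μ`, as a degenerate chain in the coherence category. -/
def constGen (Δ : SimplexCategoryᵒᵖ) {n : ℕ} (μ : C.Ops n) : ((bar C).obj Δ).Ops n :=
  (Functor.const (Fin (Δ.unop.len + 1))).obj (Coh.gen μ)

/-- The coherence morphism `μ(ν 1, …, ν n) → γ(μ, ν 1, …, ν n)`. -/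
def Coh.compHom {n : ℕ} {k : Fin n → ℕ} (μ : C.Ops n) (ν : ∀ i, C.Ops (k i)) :
    (⟨(free C).comp (Operad.gen μ) (fun i => Operad.gen (ν i))⟩ : Coh C _) ⟶
      Coh.gen (C.comp μ ν) :=
  Coh.homMk <| ((freeCounit C).map_comp _ _).trans <|
    (congrArg₂ C.comp (freeCounit_gen μ) (funext fun i => freeCounit_gen (ν i))).trans
      (freeCounit_gen _).symm

variable (C) in
/-- The coherence morphism from the generator given by the unit of `C` to the unit of `Op(C)`. -/
def Coh.oneHom : Coh.gen C.one ⟶ (⟨(free C).one⟩ : Coh C 1) :=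
  Coh.homMk <| (freeCounit_gen _).trans (freeCounit C).map_one.symm

/-- The coherence morphism `κ μ → μ κ^*`. -/
def Coh.actHom {n m : ℕ} (κ : Fin n ≃ Fin m) (μ : C.Ops n) :
    Coh.gen (C.act κ μ) ⟶ (⟨(free C).act κ (Operad.gen μ)⟩ : Coh C m) :=
  Coh.homMk <| (freeCounit_gen _).trans <|
    (congrArg (C.act κ) (freeCounit_gen μ)).symm.trans ((freeCounit C).map_act _ _).symm

/-- A morphism of the coherence category, as an operation of `C̄` in simplicial degree one. -/
def edge {n : ℕ} {σ τ : Coh C n} (f : σ ⟶ τ) :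
    ((bar C).obj (op (SimplexCategory.mk 1))).Ops n :=
  ComposableArrows.mk₁ f

end Operad

/-- A `C̄`-algebra structure on the nerve of a lax `C`-algebra is the canonical one if it extends
the given data: the operations of `C` act by the given functors, and the coherence morphisms
(of simplicial degree one) act on objects (viewed as identities) by the given coherence
isomorphisms. -/
structure IsCanonical {C : Operad.{w}} {Γ : Type u} [Category.{v} Γ] (L : LaxAlgebra C Γ)
    (A : SimplicialAlgebra (Operad.bar C) (nerve Γ)) : Prop where
  act_gen : ∀ (Δ : SimplexCategoryᵒᵖ) {n : ℕ} (μ : C.Ops n)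
    (a : Fin n → ComposableArrows Γ Δ.unop.len),
    (A.alg Δ).act (Operad.constGen Δ μ) a = Functor.pi' a ⋙ L.op μ
  act_compHom : ∀ {n : ℕ} {k : Fin n → ℕ} (μ : C.Ops n) (ν : ∀ i, C.Ops (k i))
    (x : Fin (∑ i, k i) → Γ),
    (A.alg _).act (Operad.edge (Operad.Coh.compHom μ ν))
        (fun i => ComposableArrows.mk₁ (𝟙 (x i))) =
      ComposableArrows.mk₁ ((L.compIso μ ν).hom.app x)
  act_oneHom : ∀ (x : Fin 1 → Γ),
    (A.alg _).act (Operad.edge (Operad.Coh.oneHom C))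
        (fun i => ComposableArrows.mk₁ (𝟙 (x i))) =
      ComposableArrows.mk₁ (L.oneIso.hom.app x)
  act_actHom : ∀ {n m : ℕ} (κ : Fin n ≃ Fin m) (μ : C.Ops n) (x : Fin m → Γ),
    (A.alg _).act (Operad.edge (Operad.Coh.actHom κ μ))
        (fun i => ComposableArrows.mk₁ (𝟙 (x i))) =
      ComposableArrows.mk₁ ((L.actIso κ μ).hom.app x)

/-! ### Tensor powers -/

section TensorPowers

variable {B : Type u} [Category.{v} B] [MonoidalCategory B]

/-- The tensor power `X ⊗ (X ⊗ (⋯ ⊗ 𝟙))`. -/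
def tpow (X : B) : ℕ → B
  | 0 => 𝟙_ B
  | n + 1 => X ⊗ tpow X n

/-- The tensor power of a morphism. -/
def tmap {X Y : B} (f : X ⟶ Y) : ∀ n, tpow X n ⟶ tpow Y n
  | 0 => 𝟙 _
  | n + 1 => f ⊗ₘ tmap f n

/-- The canonical isomorphism between tensor powers of equal exponents. -/
def tcast (X : B) {n m : ℕ} (h : n = m) : tpow X n ⟶ tpow X m := eqToHom (congrArg (tpow X) h)

/-- The canonical (associativity) isomorphism `X^{a + b} ⟶ X^a ⊗ X^b`. -/
def tsplit (X : B) (b : ℕ) : ∀ a, tpow X (a + b) ⟶ tpow X a ⊗ tpow X b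
  | 0 => tcast X (Nat.zero_add b) ≫ (λ_ (tpow X b)).inv
  | a + 1 => tcast X (Nat.succ_add a b) ≫ X ◁ tsplit X b a ≫
      (α_ X (tpow X a) (tpow X b)).inv

/-- The tensor product `f 0 ⊗ ⋯ ⊗ f (n - 1)` of morphisms `X^{k i} ⟶ Y`, as a morphism from the
tensor power with exponent `∑ i, k i`. -/
def tblock {X Y : B} : ∀ {n : ℕ} {k : Fin n → ℕ} (_ : ∀ i, tpow X (k i) ⟶ Y),
    tpow X (∑ i, k i) ⟶ tpow Y n
  | 0, k, _ => tcast X (Fin.sum_univ_zero k)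
  | _ + 1, k, f => tcast X (Fin.sum_univ_succ k) ≫ tsplit X _ _ ≫
      (f 0 ⊗ₘ tblock (fun i => f i.succ))

/-- The symmetry isomorphism moving the `i`-th tensor factor to the front. -/
def tpull [SymmetricCategory B] (X : B) : ∀ {n : ℕ} (_ : Fin (n + 1)), tpow X (n + 1) ⟶ X ⊗ tpow X n
  | 0, _ => 𝟙 _
  | n + 1, i => Fin.cases (motive := fun _ => tpow X (n + 2) ⟶ X ⊗ tpow X (n + 1)) (𝟙 _)
      (fun j => X ◁ tpull X j ≫ (α_ X X (tpow X n)).inv ≫ (β_ X X).hom ▷ tpow X n ≫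
        (α_ X X (tpow X n)).hom) i

/-- The bijection obtained from `κ` by removing `0` from the source and `κ 0` from the target. -/
def removeZero {n m : ℕ} (κ : Fin (n + 1) ≃ Fin (m + 1)) : Fin n ≃ Fin m :=
  Equiv.removeNone ((finSuccEquiv' 0).symm.trans (κ.trans (finSuccEquiv' (κ 0))))

/-- The symmetry isomorphism `κ^*` permuting tensor factors: the `j`-th factor of the target
is the `κ j`-th factor of the source. -/
def tperm [SymmetricCategory B] (X : B) : ∀ {n m : ℕ} (_ : Fin n ≃ Fin m), tpow X m ⟶ tpow X n
  | 0, 0, _ => 𝟙 _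
  | 0, _ + 1, κ => (κ.symm 0).elim0
  | _ + 1, 0, κ => (κ 0).elim0
  | _ + 1, _ + 1, κ => tpull X (κ 0) ≫ X ◁ tperm X (removeZero κ)

theorem tmap_id (X : B) (n : ℕ) : tmap (𝟙 X) n = 𝟙 _ := by
  induction n with
  | zero => rfl
  | succ n ih => simp only [tmap, ih, id_tensorHom_id]; rfl

theorem tmap_comp {X Y Z : B} (f : X ⟶ Y) (g : Y ⟶ Z) (n : ℕ) :
    tmap (f ≫ g) n = tmap f n ≫ tmap g n := by
  induction n with
  | zero => exact (Category.comp_id _).symm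
  | succ n ih =>
    rw [tmap, ih]
    exact (tensorHom_comp_tensorHom _ _ _ _).symm

end TensorPowers

/-! ### Categories enhanced in a category -/

/-- A category enhanced in `B`, that is, a category object in `B`. -/
structure CatObj (B : Type u) [Category.{v} B] [HasPullbacks B] where
  /-- the object of objects -/
  O : B
  /-- the object of morphisms -/
  M : B
  /-- source -/
  s : M ⟶ O
  /-- target -/
  t : M ⟶ O
  /-- identities -/
  e : O ⟶ M
  /-- composition (first factor first) -/
  c : pullback t s ⟶ M
  e_s : e ≫ s = 𝟙 O
  e_t : e ≫ t = 𝟙 O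
  c_s : c ≫ s = pullback.fst t s ≫ s
  c_t : c ≫ t = pullback.snd t s ≫ t
  e_c : ∀ {T : B} (f : T ⟶ M) (h : (f ≫ s ≫ e) ≫ t = f ≫ s), pullback.lift (f ≫ s ≫ e) f h ≫ c = f
  c_e : ∀ {T : B} (f : T ⟶ M) (h : f ≫ t = (f ≫ t ≫ e) ≫ s), pullback.lift f (f ≫ t ≫ e) h ≫ c = f
  c_c : ∀ {T : B} (f g h : T ⟶ M) (w : f ≫ t = g ≫ s) (w' : g ≫ t = h ≫ s)
    (w₁ : (pullback.lift f g w ≫ c) ≫ t = h ≫ s) (w₂ : f ≫ t = (pullback.lift g h w' ≫ c) ≫ s),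
    pullback.lift (pullback.lift f g w ≫ c) h w₁ ≫ c =
      pullback.lift f (pullback.lift g h w' ≫ c) w₂ ≫ c

namespace CatObj

variable {B : Type u} [Category.{v} B] [HasPullbacks B] (Γ : CatObj B)

variable {Γ} in
theorem lift_c_s {T : B} (f g : T ⟶ Γ.M) (w : f ≫ Γ.t = g ≫ Γ.s) :
    (pullback.lift f g w ≫ Γ.c) ≫ Γ.s = f ≫ Γ.s := by
  rw [Category.assoc, Γ.c_s, pullback.lift_fst_assoc]

variable {Γ} in
theorem lift_c_t {T : B} (f g : T ⟶ Γ.M) (w : f ≫ Γ.t = g ≫ Γ.s) :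
    (pullback.lift f g w ≫ Γ.c) ≫ Γ.t = g ≫ Γ.t := by
  rw [Category.assoc, Γ.c_t, pullback.lift_snd_assoc]

/-- `f` and `g` are composable and `h` is their composite (`f` first). -/
def IsComp {T : B} (f g h : T ⟶ Γ.M) : Prop :=
  ∃ w : f ≫ Γ.t = g ≫ Γ.s, pullback.lift f g w ≫ Γ.c = h

/-- `f` takes values in isomorphisms: it has a two-sided inverse. -/
def IsIsoValued {T : B} (f : T ⟶ Γ.M) : Prop :=
  ∃ g : T ⟶ Γ.M, Γ.IsComp f g (f ≫ Γ.s ≫ Γ.e) ∧ Γ.IsComp g f (f ≫ Γ.t ≫ Γ.e)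

/-- The category of `T`-valued points. -/
structure Pt (T : B) where
  /-- the underlying morphism -/
  pt : T ⟶ Γ.O

noncomputable instance (T : B) : Category.{v} (Γ.Pt T) where
  Hom x y := {f : T ⟶ Γ.M // f ≫ Γ.s = x.pt ∧ f ≫ Γ.t = y.pt}
  id x := ⟨x.pt ≫ Γ.e, by simp [Γ.e_s], by simp [Γ.e_t]⟩
  comp f g := ⟨pullback.lift f.1 g.1 (f.2.2.trans g.2.1.symm) ≫ Γ.c,
    (lift_c_s _ _ _).trans f.2.1, (lift_c_t _ _ _).trans g.2.2⟩
  id_comp {x y} f := by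
    apply Subtype.ext
    have h : f.1 ≫ Γ.s ≫ Γ.e = x.pt ≫ Γ.e := (Category.assoc _ _ _).symm.trans (congrArg (· ≫ Γ.e) f.2.1)
    have := Γ.e_c f.1 (by simp [Γ.e_t])
    simpa only [h] using this
  comp_id {x y} f := by
    apply Subtype.ext
    have h : f.1 ≫ Γ.t ≫ Γ.e = y.pt ≫ Γ.e := (Category.assoc _ _ _).symm.trans (congrArg (· ≫ Γ.e) f.2.2)
    have := Γ.c_e f.1 (by simp [Γ.e_s])
    simpa only [h] using this
  assoc f g h := Subtype.ext <| Γ.c_c _ _ _ _ _ _ _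

/-- The morphism of points given by a `T`-valued morphism. -/
def ptHom {T : B} {x y : Γ.Pt T} (f : T ⟶ Γ.M) (hs : f ≫ Γ.s = x.pt) (ht : f ≫ Γ.t = y.pt) :
    x ⟶ y := ⟨f, hs, ht⟩

/-- The `k`-fold fibre product `M ×_O ⋯ ×_O M`, with the source of the first factor. -/
noncomputable def chains : ℕ → Over Γ.O
  | 0 => Over.mk (𝟙 Γ.O)
  | k + 1 => Over.mk (pullback.fst Γ.t (chains k).hom ≫ Γ.s)

/-- The `k`-fold fibre product `M ×_O ⋯ ×_O M` (which is `O` for `k = 0`). -/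
noncomputable def chainObj (k : ℕ) : B := (Γ.chains k).left

/-- The `i`-th object in a chain. -/
noncomputable def vert : ∀ {k : ℕ} (_ : Fin (k + 1)), Γ.chainObj k ⟶ Γ.O
  | 0, _ => 𝟙 Γ.O
  | k + 1, i => Fin.cases (motive := fun _ => Γ.chainObj (k + 1) ⟶ Γ.O)
      (Γ.chains (k + 1)).hom (fun j => pullback.snd Γ.t (Γ.chains k).hom ≫ vert j) i

/-- The `i`-th morphism in a chain. -/
noncomputable def arr : ∀ {k : ℕ} (_ : Fin k), Γ.chainObj k ⟶ Γ.M
  | 0, i => i.elim0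
  | k + 1, i => Fin.cases (motive := fun _ => Γ.chainObj (k + 1) ⟶ Γ.M)
      (pullback.fst Γ.t (Γ.chains k).hom)
      (fun j => pullback.snd Γ.t (Γ.chains k).hom ≫ arr j) i

theorem vert_zero (k : ℕ) : Γ.vert (0 : Fin (k + 1)) = (Γ.chains k).hom := by
  cases k <;> rfl

theorem arr_s {k : ℕ} (i : Fin k) : Γ.arr i ≫ Γ.s = Γ.vert i.castSucc := by
  induction k with
  | zero => exact i.elim0
  | succ k ih =>
    refine Fin.cases ?_ (fun j => ?_) i
    · rfl
    · exact (Category.assoc _ _ _).trans (congrArg _ (ih j))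

theorem arr_t {k : ℕ} (i : Fin k) : Γ.arr i ≫ Γ.t = Γ.vert i.succ := by
  induction k with
  | zero => exact i.elim0
  | succ k ih =>
    refine Fin.cases ?_ (fun j => ?_) i
    · exact pullback.condition.trans (congrArg _ (Γ.vert_zero k).symm)
    · exact (Category.assoc _ _ _).trans (congrArg _ (ih j))

/-- A `T`-valued point of the `k`-fold fibre product gives a chain in the category of
`T`-valued points. -/
noncomputable def toChain {T : B} {k : ℕ} (g : T ⟶ Γ.chainObj k) :
    ComposableArrows (Γ.Pt T) k :=
  ComposableArrows.mkOfObjOfMapSucc (fun i => ⟨g ≫ Γ.vert i⟩)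
    (fun i => Γ.ptHom (g ≫ Γ.arr i) ((Category.assoc _ _ _).trans (congrArg _ (Γ.arr_s i)))
      ((Category.assoc _ _ _).trans (congrArg _ (Γ.arr_t i))))

theorem toChain_obj {T : B} {k : ℕ} (g : T ⟶ Γ.chainObj k) (i : Fin (k + 1)) :
    (Γ.toChain g).obj i = ⟨g ≫ Γ.vert i⟩ := rfl

theorem toChain_map {T : B} {k : ℕ} (g : T ⟶ Γ.chainObj k) (i : Fin k) :
    ((Γ.toChain g).map (homOfLE i.castSucc_le_succ)).1 = g ≫ Γ.arr i :=
  congrArg (fun f : (Γ.toChain g).obj i.castSucc ⟶ (Γ.toChain g).obj i.succ => f.1)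
    (ComposableArrows.mkOfObjOfMapSucc_map_succ (fun i => (⟨g ≫ Γ.vert i⟩ : Γ.Pt T))
      (fun i => Γ.ptHom (g ≫ Γ.arr i) ((Category.assoc _ _ _).trans (congrArg _ (Γ.arr_s i)))
        ((Category.assoc _ _ _).trans (congrArg _ (Γ.arr_t i)))) i.1 i.2)

/-- Two maps into the object of chains agree if they have the same objects and morphisms. -/
theorem chainObj_ext {T : B} {k : ℕ} {g h : T ⟶ Γ.chainObj k}
    (hv : ∀ i, g ≫ Γ.vert i = h ≫ Γ.vert i) (ha : ∀ i, g ≫ Γ.arr i = h ≫ Γ.arr i) : g = h := by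
  induction k with
  | zero => exact (Category.comp_id g).symm.trans ((hv 0).trans (Category.comp_id h))
  | succ k ih =>
    refine pullback.hom_ext (ha 0) (ih (fun i => ?_) (fun i => ?_))
    · exact (Category.assoc _ _ _).trans ((hv i.succ).trans (Category.assoc _ _ _).symm)
    · exact (Category.assoc _ _ _).trans ((ha i.succ).trans (Category.assoc _ _ _).symm)

theorem exists_lift {T : B} {k : ℕ} (v : Fin (k + 1) → (T ⟶ Γ.O)) (a : Fin k → (T ⟶ Γ.M))
    (hs : ∀ i, a i ≫ Γ.s = v i.castSucc) (ht : ∀ i, a i ≫ Γ.t = v i.succ) :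
    ∃ g : T ⟶ Γ.chainObj k, (∀ i, g ≫ Γ.vert i = v i) ∧ ∀ i, g ≫ Γ.arr i = a i := by
  induction k with
  | zero =>
    refine ⟨v 0, fun i => ?_, fun i => i.elim0⟩
    obtain rfl : i = 0 := Subsingleton.elim (α := Fin 1) _ _
    exact Category.comp_id _
  | succ k ih =>
    obtain ⟨g, hg1, hg2⟩ := ih (fun i => v i.succ) (fun i => a i.succ) (fun i => hs i.succ)
      (fun i => ht i.succ)
    have w : a 0 ≫ Γ.t = g ≫ (Γ.chains k).hom := by
      rw [← vert_zero, hg1, ht]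
    refine ⟨pullback.lift (a 0) g w, fun i => ?_, fun i => ?_⟩
    · refine Fin.cases ?_ (fun j => ?_) i
      · refine (pullback.lift_fst_assoc _ _ _ _).trans (hs 0)
      · exact (pullback.lift_snd_assoc _ _ _ _).trans (hg1 j)
    · refine Fin.cases ?_ (fun j => ?_) i
      · exact pullback.lift_fst _ _ _
      · exact (pullback.lift_snd_assoc _ _ _ _).trans (hg2 j)

theorem pt_hom_eq {T : B} {x y x' y' : Γ.Pt T} (hx : x = x') (hy : y = y') (f : x ⟶ y)
    (g : x' ⟶ y') (h : f.1 = g.1) : f = eqToHom hx ≫ g ≫ eqToHom hy.symm := by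
  subst hx hy
  simpa using! Subtype.ext h

theorem chain_ext {T : B} {k : ℕ} {F G : ComposableArrows (Γ.Pt T) k}
    (ho : ∀ i, (F.obj i).pt = (G.obj i).pt)
    (hm : ∀ i : Fin k, (F.map (homOfLE i.castSucc_le_succ)).1 =
      (G.map (homOfLE i.castSucc_le_succ)).1) : F = G :=
  have ho' : ∀ i, F.obj i = G.obj i := fun i => congrArg Pt.mk (ho i)
  ComposableArrows.ext ho' fun i hi => Γ.pt_hom_eq (ho' _) (ho' _) _ _ (hm ⟨i, hi⟩)

/-- The `T`-valued point of the `k`-fold fibre product given by a chain in the category of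
`T`-valued points. -/
noncomputable def ofChain {T : B} {k : ℕ} (F : ComposableArrows (Γ.Pt T) k) : T ⟶ Γ.chainObj k :=
  (Γ.exists_lift (fun i => (F.obj i).pt) (fun i => (F.map (homOfLE i.castSucc_le_succ)).1)
    (fun i => (F.map (homOfLE i.castSucc_le_succ)).2.1)
    (fun i => (F.map (homOfLE i.castSucc_le_succ)).2.2)).choose

theorem ofChain_vert {T : B} {k : ℕ} (F : ComposableArrows (Γ.Pt T) k) (i : Fin (k + 1)) :
    Γ.ofChain F ≫ Γ.vert i = (F.obj i).pt :=
  (Γ.exists_lift (fun i => (F.obj i).pt) (fun i => (F.map (homOfLE i.castSucc_le_succ)).1)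
    (fun i => (F.map (homOfLE i.castSucc_le_succ)).2.1)
    (fun i => (F.map (homOfLE i.castSucc_le_succ)).2.2)).choose_spec.1 i

theorem ofChain_arr {T : B} {k : ℕ} (F : ComposableArrows (Γ.Pt T) k) (i : Fin k) :
    Γ.ofChain F ≫ Γ.arr i = (F.map (homOfLE i.castSucc_le_succ)).1 :=
  (Γ.exists_lift (fun i => (F.obj i).pt) (fun i => (F.map (homOfLE i.castSucc_le_succ)).1)
    (fun i => (F.map (homOfLE i.castSucc_le_succ)).2.1)
    (fun i => (F.map (homOfLE i.castSucc_le_succ)).2.2)).choose_spec.2 i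

theorem toChain_ofChain {T : B} {k : ℕ} (F : ComposableArrows (Γ.Pt T) k) :
    Γ.toChain (Γ.ofChain F) = F :=
  Γ.chain_ext (fun i => Γ.ofChain_vert F i)
    (fun i => (Γ.toChain_map _ i).trans (Γ.ofChain_arr F i))

theorem ofChain_toChain {T : B} {k : ℕ} (g : T ⟶ Γ.chainObj k) :
    Γ.ofChain (Γ.toChain g) = g :=
  Γ.chainObj_ext (fun i => Γ.ofChain_vert _ i)
    (fun i => (Γ.ofChain_arr _ i).trans (Γ.toChain_map _ i))

theorem toChain_injective {T : B} {k : ℕ} {g h : T ⟶ Γ.chainObj k}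
    (w : Γ.toChain g = Γ.toChain h) : g = h := by
  rw [← Γ.ofChain_toChain g, w, Γ.ofChain_toChain]

/-- Restriction of points along a morphism. -/
noncomputable def ptRes {T T' : B} (f : T' ⟶ T) : Γ.Pt T ⥤ Γ.Pt T' where
  obj x := ⟨f ≫ x.pt⟩
  map a := Γ.ptHom (f ≫ a.1) ((Category.assoc _ _ _).trans (congrArg _ a.2.1))
    ((Category.assoc _ _ _).trans (congrArg _ a.2.2))
  map_id _ := Subtype.ext (Category.assoc _ _ _).symm
  map_comp _ _ := Subtype.ext <| (Category.assoc _ _ _).symm.trans <|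
    congrArg (· ≫ Γ.c) (pullback.hom_ext
      ((Category.assoc _ _ _).trans <| (congrArg (f ≫ ·) (pullback.lift_fst _ _ _)).trans
        (pullback.lift_fst _ _ _).symm)
      ((Category.assoc _ _ _).trans <| (congrArg (f ≫ ·) (pullback.lift_snd _ _ _)).trans
        (pullback.lift_snd _ _ _).symm))

theorem toChain_comp {T T' : B} {k : ℕ} (f : T' ⟶ T) (g : T ⟶ Γ.chainObj k) :
    Γ.toChain (f ≫ g) = Γ.toChain g ⋙ Γ.ptRes f :=
  Γ.chain_ext (fun _ => Category.assoc _ _ _) (fun i => (Γ.toChain_map _ i).trans <|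
    (Category.assoc _ _ _).trans (congrArg (f ≫ ·) (Γ.toChain_map g i)).symm)

/-- The operation of the simplex category on chains in the category of points (as in the nerve
of that category). -/
noncomputable def reindex {T : B} {Δ Δ' : SimplexCategoryᵒᵖ} (θ : Δ ⟶ Δ')
    (F : ComposableArrows (Γ.Pt T) Δ.unop.len) : ComposableArrows (Γ.Pt T) Δ'.unop.len :=
  (CategoryTheory.nerve (Γ.Pt T)).map θ F

/-- The nerve (classifying object) of a category object: in degree `k` it is the `k`-fold fibre
product `M ×_O ⋯ ×_O M`, with the usual faces and degeneracies. These are described on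
`T`-valued points: the `T`-valued points of the nerve are the simplices of the nerve of the
category of `T`-valued points (see `toChain_map_nerve`). -/
noncomputable def nerve : SimplicialObject B where
  obj Δ := Γ.chainObj Δ.unop.len
  map θ := Γ.ofChain (Γ.reindex θ (Γ.toChain (𝟙 _)))
  map_id _ := Γ.ofChain_toChain _
  map_comp {Δ Δ' Δ''} θ θ' := Γ.toChain_injective <| by
    rw [toChain_comp, toChain_ofChain, toChain_ofChain]
    have h := Γ.toChain_comp (Γ.ofChain (Γ.reindex θ (Γ.toChain (𝟙 (Γ.chainObj Δ.unop.len)))))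
      (𝟙 (Γ.chainObj Δ'.unop.len))
    rw [Category.comp_id, toChain_ofChain] at h
    exact congrArg (Γ.reindex θ') h

/-- The `T`-valued points of the nerve are the nerve of the category of `T`-valued points. -/
theorem toChain_map_nerve {T : B} {Δ Δ' : SimplexCategoryᵒᵖ} (θ : Δ ⟶ Δ')
    (g : T ⟶ Γ.chainObj Δ.unop.len) :
    Γ.toChain (g ≫ Γ.nerve.map θ) = Γ.reindex θ (Γ.toChain g) := by
  refine (Γ.toChain_comp g _).trans ?_
  refine (congrArg (· ⋙ Γ.ptRes g)
    (Γ.toChain_ofChain (Γ.reindex θ (Γ.toChain (𝟙 (Γ.chainObj Δ.unop.len)))))).trans ?_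
  have h := Γ.toChain_comp g (𝟙 (Γ.chainObj Δ.unop.len))
  rw [Category.comp_id] at h
  exact (congrArg (Γ.reindex θ) h).symm

end CatObj

namespace CatObj

variable {B : Type u} [Category.{v} B] [HasPullbacks B]

theorem IsComp.restrict {Γ : CatObj B} {T T' : B} {f g h : T ⟶ Γ.M} (H : Γ.IsComp f g h)
    (p : T' ⟶ T) : Γ.IsComp (p ≫ f) (p ≫ g) (p ≫ h) := by
  obtain ⟨w, rfl⟩ := H
  have w' : (p ≫ f) ≫ Γ.t = (p ≫ g) ≫ Γ.s := by rw [Category.assoc, w, Category.assoc]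
  have h : pullback.lift (p ≫ f) (p ≫ g) w' = p ≫ pullback.lift f g w :=
    pullback.hom_ext
      ((pullback.lift_fst _ _ _).trans
        ((Category.assoc _ _ _).trans (congrArg (p ≫ ·) (pullback.lift_fst _ _ _))).symm)
      ((pullback.lift_snd _ _ _).trans
        ((Category.assoc _ _ _).trans (congrArg (p ≫ ·) (pullback.lift_snd _ _ _))).symm)
  exact ⟨w', (congrArg (· ≫ Γ.c) h).trans (Category.assoc _ _ _)⟩

/-- A functor between category objects. -/
@[ext]
structure Hom (Γ Γ' : CatObj B) where
  /-- the map on objects -/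
  o : Γ.O ⟶ Γ'.O
  /-- the map on morphisms -/
  m : Γ.M ⟶ Γ'.M
  m_s : m ≫ Γ'.s = Γ.s ≫ o
  m_t : m ≫ Γ'.t = Γ.t ≫ o
  e_m : Γ.e ≫ m = o ≫ Γ'.e
  c_m : Γ'.IsComp (pullback.fst Γ.t Γ.s ≫ m) (pullback.snd Γ.t Γ.s ≫ m) (Γ.c ≫ m)

theorem Hom.isComp {Γ Γ' : CatObj B} (F : Hom Γ Γ') {T : B} {f g h : T ⟶ Γ.M}
    (H : Γ.IsComp f g h) : Γ'.IsComp (f ≫ F.m) (g ≫ F.m) (h ≫ F.m) := by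
  obtain ⟨w, rfl⟩ := H
  have := F.c_m.restrict (pullback.lift f g w)
  rwa [pullback.lift_fst_assoc, pullback.lift_snd_assoc, ← Category.assoc] at this

instance : Category (CatObj B) where
  Hom := Hom
  id Γ := ⟨𝟙 _, 𝟙 _, by simp, by simp, by simp, by
    simp only [Category.comp_id]
    exact ⟨pullback.condition, by
      rw [show pullback.lift (pullback.fst Γ.t Γ.s) (pullback.snd Γ.t Γ.s) pullback.condition =
        𝟙 _ from pullback.hom_ext (by simp) (by simp), Category.id_comp]⟩⟩
  comp F G :=
    { o := F.o ≫ G.o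
      m := F.m ≫ G.m
      m_s := by rw [Category.assoc, G.m_s, reassoc_of% F.m_s]
      m_t := by rw [Category.assoc, G.m_t, reassoc_of% F.m_t]
      e_m := by rw [reassoc_of% F.e_m, G.e_m, Category.assoc]
      c_m := by
        have := G.isComp F.c_m
        simpa only [Category.assoc] using this }
  id_comp F := Hom.ext (Category.id_comp _) (Category.id_comp _)
  comp_id F := Hom.ext (Category.comp_id _) (Category.comp_id _)
  assoc F G H := Hom.ext (Category.assoc _ _ _) (Category.assoc _ _ _)

/-- The effect of a functor on points. -/
noncomputable def ptFunctor {Γ Γ' : CatObj B} (F : Γ ⟶ Γ') (T : B) : Γ.Pt T ⥤ Γ'.Pt T where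
  obj x := ⟨x.pt ≫ F.o⟩
  map a := Γ'.ptHom (a.1 ≫ F.m)
    ((Category.assoc _ _ _).trans <| (congrArg (a.1 ≫ ·) F.m_s).trans <|
      (Category.assoc _ _ _).symm.trans (congrArg (· ≫ F.o) a.2.1))
    ((Category.assoc _ _ _).trans <| (congrArg (a.1 ≫ ·) F.m_t).trans <|
      (Category.assoc _ _ _).symm.trans (congrArg (· ≫ F.o) a.2.2))
  map_id x := Subtype.ext <| (Category.assoc _ _ _).trans <|
    (congrArg (x.pt ≫ ·) F.e_m).trans (Category.assoc _ _ _).symm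
  map_comp a b := Subtype.ext (F.isComp (⟨a.2.2.trans b.2.1.symm, rfl⟩ :
    Γ.IsComp a.1 b.1 (a ≫ b).1)).2.symm

/-- The effect of a functor on the objects of chains. -/
noncomputable def chainMap {Γ Γ' : CatObj B} (F : Γ ⟶ Γ') (k : ℕ) :
    Γ.chainObj k ⟶ Γ'.chainObj k :=
  Γ'.ofChain (Γ.toChain (𝟙 (Γ.chainObj k)) ⋙ ptFunctor F _)

theorem chainMap_vert {Γ Γ' : CatObj B} (F : Γ ⟶ Γ') {k : ℕ} (i : Fin (k + 1)) :
    chainMap F k ≫ Γ'.vert i = Γ.vert i ≫ F.o :=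
  (Γ'.ofChain_vert _ i).trans (congrArg (· ≫ F.o) (Category.id_comp (Γ.vert i)))

theorem chainMap_arr {Γ Γ' : CatObj B} (F : Γ ⟶ Γ') {k : ℕ} (i : Fin k) :
    chainMap F k ≫ Γ'.arr i = Γ.arr i ≫ F.m :=
  (Γ'.ofChain_arr _ i).trans <| congrArg (· ≫ F.m) <|
    (Γ.toChain_map _ i).trans (Category.id_comp (Γ.arr i))

theorem toChain_chainMap {Γ Γ' : CatObj B} (F : Γ ⟶ Γ') {k : ℕ} {T : B} (g : T ⟶ Γ.chainObj k) :
    Γ'.toChain (g ≫ chainMap F k) = Γ.toChain g ⋙ ptFunctor F T :=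
  Γ'.chain_ext
    (fun i => (Category.assoc _ _ _).trans <| (congrArg (g ≫ ·) (chainMap_vert F i)).trans
      (Category.assoc _ _ _).symm)
    (fun i => (Γ'.toChain_map _ i).trans <| (Category.assoc _ _ _).trans <|
      (congrArg (g ≫ ·) (chainMap_arr F i)).trans <| (Category.assoc _ _ _).symm.trans <|
      congrArg (· ≫ F.m) (Γ.toChain_map g i).symm)

/-- The effect of a functor on nerves. -/
noncomputable def nerveFunctor : CatObj B ⥤ SimplicialObject B where
  obj Γ := Γ.nerve
  map {Γ Γ'} F :=
    { app := fun Δ => chainMap F Δ.unop.len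
      naturality := fun {Δ Δ'} θ => Γ'.toChain_injective <| by
        refine (toChain_chainMap F (Γ.nerve.map θ)).trans ?_
        refine Eq.trans ?_ (Γ'.toChain_map_nerve θ (chainMap F Δ.unop.len)).symm
        have h1 := (congrArg Γ.toChain (Category.id_comp (Γ.nerve.map θ))).symm.trans
          (Γ.toChain_map_nerve θ (𝟙 _))
        have h2 := toChain_chainMap F (𝟙 (Γ.chainObj Δ.unop.len))
        rw [Category.id_comp] at h2
        refine (congrArg (· ⋙ ptFunctor F _) h1).trans ?_
        exact (congrArg (Γ'.reindex θ) h2).symm }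
  map_id Γ := NatTrans.ext <| funext fun Δ => Γ.chainObj_ext
    (fun i => (chainMap_vert (𝟙 Γ) i).trans <| (Category.comp_id _).trans
      (Category.id_comp _).symm)
    (fun i => (chainMap_arr (𝟙 Γ) i).trans <| (Category.comp_id _).trans
      (Category.id_comp _).symm)
  map_comp {Γ Γ' Γ''} F G := NatTrans.ext <| funext fun Δ => Γ''.chainObj_ext
    (fun i => (chainMap_vert (F ≫ G) i).trans <| (Category.assoc _ _ _).symm.trans <|
      (congrArg (· ≫ G.o) (chainMap_vert F i)).symm.trans <| (Category.assoc _ _ _).trans <|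
      (congrArg (chainMap F _ ≫ ·) (chainMap_vert G i)).symm.trans (Category.assoc _ _ _).symm)
    (fun i => (chainMap_arr (F ≫ G) i).trans <| (Category.assoc _ _ _).symm.trans <|
      (congrArg (· ≫ G.m) (chainMap_arr F i)).symm.trans <| (Category.assoc _ _ _).trans <|
      (congrArg (chainMap F _ ≫ ·) (chainMap_arr G i)).symm.trans (Category.assoc _ _ _).symm)

/-- The identities, as chains of length one. -/
noncomputable def idChain (Γ : CatObj B) : Γ.O ⟶ Γ.chainObj 1 :=
  Γ.ofChain (ComposableArrows.mk₁ (Γ.ptHom (x := ⟨𝟙 Γ.O⟩) (y := ⟨𝟙 Γ.O⟩) Γ.e Γ.e_s Γ.e_t))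

end CatObj

namespace LaxPair

variable {B : Type u} [Category.{v} B] [MonoidalCategory B]

theorem comp_aux {X X' Y Y' Z Z' : B} {n : ℕ} {a : tpow X n ⟶ X'} {b : tpow Y n ⟶ Y'}
    {c : tpow Z n ⟶ Z'} {p : X' ⟶ Y'} {q : X ⟶ Y} {p' : Y' ⟶ Z'} {q' : Y ⟶ Z}
    (h : a ≫ p = tmap q n ≫ b) (h' : b ≫ p' = tmap q' n ≫ c) :
    a ≫ p ≫ p' = tmap (q ≫ q') n ≫ c := by
  rw [reassoc_of% h, h', tmap_comp, Category.assoc]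

theorem id_aux {X X' : B} {n : ℕ} (a : tpow X n ⟶ X') : a ≫ 𝟙 X' = tmap (𝟙 X) n ≫ a := by
  rw [tmap_id, Category.comp_id, Category.id_comp]

end LaxPair

section Enhanced

variable {B : Type u} [Category.{v} B] [MonoidalCategory B] [SymmetricCategory B] [HasPullbacks B]

/-- The structure of a lax `C`-algebra on a category `Γ` enhanced in `B`. -/
structure EnhancedLaxAlgebra (C : Operad.{w}) (Γ : CatObj B) where
  /-- the structure maps on objects -/
  opO : ∀ {n : ℕ}, C.Ops n → (tpow Γ.O n ⟶ Γ.O)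
  /-- the structure maps on morphisms -/
  opM : ∀ {n : ℕ}, C.Ops n → (tpow Γ.M n ⟶ Γ.M)
  opM_s : ∀ {n : ℕ} (μ : C.Ops n), opM μ ≫ Γ.s = tmap Γ.s n ≫ opO μ
  opM_t : ∀ {n : ℕ} (μ : C.Ops n), opM μ ≫ Γ.t = tmap Γ.t n ≫ opO μ
  opM_e : ∀ {n : ℕ} (μ : C.Ops n), tmap Γ.e n ≫ opM μ = opO μ ≫ Γ.e
  opM_c : ∀ {n : ℕ} (μ : C.Ops n),
    Γ.IsComp (tmap (pullback.fst Γ.t Γ.s) n ≫ opM μ) (tmap (pullback.snd Γ.t Γ.s) n ≫ opM μ)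
      (tmap Γ.c n ≫ opM μ)
  /-- the coherence `μ(ν 1, …, ν n) ≅ γ(μ, ν 1, …, ν n)` -/
  compHom : ∀ {n : ℕ} {k : Fin n → ℕ} (_ : C.Ops n) (_ : ∀ i, C.Ops (k i)),
    tpow Γ.O (∑ i, k i) ⟶ Γ.M
  compHom_s : ∀ {n : ℕ} {k : Fin n → ℕ} (μ : C.Ops n) (ν : ∀ i, C.Ops (k i)),
    compHom μ ν ≫ Γ.s = tblock (fun i => opO (ν i)) ≫ opO μ
  compHom_t : ∀ {n : ℕ} {k : Fin n → ℕ} (μ : C.Ops n) (ν : ∀ i, C.Ops (k i)),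
    compHom μ ν ≫ Γ.t = opO (C.comp μ ν)
  compHom_iso : ∀ {n : ℕ} {k : Fin n → ℕ} (μ : C.Ops n) (ν : ∀ i, C.Ops (k i)),
    Γ.IsIsoValued (compHom μ ν)
  compHom_natural : ∀ {n : ℕ} {k : Fin n → ℕ} (μ : C.Ops n) (ν : ∀ i, C.Ops (k i)),
    ∃ h, Γ.IsComp (tmap Γ.s _ ≫ compHom μ ν) (opM (C.comp μ ν)) h ∧
      Γ.IsComp (tblock (fun i => opM (ν i)) ≫ opM μ) (tmap Γ.t _ ≫ compHom μ ν) h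
  /-- the coherence `1 ≅ Id` -/
  oneHom : tpow Γ.O 1 ⟶ Γ.M
  oneHom_s : oneHom ≫ Γ.s = opO C.one
  oneHom_t : oneHom ≫ Γ.t = (ρ_ Γ.O).hom
  oneHom_iso : Γ.IsIsoValued oneHom
  oneHom_natural :
    ∃ h, Γ.IsComp (tmap Γ.s _ ≫ oneHom) (ρ_ Γ.M).hom h ∧
      Γ.IsComp (opM C.one) (tmap Γ.t _ ≫ oneHom) h
  /-- the coherence `κ μ ≅ μ κ^*` -/
  actHom : ∀ {n m : ℕ} (_ : Fin n ≃ Fin m) (_ : C.Ops n), tpow Γ.O m ⟶ Γ.M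
  actHom_s : ∀ {n m : ℕ} (κ : Fin n ≃ Fin m) (μ : C.Ops n),
    actHom κ μ ≫ Γ.s = opO (C.act κ μ)
  actHom_t : ∀ {n m : ℕ} (κ : Fin n ≃ Fin m) (μ : C.Ops n),
    actHom κ μ ≫ Γ.t = tperm Γ.O κ ≫ opO μ
  actHom_iso : ∀ {n m : ℕ} (κ : Fin n ≃ Fin m) (μ : C.Ops n), Γ.IsIsoValued (actHom κ μ)
  actHom_natural : ∀ {n m : ℕ} (κ : Fin n ≃ Fin m) (μ : C.Ops n),
    ∃ h, Γ.IsComp (tmap Γ.s _ ≫ actHom κ μ) (tperm Γ.M κ ≫ opM μ) h ∧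
      Γ.IsComp (opM (C.act κ μ)) (tmap Γ.t _ ≫ actHom κ μ) h
  comp_assoc : ∀ {n : ℕ} {k : Fin n → ℕ} {l : Fin (∑ i, k i) → ℕ} (μ : C.Ops n)
    (ν : ∀ i, C.Ops (k i)) (ρ : ∀ p, C.Ops (l p)),
    ∃ h, Γ.IsComp
        (tcast Γ.O (sum_sum_blk l).symm ≫
          tblock (fun i => compHom (ν i) (fun j => ρ (blk i j))) ≫ opM μ)
        (tcast Γ.O (sum_sum_blk l).symm ≫
          compHom μ (fun i => C.comp (ν i) (fun j => ρ (blk i j)))) h ∧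
      Γ.IsComp (tblock (fun p => opO (ρ p)) ≫ compHom μ ν) (compHom (C.comp μ ν) ρ) h
  one_comp : ∀ {n : ℕ} (μ : C.Ops n),
    compHom C.one (fun _ => μ) = tblock (fun _ => opO μ) ≫ oneHom
  comp_one : ∀ {n : ℕ} (μ : C.Ops n),
    compHom μ (fun _ => C.one) = tblock (fun _ => oneHom) ≫ opM μ
  act_refl : ∀ {n : ℕ} (μ : C.Ops n), actHom (Equiv.refl _) μ = opO μ ≫ Γ.e
  act_trans : ∀ {n m l : ℕ} (κ : Fin n ≃ Fin m) (lam : Fin m ≃ Fin l) (μ : C.Ops n),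
    Γ.IsComp (actHom lam (C.act κ μ)) (tperm Γ.O lam ≫ actHom κ μ) (actHom (κ.trans lam) μ)
  comp_act : ∀ {n m : ℕ} {k k' : Fin m → ℕ} (lam : Fin n ≃ Fin m)
    (κ : ∀ i, Fin (k i) ≃ Fin (k' i)) (μ : C.Ops n) (ν : ∀ i, C.Ops (k i)),
    ∃ h h', Γ.IsComp (compHom (C.act lam μ) (fun i => C.act (κ i) (ν i)))
        (actHom (blockEquiv lam κ) (C.comp μ (fun j => ν (lam j)))) h ∧
      Γ.IsComp (tblock (fun i => actHom (κ i) (ν i)) ≫ opM (C.act lam μ))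
        (tblock (fun i => tperm Γ.O (κ i) ≫ opO (ν i)) ≫ actHom lam μ) h' ∧
      Γ.IsComp h' (tperm Γ.O (blockEquiv lam κ) ≫ compHom μ (fun j => ν (lam j))) h

/-- An algebra enhanced over `B` over an operad in sets. -/
@[ext]
structure EnhancedAlgebra (C : Operad.{w}) (X : B) where
  /-- the structure maps `X^n ⟶ X`, for each operation in `C(n)` -/
  act : ∀ {n : ℕ}, C.Ops n → (tpow X n ⟶ X)
  act_one : act C.one = (ρ_ X).hom
  act_comp : ∀ {n : ℕ} {k : Fin n → ℕ} (μ : C.Ops n) (ν : ∀ i, C.Ops (k i)),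
    act (C.comp μ ν) = tblock (fun i => act (ν i)) ≫ act μ
  act_act : ∀ {n m : ℕ} (κ : Fin n ≃ Fin m) (μ : C.Ops n),
    act (C.act κ μ) = tperm X κ ≫ act μ

/-- An algebra in simplicial objects of `B` over a simplicial operad: algebras in each simplicial
degree, natural with respect to the simplicial structure. -/
@[ext]
structure EnhancedSimplicialAlgebra (D : SimplicialObject Operad.{w}) (X : SimplicialObject B) where
  /-- the algebra structure in each degree -/
  alg : ∀ Δ, EnhancedAlgebra (D.obj Δ) (X.obj Δ)
  act_map : ∀ {Δ Δ'} (θ : Δ ⟶ Δ') {n : ℕ} (c : (D.obj Δ).Ops n),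
    (alg Δ).act c ≫ X.map θ = tmap (X.map θ) n ≫ (alg Δ').act ((D.map θ).map c)

/-- The canonical `C̄`-algebra structures on the nerve of an enhanced lax `C`-algebra: those which
extend the given data. The operations of `C` act by the given structure maps, and the coherence
morphisms (of simplicial degree one) act on objects (viewed as identities) by the given coherence
isomorphisms. -/
structure IsCanonicalEnhanced {C : Operad.{w}} {Γ : CatObj B} (L : EnhancedLaxAlgebra C Γ)
    (A : EnhancedSimplicialAlgebra (Operad.bar C) Γ.nerve) : Prop where
  act_gen_vert : ∀ (Δ : SimplexCategoryᵒᵖ) {n : ℕ} (μ : C.Ops n) (i : Fin (Δ.unop.len + 1)),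
    (A.alg Δ).act (Operad.constGen Δ μ) ≫ Γ.vert i = tmap (Γ.vert i) n ≫ L.opO μ
  act_gen_arr : ∀ (Δ : SimplexCategoryᵒᵖ) {n : ℕ} (μ : C.Ops n) (i : Fin Δ.unop.len),
    (A.alg Δ).act (Operad.constGen Δ μ) ≫ Γ.arr i = tmap (Γ.arr i) n ≫ L.opM μ
  act_compHom : ∀ {n : ℕ} {k : Fin n → ℕ} (μ : C.Ops n) (ν : ∀ i, C.Ops (k i)),
    tmap Γ.idChain _ ≫ (A.alg _).act (Operad.edge (Operad.Coh.compHom μ ν)) ≫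
      Γ.arr (k := 1) 0 = L.compHom μ ν
  act_oneHom :
    tmap Γ.idChain _ ≫ (A.alg _).act (Operad.edge (Operad.Coh.oneHom C)) ≫
      Γ.arr (k := 1) 0 = L.oneHom
  act_actHom : ∀ {n m : ℕ} (κ : Fin n ≃ Fin m) (μ : C.Ops n),
    tmap Γ.idChain _ ≫ (A.alg _).act (Operad.edge (Operad.Coh.actHom κ μ)) ≫
      Γ.arr (k := 1) 0 = L.actHom κ μ

variable (B) in
/-- An operad together with a lax algebra over it, enhanced over `B`. -/
structure LaxPair where
  /-- the operad -/
  C : Operad.{w}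
  /-- the underlying category enhanced in `B` -/
  Γ : CatObj B
  /-- the lax algebra structure -/
  L : EnhancedLaxAlgebra C Γ

namespace LaxPair

/-- A map of pairs: a map of operads and a functor which strictly preserves all the structure. -/
@[ext]
structure Hom (P Q : LaxPair.{w} B) where
  /-- the map of operads -/
  f : P.C ⟶ Q.C
  /-- the functor -/
  F : P.Γ ⟶ Q.Γ
  opO : ∀ {n : ℕ} (μ : P.C.Ops n), P.L.opO μ ≫ F.o = tmap F.o n ≫ Q.L.opO (f.map μ)
  opM : ∀ {n : ℕ} (μ : P.C.Ops n), P.L.opM μ ≫ F.m = tmap F.m n ≫ Q.L.opM (f.map μ)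
  compHom : ∀ {n : ℕ} {k : Fin n → ℕ} (μ : P.C.Ops n) (ν : ∀ i, P.C.Ops (k i)),
    P.L.compHom μ ν ≫ F.m = tmap F.o _ ≫ Q.L.compHom (f.map μ) (fun i => f.map (ν i))
  oneHom : P.L.oneHom ≫ F.m = tmap F.o 1 ≫ Q.L.oneHom
  actHom : ∀ {n m : ℕ} (κ : Fin n ≃ Fin m) (μ : P.C.Ops n),
    P.L.actHom κ μ ≫ F.m = tmap F.o m ≫ Q.L.actHom κ (f.map μ)

instance : Category (LaxPair.{w} B) where
  Hom := Hom
  id _ := ⟨𝟙 _, 𝟙 _, fun _ => id_aux _, fun _ => id_aux _, fun _ _ => id_aux _, id_aux _,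
    fun _ _ => id_aux _⟩
  comp a b := ⟨a.f ≫ b.f, a.F ≫ b.F, fun _ => comp_aux (a.opO _) (b.opO _),
    fun _ => comp_aux (a.opM _) (b.opM _), fun _ _ => comp_aux (a.compHom _ _) (b.compHom _ _),
    comp_aux a.oneHom b.oneHom, fun _ _ => comp_aux (a.actHom _ _) (b.actHom _ _)⟩
  id_comp _ := Hom.ext (Category.id_comp _) (Category.id_comp _)
  comp_id _ := Hom.ext (Category.comp_id _) (Category.comp_id _)
  assoc _ _ _ := Hom.ext (Category.assoc _ _ _) (Category.assoc _ _ _)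

variable (B) in
/-- The underlying operad. -/
def operad : LaxPair.{w} B ⥤ Operad.{w} where
  obj P := P.C
  map a := a.f

variable (B) in
/-- The underlying category enhanced in `B`. -/
def catObj : LaxPair.{w} B ⥤ CatObj B where
  obj P := P.Γ
  map a := a.F

end LaxPair

/-- For a simplicial lax algebra, the realization (diagonal) of the bisimplicial object obtained
by taking nerves in each simplicial degree. -/
noncomputable def nerveDiag (G : SimplicialObject (LaxPair.{w} B)) : SimplicialObject B :=
  Functor.diag _ ⋙ Functor.uncurry.obj (G ⋙ LaxPair.catObj B ⋙ CatObj.nerveFunctor)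

end Enhanced

/-!
The heart of the matter is a strictification. A lax `C`-algebra `L` on `Γ` is a map, up to
coherent isomorphisms, from `C` to the endomorphism operad of `Γ`, which is an operad in
categories (`CatOperad.LaxMap`). Consider the pairs of an operation `μ` of `C` and an isomorphism
from `L μ` to some functor `Γ^n → Γ`. Such pairs can be composed and permuted with the help of the
coherence isomorphisms, and the coherence diagrams are exactly what makes them an operad
(`CatOperad.LaxMap.isoOver`). By the universal property of the free operad (`Operad.freeLift`), `μ
↦ (μ, id)` extends to `Op(C)` (`CatOperad.LaxMap.canon`): every formal operation `σ` acquires a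
canonical isomorphism from `L` of its image to the functor obtained by carrying out the formal
composition strictly. Two formal operations with the same image are therefore related by a
canonical natural isomorphism, `strictMor`, and these isomorphisms are compatible with vertical
composition, operadic composition and permutations, and equal to the given coherences on the basic
morphisms.

A simplex of `C̄(n)` is a chain `σ 0 → ⋯ → σ k` of coherence morphisms. It takes an `n`-tuple of
chains in `Γ` to the chain whose arrows are the diagonals of the naturality squares of `strictMor
(σ i) (σ j)` (`nerveAlgebra`). Conversely, an algebra structure on a nerve is determined by the
action of `1`-simplices (`ext_edgeAct`), and the compatibility with the faces of a `2`-simplex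
makes this action multiplicative (`edgeAct_mult`). As the coherence morphisms are generated by the
basic ones (`Operad.coh_induction`), every structure extending the lax one is equal to
`nerveAlgebra`.

The argument is carried out twice, for ordinary categories and for categories enhanced in `B`. In
both cases natural transformations are encoded by the operation which takes a tuple of morphisms
to the diagonal of its naturality square, so that composition becomes the relation `Mult` between
operations. Over `B`, the endomorphism operad rests on the functoriality of the symmetries of
tensor powers (`tperm_trans`), on the associativity of substitution (`tblock_tblock`) and on its
compatibility with permutations (`tblock_comp_tperm`), checked on generators of the symmetric
groups. For simplicial lax algebras it only remains to see that the canonical transformations are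
natural in the lax algebra, which again follows by induction over coherence morphisms
(`LaxPair.strictNat_hom`).

The projection from `C̄` to `C` is an equivalence since a simplex of `C̄(n)` is an arbitrary tuple
of formal operations with the same image, and the generators provide a section, natural even for a
simplicial operad. For a simplicial operad `C` the homotopy between the identity and the section
is not given by a map to a coherence category, as the diagonal mixes the two simplicial
directions; instead it is constructed on geometric realizations, replacing the vertices of a
simplex one after the other by their images under the section
(`SSet.PrismHomotopy.isEquivalence`).
-/

universe w'

namespace Operad

/-! ### The universal property of the free operad -/

/-- A map of operads whose operations may live in different universes. -/
structure OpMap (C : Operad.{w}) (D : Operad.{w'}) where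
  /-- the map on operations -/
  map : ∀ {n : ℕ}, C.Ops n → D.Ops n
  map_act : ∀ {n m : ℕ} (κ : Fin n ≃ Fin m) (μ : C.Ops n), map (C.act κ μ) = D.act κ (map μ)
  map_one : map C.one = D.one
  map_comp : ∀ {n : ℕ} {k : Fin n → ℕ} (μ : C.Ops n) (ν : ∀ i, C.Ops (k i)),
    map (C.comp μ ν) = D.comp (map μ) (fun i => map (ν i))

variable {C : Operad.{w}} {D : Operad.{w'}}

theorem act_finCongr_rfl {n : ℕ} (h : n = n) (μ : C.Ops n) : C.act (finCongr h) μ = μ :=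
  C.act_refl μ

namespace Tree

variable {α β : Type} (f : ∀ {n : ℕ}, C.Ops n → D.Ops n)

/-- Relabelling of the inner vertices along maps of sets which need not respect composition. -/
def mapGen : Tree C α → Tree D α
  | leaf a => leaf a
  | node μ c => node (f μ) (fun i => (c i).mapGen)

theorem mapGen_map (g : α → β) (t : Tree C α) :
    (t.map g).mapGen f = (t.mapGen f).map g := by
  induction t with
  | leaf a => rfl
  | node μ c ih => simp only [map, mapGen, ih]

theorem mapGen_bind (g : α → Tree C β) (t : Tree C α) :
    (t.bind g).mapGen f = (t.mapGen f).bind (fun a => (g a).mapGen f) := by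
  induction t with
  | leaf a => rfl
  | node μ c ih => simp only [bind, mapGen, ih]

/-- Relabelling the inner vertices does not change the leaves, so that it preserves the bijectivity
of their numbering. -/
theorem exists_mapGen_lab (t : Tree C α) :
    ∃ e : Fin (t.mapGen f).arity ≃ Fin t.arity, ∀ p, t.lab (e p) = (t.mapGen f).lab p := by
  induction t with
  | leaf a => exact ⟨Equiv.refl _, fun _ => rfl⟩
  | node μ c ih =>
    choose e he using ih
    refine ⟨blockEquiv (Equiv.refl _) e, fun p => ?_⟩
    induction p using blk_ind with | h i j => ?_
    exact (congrArg (node μ c).lab (blockEquiv_blk (Equiv.refl _) e i j)).trans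
      ((lab_blk μ c i (e i j)).trans
        ((he i j).trans (lab_blk (f μ) (fun i => (c i).mapGen f) i j).symm))

theorem mapGen_lab_bijective {t : Tree C α} (ht : Function.Bijective t.lab) :
    Function.Bijective (t.mapGen f).lab := by
  obtain ⟨e, he⟩ := exists_mapGen_lab f t
  rw [← funext he]
  exact ht.comp e.bijective

end Tree

/-- The map of operads `Op(C) → D` which extends given maps `C(n) → D(n)`. -/
noncomputable def freeLift (f : ∀ {n : ℕ}, C.Ops n → D.Ops n) : OpMap (free C) D where
  map σ := (freeCounit D).map ⟨σ.1.mapGen f, Tree.mapGen_lab_bijective f σ.2⟩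
  map_act κ σ := by
    refine Eq.trans (congrArg (freeCounit D).map (Subtype.ext ?_)) ((freeCounit D).map_act κ _)
    exact Tree.mapGen_map f κ σ.1
  map_one := (freeCounit D).map_one
  map_comp σ τ := by
    refine Eq.trans (congrArg (freeCounit D).map (Subtype.ext ?_)) ((freeCounit D).map_comp _ _)
    refine (Tree.mapGen_bind f _ σ.1).trans ?_
    simp only [Tree.mapGen_map]
    rfl

theorem freeLift_gen (f : ∀ {n : ℕ}, C.Ops n → D.Ops n) {n : ℕ} (μ : C.Ops n) :
    (freeLift f).map (gen μ) = f μ :=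
  freeCounit_gen (C := D) (f μ)

/-- The free operad is generated by the operations of `C`. -/
theorem free_induction {R : ∀ {n : ℕ}, (free C).Ops n → Prop}
    (gen : ∀ {n : ℕ} (μ : C.Ops n), R (gen μ)) (one : R (free C).one)
    (comp : ∀ {n : ℕ} {k : Fin n → ℕ} (σ : (free C).Ops n) (τ : ∀ i, (free C).Ops (k i)),
      R σ → (∀ i, R (τ i)) → R ((free C).comp σ τ))
    (act : ∀ {n m : ℕ} (κ : Fin n ≃ Fin m) (σ : (free C).Ops n), R σ → R ((free C).act κ σ))
    {n : ℕ} (σ : (free C).Ops n) : R σ := by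
  -- A tree need not have its leaves in the planar order, hence the statement about the tree `s`
  -- with leaves in that order; `act` is only needed at the end, to renumber the leaves.
  have key : ∀ {α : Type} (t : Tree C α),
      ∃ s : (free C).Ops t.arity, R s ∧ s.1.map t.lab = t := by
    intro α t
    induction t with
    | leaf a => exact ⟨_, one, rfl⟩
    | node μ c ih =>
      choose s hs hs' using ih
      refine ⟨_, comp _ s (gen μ) hs, congrArg (Tree.node μ) (funext fun i => ?_)⟩
      refine (Tree.map_map _ _ _).trans (Eq.trans ?_ (hs' i))
      exact congrArg (fun g => (s i).1.map g) (funext fun j => Tree.lab_blk μ c i j)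
  obtain ⟨s, hs, h⟩ := key σ.1
  have : σ = (free C).act (Equiv.ofBijective _ σ.2) s := Subtype.ext h.symm
  rw [this]
  exact act _ _ hs

/-- The morphisms of the coherence categories are generated, under the operad structure,
composition and inversion, by the identities of generators and the three kinds of coherence
morphisms. -/
theorem coh_induction {Q : ∀ {n : ℕ}, (free C).Ops n → (free C).Ops n → Prop}
    (symm : ∀ {n : ℕ} (σ τ : (free C).Ops n), Q σ τ → Q τ σ)
    (trans : ∀ {n : ℕ} (σ τ ρ : (free C).Ops n), Q σ τ → Q τ ρ → Q σ ρ)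
    (comp : ∀ {n : ℕ} {k : Fin n → ℕ} (σ τ : (free C).Ops n) (σ' τ' : ∀ i, (free C).Ops (k i)),
      Q σ τ → (∀ i, Q (σ' i) (τ' i)) → Q ((free C).comp σ σ') ((free C).comp τ τ'))
    (act : ∀ {n m : ℕ} (κ : Fin n ≃ Fin m) (σ τ : (free C).Ops n), Q σ τ →
      Q ((free C).act κ σ) ((free C).act κ τ))
    (gen : ∀ {n : ℕ} (μ : C.Ops n), Q (gen μ) (gen μ))
    (compHom : ∀ {n : ℕ} {k : Fin n → ℕ} (μ : C.Ops n) (ν : ∀ i, C.Ops (k i)),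
      Q ((free C).comp (Operad.gen μ) (fun i => Operad.gen (ν i))) (Operad.gen (C.comp μ ν)))
    (oneHom : Q (Operad.gen C.one) (free C).one)
    (actHom : ∀ {n m : ℕ} (κ : Fin n ≃ Fin m) (μ : C.Ops n),
      Q (Operad.gen (C.act κ μ)) ((free C).act κ (Operad.gen μ)))
    {n : ℕ} (σ τ : (free C).Ops n) (h : (freeCounit C).map σ = (freeCounit C).map τ) : Q σ τ := by
  -- Every formal operation is connected to the generator given by its image.
  have key : ∀ {n : ℕ} (σ : (free C).Ops n), Q σ (Operad.gen ((freeCounit C).map σ)) := by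
    intro n σ
    induction σ using free_induction with
    | gen μ => rw [freeCounit_gen]; exact gen μ
    | one => rw [(freeCounit C).map_one]; exact symm _ _ oneHom
    | comp σ τ hσ hτ =>
      rw [(freeCounit C).map_comp]
      exact trans _ _ _ (comp _ _ _ _ hσ hτ) (compHom _ _)
    | act κ σ hσ =>
      rw [(freeCounit C).map_act]
      exact trans _ _ _ (act κ _ _ hσ) (symm _ _ (actHom κ _))
  have h1 := key τ
  rw [← h] at h1
  exact trans _ _ _ (key σ) (symm _ _ h1)

end Operad

namespace Operad

/-! ### Operads in categories and strictification -/

/-- An operad in categories, presented as a category internal to operads: an operad of objects and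
an operad of morphisms. Composition is a total operation which is only meaningful for composable
pairs. -/
structure CatOperad where
  /-- the operad of objects -/
  Ob : Operad.{w'}
  /-- the operad of morphisms -/
  Mor : Operad.{w'}
  /-- source -/
  src : OpMap Mor Ob
  /-- target -/
  tgt : OpMap Mor Ob
  /-- identities -/
  idn : OpMap Ob Mor
  /-- composition (first factor first) -/
  cmp : ∀ {n : ℕ}, Mor.Ops n → Mor.Ops n → Mor.Ops n
  src_idn : ∀ {n : ℕ} (x : Ob.Ops n), src.map (idn.map x) = x
  tgt_idn : ∀ {n : ℕ} (x : Ob.Ops n), tgt.map (idn.map x) = x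
  src_cmp : ∀ {n : ℕ} {f g : Mor.Ops n}, tgt.map f = src.map g → src.map (cmp f g) = src.map f
  tgt_cmp : ∀ {n : ℕ} {f g : Mor.Ops n}, tgt.map f = src.map g → tgt.map (cmp f g) = tgt.map g
  idn_cmp : ∀ {n : ℕ} (f : Mor.Ops n), cmp (idn.map (src.map f)) f = f
  cmp_idn : ∀ {n : ℕ} (f : Mor.Ops n), cmp f (idn.map (tgt.map f)) = f
  cmp_assoc : ∀ {n : ℕ} {f g h : Mor.Ops n}, tgt.map f = src.map g → tgt.map g = src.map h →
    cmp (cmp f g) h = cmp f (cmp g h)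
  comp_cmp : ∀ {n : ℕ} {k : Fin n → ℕ} {f g : Mor.Ops n} {a b : ∀ i, Mor.Ops (k i)},
    tgt.map f = src.map g → (∀ i, tgt.map (a i) = src.map (b i)) →
    Mor.comp (cmp f g) (fun i => cmp (a i) (b i)) = cmp (Mor.comp f a) (Mor.comp g b)
  act_cmp : ∀ {n m : ℕ} (κ : Fin n ≃ Fin m) {f g : Mor.Ops n}, tgt.map f = src.map g →
    Mor.act κ (cmp f g) = cmp (Mor.act κ f) (Mor.act κ g)

namespace CatOperad

variable (E : CatOperad.{w'})

/-- `f` is a morphism from `x` to `y`. -/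
structure IsHom {n : ℕ} (f : E.Mor.Ops n) (x y : E.Ob.Ops n) : Prop where
  src : E.src.map f = x
  tgt : E.tgt.map f = y

/-- `g` is a two-sided inverse of `f`. -/
structure IsInv {n : ℕ} (f g : E.Mor.Ops n) : Prop where
  isHom : E.IsHom g (E.tgt.map f) (E.src.map f)
  hom_inv : E.cmp f g = E.idn.map (E.src.map f)
  inv_hom : E.cmp g f = E.idn.map (E.tgt.map f)

variable {E}

section

variable {n m : ℕ} {k : Fin n → ℕ}

theorem isHom_idn (x : E.Ob.Ops n) : E.IsHom (E.idn.map x) x x := ⟨E.src_idn x, E.tgt_idn x⟩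

theorem IsHom.cmp {f g : E.Mor.Ops n} {x y z : E.Ob.Ops n} (hf : E.IsHom f x y)
    (hg : E.IsHom g y z) : E.IsHom (E.cmp f g) x z :=
  ⟨(E.src_cmp (hf.tgt.trans hg.src.symm)).trans hf.src,
    (E.tgt_cmp (hf.tgt.trans hg.src.symm)).trans hg.tgt⟩

theorem IsHom.comp {f : E.Mor.Ops n} {x y : E.Ob.Ops n} {g : ∀ i, E.Mor.Ops (k i)}
    {x' y' : ∀ i, E.Ob.Ops (k i)} (hf : E.IsHom f x y) (hg : ∀ i, E.IsHom (g i) (x' i) (y' i)) :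
    E.IsHom (E.Mor.comp f g) (E.Ob.comp x x') (E.Ob.comp y y') :=
  ⟨(E.src.map_comp f g).trans (congrArg₂ E.Ob.comp hf.src (funext fun i => (hg i).src)),
    (E.tgt.map_comp f g).trans (congrArg₂ E.Ob.comp hf.tgt (funext fun i => (hg i).tgt))⟩

theorem IsHom.act {f : E.Mor.Ops n} {x y : E.Ob.Ops n} (hf : E.IsHom f x y) (κ : Fin n ≃ Fin m) :
    E.IsHom (E.Mor.act κ f) (E.Ob.act κ x) (E.Ob.act κ y) :=
  ⟨(E.src.map_act κ f).trans (congrArg _ hf.src), (E.tgt.map_act κ f).trans (congrArg _ hf.tgt)⟩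

theorem IsHom.idn_cmp {f : E.Mor.Ops n} {x y : E.Ob.Ops n} (hf : E.IsHom f x y) :
    E.cmp (E.idn.map x) f = f := by
  rw [← hf.src, E.idn_cmp]

theorem IsHom.cmp_idn {f : E.Mor.Ops n} {x y : E.Ob.Ops n} (hf : E.IsHom f x y) :
    E.cmp f (E.idn.map y) = f := by
  rw [← hf.tgt, E.cmp_idn]

theorem IsHom.cmp_assoc {f g h : E.Mor.Ops n} {x y z t : E.Ob.Ops n} (hf : E.IsHom f x y)
    (hg : E.IsHom g y z) (hh : E.IsHom h z t) : E.cmp (E.cmp f g) h = E.cmp f (E.cmp g h) :=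
  E.cmp_assoc (hf.tgt.trans hg.src.symm) (hg.tgt.trans hh.src.symm)

theorem IsHom.comp_cmp {f g : E.Mor.Ops n} {x y z : E.Ob.Ops n} {a b : ∀ i, E.Mor.Ops (k i)}
    {x' y' z' : ∀ i, E.Ob.Ops (k i)} (hf : E.IsHom f x y) (hg : E.IsHom g y z)
    (ha : ∀ i, E.IsHom (a i) (x' i) (y' i)) (hb : ∀ i, E.IsHom (b i) (y' i) (z' i)) :
    E.Mor.comp (E.cmp f g) (fun i => E.cmp (a i) (b i)) =
      E.cmp (E.Mor.comp f a) (E.Mor.comp g b) :=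
  E.comp_cmp (hf.tgt.trans hg.src.symm) (fun i => (ha i).tgt.trans (hb i).src.symm)

theorem IsHom.act_cmp {f g : E.Mor.Ops n} {x y z : E.Ob.Ops n} (hf : E.IsHom f x y)
    (hg : E.IsHom g y z) (κ : Fin n ≃ Fin m) :
    E.Mor.act κ (E.cmp f g) = E.cmp (E.Mor.act κ f) (E.Mor.act κ g) :=
  E.act_cmp κ (hf.tgt.trans hg.src.symm)

theorem isHom_self (f : E.Mor.Ops n) : E.IsHom f (E.src.map f) (E.tgt.map f) := ⟨rfl, rfl⟩

theorem IsInv.mk' {f g : E.Mor.Ops n} {x y : E.Ob.Ops n} (hf : E.IsHom f x y)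
    (hg : E.IsHom g y x) (h1 : E.cmp f g = E.idn.map x) (h2 : E.cmp g f = E.idn.map y) :
    E.IsInv f g := by
  obtain ⟨rfl, rfl⟩ := hf
  exact ⟨hg, h1, h2⟩

theorem IsInv.symm {f g : E.Mor.Ops n} (h : E.IsInv f g) : E.IsInv g f :=
  IsInv.mk' h.isHom (isHom_self f) h.inv_hom h.hom_inv

theorem isInv_idn (x : E.Ob.Ops n) : E.IsInv (E.idn.map x) (E.idn.map x) :=
  IsInv.mk' (isHom_idn x) (isHom_idn x) (isHom_idn x).idn_cmp (isHom_idn x).idn_cmp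

theorem IsInv.cancel {f g h : E.Mor.Ops n} {x : E.Ob.Ops n} (H : E.IsInv f g)
    (hh : E.IsHom h (E.tgt.map f) x) : E.cmp g (E.cmp f h) = h := by
  rw [← H.isHom.cmp_assoc (isHom_self f) hh, H.inv_hom, hh.idn_cmp]

theorem IsInv.unique {f g g' : E.Mor.Ops n} (H : E.IsInv f g) (H' : E.IsInv f g') : g = g' := by
  rw [← H.cancel H'.isHom, H'.hom_inv, H.isHom.cmp_idn]

theorem IsInv.cmp {f g f' g' : E.Mor.Ops n} (H : E.IsInv f g) (H' : E.IsInv f' g')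
    (h : E.tgt.map f = E.src.map f') : E.IsInv (E.cmp f f') (E.cmp g' g) := by
  have aux : ∀ {f g f' g' : E.Mor.Ops n}, E.IsInv f g → E.IsInv f' g' →
      E.tgt.map f = E.src.map f' → E.cmp (E.cmp f f') (E.cmp g' g) = E.idn.map (E.src.map f) := by
    intro f g f' g' H H' h
    have hg := H.isHom
    have hf' := isHom_self f'
    rw [h] at hg
    rw [(isHom_self f).cmp_assoc (h ▸ hf') (H'.isHom.cmp hg), H'.symm.cancel
      (H'.isHom.tgt.symm ▸ hg), H.hom_inv]
  have hf' := isHom_self f'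
  have hg' := H'.isHom
  rw [← h] at hf' hg'
  refine IsInv.mk' ((isHom_self f).cmp hf') (hg'.cmp H.isHom) (aux H H' h) ?_
  rw [aux H'.symm H.symm (H'.isHom.tgt.trans (h.symm.trans H.isHom.src.symm)), H'.isHom.src]

theorem IsInv.comp {f g : E.Mor.Ops n} {a b : ∀ i, E.Mor.Ops (k i)} (H : E.IsInv f g)
    (H' : ∀ i, E.IsInv (a i) (b i)) : E.IsInv (E.Mor.comp f a) (E.Mor.comp g b) := by
  refine IsInv.mk' ((isHom_self f).comp fun i => isHom_self (a i))
    (H.isHom.comp fun i => (H' i).isHom) ?_ ?_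
  · rw [← (isHom_self f).comp_cmp H.isHom (fun i => isHom_self (a i)) (fun i => (H' i).isHom),
      H.hom_inv, funext fun i => (H' i).hom_inv, ← E.idn.map_comp]
  · rw [← H.isHom.comp_cmp (isHom_self f) (fun i => (H' i).isHom) (fun i => isHom_self (a i)),
      H.inv_hom, funext fun i => (H' i).inv_hom, ← E.idn.map_comp]

theorem IsInv.act {f g : E.Mor.Ops n} (H : E.IsInv f g) (κ : Fin n ≃ Fin m) :
    E.IsInv (E.Mor.act κ f) (E.Mor.act κ g) := by
  refine IsInv.mk' ((isHom_self f).act κ) (H.isHom.act κ) ?_ ?_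
  · rw [← (isHom_self f).act_cmp H.isHom, H.hom_inv, E.idn.map_act]
  · rw [← H.isHom.act_cmp (isHom_self f), H.inv_hom, E.idn.map_act]

/-- A commutative square remains commutative when two opposite invertible sides are replaced by
their inverses. -/
theorem cmp_eq_cmp_of_isInv {f f' g g' h h' : E.Mor.Ops n} {x y z t : E.Ob.Ops n}
    (hf : E.IsHom f x y) (hg : E.IsHom g y z) (hf' : E.IsHom f' x t) (hg' : E.IsHom g' t z)
    (e : E.cmp f g = E.cmp f' g') (H : E.IsInv f h) (H' : E.IsInv g' h') :
    E.cmp g h' = E.cmp h f' := by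
  obtain ⟨rfl, rfl⟩ := hf
  obtain ⟨rfl, rfl⟩ := hg'
  rw [← H.cancel hg, e, H.isHom.cmp_assoc (hf'.cmp (isHom_self g')) H'.isHom,
    hf'.cmp_assoc (isHom_self g') H'.isHom, H'.hom_inv, hf'.cmp_idn]

end

variable (E) in
open Classical in
/-- The inverse of an invertible morphism. -/
noncomputable def inv {n : ℕ} (f : E.Mor.Ops n) : E.Mor.Ops n :=
  if h : ∃ g, E.IsInv f g then h.choose else f

theorem isInv_inv {n : ℕ} {f : E.Mor.Ops n} (h : ∃ g, E.IsInv f g) : E.IsInv f (E.inv f) := by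
  rw [inv, dif_pos h]
  exact h.choose_spec

theorem IsInv.inv_eq {n : ℕ} {f g : E.Mor.Ops n} (h : E.IsInv f g) : E.inv f = g :=
  (isInv_inv ⟨g, h⟩).unique h

/-- A pseudo-map from an operad `C` in sets to an operad in categories. For the endomorphism operad
of a category `Γ` this is the structure of a lax `C`-algebra on `Γ`. -/
structure LaxMap (C : Operad.{w}) (E : CatOperad.{w'}) where
  /-- the image of an operation -/
  op : ∀ {n : ℕ}, C.Ops n → E.Ob.Ops n
  /-- the coherence `μ(ν 1, …, ν n) ≅ γ(μ, ν 1, …, ν n)` -/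
  compHom : ∀ {n : ℕ} {k : Fin n → ℕ}, C.Ops n → (∀ i, C.Ops (k i)) → E.Mor.Ops (∑ i, k i)
  /-- the coherence `1 ≅ Id` -/
  oneHom : E.Mor.Ops 1
  /-- the coherence `κ μ ≅ μ κ^*` -/
  actHom : ∀ {n m : ℕ}, (Fin n ≃ Fin m) → C.Ops n → E.Mor.Ops m
  compHom_isHom : ∀ {n : ℕ} {k : Fin n → ℕ} (μ : C.Ops n) (ν : ∀ i, C.Ops (k i)),
    E.IsHom (compHom μ ν) (E.Ob.comp (op μ) (fun i => op (ν i))) (op (C.comp μ ν))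
  oneHom_isHom : E.IsHom oneHom (op C.one) E.Ob.one
  actHom_isHom : ∀ {n m : ℕ} (κ : Fin n ≃ Fin m) (μ : C.Ops n),
    E.IsHom (actHom κ μ) (op (C.act κ μ)) (E.Ob.act κ (op μ))
  compHom_iso : ∀ {n : ℕ} {k : Fin n → ℕ} (μ : C.Ops n) (ν : ∀ i, C.Ops (k i)),
    ∃ g, E.IsInv (compHom μ ν) g
  oneHom_iso : ∃ g, E.IsInv oneHom g
  actHom_iso : ∀ {n m : ℕ} (κ : Fin n ≃ Fin m) (μ : C.Ops n), ∃ g, E.IsInv (actHom κ μ) g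
  comp_assoc : ∀ {n : ℕ} {k : Fin n → ℕ} {l : Fin (∑ i, k i) → ℕ} (μ : C.Ops n)
    (ν : ∀ i, C.Ops (k i)) (ρ : ∀ p, C.Ops (l p)),
    E.cmp
        (E.Mor.act (finCongr (sum_sum_blk l)) (E.Mor.comp (E.idn.map (op μ))
          (fun i => compHom (ν i) (fun j => ρ (blk i j)))))
        (E.Mor.act (finCongr (sum_sum_blk l))
          (compHom μ (fun i => C.comp (ν i) (fun j => ρ (blk i j))))) =
      E.cmp (E.Mor.comp (compHom μ ν) (fun p => E.idn.map (op (ρ p)))) (compHom (C.comp μ ν) ρ)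
  one_comp : ∀ {n : ℕ} (μ : C.Ops n),
    compHom C.one (fun _ => μ) = E.Mor.comp oneHom (fun _ => E.idn.map (op μ))
  comp_one : ∀ {n : ℕ} (μ : C.Ops n),
    compHom μ (fun _ => C.one) = E.Mor.comp (E.idn.map (op μ)) (fun _ => oneHom)
  act_refl : ∀ {n : ℕ} (μ : C.Ops n), actHom (Equiv.refl _) μ = E.idn.map (op μ)
  act_trans : ∀ {n m l : ℕ} (κ : Fin n ≃ Fin m) (lam : Fin m ≃ Fin l) (μ : C.Ops n),
    actHom (κ.trans lam) μ = E.cmp (actHom lam (C.act κ μ)) (E.Mor.act lam (actHom κ μ))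
  comp_act : ∀ {n m : ℕ} {k k' : Fin m → ℕ} (lam : Fin n ≃ Fin m)
    (κ : ∀ i, Fin (k i) ≃ Fin (k' i)) (μ : C.Ops n) (ν : ∀ i, C.Ops (k i)),
    E.cmp (compHom (C.act lam μ) (fun i => C.act (κ i) (ν i)))
        (actHom (blockEquiv lam κ) (C.comp μ (fun j => ν (lam j)))) =
      E.cmp
        (E.cmp (E.Mor.comp (E.idn.map (op (C.act lam μ))) (fun i => actHom (κ i) (ν i)))
          (E.Mor.comp (actHom lam μ) (fun i => E.idn.map (E.Ob.act (κ i) (op (ν i))))))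
        (E.Mor.act (blockEquiv lam κ) (compHom μ (fun j => ν (lam j))))

namespace LaxMap

variable {C : Operad.{w}} (L : LaxMap C E)

/-- The inverse of the coherence of composition. -/
noncomputable def dec {n : ℕ} {k : Fin n → ℕ} (μ : C.Ops n) (ν : ∀ i, C.Ops (k i)) :
    E.Mor.Ops (∑ i, k i) := E.inv (L.compHom μ ν)

section

variable {n : ℕ} {k : Fin n → ℕ}

theorem isInv_dec (μ : C.Ops n) (ν : ∀ i, C.Ops (k i)) :
    E.IsInv (L.compHom μ ν) (L.dec μ ν) := isInv_inv (L.compHom_iso μ ν)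

theorem dec_isHom (μ : C.Ops n) (ν : ∀ i, C.Ops (k i)) :
    E.IsHom (L.dec μ ν) (L.op (C.comp μ ν)) (E.Ob.comp (L.op μ) (fun i => L.op (ν i))) := by
  have := (L.isInv_dec μ ν).isHom
  rwa [(L.compHom_isHom μ ν).src, (L.compHom_isHom μ ν).tgt] at this

theorem op_act_finCongr {m : ℕ} (h : n = m) (μ : C.Ops n) :
    L.op (C.act (finCongr h) μ) = E.Ob.act (finCongr h) (L.op μ) := by
  subst h
  rw [act_finCongr_rfl, act_finCongr_rfl]

theorem actHom_finCongr {m : ℕ} (h : n = m) (μ : C.Ops n) :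
    L.actHom (finCongr h) μ = E.idn.map (L.op (C.act (finCongr h) μ)) := by
  subst h
  rw [act_finCongr_rfl]
  exact L.act_refl μ

/-- The associativity coherence diagram, in terms of the inverses of the coherences of composition.
-/
theorem dec_assoc {l : Fin (∑ i, k i) → ℕ} (μ : C.Ops n)
    (ν : ∀ i, C.Ops (k i)) (ρ : ∀ p, C.Ops (l p)) :
    E.cmp (L.dec (C.comp μ ν) ρ) (E.Mor.comp (L.dec μ ν) (fun p => E.idn.map (L.op (ρ p)))) =
      E.cmp (E.Mor.act (finCongr (sum_sum_blk l))
          (L.dec μ (fun i => C.comp (ν i) (fun j => ρ (blk i j)))))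
        (E.Mor.act (finCongr (sum_sum_blk l)) (E.Mor.comp (E.idn.map (L.op μ))
          (fun i => L.dec (ν i) (fun j => ρ (blk i j))))) := by
  have h := L.comp_assoc μ ν ρ
  have h1 := ((L.isInv_dec μ ν).comp (fun p => isInv_idn (L.op (ρ p)))).cmp
    (L.isInv_dec (C.comp μ ν) ρ) (by
      rw [(L.compHom_isHom _ _).src,
        ((L.compHom_isHom μ ν).comp (fun p => isHom_idn (L.op (ρ p)))).tgt])
  have h2 := (((isInv_idn (L.op μ)).comp
    (fun i => L.isInv_dec (ν i) (fun j => ρ (blk i j)))).act (finCongr (sum_sum_blk l))).cmp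
    ((L.isInv_dec μ (fun i => C.comp (ν i) (fun j => ρ (blk i j)))).act
      (finCongr (sum_sum_blk l))) (by
      rw [((L.compHom_isHom _ _).act _).src,
        (((isHom_idn (L.op μ)).comp (fun i => L.compHom_isHom (ν i) _)).act _).tgt])
  rw [h] at h2
  exact h1.unique h2

/-- The compatibility of the coherences of composition with permutations, in terms of the inverses
of the former. -/
theorem dec_act {m : ℕ} {k k' : Fin m → ℕ} (lam : Fin n ≃ Fin m)
    (κ : ∀ i, Fin (k i) ≃ Fin (k' i)) (μ : C.Ops n) (ν : ∀ i, C.Ops (k i)) :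
    E.cmp (L.dec (C.act lam μ) (fun i => C.act (κ i) (ν i)))
        (E.Mor.comp (L.actHom lam μ) (fun i => L.actHom (κ i) (ν i))) =
      E.cmp (L.actHom (blockEquiv lam κ) (C.comp μ (fun j => ν (lam j))))
        (E.Mor.act (blockEquiv lam κ) (L.dec μ (fun j => ν (lam j)))) := by
  have h := L.comp_act lam κ μ ν
  rw [← (isHom_idn _).comp_cmp (L.actHom_isHom lam μ) (fun i => L.actHom_isHom (κ i) (ν i))
    (fun i => isHom_idn _), (L.actHom_isHom lam μ).idn_cmp,
    funext fun i => (L.actHom_isHom (κ i) (ν i)).cmp_idn] at h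
  have h1 := L.compHom_isHom (C.act lam μ) (fun i => C.act (κ i) (ν i))
  have h2 := L.actHom_isHom (blockEquiv lam κ) (C.comp μ (fun j => ν (lam j)))
  have h3 := (L.actHom_isHom lam μ).comp (fun i => L.actHom_isHom (κ i) (ν i))
  have h4 := (L.compHom_isHom μ (fun j => ν (lam j))).act (blockEquiv lam κ)
  rw [E.Ob.comp_act] at h3
  rw [C.comp_act] at h1
  exact (cmp_eq_cmp_of_isInv h1 h2 h3 h4 h (L.isInv_dec _ _)
    ((L.isInv_dec _ _).act _)).symm

end

/-- The operations of `C` together with an object isomorphic to their image. -/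
@[ext]
structure IsoOver (n : ℕ) where
  /-- the operation of `C` -/
  op : C.Ops n
  /-- the isomorphism from its image -/
  hom : E.Mor.Ops n
  src_hom : E.src.map hom = L.op op
  iso : ∃ g, E.IsInv hom g

variable {L} in
theorem IsoOver.isHom {n : ℕ} (x : L.IsoOver n) :
    E.IsHom x.hom (L.op x.op) (E.tgt.map x.hom) := ⟨x.src_hom, rfl⟩

/-- The composition of pairs of an operation and an isomorphism from its image. -/
noncomputable def compOver {n : ℕ} {k : Fin n → ℕ} (x : L.IsoOver n) (y : ∀ i, L.IsoOver (k i)) :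
    L.IsoOver (∑ i, k i) where
  op := C.comp x.op (fun i => (y i).op)
  hom := E.cmp (L.dec x.op (fun i => (y i).op)) (E.Mor.comp x.hom (fun i => (y i).hom))
  src_hom := ((L.dec_isHom _ _).cmp (x.isHom.comp fun i => (y i).isHom)).src
  iso := ⟨_, (L.isInv_dec _ _).symm.cmp
    ((isInv_inv x.iso).comp fun i => isInv_inv (y i).iso)
    ((L.dec_isHom _ _).tgt.trans (x.isHom.comp fun i => (y i).isHom).src.symm)⟩

/-- The permutation action on pairs of an operation and an isomorphism from its image. -/
noncomputable def actOver {n m : ℕ} (κ : Fin n ≃ Fin m) (x : L.IsoOver n) : L.IsoOver m where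
  op := C.act κ x.op
  hom := E.cmp (L.actHom κ x.op) (E.Mor.act κ x.hom)
  src_hom := ((L.actHom_isHom κ x.op).cmp (x.isHom.act κ)).src
  iso := ⟨_, (isInv_inv (L.actHom_iso κ x.op)).cmp ((isInv_inv x.iso).act κ)
    ((L.actHom_isHom κ x.op).tgt.trans (x.isHom.act κ).src.symm)⟩

theorem actOver_finCongr_hom {n m : ℕ} (h : n = m) (x : L.IsoOver n) :
    (L.actOver (finCongr h) x).hom = E.Mor.act (finCongr h) x.hom := by
  have h1 := x.isHom.act (finCongr h)
  rw [← L.op_act_finCongr] at h1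
  change E.cmp (L.actHom _ _) _ = _
  rw [L.actHom_finCongr, h1.idn_cmp]

/-- The operad of operations of `C` equipped with an isomorphism from their image: each operad axiom
follows from one of the coherence diagrams of the lax map. -/
noncomputable def isoOver : Operad where
  Ops := L.IsoOver
  act κ x := L.actOver κ x
  one := ⟨C.one, L.oneHom, L.oneHom_isHom.src, L.oneHom_iso⟩
  comp x y := L.compOver x y
  act_refl x := IsoOver.ext (C.act_refl _) (by
    change E.cmp (L.actHom _ _) _ = _
    rw [L.act_refl, E.Mor.act_refl, x.isHom.idn_cmp])
  act_trans κ lam x := IsoOver.ext (C.act_trans _ _ _) (by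
    change E.cmp (L.actHom _ _) _ = E.cmp (L.actHom _ _) (E.Mor.act _ (E.cmp (L.actHom _ _) _))
    rw [L.act_trans, (L.actHom_isHom κ x.op).act_cmp (x.isHom.act κ), E.Mor.act_trans,
      (L.actHom_isHom lam _).cmp_assoc ((L.actHom_isHom κ x.op).act lam)
        ((x.isHom.act κ).act lam)]
    rfl)
  one_comp {n} x := IsoOver.ext (C.one_comp _) (by
    rw [L.actOver_finCongr_hom, ← E.Mor.one_comp]
    change E.cmp (L.dec C.one fun _ => x.op) (E.Mor.comp L.oneHom fun _ => x.hom) = _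
    have h1 := L.isInv_dec C.one (fun _ => x.op)
    rw [L.one_comp] at h1
    have h2 := (isInv_inv L.oneHom_iso).comp (k := fun _ => n) (fun _ => isInv_idn (L.op x.op))
    have hi := (isInv_inv L.oneHom_iso).isHom
    rw [L.oneHom_isHom.tgt, L.oneHom_isHom.src] at hi
    rw [h1.unique h2, ← hi.comp_cmp L.oneHom_isHom (fun _ => isHom_idn _) (fun _ => x.isHom),
      (isInv_inv L.oneHom_iso).inv_hom, x.isHom.idn_cmp, L.oneHom_isHom.tgt, E.idn.map_one])
  comp_one {n} x := IsoOver.ext (C.comp_one _) (by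
    rw [L.actOver_finCongr_hom, ← E.Mor.comp_one]
    change E.cmp (L.dec x.op fun _ => C.one) (E.Mor.comp x.hom fun _ => L.oneHom) = _
    have h1 := L.isInv_dec x.op (fun _ => C.one)
    rw [L.comp_one] at h1
    have h2 := (isInv_idn (L.op x.op)).comp (fun _ => isInv_inv L.oneHom_iso)
    have hi := (isInv_inv L.oneHom_iso).isHom
    rw [L.oneHom_isHom.tgt, L.oneHom_isHom.src] at hi
    rw [h1.unique h2, ← (isHom_idn _).comp_cmp x.isHom (fun _ => hi) (fun _ => L.oneHom_isHom),
      (isInv_inv L.oneHom_iso).inv_hom, x.isHom.idn_cmp, L.oneHom_isHom.tgt, E.idn.map_one])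
  comp_assoc {n k l} x y z := IsoOver.ext (C.comp_assoc _ _ _) (by
    rw [L.actOver_finCongr_hom]
    change E.cmp (L.dec (C.comp x.op fun i => (y i).op) fun p => (z p).op)
        (E.Mor.comp (E.cmp (L.dec x.op fun i => (y i).op) (E.Mor.comp x.hom fun i => (y i).hom))
          fun p => (z p).hom) =
      E.Mor.act _ (E.cmp (L.dec x.op fun i => C.comp (y i).op fun j => (z (blk i j)).op)
        (E.Mor.comp x.hom fun i => E.cmp (L.dec (y i).op fun j => (z (blk i j)).op)
          (E.Mor.comp (y i).hom fun j => (z (blk i j)).hom)))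
    have hxy := x.isHom.comp fun i => (y i).isHom
    have hyz := fun i => (y i).isHom.comp fun j => (z (blk i j)).isHom
    have h1 := L.dec_isHom (C.comp x.op fun i => (y i).op) fun p => (z p).op
    have h2 := L.dec_isHom x.op fun i => (y i).op
    have h3 := L.dec_isHom x.op fun i => C.comp (y i).op fun j => (z (blk i j)).op
    have h4 := fun i => L.dec_isHom (y i).op fun j => (z (blk i j)).op
    rw [funext fun p => ((z p).isHom.idn_cmp).symm,
      h2.comp_cmp hxy (fun p => isHom_idn _) (fun p => (z p).isHom),
      ← h1.cmp_assoc (h2.comp fun p => isHom_idn _) (hxy.comp fun p => (z p).isHom),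
      L.dec_assoc]
    conv_rhs => rw [← x.isHom.idn_cmp]
    rw [(isHom_idn _).comp_cmp x.isHom h4 hyz,
      h3.act_cmp (((isHom_idn _).comp h4).cmp (x.isHom.comp hyz)),
      ((isHom_idn _).comp h4).act_cmp (x.isHom.comp hyz), E.Mor.comp_assoc,
      (h3.act _).cmp_assoc (((isHom_idn _).comp h4).act _) ((x.isHom.comp hyz).act _)])
  comp_act {n m k k'} lam κ x y := IsoOver.ext (C.comp_act _ _ _ _) (by
    change E.cmp (L.dec (C.act lam x.op) fun i => C.act (κ i) (y i).op)
        (E.Mor.comp (E.cmp (L.actHom lam x.op) (E.Mor.act lam x.hom))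
          fun i => E.cmp (L.actHom (κ i) (y i).op) (E.Mor.act (κ i) (y i).hom)) =
      E.cmp (L.actHom (blockEquiv lam κ) (C.comp x.op fun j => (y (lam j)).op))
        (E.Mor.act (blockEquiv lam κ) (E.cmp (L.dec x.op fun j => (y (lam j)).op)
          (E.Mor.comp x.hom fun j => (y (lam j)).hom)))
    have h1 := L.actHom_isHom lam x.op
    have h2 := fun i => L.actHom_isHom (κ i) (y i).op
    have h3 := L.dec_isHom (C.act lam x.op) fun i => C.act (κ i) (y i).op
    have h4 := L.dec_isHom x.op fun j => (y (lam j)).op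
    have h5 := L.actHom_isHom (blockEquiv lam κ) (C.comp x.op fun j => (y (lam j)).op)
    have h6 := x.isHom.comp fun j => (y (lam j)).isHom
    have h7 := (x.isHom.act lam).comp fun i => (y i).isHom.act (κ i)
    rw [h1.comp_cmp (x.isHom.act lam) h2 (fun i => (y i).isHom.act (κ i)),
      ← h3.cmp_assoc (h1.comp h2) h7, L.dec_act, h4.act_cmp h6,
      ← h5.cmp_assoc (h4.act _) (h6.act _), E.Mor.comp_act])

/-- The formal operations, with the canonical isomorphism between the image of the underlying
operation of `C` and the result of carrying out the formal composition in `E`. -/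
noncomputable def canon : OpMap (free C) L.isoOver :=
  freeLift (D := L.isoOver) (fun {_} μ =>
    (⟨μ, E.idn.map (L.op μ), E.src_idn _, ⟨_, isInv_idn _⟩⟩ : L.IsoOver _))

theorem canon_gen {n : ℕ} (μ : C.Ops n) : L.canon.map (gen μ) =
    (⟨μ, E.idn.map (L.op μ), E.src_idn _, ⟨_, isInv_idn _⟩⟩ : L.IsoOver n) :=
  freeLift_gen _ μ

/-- The canonical isomorphism from `L` of the image of a formal operation. -/
noncomputable def canonHom {n : ℕ} (σ : (free C).Ops n) : E.Mor.Ops n := (L.canon.map σ).hom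

/-- The result of carrying out a formal composition in `E`. -/
noncomputable def strictOb {n : ℕ} (σ : (free C).Ops n) : E.Ob.Ops n :=
  E.tgt.map (L.canonHom σ)

theorem canon_op {n : ℕ} (σ : (free C).Ops n) : (L.canon.map σ).op = (freeCounit C).map σ := by
  induction σ using free_induction with
  | gen μ => rw [canon_gen, freeCounit_gen]
  | one => rw [L.canon.map_one, (freeCounit C).map_one]; rfl
  | comp σ τ hσ hτ =>
    rw [L.canon.map_comp, (freeCounit C).map_comp, ← hσ, ← funext hτ]; rfl
  | act κ σ hσ => rw [L.canon.map_act, (freeCounit C).map_act, ← hσ]; rfl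

theorem canonHom_isHom {n : ℕ} (σ : (free C).Ops n) :
    E.IsHom (L.canonHom σ) (L.op ((freeCounit C).map σ)) (L.strictOb σ) :=
  ⟨by rw [← canon_op]; exact (L.canon.map σ).src_hom, rfl⟩

theorem isInv_canonHom {n : ℕ} (σ : (free C).Ops n) :
    E.IsInv (L.canonHom σ) (E.inv (L.canonHom σ)) := isInv_inv (L.canon.map σ).iso

theorem inv_canonHom_isHom {n : ℕ} (σ : (free C).Ops n) :
    E.IsHom (E.inv (L.canonHom σ)) (L.strictOb σ) (L.op ((freeCounit C).map σ)) := by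
  have := (L.isInv_canonHom σ).isHom
  rwa [(L.canonHom_isHom σ).src, (L.canonHom_isHom σ).tgt] at this

theorem canonHom_gen {n : ℕ} (μ : C.Ops n) : L.canonHom (gen μ) = E.idn.map (L.op μ) := by
  rw [canonHom, canon_gen]

theorem canonHom_one : L.canonHom (free C).one = L.oneHom := by
  rw [canonHom, L.canon.map_one]
  rfl

theorem canonHom_comp {n : ℕ} {k : Fin n → ℕ} (σ : (free C).Ops n) (τ : ∀ i, (free C).Ops (k i)) :
    L.canonHom ((free C).comp σ τ) =
      E.cmp (L.dec ((freeCounit C).map σ) (fun i => (freeCounit C).map (τ i)))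
        (E.Mor.comp (L.canonHom σ) (fun i => L.canonHom (τ i))) := by
  rw [canonHom, L.canon.map_comp, ← L.canon_op σ, ← funext fun i => L.canon_op (τ i)]
  rfl

theorem canonHom_act {n m : ℕ} (κ : Fin n ≃ Fin m) (σ : (free C).Ops n) :
    L.canonHom ((free C).act κ σ) =
      E.cmp (L.actHom κ ((freeCounit C).map σ)) (E.Mor.act κ (L.canonHom σ)) := by
  rw [canonHom, L.canon.map_act, ← L.canon_op σ]
  rfl

/-- The strictification on objects is a map of operads. -/
noncomputable def strictObMap : OpMap (free C) E.Ob where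
  map σ := L.strictOb σ
  map_act κ σ := by
    rw [strictOb, canonHom_act, ((L.actHom_isHom _ _).cmp ((L.canonHom_isHom σ).act κ)).tgt]
  map_one := by rw [strictOb, canonHom_one, L.oneHom_isHom.tgt]
  map_comp σ τ := by
    rw [strictOb, canonHom_comp, ((L.dec_isHom _ _).cmp
      ((L.canonHom_isHom σ).comp fun i => L.canonHom_isHom (τ i))).tgt]

/-- The image in `E` of the morphism `σ → τ` of the coherence category. It is meaningful only if
`σ` and `τ` have the same image in `C`. -/
noncomputable def strictMor {n : ℕ} (σ τ : (free C).Ops n) : E.Mor.Ops n :=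
  E.cmp (E.inv (L.canonHom σ)) (L.canonHom τ)

section

variable {n : ℕ} {σ τ ρ : (free C).Ops n}

theorem strictMor_isHom (h : (freeCounit C).map σ = (freeCounit C).map τ) :
    E.IsHom (L.strictMor σ τ) (L.strictOb σ) (L.strictOb τ) :=
  (L.inv_canonHom_isHom σ).cmp (h ▸ L.canonHom_isHom τ)

theorem strictMor_self (σ : (free C).Ops n) : L.strictMor σ σ = E.idn.map (L.strictOb σ) :=
  (L.isInv_canonHom σ).inv_hom

theorem strictMor_cmp (h : (freeCounit C).map σ = (freeCounit C).map τ)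
    (h' : (freeCounit C).map τ = (freeCounit C).map ρ) :
    E.cmp (L.strictMor σ τ) (L.strictMor τ ρ) = L.strictMor σ ρ := by
  have h1 := L.canonHom_isHom τ
  have h2 := L.inv_canonHom_isHom τ
  have h3 := L.canonHom_isHom ρ
  rw [← h] at h1 h2
  rw [← h', ← h] at h3
  rw [strictMor, strictMor, (L.inv_canonHom_isHom σ).cmp_assoc h1 (h2.cmp h3),
    (L.isInv_canonHom τ).symm.cancel (h2.tgt.symm ▸ h3)]
  rfl

/-- The image of `σ → τ` is characterized by its compatibility with the canonical isomorphisms. -/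
theorem eq_strictMor {f : E.Mor.Ops n} {x : E.Ob.Ops n} (hf : E.IsHom f (L.strictOb σ) x)
    (e : E.cmp (L.canonHom σ) f = L.canonHom τ) : f = L.strictMor σ τ := by
  rw [strictMor, ← e, (L.isInv_canonHom σ).cancel ((L.canonHom_isHom σ).tgt.symm ▸ hf)]

theorem canonHom_cmp_strictMor (h : (freeCounit C).map σ = (freeCounit C).map τ) :
    E.cmp (L.canonHom σ) (L.strictMor σ τ) = L.canonHom τ :=
  (L.isInv_canonHom σ).symm.cancel
    ((L.inv_canonHom_isHom σ).tgt.symm ▸ h.symm ▸ L.canonHom_isHom τ)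

theorem strictMor_comp {k : Fin n → ℕ} {σ' τ' : ∀ i, (free C).Ops (k i)}
    (h : (freeCounit C).map σ = (freeCounit C).map τ)
    (h' : ∀ i, (freeCounit C).map (σ' i) = (freeCounit C).map (τ' i)) :
    L.strictMor ((free C).comp σ σ') ((free C).comp τ τ') =
      E.Mor.comp (L.strictMor σ τ) (fun i => L.strictMor (σ' i) (τ' i)) := by
  have h1 := (L.strictMor_isHom h).comp fun i => L.strictMor_isHom (h' i)
  refine (L.eq_strictMor (L.strictObMap.map_comp σ σ' ▸ h1) ?_).symm
  have h2 := L.dec_isHom ((freeCounit C).map σ) fun i => (freeCounit C).map (σ' i)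
  rw [canonHom_comp, h2.cmp_assoc ((L.canonHom_isHom σ).comp fun i => L.canonHom_isHom (σ' i)) h1,
    ← (L.canonHom_isHom σ).comp_cmp (L.strictMor_isHom h) (fun i => L.canonHom_isHom (σ' i))
      (fun i => L.strictMor_isHom (h' i)), L.canonHom_cmp_strictMor h,
    funext fun i => L.canonHom_cmp_strictMor (h' i), canonHom_comp, h, funext h']

theorem strictMor_act {m : ℕ} (κ : Fin n ≃ Fin m)
    (h : (freeCounit C).map σ = (freeCounit C).map τ) :
    L.strictMor ((free C).act κ σ) ((free C).act κ τ) = E.Mor.act κ (L.strictMor σ τ) := by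
  have h1 := (L.strictMor_isHom h).act κ
  refine (L.eq_strictMor (L.strictObMap.map_act κ σ ▸ h1) ?_).symm
  rw [canonHom_act, (L.actHom_isHom κ _).cmp_assoc ((L.canonHom_isHom σ).act κ) h1,
    ← (L.canonHom_isHom σ).act_cmp (L.strictMor_isHom h), L.canonHom_cmp_strictMor h,
    canonHom_act, h]

end

theorem strictOb_gen {n : ℕ} (μ : C.Ops n) : L.strictOb (gen μ) = L.op μ := by
  rw [strictOb, canonHom_gen, E.tgt_idn]

theorem strictMor_compHom {n : ℕ} {k : Fin n → ℕ} (μ : C.Ops n) (ν : ∀ i, C.Ops (k i)) :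
    L.strictMor ((free C).comp (gen μ) (fun i => gen (ν i))) (gen (C.comp μ ν)) =
      L.compHom μ ν := by
  have h : L.canonHom ((free C).comp (gen μ) (fun i => gen (ν i))) = L.dec μ ν := by
    rw [canonHom_comp, freeCounit_gen, funext fun i => freeCounit_gen (ν i), canonHom_gen,
      funext fun i => L.canonHom_gen (ν i), ← E.idn.map_comp, (L.dec_isHom μ ν).cmp_idn]
  rw [strictMor, h, (L.isInv_dec μ ν).symm.inv_eq, canonHom_gen, (L.compHom_isHom μ ν).cmp_idn]

theorem strictMor_oneHom : L.strictMor (gen C.one) (free C).one = L.oneHom := by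
  rw [strictMor, canonHom_gen, canonHom_one, (isInv_idn _).inv_eq, L.oneHom_isHom.idn_cmp]

theorem strictMor_actHom {n m : ℕ} (κ : Fin n ≃ Fin m) (μ : C.Ops n) :
    L.strictMor (gen (C.act κ μ)) ((free C).act κ (gen μ)) = L.actHom κ μ := by
  rw [strictMor, canonHom_gen, canonHom_act, (isInv_idn _).inv_eq, freeCounit_gen, canonHom_gen,
    ← E.idn.map_act, (L.actHom_isHom κ μ).cmp_idn, (L.actHom_isHom κ μ).idn_cmp]

end LaxMap

end CatOperad

end Operad

/-! ### Permutations of finite sets -/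

section Permutations

/-- The bijection obtained from `κ` by removing `j` from the source and `κ j` from the target. -/
def removeAt {n m : ℕ} (κ : Fin (n + 1) ≃ Fin (m + 1)) (j : Fin (n + 1)) : Fin n ≃ Fin m :=
  Equiv.removeNone ((finSuccEquiv' j).symm.trans (κ.trans (finSuccEquiv' (κ j))))

theorem removeAt_zero {n m : ℕ} (κ : Fin (n + 1) ≃ Fin (m + 1)) :
    removeAt κ 0 = removeZero κ := rfl

theorem succAbove_removeAt {n m : ℕ} (κ : Fin (n + 1) ≃ Fin (m + 1)) (j : Fin (n + 1))
    (a : Fin n) : (κ j).succAbove (removeAt κ j a) = κ (j.succAbove a) := by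
  have h := Equiv.removeNone_some ((finSuccEquiv' j).symm.trans (κ.trans (finSuccEquiv' (κ j))))
    (x := a) (by
      have : κ (j.succAbove a) ≠ κ j := fun h => Fin.succAbove_ne j a (κ.injective h)
      obtain ⟨b, hb⟩ := Fin.exists_succAbove_eq this
      exact ⟨b, by simp [← hb]⟩)
  have h2 := congrArg (finSuccEquiv' (κ j)).symm h
  simpa [removeAt] using h2

theorem succAbove_removeZero {n m : ℕ} (κ : Fin (n + 1) ≃ Fin (m + 1)) (a : Fin n) :
    (κ 0).succAbove (removeZero κ a) = κ a.succ :=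
  succAbove_removeAt κ 0 a

theorem removeZero_eq {n m : ℕ} {κ : Fin (n + 1) ≃ Fin (m + 1)} {κ' : Fin n ≃ Fin m}
    (h : ∀ a, (κ 0).succAbove (κ' a) = κ a.succ) : removeZero κ = κ' :=
  Equiv.ext fun a => Fin.succAbove_right_injective ((succAbove_removeZero κ a).trans (h a).symm)

/-- The extension of a bijection by `0 ↦ 0`. -/
def liftZero {n m : ℕ} (κ : Fin n ≃ Fin m) : Fin (n + 1) ≃ Fin (m + 1) :=
  (finSuccEquiv n).trans ((Equiv.optionCongr κ).trans (finSuccEquiv m).symm)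

@[simp]
theorem liftZero_zero {n m : ℕ} (κ : Fin n ≃ Fin m) : liftZero κ 0 = 0 := by
  simp [liftZero]

@[simp]
theorem liftZero_succ {n m : ℕ} (κ : Fin n ≃ Fin m) (j : Fin n) :
    liftZero κ j.succ = (κ j).succ := by
  simp [liftZero]

theorem removeZero_liftZero {n m : ℕ} (κ : Fin n ≃ Fin m) : removeZero (liftZero κ) = κ :=
  removeZero_eq fun a => by simp

/-- The disjoint union of two bijections. -/
def addEquiv {a a' b b' : ℕ} (κ : Fin a ≃ Fin a') (κ' : Fin b ≃ Fin b') :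
    Fin (a + b) ≃ Fin (a' + b') :=
  finSumFinEquiv.symm.trans ((Equiv.sumCongr κ κ').trans finSumFinEquiv)

@[simp]
theorem addEquiv_castAdd {a a' b b' : ℕ} (κ : Fin a ≃ Fin a') (κ' : Fin b ≃ Fin b') (i : Fin a) :
    addEquiv κ κ' (Fin.castAdd b i) = Fin.castAdd b' (κ i) := by
  simp [addEquiv]

@[simp]
theorem addEquiv_natAdd {a a' b b' : ℕ} (κ : Fin a ≃ Fin a') (κ' : Fin b ≃ Fin b') (i : Fin b) :
    addEquiv κ κ' (Fin.natAdd a i) = Fin.natAdd a' (κ' i) := by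
  simp [addEquiv]

theorem equiv_ext_add {a b m : ℕ} {κ κ' : Fin (a + b) ≃ Fin m}
    (h : ∀ i, κ (Fin.castAdd b i) = κ' (Fin.castAdd b i))
    (h' : ∀ i, κ (Fin.natAdd a i) = κ' (Fin.natAdd a i)) : κ = κ' :=
  Equiv.ext fun i => by induction i using Fin.addCases <;> simp only [h, h']

theorem equiv_ext_succ {n m : ℕ} {κ κ' : Fin (n + 1) ≃ Fin m} (h : κ 0 = κ' 0)
    (h' : ∀ i : Fin n, κ i.succ = κ' i.succ) : κ = κ' :=
  Equiv.ext fun i => by induction i using Fin.cases <;> simp only [h, h']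

theorem swap_succ_succ {n : ℕ} (j : Fin n) :
    Equiv.swap (0 : Fin (n + 2)) 1 j.succ.succ = j.succ.succ :=
  Equiv.swap_apply_of_ne_of_ne (Fin.succ_ne_zero _)
    (fun h => Fin.succ_ne_zero j (Fin.succ_injective _ h))

theorem removeZero_swap (n : ℕ) :
    removeZero (Equiv.swap (0 : Fin (n + 2)) 1) = Equiv.refl _ :=
  removeZero_eq fun a => by
    rw [Equiv.swap_apply_left]
    induction a using Fin.cases with
    | zero => rw [Fin.succ_zero_eq_one, Equiv.swap_apply_right]; rfl
    | succ j => rw [swap_succ_succ]; rfl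

/-- The cyclic permutation which takes `0` to `i` and preserves the order of the other elements. -/
theorem exists_pull : ∀ {n : ℕ} (i : Fin (n + 1)), ∃ c : Equiv.Perm (Fin (n + 1)),
    c 0 = i ∧ ∀ j, c (Fin.succ j) = i.succAbove j := fun {n} i =>
  ⟨(finSuccEquiv' 0).trans (finSuccEquiv' i).symm, by simp, fun j => by
    rw [Equiv.trans_apply, finSuccEquiv'_zero, finSuccEquiv_succ, finSuccEquiv'_symm_some]⟩

/-- The permutations of the sets `Fin n` are generated by the transpositions `(0 1)` and by
the inclusions of the symmetric groups as stabilizers of `0`. -/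
theorem perm_induction {P : ∀ {n : ℕ}, Equiv.Perm (Fin n) → Prop}
    (refl : ∀ n, P (Equiv.refl (Fin n)))
    (trans : ∀ {n : ℕ} (κ lam : Equiv.Perm (Fin n)), P κ → P lam → P (κ.trans lam))
    (lift : ∀ {n : ℕ} (κ : Equiv.Perm (Fin n)), P κ → P (liftZero κ))
    (swap : ∀ n : ℕ, P (Equiv.swap (0 : Fin (n + 2)) 1))
    {n : ℕ} (κ : Equiv.Perm (Fin n)) : P κ := by
  have key : ∀ {n : ℕ} (i : Fin (n + 1)) (c : Equiv.Perm (Fin (n + 1))), c 0 = i →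
      (∀ j, c (Fin.succ j) = i.succAbove j) → P c := by
    intro n
    induction n with
    | zero =>
      intro i c _ _
      rw [show c = Equiv.refl _ from Equiv.ext fun _ => Subsingleton.elim (α := Fin 1) _ _]
      exact refl _
    | succ n ih =>
      intro i c h0 h
      induction i using Fin.cases with
      | zero =>
        rw [show c = Equiv.refl _ from equiv_ext_succ h0 (fun j => h j)]
        exact refl _
      | succ i =>
        obtain ⟨d, hd0, hd⟩ := exists_pull i
        rw [show c = (Equiv.swap 0 1).trans (liftZero d) from equiv_ext_succ (by
            rw [Equiv.trans_apply, Equiv.swap_apply_left, ← Fin.succ_zero_eq_one, liftZero_succ,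
              hd0, h0]) (fun j => by
            rw [h]
            induction j using Fin.cases with
            | zero => simp
            | succ j => rw [Equiv.trans_apply, swap_succ_succ, liftZero_succ, hd]; simp)]
        exact trans _ _ (swap n) (lift _ (ih i d hd0 hd))
  induction n with
  | zero =>
    rw [show κ = Equiv.refl _ from Equiv.ext fun i => i.elim0]
    exact refl _
  | succ n ih =>
    obtain ⟨c, hc0, hc⟩ := exists_pull (κ 0)
    rw [show κ = (liftZero (removeZero κ)).trans c from equiv_ext_succ (by simp [hc0])
      (fun j => by simp [hc, succAbove_removeZero])]
    exact trans _ _ (lift _ (ih _)) (key _ c hc0 hc)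

end Permutations

/-! ### Symmetries of tensor powers -/

section SymmetricPowers

variable {B : Type u} [Category.{v} B] [MonoidalCategory B]

/-- The definitional identification of `X ⊗ X^n` with `X^{n + 1}`. -/
def tcons (X : B) (n : ℕ) : X ⊗ tpow X n ≅ tpow X (n + 1) := Iso.refl _

/-- The definitional identification of the unit with `X^0`. -/
def tnil (X : B) : 𝟙_ B ≅ tpow X 0 := Iso.refl _

/-- The right unitor `X^1 ⟶ X`. -/
def tone (X : B) : tpow X 1 ≅ X := (tcons X 0).symm ≪≫ whiskerLeftIso X (tnil X).symm ≪≫ ρ_ X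

theorem tone_hom (X : B) : (tone X).hom = (ρ_ X).hom :=
  (Category.id_comp _).trans <|
    (congrArg (· ≫ (ρ_ X).hom) (MonoidalCategory.whiskerLeft_id X (𝟙_ B))).trans
      (Category.id_comp _)

theorem tmap_zero {X Y : B} (f : X ⟶ Y) : tmap f 0 = (tnil X).inv ≫ (tnil Y).hom :=
  (Category.comp_id _).symm

theorem tmap_succ {X Y : B} (f : X ⟶ Y) (n : ℕ) :
    tmap f (n + 1) = (tcons X n).inv ≫ (f ⊗ₘ tmap f n) ≫ (tcons Y n).hom :=
  ((Category.id_comp _).trans (Category.comp_id _)).symm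

theorem tcast_rfl (X : B) {n : ℕ} (h : n = n) : tcast X h = 𝟙 _ := rfl

@[simp]
theorem tcast_tcast (X : B) {n m l : ℕ} (h : n = m) (h' : m = l) :
    tcast X h ≫ tcast X h' = tcast X (h.trans h') := by
  subst h h'
  exact Category.comp_id _

@[simp]
theorem tcast_tcast_assoc (X : B) {n m l : ℕ} (h : n = m) (h' : m = l) {Z : B}
    (f : tpow X l ⟶ Z) : tcast X h ≫ tcast X h' ≫ f = tcast X (h.trans h') ≫ f := by
  rw [← Category.assoc, tcast_tcast]

theorem tcast_succ (X : B) {n m : ℕ} (h : n = m) (h' : n + 1 = m + 1) :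
    tcast X h' = (tcons X n).inv ≫ X ◁ tcast X h ≫ (tcons X m).hom := by
  subst h
  simp [tcast_rfl]

theorem tmap_tcast {X Y : B} (f : X ⟶ Y) {n m : ℕ} (h : n = m) :
    tmap f n ≫ tcast Y h = tcast X h ≫ tmap f m := by
  subst h
  exact (Category.comp_id _).trans (Category.id_comp _).symm

theorem tsplit_zero (X : B) (b : ℕ) :
    tsplit X b 0 = tcast X (Nat.zero_add b) ≫ (λ_ (tpow X b)).inv ≫ (tnil X).hom ▷ _ :=
  congrArg (tcast X (Nat.zero_add b) ≫ ·) <| (Category.comp_id _).symm.trans <|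
    congrArg ((λ_ (tpow X b)).inv ≫ ·) (MonoidalCategory.id_whiskerRight _ _).symm

theorem tsplit_succ (X : B) (b a : ℕ) :
    tsplit X b (a + 1) = tcast X (Nat.succ_add a b) ≫ (tcons X (a + b)).inv ≫ X ◁ tsplit X b a ≫
      (α_ X (tpow X a) (tpow X b)).inv ≫ (tcons X a).hom ▷ tpow X b :=
  congrArg (tcast X (Nat.succ_add a b) ≫ ·) <| (Category.id_comp _).symm.trans <|
    congrArg (fun f => (tcons X (a + b)).inv ≫ X ◁ tsplit X b a ≫ f) <|
      (Category.comp_id _).symm.trans <|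
        congrArg ((α_ X (tpow X a) (tpow X b)).inv ≫ ·) (MonoidalCategory.id_whiskerRight _ _).symm

theorem tblock_zero {X Y : B} {k : Fin 0 → ℕ} (f : ∀ i, tpow X (k i) ⟶ Y) :
    tblock f = tcast X (Fin.sum_univ_zero k) ≫ (tnil X).inv ≫ (tnil Y).hom :=
  ((congrArg (tcast X (Fin.sum_univ_zero k) ≫ ·) (Category.comp_id _)).trans
    (Category.comp_id _)).symm

theorem tblock_succ {X Y : B} {n : ℕ} {k : Fin (n + 1) → ℕ} (f : ∀ i, tpow X (k i) ⟶ Y) :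
    tblock f = tcast X (Fin.sum_univ_succ k) ≫ tsplit X _ _ ≫
      (f 0 ⊗ₘ tblock (fun i => f i.succ)) ≫ (tcons Y n).hom :=
  congrArg (fun g => tcast X (Fin.sum_univ_succ k) ≫ tsplit X _ _ ≫ g) (Category.comp_id _).symm

variable [SymmetricCategory B]

/-- The symmetry interchanging the first two factors. -/
def tswap (X Y Z : B) : X ⊗ (Y ⊗ Z) ⟶ Y ⊗ (X ⊗ Z) :=
  (α_ X Y Z).inv ≫ (β_ X Y).hom ▷ Z ≫ (α_ Y X Z).hom

theorem tswap_tswap (X Y Z : B) : tswap X Y Z ≫ tswap Y X Z = 𝟙 _ := by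
  simp only [tswap, Category.assoc, Iso.hom_inv_id_assoc]
  rw [← comp_whiskerRight_assoc, SymmetricCategory.symmetry]
  simp

theorem tswap_naturality {X X' Y Y' Z Z' : B} (f : X ⟶ X') (g : Y ⟶ Y') (h : Z ⟶ Z') :
    (f ⊗ₘ (g ⊗ₘ h)) ≫ tswap X' Y' Z' = tswap X Y Z ≫ (g ⊗ₘ (f ⊗ₘ h)) := by
  simp only [tswap, Category.assoc, associator_inv_naturality_assoc]
  rw [← associator_naturality, ← tensorHom_id, ← tensorHom_id, tensorHom_comp_tensorHom_assoc,
    tensorHom_comp_tensorHom_assoc, BraidedCategory.braiding_naturality, Category.comp_id,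
    Category.id_comp]

theorem tswap_naturality_right (X Y : B) {Z Z' : B} (h : Z ⟶ Z') :
    X ◁ Y ◁ h ≫ tswap X Y Z' = tswap X Y Z ≫ Y ◁ X ◁ h := by
  simpa using tswap_naturality (𝟙 X) (𝟙 Y) h

/-- The braid relation. -/
theorem tswap_braid (X Z : B) :
    X ◁ tswap X X Z ≫ tswap X X (X ⊗ Z) ≫ X ◁ tswap X X Z =
      tswap X X (X ⊗ Z) ≫ X ◁ tswap X X Z ≫ tswap X X (X ⊗ Z) := by
  have h := congrArg (fun f => X ◁ (α_ X X Z).inv ≫ (α_ X (X ⊗ X) Z).inv ≫ f ▷ Z ≫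
    (α_ X (X ⊗ X) Z).hom ≫ X ◁ (α_ X X Z).hom) (BraidedCategory.yang_baxter X X X)
  simp only [tswap]
  refine Eq.trans ?_ (h.symm.trans ?_) <;> monoidal

theorem tpull_zero (X : B) (n : ℕ) : tpull X (0 : Fin (n + 1)) = (tcons X n).inv := by
  cases n <;> rfl

theorem tpull_succ (X : B) {n : ℕ} (j : Fin (n + 1)) :
    tpull X j.succ = (tcons X (n + 1)).inv ≫ X ◁ tpull X j ≫ tswap X X (tpow X n) ≫
      X ◁ (tcons X n).hom :=
  ((Category.id_comp _).trans <| congrArg (X ◁ tpull X j ≫ ·) <|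
    (congrArg (tswap X X (tpow X n) ≫ ·) (MonoidalCategory.whiskerLeft_id _ _)).trans
      (Category.comp_id _)).symm

theorem tperm_succ (X : B) {n m : ℕ} (κ : Fin (n + 1) ≃ Fin (m + 1)) :
    tperm X κ = tpull X (κ 0) ≫ X ◁ tperm X (removeZero κ) ≫ (tcons X n).hom :=
  congrArg (tpull X (κ 0) ≫ ·) (Category.comp_id _).symm

/-- Moving two factors to the front one after the other, in either order. -/
theorem tpull_tpull (X : B) {n : ℕ} (a b : Fin (n + 2)) (a' b' : Fin (n + 1))
    (hb : a.succAbove b' = b) (ha : b.succAbove a' = a) :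
    tpull X a ≫ X ◁ tpull X b' = tpull X b ≫ X ◁ tpull X a' ≫ tswap X X (tpow X n) := by
  induction n with
  | zero =>
    induction a using Fin.cases with
    | zero =>
      rw [Fin.succAbove_zero] at hb
      subst hb
      obtain rfl : a' = 0 :=
        Fin.succAbove_right_injective (ha.trans (Fin.succ_succAbove_zero b').symm)
      simp only [tpull_zero, tpull_succ, Category.assoc, ← MonoidalCategory.whiskerLeft_comp_assoc,
        Iso.hom_inv_id, MonoidalCategory.whiskerLeft_id, Category.id_comp, tswap_tswap,
        Category.comp_id]
    | succ a =>
      induction b using Fin.cases with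
      | zero =>
        rw [Fin.succAbove_zero] at ha
        obtain rfl := Fin.succ_injective _ ha
        obtain rfl : b' = 0 :=
          Fin.succAbove_right_injective (hb.trans (Fin.succ_succAbove_zero a').symm)
        simp only [tpull_zero, tpull_succ, Category.assoc, ← MonoidalCategory.whiskerLeft_comp,
          Iso.hom_inv_id, MonoidalCategory.whiskerLeft_id, Category.comp_id]
      | succ b =>
        exact (Fin.succ_ne_zero a).elim (ha.symm.trans (by
          obtain rfl : a' = 0 := Subsingleton.elim (α := Fin 1) _ _
          exact Fin.succAbove_ne_zero_zero (Fin.succ_ne_zero b)))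
  | succ n ih =>
    induction a using Fin.cases with
    | zero =>
      rw [Fin.succAbove_zero] at hb
      subst hb
      obtain rfl : a' = 0 :=
        Fin.succAbove_right_injective (ha.trans (Fin.succ_succAbove_zero b').symm)
      simp only [tpull_zero, tpull_succ, Category.assoc, ← MonoidalCategory.whiskerLeft_comp_assoc,
        Iso.hom_inv_id, MonoidalCategory.whiskerLeft_id, Category.id_comp, tswap_tswap,
        Category.comp_id]
    | succ a =>
      induction b using Fin.cases with
      | zero =>
        rw [Fin.succAbove_zero] at ha
        obtain rfl := Fin.succ_injective _ ha
        obtain rfl : b' = 0 :=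
          Fin.succAbove_right_injective (hb.trans (Fin.succ_succAbove_zero a').symm)
        simp only [tpull_zero, tpull_succ, Category.assoc, ← MonoidalCategory.whiskerLeft_comp,
          Iso.hom_inv_id, MonoidalCategory.whiskerLeft_id, Category.comp_id]
      | succ b =>
        induction a' using Fin.cases with
        | zero =>
          rw [Fin.succAbove_ne_zero_zero (Fin.succ_ne_zero b)] at ha
          exact absurd ha.symm (Fin.succ_ne_zero a)
        | succ a' =>
        induction b' using Fin.cases with
        | zero =>
          rw [Fin.succAbove_ne_zero_zero (Fin.succ_ne_zero a)] at hb
          exact absurd hb.symm (Fin.succ_ne_zero b)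
        | succ b' =>
          rw [Fin.succ_succAbove_succ] at ha hb
          have := ih a b a' b' (Fin.succ_injective _ hb) (Fin.succ_injective _ ha)
          have h1 := congrArg (fun f => X ◁ f) this
          simp only [MonoidalCategory.whiskerLeft_comp] at h1
          simp only [tpull_succ, MonoidalCategory.whiskerLeft_comp, Category.assoc,
            ← MonoidalCategory.whiskerLeft_comp_assoc X (tcons X (n + 1)).hom, Iso.hom_inv_id,
            MonoidalCategory.whiskerLeft_id, Category.id_comp]
          rw [← reassoc_of% tswap_naturality_right, reassoc_of% h1,
            ← reassoc_of% tswap_naturality_right, tswap_naturality_right, reassoc_of% tswap_braid]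

end SymmetricPowers

/-! ### Functoriality of the symmetries of tensor powers -/

theorem succAbove_succAbove_comm {m : ℕ} {p q : Fin (m + 2)} {p' q' : Fin (m + 1)}
    (h : p.succAbove p' = q) (h' : q.succAbove q' = p) (x : Fin m) :
    p.succAbove (p'.succAbove x) = q.succAbove (q'.succAbove x) := by
  simp only [Fin.ext_iff, Fin.succAbove, Fin.lt_def, Fin.val_castSucc] at h h' ⊢
  split_ifs at h h' ⊢ <;> simp_all <;> omega

section SymmetricPowers

variable {B : Type u} [Category.{v} B] [MonoidalCategory B] [SymmetricCategory B]

theorem tmap_tpull {X Y : B} (f : X ⟶ Y) {n : ℕ} (i : Fin (n + 1)) :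
    tmap f (n + 1) ≫ tpull Y i = tpull X i ≫ (f ⊗ₘ tmap f n) := by
  induction n with
  | zero =>
    obtain rfl : i = 0 := Subsingleton.elim (α := Fin 1) _ _
    simp [tpull_zero, tmap_succ]
  | succ n ih =>
    induction i using Fin.cases with
    | zero => simp [tpull_zero, tmap_succ]
    | succ i =>
      have h := tswap_naturality f f (tmap f n)
      simp only [tpull_succ, tmap_succ f (n + 1), Category.assoc, Iso.hom_inv_id_assoc]
      rw [← id_tensorHom, ← id_tensorHom, ← id_tensorHom, ← id_tensorHom,
        tensorHom_comp_tensorHom_assoc, Category.comp_id, ih]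
      have e : (f ⊗ₘ tpull X i ≫ (f ⊗ₘ tmap f n)) =
          (𝟙 X ⊗ₘ tpull X i) ≫ (f ⊗ₘ (f ⊗ₘ tmap f n)) := by
        rw [tensorHom_comp_tensorHom, Category.id_comp]
      rw [e, Category.assoc, reassoc_of% h, tensorHom_comp_tensorHom, Category.comp_id,
        tensorHom_comp_tensorHom, Category.id_comp, tmap_succ]
      simp

theorem tmap_tperm {X Y : B} (f : X ⟶ Y) {n m : ℕ} (κ : Fin n ≃ Fin m) :
    tmap f m ≫ tperm Y κ = tperm X κ ≫ tmap f n := by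
  induction n generalizing m with
  | zero =>
    cases m with
    | zero => exact (Category.comp_id _).trans (Category.id_comp _).symm
    | succ m => exact (κ.symm 0).elim0
  | succ n ih =>
    cases m with
    | zero => exact (κ 0).elim0
    | succ m =>
      rw [tperm_succ, reassoc_of% tmap_tpull, MonoidalCategory.tensorHom_def, tperm_succ,
        tmap_succ, Category.assoc, ← MonoidalCategory.whiskerLeft_comp_assoc, ih]
      simp [MonoidalCategory.tensorHom_def, whisker_exchange_assoc]

/-- To permute the factors and move one of them to the front is to move it first and to permute the
remaining ones. -/
theorem tperm_tpull (X : B) {n m : ℕ} (κ : Fin (n + 1) ≃ Fin (m + 1))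
    (j : Fin (n + 1)) :
    tperm X κ ≫ tpull X j = tpull X (κ j) ≫ X ◁ tperm X (removeAt κ j) := by
  induction n generalizing m with
  | zero =>
    obtain rfl : j = 0 := Subsingleton.elim (α := Fin 1) _ _
    simp [tperm_succ, tpull_zero, removeAt_zero]
  | succ n ih =>
    cases m with
    | zero => exact absurd (Fintype.card_congr κ) (by simp)
    | succ m =>
      induction j using Fin.cases with
      | zero => simp [tperm_succ, tpull_zero, removeAt_zero]
      | succ j =>
        have h0 := succAbove_removeZero κ j
        have h1 := succAbove_removeAt κ j.succ 0
        rw [Fin.succAbove_ne_zero_zero (Fin.succ_ne_zero j)] at h1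
        have h2 : removeZero (removeAt κ j.succ) = removeAt (removeZero κ) j :=
          removeZero_eq fun a => by
            apply Fin.succAbove_right_injective (p := κ j.succ)
            refine (succAbove_succAbove_comm h0 h1 _).symm.trans ?_
            rw [succAbove_removeAt (removeZero κ) j a, succAbove_removeZero,
              succAbove_removeAt κ j.succ a.succ, Fin.succ_succAbove_succ]
        have h := tpull_tpull X (κ 0) (κ j.succ) _ _ h0 h1
        rw [tperm_succ X κ, tpull_succ, tperm_succ X (removeAt κ j.succ), h2]
        simp only [Category.assoc, Iso.hom_inv_id_assoc]
        rw [← MonoidalCategory.whiskerLeft_comp_assoc, ih, MonoidalCategory.whiskerLeft_comp,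
          Category.assoc, reassoc_of% tswap_naturality_right, reassoc_of% h,
          reassoc_of% tswap_tswap]
        simp

theorem tperm_refl (X : B) (n : ℕ) : tperm X (Equiv.refl (Fin n)) = 𝟙 _ := by
  induction n with
  | zero => rfl
  | succ n ih =>
    rw [tperm_succ, removeZero_eq (κ' := Equiv.refl _) (fun _ => rfl), ih, Equiv.refl_apply,
      tpull_zero]
    simp

/-- Permutations act functorially on tensor powers. -/
theorem tperm_trans (X : B) {n m l : ℕ} (κ : Fin n ≃ Fin m) (lam : Fin m ≃ Fin l) :
    tperm X (κ.trans lam) = tperm X lam ≫ tperm X κ := by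
  induction n generalizing m l with
  | zero =>
    cases m with
    | zero =>
      rw [show κ = Equiv.refl _ from Equiv.ext fun i => i.elim0, tperm_refl, Category.comp_id]
      rfl
    | succ m => exact (κ.symm 0).elim0
  | succ n ih =>
    cases m with
    | zero => exact (κ 0).elim0
    | succ m =>
      cases l with
      | zero => exact (lam 0).elim0
      | succ l =>
        have h : removeZero (κ.trans lam) = (removeZero κ).trans (removeAt lam (κ 0)) :=
          removeZero_eq fun a => by
            simp [succAbove_removeAt, succAbove_removeZero]
        rw [tperm_succ, tperm_succ X κ, reassoc_of% tperm_tpull X lam (κ 0), h, ih]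
        simp

theorem tperm_tperm (X : B) {n m l : ℕ} (κ : Fin n ≃ Fin m) (lam : Fin m ≃ Fin l) :
    tperm X lam ≫ tperm X κ = tperm X (κ.trans lam) :=
  (tperm_trans X κ lam).symm

theorem tcast_eq (X : B) {n m : ℕ} (h : n = m) : tcast X h = tperm X (finCongr h.symm) := by
  subst h
  exact (tperm_refl X n).symm

theorem tperm_liftZero (X : B) {n m : ℕ} (κ : Fin n ≃ Fin m) :
    tperm X (liftZero κ) = (tcons X m).inv ≫ X ◁ tperm X κ ≫ (tcons X n).hom := by
  rw [tperm_succ, removeZero_liftZero, liftZero_zero, tpull_zero]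

theorem tperm_swap (X : B) (n : ℕ) :
    tperm X (Equiv.swap (0 : Fin (n + 2)) 1) = (tcons X (n + 1)).inv ≫ X ◁ (tcons X n).inv ≫
      tswap X X (tpow X n) ≫ X ◁ (tcons X n).hom ≫ (tcons X (n + 1)).hom := by
  rw [tperm_succ, removeZero_swap, Equiv.swap_apply_left, ← Fin.succ_zero_eq_one, tpull_succ,
    tpull_zero, tperm_refl]
  simp

end SymmetricPowers

/-! ### Splitting tensor powers -/

section SymmetricPowers

theorem cast_castAdd_zero (a b : ℕ) :
    Fin.cast (Nat.succ_add a b) (Fin.castAdd b (0 : Fin (a + 1))) = 0 := rfl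

theorem cast_castAdd_succ {a : ℕ} (b : ℕ) (i : Fin a) :
    Fin.cast (Nat.succ_add a b) (Fin.castAdd b i.succ) = (Fin.castAdd b i).succ := rfl

theorem cast_natAdd_succ (a : ℕ) {b : ℕ} (i : Fin b) :
    Fin.cast (Nat.succ_add a b) (Fin.natAdd (a + 1) i) = (Fin.natAdd a i).succ :=
  Fin.ext (by simp; omega)

theorem val_swap_zero_one {n : ℕ} (i : Fin (n + 2)) :
    ((Equiv.swap (0 : Fin (n + 2)) 1 i : Fin (n + 2)) : ℕ) = if (i : ℕ) = 0 then (1 : ℕ) else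
      if (i : ℕ) = 1 then (0 : ℕ) else (i : ℕ) := by
  simp only [Equiv.swap_apply_def, Fin.ext_iff]
  split_ifs <;> simp_all

theorem addEquiv_liftZero {a a' b b' : ℕ} (κ : Fin a ≃ Fin a') (κ' : Fin b ≃ Fin b') :
    (finCongr (Nat.succ_add a b).symm).trans (addEquiv (liftZero κ) κ') =
      (liftZero (addEquiv κ κ')).trans (finCongr (Nat.succ_add a' b').symm) := by
  have h : (addEquiv (liftZero κ) κ').trans (finCongr (Nat.succ_add a' b')) =
      (finCongr (Nat.succ_add a b)).trans (liftZero (addEquiv κ κ')) := by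
    refine equiv_ext_add (fun i => ?_) (fun i => ?_)
    · induction i using Fin.cases with
      | zero =>
        simp only [Equiv.trans_apply, finCongr_apply, addEquiv_castAdd, cast_castAdd_zero,
          liftZero_zero]
      | succ i =>
        simp only [Equiv.trans_apply, finCongr_apply, addEquiv_castAdd, cast_castAdd_succ,
          liftZero_succ]
    · simp only [Equiv.trans_apply, finCongr_apply, addEquiv_natAdd, cast_natAdd_succ,
        liftZero_succ]
  refine Equiv.ext fun i => (finCongr (Nat.succ_add a' b')).injective ?_
  exact (Equiv.congr_fun h (Fin.cast (Nat.succ_add a b).symm i)).trans (by simp)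

theorem liftZero_refl (n : ℕ) : liftZero (Equiv.refl (Fin n)) = Equiv.refl _ :=
  equiv_ext_succ (by simp) (by simp)

variable {B : Type u} [Category.{v} B] [MonoidalCategory B]

theorem tmap_tsplit {X Y : B} (f : X ⟶ Y) (b a : ℕ) :
    tmap f (a + b) ≫ tsplit Y b a = tsplit X b a ≫ (tmap f a ⊗ₘ tmap f b) := by
  induction a with
  | zero =>
    rw [tsplit_zero, tsplit_zero, reassoc_of% tmap_tcast, tmap_zero, Category.assoc,
      Category.assoc, leftUnitor_inv_naturality_assoc, ← id_tensorHom,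
      ← tensorHom_id, ← tensorHom_id, tensorHom_comp_tensorHom, tensorHom_comp_tensorHom]
    simp
  | succ a ih =>
    rw [tsplit_succ, tsplit_succ, reassoc_of% tmap_tcast, tmap_succ, tmap_succ]
    simp only [Category.assoc, Iso.hom_inv_id_assoc]
    have e : (f ⊗ₘ tmap f (a + b)) ≫ Y ◁ tsplit Y b a =
        X ◁ tsplit X b a ≫ (f ⊗ₘ (tmap f a ⊗ₘ tmap f b)) := by
      rw [← id_tensorHom, ← id_tensorHom, tensorHom_comp_tensorHom, tensorHom_comp_tensorHom, ih]
      simp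
    rw [reassoc_of% e, associator_inv_naturality_assoc]
    simp only [← tensorHom_id, tensorHom_comp_tensorHom, Iso.hom_inv_id_assoc, Category.comp_id,
      Category.id_comp]

theorem tcast_tsplit_left (X : B) {a a' : ℕ} (b : ℕ) (h : a = a') (h' : a + b = a' + b) :
    tcast X h' ≫ tsplit X b a' = tsplit X b a ≫ tcast X h ▷ tpow X b := by
  subst h
  simp [tcast_rfl]

theorem tcast_tsplit_right (X : B) (a : ℕ) {b b' : ℕ} (h : b = b') (h' : a + b = a + b') :
    tcast X h' ≫ tsplit X b' a = tsplit X b a ≫ tpow X a ◁ tcast X h := by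
  subst h
  simp [tcast_rfl]

theorem tsplit_assoc (X : B) (a b c : ℕ) :
    tsplit X c (a + b) ≫ tsplit X b a ▷ tpow X c =
      tcast X (Nat.add_assoc a b c) ≫ tsplit X (b + c) a ≫ tpow X a ◁ tsplit X c b ≫
        (α_ (tpow X a) (tpow X b) (tpow X c)).inv := by
  induction a with
  | zero =>
    rw [tsplit_zero, tsplit_zero, comp_whiskerRight,
      ← reassoc_of% (tcast_tsplit_left X c (Nat.zero_add b) (by omega))]
    simp [← whisker_exchange_assoc]
  | succ a ih =>
    have h1 := congrArg (fun f => X ◁ f) ih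
    simp only [MonoidalCategory.whiskerLeft_comp] at h1
    rw [tsplit_succ X b a, comp_whiskerRight,
      ← reassoc_of% (tcast_tsplit_left X c (Nat.succ_add a b) (by omega)), tsplit_succ, tsplit_succ]
    have e : (tcons X (a + b)).hom ▷ tpow X c ≫ (tcons X (a + b)).inv ▷ tpow X c = 𝟙 _ := by
      rw [← comp_whiskerRight, Iso.hom_inv_id, id_whiskerRight]
    have hc : (tcons X (a + b + c)).inv ≫ X ◁ tcast X (Nat.add_assoc a b c) =
        tcast X (congrArg (· + 1) (Nat.add_assoc a b c)) ≫ (tcons X (a + (b + c))).inv := by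
      rw [tcast_succ X (Nat.add_assoc a b c)]
      simp
    simp only [comp_whiskerRight, Category.assoc, reassoc_of% e]
    rw [← associator_inv_naturality_middle_assoc, reassoc_of% h1, reassoc_of% hc]
    simp [← whisker_exchange_assoc]

/-- The splitting which leaves the first two factors untouched. -/
theorem tsplit_succ_succ (X : B) (b a : ℕ) :
    tsplit X b (a + 2) = tcast X (show a + 2 + b = a + b + 2 by omega) ≫ (tcons X (a + b + 1)).inv ≫
      X ◁ (tcons X (a + b)).inv ≫ X ◁ X ◁ tsplit X b a ≫ X ◁ (α_ X (tpow X a) (tpow X b)).inv ≫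
        (α_ X (X ⊗ tpow X a) (tpow X b)).inv ≫ (X ◁ (tcons X a).hom) ▷ tpow X b ≫
          (tcons X (a + 1)).hom ▷ tpow X b := by
  rw [tsplit_succ, tsplit_succ X b a]
  have h : (tcons X (a + 1 + b)).inv ≫ X ◁ tcast X (Nat.succ_add a b) =
      tcast X (congrArg (· + 1) (Nat.succ_add a b)) ≫ (tcons X (a + b + 1)).inv := by
    rw [tcast_succ X (Nat.succ_add a b)]
    simp
  simp only [MonoidalCategory.whiskerLeft_comp, Category.assoc, reassoc_of% h, tcast_tcast_assoc,
    associator_inv_naturality_middle_assoc]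

theorem tsplit_zero_right (X : B) (a : ℕ) :
    tsplit X 0 a = (ρ_ (tpow X a)).inv ≫ tpow X a ◁ (tnil X).hom := by
  induction a with
  | zero =>
    have h : tsplit X 0 0 = (λ_ (tpow X 0)).inv ≫ (tnil X).hom ▷ _ := by
      rw [tsplit_zero]
      exact Category.id_comp _
    rw [h, ← cancel_epi (tnil X).hom, leftUnitor_inv_naturality_assoc,
      rightUnitor_inv_naturality_assoc, whisker_exchange, unitors_inv_equal]
  | succ a ih =>
    have h : tsplit X 0 (a + 1) = (tcons X a).inv ≫ X ◁ tsplit X 0 a ≫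
        (α_ X (tpow X a) (tpow X 0)).inv ≫ (tcons X a).hom ▷ tpow X 0 := by
      rw [tsplit_succ]
      exact Category.id_comp _
    rw [h, ih, ← cancel_epi (tcons X a).hom, rightUnitor_inv_naturality_assoc, ← whisker_exchange]
    simp

variable [SymmetricCategory B]

theorem tperm_addEquiv_refl_left (X : B) (a : ℕ) {b b' : ℕ} (κ : Fin b ≃ Fin b') :
    tperm X (addEquiv (Equiv.refl (Fin a)) κ) ≫ tsplit X b a =
      tsplit X b' a ≫ tpow X a ◁ tperm X κ := by
  induction a with
  | zero =>
    rw [tsplit_zero, tsplit_zero, tcast_eq, tcast_eq, reassoc_of% tperm_tperm]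
    have e : (finCongr (Nat.zero_add b).symm).trans (addEquiv (Equiv.refl (Fin 0)) κ) =
        κ.trans (finCongr (Nat.zero_add b').symm) := Equiv.ext fun i => by
      have h1 : ∀ {b : ℕ} (i : Fin b), finCongr (Nat.zero_add b).symm i = Fin.natAdd 0 i :=
        fun i => Fin.ext (by simp)
      rw [Equiv.trans_apply, Equiv.trans_apply, h1, h1, addEquiv_natAdd]
    rw [e, tperm_trans]
    simp [← whisker_exchange]
  | succ a ih =>
    rw [tsplit_succ, tsplit_succ, tcast_eq, tcast_eq, reassoc_of% tperm_tperm, ← liftZero_refl,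
      addEquiv_liftZero, tperm_trans, tperm_liftZero]
    simp only [Category.assoc, Iso.hom_inv_id_assoc]
    rw [← MonoidalCategory.whiskerLeft_comp_assoc, ih]
    simp only [MonoidalCategory.whiskerLeft_comp, Category.assoc, ← whisker_exchange,
      associator_inv_naturality_right_assoc]

theorem tperm_addEquiv_refl_right (X : B) {a : ℕ} (b : ℕ) (κ : Equiv.Perm (Fin a)) :
    tperm X (addEquiv κ (Equiv.refl (Fin b))) ≫ tsplit X b a =
      tsplit X b a ≫ tperm X κ ▷ tpow X b := by
  -- Both sides are functorial in `κ`, so that only generators of the symmetric groups remain.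
  induction κ using perm_induction with
  | refl a => rw [tperm_addEquiv_refl_left, tperm_refl, tperm_refl]; simp
  | trans κ lam hκ hlam =>
    rw [show addEquiv (κ.trans lam) (Equiv.refl (Fin b)) =
      (addEquiv κ (Equiv.refl _)).trans (addEquiv lam (Equiv.refl _)) from
        equiv_ext_add (by simp) (by simp), tperm_trans, Category.assoc, hκ, reassoc_of% hlam,
      tperm_trans, comp_whiskerRight]
  | lift κ hκ =>
    rw [tsplit_succ, tcast_eq, reassoc_of% tperm_tperm, addEquiv_liftZero, tperm_trans,
      tperm_liftZero]
    simp only [Category.assoc, Iso.hom_inv_id_assoc]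
    rw [← MonoidalCategory.whiskerLeft_comp_assoc, hκ, tperm_liftZero]
    simp only [comp_whiskerRight, MonoidalCategory.whiskerLeft_comp, Category.assoc]
    rw [associator_inv_naturality_middle_assoc, ← comp_whiskerRight_assoc (tcons X _).hom]
    simp
  | swap n =>
    have e : (finCongr (show n + b + 2 = n + 2 + b by omega)).trans
        (addEquiv (Equiv.swap (0 : Fin (n + 2)) 1) (Equiv.refl (Fin b))) =
        (Equiv.swap (0 : Fin (n + b + 2)) 1).trans
          (finCongr (show n + b + 2 = n + 2 + b by omega)) := by
      have h : (addEquiv (Equiv.swap (0 : Fin (n + 2)) 1) (Equiv.refl (Fin b))).trans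
          (finCongr (show n + 2 + b = n + b + 2 by omega)) =
          (finCongr (show n + 2 + b = n + b + 2 by omega)).trans
            (Equiv.swap (0 : Fin (n + b + 2)) 1) := by
        refine equiv_ext_add (fun i => ?_) (fun i => ?_)
        · apply Fin.ext
          simp only [Equiv.trans_apply, addEquiv_castAdd, finCongr_apply, Fin.val_cast,
            Fin.val_castAdd]
          rw [val_swap_zero_one, val_swap_zero_one]
          rfl
        · apply Fin.ext
          simp only [Equiv.trans_apply, addEquiv_natAdd, finCongr_apply, Fin.val_cast,
            Fin.val_natAdd]
          rw [val_swap_zero_one]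
          simp
          omega
      exact Equiv.ext fun i => (finCongr (show n + 2 + b = n + b + 2 by omega)).injective
        ((Equiv.congr_fun h (Fin.cast (by omega) i)).trans (by simp))
    rw [tsplit_succ_succ, tcast_eq, reassoc_of% tperm_tperm, e, tperm_trans, tperm_swap, tperm_swap]
    have h1 : (tcons X (n + 1)).hom ▷ tpow X b ≫ (tcons X (n + 1)).inv ▷ tpow X b = 𝟙 _ := by
      rw [← comp_whiskerRight, Iso.hom_inv_id, id_whiskerRight]
    have h2 : (X ◁ (tcons X n).hom) ▷ tpow X b ≫ (X ◁ (tcons X n).inv) ▷ tpow X b = 𝟙 _ := by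
      rw [← comp_whiskerRight, ← MonoidalCategory.whiskerLeft_comp, Iso.hom_inv_id,
        MonoidalCategory.whiskerLeft_id, id_whiskerRight]
    have h3 : tswap X X (tpow X n ⊗ tpow X b) ≫ X ◁ (α_ X (tpow X n) (tpow X b)).inv ≫
        (α_ X (X ⊗ tpow X n) (tpow X b)).inv = X ◁ (α_ X (tpow X n) (tpow X b)).inv ≫
        (α_ X (X ⊗ tpow X n) (tpow X b)).inv ≫ tswap X X (tpow X n) ▷ tpow X b := by
      simp only [tswap]
      monoidal
    simp only [Category.assoc, Iso.hom_inv_id_assoc, comp_whiskerRight, reassoc_of% h1,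
      reassoc_of% h2, ← MonoidalCategory.whiskerLeft_comp_assoc X (tcons X _).hom, Iso.hom_inv_id,
      MonoidalCategory.whiskerLeft_id, Category.id_comp, ← reassoc_of% h3,
      ← reassoc_of% tswap_naturality_right]

theorem tperm_addEquiv (X : B) {a a' b b' : ℕ} (κ : Fin a ≃ Fin a') (κ' : Fin b ≃ Fin b') :
    tperm X (addEquiv κ κ') ≫ tsplit X b a =
      tsplit X b' a' ≫ (tperm X κ ⊗ₘ tperm X κ') := by
  obtain rfl : a = a' := by simpa using Fintype.card_congr κ
  rw [show addEquiv κ κ' = (addEquiv κ (Equiv.refl _)).trans (addEquiv (Equiv.refl _) κ') from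
        equiv_ext_add (by simp) (by simp), tperm_trans, Category.assoc, tperm_addEquiv_refl_right,
      reassoc_of% tperm_addEquiv_refl_left, MonoidalCategory.tensorHom_def, whisker_exchange]

end SymmetricPowers

/-! ### Tensor products of blocks -/

theorem blk_zero_val {n : ℕ} {k : Fin (n + 1) → ℕ} (p : Fin (k 0)) : (blk 0 p : ℕ) = p := by
  rw [blk_val]
  simp

theorem blk_succ_val {n : ℕ} {k : Fin (n + 1) → ℕ} (i : Fin n) (p : Fin (k i.succ)) :
    (blk i.succ p : ℕ) = k 0 + (blk (k := fun i => k i.succ) i p : ℕ) := by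
  rw [blk_val, blk_val, Fin.val_succ, Finset.sum_range_succ', add_right_comm, add_comm]
  simp only [Nat.zero_lt_succ, dif_pos, Nat.add_lt_add_iff_right]
  rfl

theorem cast_castAdd_eq_blk {n : ℕ} {k : Fin (n + 1) → ℕ} (p : Fin (k 0)) :
    Fin.cast (Fin.sum_univ_succ k).symm (Fin.castAdd _ p) = blk 0 p :=
  Fin.ext (blk_zero_val p).symm

theorem cast_natAdd_eq_blk {n : ℕ} {k : Fin (n + 1) → ℕ} (i : Fin n) (p : Fin (k i.succ)) :
    Fin.cast (Fin.sum_univ_succ k).symm (Fin.natAdd _ (blk (k := fun i => k i.succ) i p)) =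
      blk i.succ p :=
  Fin.ext (blk_succ_val i p).symm

theorem sum_cast {n m : ℕ} (h : n = m) (k : Fin n → ℕ) :
    ∑ i, k i = ∑ i, k (Fin.cast h.symm i) :=
  (Equiv.sum_comp (finCongr h.symm) k).symm

theorem val_finAddFlip {m n : ℕ} (i : Fin (m + n)) :
    ((finAddFlip i : Fin (n + m)) : ℕ) =
      if (i : ℕ) < m then n + (i : ℕ) else (i : ℕ) - m := by
  induction i using Fin.addCases <;> simp

theorem val_liftZero {n m : ℕ} (κ : Fin n ≃ Fin m) (i : Fin (n + 1)) :
    ((liftZero κ i : Fin (m + 1)) : ℕ) =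
      if h : (i : ℕ) = 0 then (0 : ℕ) else (κ ⟨i - 1, by omega⟩ : ℕ) + 1 := by
  induction i using Fin.cases <;> simp

theorem val_addEquiv {a a' b b' : ℕ} (κ : Fin a ≃ Fin a') (κ' : Fin b ≃ Fin b')
    (i : Fin (a + b)) :
    ((addEquiv κ κ' i : Fin (a' + b')) : ℕ) =
      if h : (i : ℕ) < a then (κ ⟨i, h⟩ : ℕ) else a' + (κ' ⟨i - a, by omega⟩ : ℕ) := by
  induction i using Fin.addCases <;> simp

section SymmetricPowers

variable {B : Type u} [Category.{v} B] [MonoidalCategory B]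

theorem tcons_inv_tcast (X : B) {n m : ℕ} (h : n = m) :
    (tcons X n).inv ≫ X ◁ tcast X h = tcast X (congrArg (· + 1) h) ≫ (tcons X m).inv := by
  rw [tcast_succ X h]
  simp

theorem tsplit_one (X : B) (b : ℕ) :
    tsplit X b 1 ≫ (tone X).hom ▷ tpow X b =
      tcast X (Nat.add_comm 1 b) ≫ (tcons X b).inv := by
  rw [tsplit_succ, tsplit_zero]
  simp only [MonoidalCategory.whiskerLeft_comp, Category.assoc,
    reassoc_of% (tcons_inv_tcast X (Nat.zero_add b)), tone, tcast_tcast_assoc, Iso.trans_hom,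
    Iso.symm_hom, comp_whiskerRight]
  rw [← comp_whiskerRight_assoc (tcons X _).hom]
  simp [← comp_whiskerRight_assoc, ← MonoidalCategory.whiskerLeft_comp, -comp_whiskerRight]

theorem tblock_congr {X Y : B} {n : ℕ} {k k' : Fin n → ℕ} {f : ∀ i, tpow X (k i) ⟶ Y}
    {f' : ∀ i, tpow X (k' i) ⟶ Y} (h : ∀ i, k i = k' i) (hf : ∀ i, f i = tcast X (h i) ≫ f' i) :
    tblock f = tcast X (Finset.sum_congr rfl fun i _ => h i) ≫ tblock f' := by
  obtain rfl : k = k' := funext h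
  obtain rfl : f = f' := funext fun i => (hf i).trans (Category.id_comp _)
  exact (Category.id_comp _).symm

/-- The family of exponents depends on the indexing map, so that even a pointwise equality of
indexing maps gives rise to a transport. -/
theorem tblock_reindex {X Y : B} {n m : ℕ} {k : Fin m → ℕ} (f : ∀ i, tpow X (k i) ⟶ Y)
    {g g' : Fin n → Fin m} (h : ∀ i, g i = g' i) :
    tblock (fun i => f (g i)) =
      tcast X (Finset.sum_congr rfl fun i _ => congrArg k (h i)) ≫ tblock (fun i => f (g' i)) := by
  obtain rfl : g = g' := funext h
  exact (Category.id_comp _).symm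

theorem tblock_tcast {X Y : B} {n m : ℕ} (h : n = m) {k : Fin n → ℕ}
    (f : ∀ i, tpow X (k i) ⟶ Y) (hk : ∑ i, k i = ∑ i, k (Fin.cast h.symm i)) :
    tblock f ≫ tcast Y h = tcast X hk ≫ tblock (fun i => f (Fin.cast h.symm i)) := by
  subst h
  exact (Category.comp_id _).trans (Category.id_comp _).symm

theorem tmap_tblock {W X Y : B} (g : W ⟶ X) {n : ℕ} {k : Fin n → ℕ}
    (f : ∀ i, tpow X (k i) ⟶ Y) :
    tmap g (∑ i, k i) ≫ tblock f = tblock (fun i => tmap g (k i) ≫ f i) := by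
  induction n with
  | zero =>
    rw [tblock_zero, tblock_zero, reassoc_of% tmap_tcast, tmap_zero]
    simp
  | succ n ih =>
    rw [tblock_succ, tblock_succ, reassoc_of% tmap_tcast, reassoc_of% tmap_tsplit, ← ih,
      tensorHom_comp_tensorHom_assoc]

theorem tblock_comp_tmap {X Y Z : B} {n : ℕ} {k : Fin n → ℕ}
    (f : ∀ i, tpow X (k i) ⟶ Y) (g : Y ⟶ Z) :
    tblock f ≫ tmap g n = tblock (fun i => f i ≫ g) := by
  induction n with
  | zero =>
    rw [tblock_zero, tblock_zero, tmap_zero]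
    simp
  | succ n ih =>
    rw [tblock_succ, tblock_succ, ← ih, tmap_succ]
    simp

/-- The coassociativity of splittings, with exponents which are only propositionally equal to the
expected sums. -/
theorem tsplit_tsplit_of_eq (X : B) {a b c ab bc c' abc : ℕ} (h₁ : abc = a + bc)
    (h₂ : bc = b + c') (h₃ : c' = c) (h₄ : abc = ab + c) (h₅ : ab = a + b) {Z : B}
    (f : (tpow X a ⊗ tpow X b) ⊗ tpow X c ⟶ Z) :
    tcast X h₁ ≫ tsplit X bc a ≫ tpow X a ◁ tcast X h₂ ≫ tpow X a ◁ tsplit X c' b ≫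
      tpow X a ◁ tpow X b ◁ tcast X h₃ ≫ (α_ _ _ _).inv ≫ f =
    tcast X h₄ ≫ tsplit X c ab ≫ tcast X h₅ ▷ tpow X c ≫ tsplit X b a ▷ tpow X c ≫ f := by
  subst h₃ h₂ h₅ h₄
  simp [tcast_rfl, reassoc_of% tsplit_assoc]

theorem tsplit_of_eq (X : B) {a b a' b' c : ℕ} (h : c = a + b) (ha : a = a') (hb : b = b')
    (h' : c = a' + b') {Y Y' Z : B} (f : tpow X a' ⟶ Y) (f' : tpow X b' ⟶ Y') (g : Y ⊗ Y' ⟶ Z) :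
    tcast X h ≫ tsplit X b a ≫ (tcast X ha ≫ f ⊗ₘ tcast X hb ≫ f') ≫ g =
      tcast X h' ≫ tsplit X b' a' ≫ (f ⊗ₘ f') ≫ g := by
  subst ha hb
  simp [tcast_rfl]

/-- The compatibility of `tblock` with the decomposition of a sum of exponents. -/
theorem tblock_tsplit {X Y : B} {a b : ℕ} {k : Fin (a + b) → ℕ}
    (f : ∀ i, tpow X (k i) ⟶ Y) :
    tblock f ≫ tsplit Y b a = tcast X (Fin.sum_univ_add k) ≫
      tsplit X (∑ i, k (Fin.natAdd a i)) (∑ i, k (Fin.castAdd b i)) ≫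
        (tblock (fun i => f (Fin.castAdd b i)) ⊗ₘ tblock (fun i => f (Fin.natAdd a i))) := by
  induction a with
  | zero =>
    rw [tsplit_zero, ← Category.assoc,
      tblock_tcast (Nat.zero_add b) f (sum_cast (Nat.zero_add b) k), tblock_zero,
      tblock_reindex f (g' := Fin.natAdd 0) (fun i => Fin.ext (by simp))]
    rw [MonoidalCategory.tensorHom_def, comp_whiskerRight, Category.assoc, Category.assoc,
      Category.assoc, ← reassoc_of% (tcast_tsplit_left X _
      (Fin.sum_univ_zero (fun i => k (Fin.castAdd b i))) (by rw [Fin.sum_univ_zero])), tsplit_zero]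
    simp [← whisker_exchange]
  | succ a ih =>
    have h0 : ∀ i : Fin b, Fin.cast (Nat.succ_add a b).symm (Fin.natAdd a i).succ =
      Fin.natAdd (a + 1) i := fun i => Fin.ext (by simp; omega)
    rw [tsplit_succ, ← Category.assoc, tblock_tcast (Nat.succ_add a b) f
        (sum_cast (Nat.succ_add a b) k),
      tblock_succ, tblock_succ]
    simp only [Category.assoc, Iso.hom_inv_id_assoc]
    rw [tensorHom_comp_whiskerLeft_assoc, ih (fun i => f (Fin.cast (Nat.succ_add a b).symm i.succ)),
      tblock_reindex f h0, ← whiskerLeft_comp_tensorHom, ← whiskerLeft_comp_tensorHom,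
      ← whiskerLeft_comp_tensorHom, ← whiskerLeft_comp_tensorHom, Category.assoc, Category.assoc,
      Category.assoc, associator_inv_naturality_assoc,
      ← whiskerRight_comp_tensorHom (tcast X _), ← whiskerRight_comp_tensorHom (tsplit X _ _),
      ← tensorHom_comp_whiskerRight]
    simp only [tcast_tcast_assoc]
    exact tsplit_tsplit_of_eq X (b := ∑ i : Fin a, k (Fin.castAdd b i.succ))
      (c := ∑ i, k (Fin.natAdd (a + 1) i)) _ _ _ (Fin.sum_univ_add k)
      (Fin.sum_univ_succ (fun i => k (Fin.castAdd b i))) _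

/-- The associativity of substitution of tensor powers of morphisms. -/
theorem tblock_tblock {X Y Z : B} {n : ℕ} {k : Fin n → ℕ} {l : Fin (∑ i, k i) → ℕ}
    (g : ∀ i, tpow Y (k i) ⟶ Z) (f : ∀ p, tpow X (l p) ⟶ Y) :
    tblock f ≫ tblock g =
      tcast X (sum_sum_blk l).symm ≫ tblock (fun i => tblock (fun j => f (blk i j)) ≫ g i) := by
  induction n with
  | zero =>
    have h := sum_cast (Fin.sum_univ_zero k) l
    rw [tblock_zero g, tblock_zero, ← Category.assoc, tblock_tcast (Fin.sum_univ_zero k) f h,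
      tblock_zero]
    simp
  | succ n ih =>
    have e : ∀ i : Fin n, tblock (fun j => f (Fin.cast (Fin.sum_univ_succ k).symm
          (Fin.natAdd (k 0) (blk (k := fun i => k i.succ) i j)))) ≫ g i.succ =
        tcast X (Finset.sum_congr rfl fun j _ => congrArg l (cast_natAdd_eq_blk i j)) ≫
          tblock (fun j => f (blk i.succ j)) ≫ g i.succ := fun i => by
      rw [tblock_reindex f (fun j => cast_natAdd_eq_blk i j), Category.assoc]
    rw [tblock_succ g, ← Category.assoc, tblock_tcast (Fin.sum_univ_succ k) f
        (sum_cast (Fin.sum_univ_succ k) l),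
      Category.assoc, reassoc_of% tblock_tsplit (fun i => f (Fin.cast _ i)),
      tensorHom_comp_tensorHom_assoc, ih, tblock_congr _ e,
      tblock_reindex f (fun j => cast_castAdd_eq_blk j), tblock_succ, tcast_tcast_assoc,
      tcast_tcast_assoc, tcast_tcast_assoc, Category.assoc, tsplit_of_eq]

theorem tblock_fin_one {X Y : B} {n : ℕ} (f : tpow X n ⟶ Y) :
    tblock (fun _ : Fin 1 => f) ≫ (tone Y).hom = tcast X (sum_one_fin n).symm ≫ f := by
  rw [tblock_succ, tblock_zero, ← whiskerLeft_comp_tensorHom]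
  simp only [Category.assoc]
  rw [← reassoc_of% (tcast_tsplit_right X n (Fin.sum_univ_zero _) (by simp)), tsplit_zero_right]
  simp [tone, MonoidalCategory.tensorHom_def, whisker_exchange_assoc]

theorem tblock_one (X : B) (n : ℕ) :
    tblock (fun _ : Fin n => (tone X).hom) = tcast X (sum_fin_one n).symm := by
  induction n with
  | zero =>
    rw [tblock_zero, Iso.inv_hom_id, Category.comp_id]
  | succ n ih =>
    rw [tblock_succ, ih, MonoidalCategory.tensorHom_def', Category.assoc,
      ← reassoc_of% (tcast_tsplit_right X 1 (sum_fin_one n).symm (by simp)),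
      reassoc_of% tsplit_one]
    simp

variable [SymmetricCategory B]

theorem tsplit_zero_braiding (X : B) (b : ℕ) :
    tsplit X b 0 ≫ (β_ (tpow X 0) (tpow X b)).hom =
      tcast X (Nat.zero_add b) ≫ tsplit X 0 b := by
  rw [tsplit_zero, tsplit_zero_right, Category.assoc, Category.assoc,
    BraidedCategory.braiding_naturality_left]
  simp

/-- The braiding of one factor past a tensor power is a cyclic permutation of the factors. -/
theorem tcons_inv_braiding (X : B) (b : ℕ) :
    (tcons X b).inv ≫ (β_ X (tpow X b)).hom =
      tperm X (finRotate (b + 1)) ≫ tsplit X 1 b ≫ tpow X b ◁ (tone X).hom := by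
  induction b with
  | zero =>
    rw [finRotate_one, tperm_refl, tsplit_zero, Category.id_comp, Category.assoc, Category.assoc,
      show tcast X (Nat.zero_add 1) = 𝟙 _ from rfl, Category.id_comp, ← whisker_exchange,
      ← leftUnitor_inv_naturality_assoc, ← cancel_epi (X ◁ (tnil X).hom ≫ (tcons X 0).hom)]
    simp [tone]
  | succ b ih =>
    have e : finRotate (b + 2) = (liftZero (finRotate (b + 1))).trans (Equiv.swap 0 1) :=
      Equiv.ext fun i => Fin.ext (by
        rw [Equiv.trans_apply, val_swap_zero_one, val_liftZero, coe_finRotate]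
        simp only [coe_finRotate, Fin.ext_iff, Fin.val_last]
        rcases Nat.eq_zero_or_pos i with h | h
        · simp [h]
        · have := i.2
          rw [dif_neg h.ne']
          split_ifs <;> first | omega | contradiction)
    have h : (tcons X (b + 1)).inv ≫ (β_ X (tpow X (b + 1))).hom = (tcons X (b + 1)).inv ≫
        X ◁ (tcons X b).inv ≫ (β_ X (X ⊗ tpow X b)).hom ≫ (tcons X b).hom ▷ X := by
      rw [← BraidedCategory.braiding_naturality_right, ← MonoidalCategory.whiskerLeft_comp_assoc]
      simp
    have h2 := congrArg (X ◁ ·) ih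
    simp only [MonoidalCategory.whiskerLeft_comp] at h2
    rw [h, e, tperm_trans, tperm_swap, tperm_liftZero, tsplit_succ,
      show tcast X (Nat.succ_add b 1) = 𝟙 _ from rfl,
      BraidedCategory.braiding_tensor_right_hom]
    simp only [Category.assoc, Iso.hom_inv_id_assoc, Category.id_comp]
    rw [← whisker_exchange, ← associator_inv_naturality_right_assoc, ← reassoc_of% h2,
      ← MonoidalCategory.whiskerLeft_comp_assoc X (tcons X b).hom]
    simp [tswap]

/-- The braiding of two tensor powers is the permutation which interchanges two blocks of factors.
-/
theorem tsplit_braiding (X : B) (a b : ℕ) :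
    tsplit X b a ≫ (β_ (tpow X a) (tpow X b)).hom =
      tperm X (finAddFlip : Fin (b + a) ≃ Fin (a + b)) ≫ tsplit X a b := by
  induction a with
  | zero =>
    have e : (finCongr (Nat.zero_add b).symm : Fin (b + 0) ≃ Fin (0 + b)) = finAddFlip :=
      Equiv.ext fun i => Fin.ext (by
      rw [val_finAddFlip]
      have := i.2
      simp)
    rw [tsplit_zero_braiding, tcast_eq, e]
  | succ a ih =>
    have h2 := congrArg (X ◁ ·) ih
    simp only [MonoidalCategory.whiskerLeft_comp] at h2
    have h3 : X ◁ tsplit X a b ≫ (α_ X (tpow X b) (tpow X a)).inv =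
        (tcons X (b + a)).hom ≫ tcast X (Nat.succ_add b a).symm ≫ tsplit X a (b + 1) ≫
          (tcons X b).inv ▷ tpow X a := by
      rw [tsplit_succ, Category.assoc, tcast_tcast_assoc, tcast_rfl, Category.id_comp]
      simp
    have h4 : tsplit X a 1 ≫ (tone X).hom ▷ tpow X a ≫ (tcons X a).hom =
        tcast X (Nat.add_comm 1 a) := by
      rw [reassoc_of% tsplit_one, Iso.inv_hom_id, Category.comp_id]
    have h5 : tperm X (addEquiv (finRotate (b + 1)) (Equiv.refl (Fin a))) ≫ tsplit X a (b + 1) =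
      tsplit X a (b + 1) ≫ tperm X (finRotate (b + 1)) ▷ tpow X a :=
      tperm_addEquiv_refl_right X a _
    rw [tsplit_succ, Category.assoc, Category.assoc, Category.assoc, Category.assoc,
      BraidedCategory.braiding_naturality_left, BraidedCategory.braiding_tensor_left_hom]
    simp only [Category.assoc, Iso.inv_hom_id_assoc]
    rw [reassoc_of% h2, reassoc_of% h3, ← comp_whiskerRight_assoc (tcons X b).inv,
      tcons_inv_braiding, comp_whiskerRight, comp_whiskerRight, Category.assoc, Category.assoc,
      ← reassoc_of% h5, associator_naturality_middle_assoc,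
      ← MonoidalCategory.whiskerLeft_comp, reassoc_of% tsplit_assoc, Iso.inv_hom_id_assoc,
      ← MonoidalCategory.whiskerLeft_comp, h4,
      ← tcast_tsplit_right X b (Nat.add_comm 1 a) (by omega), tcast_tcast_assoc,
      ← reassoc_of% (tperm_liftZero X (finAddFlip : Fin (b + a) ≃ Fin (a + b)))]
    simp only [tcast_eq, reassoc_of% tperm_tperm]
    congr 2
    refine Equiv.ext fun i => Fin.ext ?_
    simp only [Equiv.trans_apply, finCongr_apply, Fin.val_cast, val_liftZero, val_addEquiv,
      coe_finRotate, Equiv.refl_apply, val_finAddFlip, Fin.ext_iff, Fin.val_last]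
    split_ifs <;> first | omega | contradiction

end SymmetricPowers

/-! ### Permutations of blocks -/

/-- The position of the first input of the `i`-th block. -/
def blkStart {n : ℕ} (k : Fin n → ℕ) (i : Fin n) : ℕ :=
  ∑ x ∈ Finset.range i, (if h : x < n then k ⟨x, h⟩ else 0)

theorem blk_val_eq {n : ℕ} {k : Fin n → ℕ} (i : Fin n) (p : Fin (k i)) :
    (blk i p : ℕ) = blkStart k i + p :=
  blk_val i p

theorem blkStart_zero {n : ℕ} (k : Fin (n + 1) → ℕ) : blkStart k 0 = 0 := rfl

theorem blkStart_succ {n : ℕ} (k : Fin (n + 1) → ℕ) (i : Fin n) :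
    blkStart k i.succ = k 0 + blkStart (fun i => k i.succ) i := by
  rw [blkStart, Fin.val_succ, Finset.sum_range_succ', add_comm]
  simp only [Nat.zero_lt_succ, dif_pos, Nat.add_lt_add_iff_right]
  rfl

theorem blkStart_one {n : ℕ} (k : Fin (n + 2) → ℕ) : blkStart k 1 = k 0 :=
  (blkStart_succ k 0).trans (add_zero _)

theorem equiv_ext_blk {n m : ℕ} {k : Fin n → ℕ} {e e' : Fin (∑ i, k i) ≃ Fin m}
    (h : ∀ i p, (e (blk i p) : ℕ) = (e' (blk i p) : ℕ)) : e = e' :=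
  Equiv.ext fun x => by
    induction x using blk_ind with | h i p => exact Fin.ext (h i p)

/-- A permutation of blocks, in terms of positions: the `p`-th input of the `i`-th block becomes the
`p`-th input of the block `lam i`. -/
theorem val_blockEquiv_refl {n m : ℕ} {k : Fin m → ℕ} (lam : Fin n ≃ Fin m) (i : Fin n) (p : ℕ)
    (hp : p < k (lam i)) (x : Fin (∑ i, k (lam i)))
    (hx : (x : ℕ) = blkStart (fun j => k (lam j)) i + p) :
    (blockEquiv lam (fun i => Equiv.refl (Fin (k i))) x : ℕ) = blkStart k (lam i) + p := by
  obtain rfl : x = blk (k := fun j => k (lam j)) i ⟨p, hp⟩ :=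
    Fin.ext (hx.trans (blk_val_eq (k := fun j => k (lam j)) i ⟨p, hp⟩).symm)
  rw [blockEquiv_blk, blk_val_eq, Equiv.refl_apply]

/-- The disjoint union of a family of bijections. -/
def blockPerm {n : ℕ} {k k' : Fin n → ℕ} (κ : ∀ i, Fin (k i) ≃ Fin (k' i)) :
    Fin (∑ i, k i) ≃ Fin (∑ i, k' i) :=
  finSigmaFinEquiv.symm.trans ((Equiv.sigmaCongrRight κ).trans finSigmaFinEquiv)

@[simp]
theorem blockPerm_blk {n : ℕ} {k k' : Fin n → ℕ} (κ : ∀ i, Fin (k i) ≃ Fin (k' i)) (i : Fin n)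
    (p : Fin (k i)) : blockPerm κ (blk i p) = blk i (κ i p) := by
  simp [blockPerm]

/-- The interchange of the first two of three blocks. -/
def addEquivSwap (a b c : ℕ) : Fin (b + (a + c)) ≃ Fin (a + (b + c)) :=
  (finCongr (Nat.add_assoc b a c).symm).trans
    ((addEquiv finAddFlip (Equiv.refl (Fin c))).trans (finCongr (Nat.add_assoc a b c)))

theorem val_addEquivSwap (a b c : ℕ) (i : Fin (b + (a + c))) :
    (addEquivSwap a b c i : ℕ) = if (i : ℕ) < b then a + (i : ℕ) else
      if (i : ℕ) < a + b then (i : ℕ) - b else (i : ℕ) := by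
  simp only [addEquivSwap, Equiv.trans_apply, finCongr_apply, Fin.val_cast, val_addEquiv,
    val_finAddFlip, Equiv.refl_apply]
  split_ifs <;> omega

section SymmetricPowers

variable {B : Type u} [Category.{v} B] [MonoidalCategory B]

theorem tblock_succ_succ {X Y : B} {n : ℕ} {k : Fin (n + 2) → ℕ} (f : ∀ i, tpow X (k i) ⟶ Y)
    (h : ∑ i, k i = k 0 + (k 1 + ∑ i : Fin n, k i.succ.succ)) :
    tblock f = tcast X h ≫ tsplit X _ _ ≫ tpow X (k 0) ◁ tsplit X _ _ ≫
      (f 0 ⊗ₘ (f 1 ⊗ₘ tblock (fun i => f i.succ.succ))) ≫ Y ◁ (tcons Y n).hom ≫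
        (tcons Y (n + 1)).hom := by
  rw [tblock_succ, tblock_succ, ← whiskerLeft_comp_tensorHom, Category.assoc,
    ← reassoc_of% (tcast_tsplit_right X (k 0) (Fin.sum_univ_succ (fun i => k i.succ))
      (congrArg (k 0 + ·) (Fin.sum_univ_succ (fun i => k i.succ)))), tcast_tcast_assoc,
    ← whiskerLeft_comp_tensorHom, ← tensorHom_comp_whiskerLeft]
  simp only [Category.assoc]
  rfl

variable [SymmetricCategory B]

/-- The interchange of the first two of three tensor powers is a permutation of the factors. -/
theorem tsplit_tswap (X : B) (a b c : ℕ) :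
    tsplit X (b + c) a ≫ tpow X a ◁ tsplit X c b ≫ tswap (tpow X a) (tpow X b) (tpow X c) =
      tperm X (addEquivSwap a b c) ≫ tsplit X (a + c) b ≫ tpow X b ◁ tsplit X c a := by
  have h : tsplit X (b + c) a ≫ tpow X a ◁ tsplit X c b ≫ (α_ _ _ _).inv =
      tcast X (Nat.add_assoc a b c).symm ≫ tsplit X c (a + b) ≫ tsplit X b a ▷ tpow X c := by
    rw [tsplit_assoc, tcast_tcast_assoc, tcast_rfl, Category.id_comp]
  have h2 := tperm_addEquiv X (finAddFlip : Fin (b + a) ≃ Fin (a + b)) (Equiv.refl (Fin c))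
  rw [tperm_refl, tensorHom_id] at h2
  rw [tswap, reassoc_of% h, ← comp_whiskerRight_assoc, tsplit_braiding, comp_whiskerRight,
    Category.assoc, ← reassoc_of% h2, reassoc_of% tsplit_assoc, Iso.inv_hom_id, Category.comp_id]
  simp only [tcast_eq, reassoc_of% tperm_tperm]
  rfl

/-- The symmetries act on a substitution through the individual blocks. -/
theorem tblock_tperm_block {X Y : B} {n : ℕ} {k k' : Fin n → ℕ} (f : ∀ i, tpow X (k i) ⟶ Y)
    (κ : ∀ i, Fin (k i) ≃ Fin (k' i)) :
    tblock (fun i => tperm X (κ i) ≫ f i) =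
      tperm X (blockPerm κ) ≫ tblock f := by
  induction n with
  | zero =>
    rw [tblock_zero, tblock_zero, tcast_eq, tcast_eq, reassoc_of% tperm_tperm]
    congr 2
    exact Equiv.ext fun i => (Fin.cast (Fin.sum_univ_zero k') i).elim0
  | succ n ih =>
    rw [tblock_succ, tblock_succ, ih, ← tensorHom_comp_tensorHom, Category.assoc,
      ← reassoc_of% tperm_addEquiv]
    simp only [tcast_eq, reassoc_of% tperm_tperm]
    congr 2
    refine Equiv.ext (Fin.addCases (fun i => ?_) (fun i => ?_))
    · simp [cast_castAdd_eq_blk]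
    · induction i using blk_ind (k := fun i => k i.succ) with | h i p => ?_
      simp [cast_natAdd_eq_blk]

/-- Permuting the factors of a tensor product of blocks amounts to permuting the blocks. -/
theorem tblock_tperm {X Y : B} {n : ℕ} {k : Fin n → ℕ} (f : ∀ i, tpow X (k i) ⟶ Y)
    (lam : Equiv.Perm (Fin n)) :
    tblock f ≫ tperm Y lam =
      tperm X (blockEquiv lam (fun i => Equiv.refl (Fin (k i)))) ≫ tblock (fun i => f (lam i)) := by
  -- Both sides are functorial in `lam`, so that only generators of the symmetric groups remain.
  induction lam using perm_induction with
  | refl n =>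
    have e : blockEquiv (Equiv.refl (Fin n)) (fun i => Equiv.refl (Fin (k i))) =
        Equiv.refl (Fin (∑ i, k i)) := equiv_ext_blk fun i p => congrArg Fin.val
        (blockEquiv_blk (Equiv.refl (Fin n)) (fun i => Equiv.refl (Fin (k i))) i p)
    rw [tperm_refl, Category.comp_id]
    exact (Category.id_comp _).symm.trans (congrArg (· ≫ tblock f)
      ((congrArg (tperm X) e).trans (tperm_refl X _)).symm)
  | trans κ lam hκ hlam =>
    rw [tperm_trans, reassoc_of% hlam, hκ, reassoc_of% tperm_tperm]
    congr 2
    refine equiv_ext_blk fun i p => congrArg Fin.val ?_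
    rw [Equiv.trans_apply]
    exact (congrArg _ (blockEquiv_blk κ (fun i => Equiv.refl (Fin (k (lam i)))) i p)).trans <|
      (blockEquiv_blk lam (fun i => Equiv.refl (Fin (k i))) (κ i) p).trans
        (blockEquiv_blk (κ.trans lam) (fun i => Equiv.refl (Fin (k i))) i p).symm
  | @lift n κ hκ =>
    have hg : ∀ i, liftZero κ i =
        (Fin.cons 0 (fun j => (κ j).succ) : Fin (n + 1) → Fin (n + 1)) i :=
      Fin.cases (by simp) (fun i => by simp)
    have h2 := tperm_addEquiv_refl_left X (k 0)
      (blockEquiv κ (fun i => Equiv.refl (Fin (k i.succ))))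
    rw [tblock_succ, tperm_liftZero, Category.assoc, Category.assoc, Category.assoc,
      Iso.hom_inv_id_assoc, tensorHom_comp_whiskerLeft_assoc, hκ (fun i => f i.succ),
      ← whiskerLeft_comp_tensorHom, Category.assoc, ← reassoc_of% h2, tblock_reindex f hg,
      tblock_succ]
    simp only [tcast_eq, reassoc_of% tperm_tperm]
    refine congrArg (· ≫ _) (congrArg (tperm X) (Equiv.ext (Fin.addCases (fun p => Fin.ext ?_)
      (fun p => Fin.ext ?_))))
    · refine Eq.trans ?_ (val_blockEquiv_refl (liftZero κ) 0 p (by rw [liftZero_zero]; exact p.2)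
        _ ?_).symm
      · rw [liftZero_zero, blkStart_zero]
        simp
      · exact (zero_add _).symm
    · induction p using blk_ind (k := fun i => k (κ i).succ) with | h i p => ?_
      refine Eq.trans ?_ (val_blockEquiv_refl (liftZero κ) i.succ p
        (by rw [liftZero_succ]; exact p.2) _ ?_).symm
      · rw [liftZero_succ, blkStart_succ]
        simp only [Equiv.trans_apply, addEquiv_natAdd, blockEquiv_blk, finCongr_apply,
          Fin.val_cast, Fin.val_natAdd, blk_val_eq, Equiv.refl_apply, add_assoc]
      · refine Eq.trans (b := k 0 + (blk (k := fun i => k (κ i).succ) i p : ℕ)) rfl ?_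
        simp only [blk_val_eq, blkStart_succ, liftZero_zero, liftZero_succ, add_assoc]
  | swap n =>
    have hg : ∀ i, Equiv.swap (0 : Fin (n + 2)) 1 i = (Fin.cons 1 (Fin.cons 0
        (fun j => j.succ.succ) : Fin (n + 1) → Fin (n + 2)) : Fin (n + 2) → Fin (n + 2)) i :=
      Fin.cases (by simp) (Fin.cases (by simp) (fun i => by simp [swap_succ_succ]))
    rw [tblock_succ_succ f (by rw [Fin.sum_univ_succ, Fin.sum_univ_succ]; rfl), Category.assoc,
      Category.assoc, Category.assoc, Category.assoc, Category.assoc, tperm_swap]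
    simp only [Iso.hom_inv_id_assoc]
    rw [← MonoidalCategory.whiskerLeft_comp_assoc Y (tcons Y n).hom, Iso.hom_inv_id,
      MonoidalCategory.whiskerLeft_id, Category.id_comp, reassoc_of% tswap_naturality,
      reassoc_of% tsplit_tswap, tblock_reindex f hg, tblock_succ_succ (fun i => f _)
        (by rw [Fin.sum_univ_succ, Fin.sum_univ_succ]; rfl)]
    simp only [tcast_eq, reassoc_of% tperm_tperm]
    refine congrArg (· ≫ _) (congrArg (tperm X) (Equiv.ext fun x => Fin.ext ?_))
    have h0 : k (Equiv.swap (0 : Fin (n + 2)) 1 0) = k 1 := by rw [Equiv.swap_apply_left]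
    have h1 : k (Equiv.swap (0 : Fin (n + 2)) 1 1) = k 0 := by rw [Equiv.swap_apply_right]
    simp only [Equiv.trans_apply, finCongr_apply, Fin.val_cast, val_addEquivSwap]
    split_ifs with h h'
    · refine Eq.trans ?_ (val_blockEquiv_refl (Equiv.swap 0 1) 0 x (by rw [h0]; exact h)
        _ ?_).symm
      · rw [Equiv.swap_apply_left, blkStart_one]
      · exact (zero_add _).symm
    · refine Eq.trans ?_ (val_blockEquiv_refl (Equiv.swap 0 1) 1 (x - k 1)
        (by rw [h1]; omega) _ ?_).symm
      · rw [Equiv.swap_apply_right, blkStart_zero, zero_add]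
      · refine Eq.trans (b := (x : ℕ)) rfl ?_
        rw [blkStart_one, h0]
        omega
    · obtain ⟨y, hy⟩ : ∃ y : Fin (∑ i : Fin n, k i.succ.succ), (x : ℕ) = k 0 + k 1 + y :=
        ⟨⟨x - (k 0 + k 1), by have := x.2; omega⟩, by simp; omega⟩
      induction y using blk_ind (k := fun i : Fin n => k i.succ.succ) with | h i p => ?_
      rw [blk_val_eq] at hy
      refine Eq.trans ?_ (val_blockEquiv_refl (Equiv.swap 0 1) i.succ.succ p
        (by rw [swap_succ_succ]; exact p.2) _ ?_).symm
      · rw [swap_succ_succ, blkStart_succ, blkStart_succ, hy, Fin.succ_zero_eq_one]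
        omega
      · refine Eq.trans (b := (x : ℕ)) rfl ?_
        rw [blkStart_succ, blkStart_succ, Fin.succ_zero_eq_one, h0, h1]
        simp only [swap_succ_succ]
        omega

/-- The compatibility of substitution with the symmetries. -/
theorem tblock_comp_tperm {X Y : B} {n m : ℕ} {k k' : Fin m → ℕ} (f : ∀ i, tpow X (k i) ⟶ Y)
    (lam : Fin n ≃ Fin m) (κ : ∀ i, Fin (k i) ≃ Fin (k' i)) :
    tblock (fun i => tperm X (κ i) ≫ f i) ≫ tperm Y lam =
      tperm X (blockEquiv lam κ) ≫ tblock (fun i => f (lam i)) := by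
  obtain rfl : n = m := by simpa using Fintype.card_congr lam
  rw [tblock_tperm_block, Category.assoc, tblock_tperm, reassoc_of% tperm_tperm]
  congr 2
  refine equiv_ext_blk fun i p => ?_
  rw [Equiv.trans_apply, blockEquiv_blk, blockEquiv_blk, blockPerm_blk]
  rfl

end SymmetricPowers

/-! ### Endomorphism operads of objects -/

section EndOperad

variable {B : Type u} [Category.{v} B] [MonoidalCategory B]

theorem tmap_tone {X Y : B} (f : X ⟶ Y) : tmap f 1 ≫ (tone Y).hom = (tone X).hom ≫ f := by
  rw [tone_hom, tone_hom]
  change (f ⊗ₘ 𝟙 _) ≫ (ρ_ Y).hom = _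
  rw [tensorHom_id, rightUnitor_naturality]
  rfl

variable [SymmetricCategory B]

/-- The endomorphism operad of an object of a symmetric monoidal category. -/
def endOperad (X : B) : Operad.{v} where
  Ops n := tpow X n ⟶ X
  act κ f := tperm X κ ≫ f
  one := (tone X).hom
  comp f g := tblock g ≫ f
  act_refl f := by rw [tperm_refl, Category.id_comp]
  act_trans κ lam f := by rw [tperm_trans, Category.assoc]
  one_comp f := (tblock_fin_one f).trans (congrArg (· ≫ f) (tcast_eq X _))
  comp_one f := congrArg (· ≫ f) ((tblock_one X _).trans (tcast_eq X _))
  comp_assoc f g h := by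
    rw [← Category.assoc, tblock_tblock, Category.assoc, tcast_eq]
  comp_act lam κ f g := by
    rw [← Category.assoc, tblock_comp_tperm, Category.assoc]

end EndOperad

namespace CatObj

variable {B : Type u} [Category.{v} B] [HasPullbacks B] {Γ : CatObj B}

/-! ### Composition in category objects -/

section Comp

variable {T : B} {f g h a b c : T ⟶ Γ.M}

theorem IsComp.w (H : Γ.IsComp f g h) : f ≫ Γ.t = g ≫ Γ.s := H.choose

theorem IsComp.s (H : Γ.IsComp f g h) : h ≫ Γ.s = f ≫ Γ.s := by
  obtain ⟨w, rfl⟩ := H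
  exact lift_c_s _ _ _

theorem IsComp.t (H : Γ.IsComp f g h) : h ≫ Γ.t = g ≫ Γ.t := by
  obtain ⟨w, rfl⟩ := H
  exact lift_c_t _ _ _

theorem IsComp.unique {h' : T ⟶ Γ.M} (H : Γ.IsComp f g h) (H' : Γ.IsComp f g h') : h = h' := by
  obtain ⟨w, rfl⟩ := H
  obtain ⟨w', rfl⟩ := H'
  rfl

theorem exists_isComp (w : f ≫ Γ.t = g ≫ Γ.s) : ∃ h, Γ.IsComp f g h := ⟨_, w, rfl⟩

/-- If `fg = a`, `ah = b` and `gh = c`, then `fc = b`. -/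
theorem IsComp.assoc (H₁ : Γ.IsComp f g a) (H₂ : Γ.IsComp a h b) (H₃ : Γ.IsComp g h c) :
    Γ.IsComp f c b := by
  have w : f ≫ Γ.t = c ≫ Γ.s := H₁.w.trans H₃.s.symm
  obtain ⟨w₁, rfl⟩ := H₁
  obtain ⟨w₃, rfl⟩ := H₃
  obtain ⟨w₂, rfl⟩ := H₂
  exact ⟨w, (Γ.c_c f g h w₁ w₃ w₂ w).symm⟩

/-- If `fg = a`, `fc = b` and `gh = c`, then `ah = b`. -/
theorem IsComp.assoc' (H₁ : Γ.IsComp f g a) (H₂ : Γ.IsComp f c b) (H₃ : Γ.IsComp g h c) :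
    Γ.IsComp a h b := by
  have w : a ≫ Γ.t = h ≫ Γ.s := H₁.t.trans H₃.w
  obtain ⟨w₁, rfl⟩ := H₁
  obtain ⟨w₃, rfl⟩ := H₃
  obtain ⟨w₂, rfl⟩ := H₂
  exact ⟨w, Γ.c_c f g h w₁ w₃ w w₂⟩

theorem isComp_id (f : T ⟶ Γ.M) : Γ.IsComp f (f ≫ Γ.t ≫ Γ.e) f :=
  ⟨by simp [Γ.e_s], Γ.c_e f _⟩

theorem id_isComp (f : T ⟶ Γ.M) : Γ.IsComp (f ≫ Γ.s ≫ Γ.e) f f :=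
  ⟨by simp [Γ.e_t], Γ.e_c f _⟩

theorem IsComp.eq_of_id' {x : T ⟶ Γ.O} (H : Γ.IsComp (x ≫ Γ.e) f h) : h = f := by
  have w := H.w
  rw [Category.assoc, Γ.e_t, Category.comp_id] at w
  subst w
  rw [Category.assoc] at H
  exact H.unique (id_isComp f)

theorem IsComp.exists_lift (H : Γ.IsComp f g h) : ∃ r : T ⟶ pullback Γ.t Γ.s,
    r ≫ pullback.fst Γ.t Γ.s = f ∧ r ≫ pullback.snd Γ.t Γ.s = g ∧ r ≫ Γ.c = h := by
  obtain ⟨w, h⟩ := H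
  exact ⟨_, pullback.lift_fst _ _ _, pullback.lift_snd _ _ _, h⟩

theorem c_isComp : Γ.IsComp (pullback.fst Γ.t Γ.s) (pullback.snd Γ.t Γ.s) Γ.c :=
  ⟨pullback.condition, by
    rw [show pullback.lift (pullback.fst Γ.t Γ.s) (pullback.snd Γ.t Γ.s) pullback.condition =
      𝟙 _ from pullback.hom_ext (by simp) (by simp), Category.id_comp]⟩

end Comp

section Mult

variable [MonoidalCategory B] {Γ' : CatObj B} {n : ℕ} {Φ Ψ Ω : tpow Γ.M n ⟶ Γ'.M}

variable (Γ) in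
/-- The relation `Ω(f g) = Φ(f) Ψ(g)` between operations on tuples of morphisms, for composable
tuples `f` and `g`. -/
def Mult (Φ Ψ Ω : tpow Γ.M n ⟶ Γ'.M) : Prop :=
  Γ'.IsComp (tmap (pullback.fst Γ.t Γ.s) n ≫ Φ) (tmap (pullback.snd Γ.t Γ.s) n ≫ Ψ)
    (tmap Γ.c n ≫ Ω)

theorem Mult.tmap (H : Γ.Mult Φ Ψ Ω) {X : B} {a b c : X ⟶ Γ.M} (h : Γ.IsComp a b c) :
    Γ'.IsComp (tmap a n ≫ Φ) (tmap b n ≫ Ψ) (tmap c n ≫ Ω) := by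
  obtain ⟨r, rfl, rfl, rfl⟩ := h.exists_lift
  simpa only [tmap_comp, Category.assoc] using H.restrict (_root_.tmap r n)

theorem Mult.tblock (H : Γ.Mult Φ Ψ Ω) {X : B} {k : Fin n → ℕ}
    {a b c : ∀ i, tpow X (k i) ⟶ Γ.M} (h : ∀ i, Γ.IsComp (a i) (b i) (c i)) :
    Γ'.IsComp (tblock a ≫ Φ) (tblock b ≫ Ψ) (tblock c ≫ Ω) := by
  choose r h1 h2 h3 using fun i => (h i).exists_lift
  obtain rfl := funext h1
  obtain rfl := funext h2
  obtain rfl := funext h3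
  have := H.restrict (_root_.tblock r)
  simpa only [← Category.assoc, tblock_comp_tmap] using this

theorem Mult.comp (H : Γ.Mult Φ Ψ Ω) {k : Fin n → ℕ} {φ ψ ω : ∀ i, tpow Γ.M (k i) ⟶ Γ.M}
    (h : ∀ i, Γ.Mult (φ i) (ψ i) (ω i)) :
    Γ.Mult (_root_.tblock φ ≫ Φ) (_root_.tblock ψ ≫ Ψ) (_root_.tblock ω ≫ Ω) := by
  have := H.tblock h
  simpa only [Mult, ← tmap_tblock, Category.assoc] using this

theorem Mult.act [SymmetricCategory B] (H : Γ.Mult Φ Ψ Ω) {m : ℕ} (κ : Fin n ≃ Fin m) :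
    Γ.Mult (tperm Γ.M κ ≫ Φ) (tperm Γ.M κ ≫ Ψ) (tperm Γ.M κ ≫ Ω) := by
  have := H.restrict (tperm _ κ)
  simpa only [Mult, reassoc_of% @tmap_tperm] using this

theorem mult_one : Γ.Mult (tone Γ.M).hom (tone Γ.M).hom (tone Γ.M).hom := by
  rw [Mult, tmap_tone, tmap_tone, tmap_tone]
  exact c_isComp.restrict (tone _).hom

end Mult

/-! ### The endomorphism operad of a category object -/

section EndCat

variable [MonoidalCategory B]

variable (Γ) in
/-- An internal functor `Γ^n → Γ`. -/
@[ext]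
structure MultiFunctor (n : ℕ) where
  /-- the map on objects -/
  o : tpow Γ.O n ⟶ Γ.O
  /-- the map on morphisms -/
  m : tpow Γ.M n ⟶ Γ.M
  m_s : m ≫ Γ.s = tmap Γ.s n ≫ o
  m_t : m ≫ Γ.t = tmap Γ.t n ≫ o
  e_m : tmap Γ.e n ≫ m = o ≫ Γ.e
  mult : Γ.Mult m m m

variable (Γ) in
/-- An internal natural transformation between functors `Γ^n → Γ`, given by the operation `hom`
which takes the tuple of morphisms `f : x ⟶ y` to the diagonal `F x ⟶ G y` of the naturality
square. -/
@[ext]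
structure MultiNat (n : ℕ) where
  /-- the source -/
  F : Γ.MultiFunctor n
  /-- the target -/
  G : Γ.MultiFunctor n
  /-- the diagonals of the naturality squares -/
  hom : tpow Γ.M n ⟶ Γ.M
  hom_s : hom ≫ Γ.s = tmap Γ.s n ≫ F.o
  hom_t : hom ≫ Γ.t = tmap Γ.t n ≫ G.o
  mult_left : Γ.Mult F.m hom hom
  mult_right : Γ.Mult hom G.m hom

variable [SymmetricCategory B]

variable (Γ) in
/-- The operad of internal functors `Γ^n → Γ`. -/
abbrev functorOperad : Operad.{v} where
  Ops := Γ.MultiFunctor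
  act κ F :=
    { o := tperm Γ.O κ ≫ F.o
      m := tperm Γ.M κ ≫ F.m
      m_s := by rw [Category.assoc, F.m_s, reassoc_of% @tmap_tperm]
      m_t := by rw [Category.assoc, F.m_t, reassoc_of% @tmap_tperm]
      e_m := by rw [reassoc_of% @tmap_tperm, F.e_m, Category.assoc]
      mult := F.mult.act κ }
  one :=
    { o := (tone Γ.O).hom
      m := (tone Γ.M).hom
      m_s := (tmap_tone _).symm
      m_t := (tmap_tone _).symm
      e_m := tmap_tone _
      mult := mult_one }
  comp F G :=
    { o := tblock (fun i => (G i).o) ≫ F.o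
      m := tblock (fun i => (G i).m) ≫ F.m
      m_s := by
        rw [Category.assoc, F.m_s, reassoc_of% @tblock_comp_tmap, reassoc_of% @tmap_tblock]
        simp only [MultiFunctor.m_s]
      m_t := by
        rw [Category.assoc, F.m_t, reassoc_of% @tblock_comp_tmap, reassoc_of% @tmap_tblock]
        simp only [MultiFunctor.m_t]
      e_m := by
        rw [reassoc_of% @tmap_tblock, Category.assoc, ← F.e_m, reassoc_of% @tblock_comp_tmap]
        simp only [MultiFunctor.e_m]
      mult := F.mult.comp fun i => (G i).mult }
  act_refl F := MultiFunctor.ext ((endOperad Γ.O).act_refl F.o) ((endOperad Γ.M).act_refl F.m)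
  act_trans κ lam F := MultiFunctor.ext ((endOperad Γ.O).act_trans κ lam F.o)
    ((endOperad Γ.M).act_trans κ lam F.m)
  one_comp F := MultiFunctor.ext ((endOperad Γ.O).one_comp F.o) ((endOperad Γ.M).one_comp F.m)
  comp_one F := MultiFunctor.ext ((endOperad Γ.O).comp_one F.o) ((endOperad Γ.M).comp_one F.m)
  comp_assoc F G H := MultiFunctor.ext
    ((endOperad Γ.O).comp_assoc F.o (fun i => (G i).o) (fun p => (H p).o))
    ((endOperad Γ.M).comp_assoc F.m (fun i => (G i).m) (fun p => (H p).m))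
  comp_act lam κ F G := MultiFunctor.ext
    ((endOperad Γ.O).comp_act lam κ F.o (fun i => (G i).o))
    ((endOperad Γ.M).comp_act lam κ F.m (fun i => (G i).m))

variable (Γ) in
/-- The operad of internal natural transformations between functors `Γ^n → Γ`. -/
abbrev natOperad : Operad.{v} where
  Ops := Γ.MultiNat
  act κ f :=
    { F := Γ.functorOperad.act κ f.F
      G := Γ.functorOperad.act κ f.G
      hom := tperm Γ.M κ ≫ f.hom
      hom_s := by
        rw [Category.assoc, f.hom_s, ← reassoc_of% @tmap_tperm]
      hom_t := by
        rw [Category.assoc, f.hom_t, ← reassoc_of% @tmap_tperm]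
      mult_left := f.mult_left.act κ
      mult_right := f.mult_right.act κ }
  one :=
    { F := Γ.functorOperad.one
      G := Γ.functorOperad.one
      hom := (tone Γ.M).hom
      hom_s := (tmap_tone _).symm
      hom_t := (tmap_tone _).symm
      mult_left := mult_one
      mult_right := mult_one }
  comp f g :=
    { F := Γ.functorOperad.comp f.F (fun i => (g i).F)
      G := Γ.functorOperad.comp f.G (fun i => (g i).G)
      hom := tblock (fun i => (g i).hom) ≫ f.hom
      hom_s := by
        rw [Category.assoc, f.hom_s, reassoc_of% @tblock_comp_tmap]
        simp only [MultiNat.hom_s, ← tmap_tblock, Category.assoc]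
      hom_t := by
        rw [Category.assoc, f.hom_t, reassoc_of% @tblock_comp_tmap]
        simp only [MultiNat.hom_t, ← tmap_tblock, Category.assoc]
      mult_left := f.mult_left.comp fun i => (g i).mult_left
      mult_right := f.mult_right.comp fun i => (g i).mult_right }
  act_refl f := MultiNat.ext (Γ.functorOperad.act_refl _) (Γ.functorOperad.act_refl _)
    ((endOperad Γ.M).act_refl f.hom)
  act_trans κ lam f := MultiNat.ext (Γ.functorOperad.act_trans κ lam _)
    (Γ.functorOperad.act_trans κ lam _) ((endOperad Γ.M).act_trans κ lam f.hom)
  one_comp f := MultiNat.ext (Γ.functorOperad.one_comp _) (Γ.functorOperad.one_comp _)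
    ((endOperad Γ.M).one_comp f.hom)
  comp_one f := MultiNat.ext (Γ.functorOperad.comp_one _) (Γ.functorOperad.comp_one _)
    ((endOperad Γ.M).comp_one f.hom)
  comp_assoc f g h := MultiNat.ext
    (Γ.functorOperad.comp_assoc f.F (fun i => (g i).F) (fun p => (h p).F))
    (Γ.functorOperad.comp_assoc f.G (fun i => (g i).G) (fun p => (h p).G))
    ((endOperad Γ.M).comp_assoc f.hom (fun i => (g i).hom) (fun p => (h p).hom))
  comp_act lam κ f g := MultiNat.ext
    (Γ.functorOperad.comp_act lam κ f.F (fun i => (g i).F))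
    (Γ.functorOperad.comp_act lam κ f.G (fun i => (g i).G))
    ((endOperad Γ.M).comp_act lam κ f.hom (fun i => (g i).hom))

end EndCat

end CatObj

/-! ### Natural transformations between functors on tensor powers -/

namespace CatObj

variable {B : Type u} [Category.{v} B] [HasPullbacks B] {Γ : CatObj B}

theorem isComp_idn {T : B} (x : T ⟶ Γ.O) : Γ.IsComp (x ≫ Γ.e) (x ≫ Γ.e) (x ≫ Γ.e) := by
  have := isComp_id (x ≫ Γ.e)
  rwa [Category.assoc, reassoc_of% Γ.e_t] at this

section

variable [MonoidalCategory B] {Γ' : CatObj B} {n : ℕ} {Φ Ψ Ω Φ' Ω' : tpow Γ.M n ⟶ Γ'.M}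

theorem Mult.right_id (H : Γ.Mult Φ Ψ Ω) : Γ'.IsComp Φ (_root_.tmap (Γ.t ≫ Γ.e) n ≫ Ψ) Ω := by
  have := H.tmap (isComp_id (𝟙 Γ.M))
  simpa only [tmap_id, Category.id_comp] using this

theorem Mult.left_id (H : Γ.Mult Φ Ψ Ω) : Γ'.IsComp (_root_.tmap (Γ.s ≫ Γ.e) n ≫ Φ) Ψ Ω := by
  have := H.tmap (id_isComp (𝟙 Γ.M))
  simpa only [tmap_id, Category.id_comp] using this

theorem Mult.component (H : Γ.Mult Φ Ψ Ω) :
    Γ'.IsComp (_root_.tmap Γ.e n ≫ Φ) (_root_.tmap Γ.e n ≫ Ψ) (_root_.tmap Γ.e n ≫ Ω) := by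
  have := isComp_idn (Γ := Γ) (𝟙 Γ.O)
  rw [Category.id_comp] at this
  exact H.tmap this

theorem Mult.unique (H : Γ.Mult Φ Ψ Ω) (H' : Γ.Mult Φ Ψ Ω') : Ω = Ω' :=
  H.right_id.unique H'.right_id

theorem Mult.assoc {A D D' : tpow Γ.M n ⟶ Γ'.M} (H₁ : Γ.Mult Φ Ψ A) (H₂ : Γ.Mult A Ω D)
    (H₃ : Γ.Mult Ψ Ω Φ') (H₄ : Γ.Mult Φ Φ' D') : D = D' := by
  have h := H₃.tmap (isComp_idn Γ.t)
  exact (H₁.right_id.assoc H₂.right_id h).unique H₄.right_id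

/-- The component at a tuple of objects: the value at the tuple of identities. -/
def MultiNat.component (f : Γ.MultiNat n) : tpow Γ.O n ⟶ Γ.M := tmap Γ.e n ≫ f.hom

theorem MultiNat.component_s (f : Γ.MultiNat n) : f.component ≫ Γ.s = f.F.o := by
  rw [component, Category.assoc, f.hom_s, ← Category.assoc, ← tmap_comp, Γ.e_s, tmap_id,
    Category.id_comp]

theorem MultiNat.component_t (f : Γ.MultiNat n) : f.component ≫ Γ.t = f.G.o := by
  rw [component, Category.assoc, f.hom_t, ← Category.assoc, ← tmap_comp, Γ.e_t, tmap_id,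
    Category.id_comp]

theorem MultiNat.isComp_component (f : Γ.MultiNat n) :
    Γ.IsComp f.F.m (tmap Γ.t n ≫ f.component) f.hom := by
  have := f.mult_left.right_id
  rwa [tmap_comp, Category.assoc] at this

theorem MultiNat.component_isComp (f : Γ.MultiNat n) :
    Γ.IsComp (tmap Γ.s n ≫ f.component) f.G.m f.hom := by
  have := f.mult_right.left_id
  rwa [tmap_comp, Category.assoc] at this

/-- A natural transformation is determined by its components. -/
theorem MultiNat.ext_component {f g : Γ.MultiNat n} (hF : f.F = g.F) (hG : f.G = g.G)
    (h : f.component = g.component) : f = g := by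
  refine MultiNat.ext hF hG ?_
  have h1 := f.isComp_component
  rw [hF, h] at h1
  exact h1.unique g.isComp_component

/-- A natural family of components defines a natural transformation. -/
theorem exists_multiNat (F G : Γ.MultiFunctor n) (α : tpow Γ.O n ⟶ Γ.M) (hs : α ≫ Γ.s = F.o)
    (ht : α ≫ Γ.t = G.o)
    (H : ∃ h, Γ.IsComp (tmap Γ.s n ≫ α) G.m h ∧ Γ.IsComp F.m (tmap Γ.t n ≫ α) h) :
    ∃ f : Γ.MultiNat n, f.F = F ∧ f.G = G ∧ f.component = α := by
  obtain ⟨h, h1, h2⟩ := H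
  refine ⟨⟨F, G, h, by rw [h1.s, Category.assoc, hs], by rw [h2.t, Category.assoc, ht], ?_, ?_⟩,
    rfl, rfl, ?_⟩
  · have k := h2.restrict (tmap Γ.c n)
    rw [← Category.assoc (tmap Γ.c n) (tmap Γ.t n), ← tmap_comp, Γ.c_t, tmap_comp,
      Category.assoc] at k
    exact IsComp.assoc F.mult k (h2.restrict (tmap (pullback.snd Γ.t Γ.s) n))
  · have k := h1.restrict (tmap Γ.c n)
    rw [← Category.assoc (tmap Γ.c n) (tmap Γ.s n), ← tmap_comp, Γ.c_s, tmap_comp,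
      Category.assoc] at k
    exact (h1.restrict (tmap (pullback.fst Γ.t Γ.s) n)).assoc' k G.mult
  · have k := h2.restrict (tmap Γ.e n)
    rw [F.e_m, ← Category.assoc (tmap Γ.e n), ← tmap_comp, Γ.e_t, tmap_id,
      Category.id_comp] at k
    exact k.eq_of_id'

/-- The composite of two transformations takes `f : x ⟶ y` to the composite of the diagonal of the
first at `f` with the component of the second at `y`. -/
theorem exists_mult (f g : Γ.MultiNat n) (w : f.G = g.F) :
    ∃ h : Γ.MultiNat n, h.F = f.F ∧ h.G = g.G ∧ Γ.Mult f.hom g.hom h.hom := by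
  obtain ⟨h, hh⟩ := exists_isComp (Γ := Γ) (f := f.hom) (g := tmap (Γ.t ≫ Γ.e) n ≫ g.hom) (by
    rw [f.hom_t, Category.assoc, g.hom_s, ← Category.assoc, ← tmap_comp, Category.assoc, Γ.e_s,
      Category.comp_id, w])
  have key : Γ.Mult f.hom g.hom h := by
    have h1 := f.mult_right
    have h2 := g.mult_left.right_id.restrict (tmap (pullback.snd Γ.t Γ.s) n)
    rw [w] at h1
    have h3 := hh.restrict (tmap Γ.c n)
    rw [← Category.assoc (tmap Γ.c n) (tmap (Γ.t ≫ Γ.e) n), ← tmap_comp, ← Category.assoc Γ.c,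
      Γ.c_t, Category.assoc, tmap_comp, Category.assoc] at h3
    exact IsComp.assoc h1 h3 h2
  refine ⟨⟨f.F, g.G, h, hh.s.trans f.hom_s, ?_, ?_, ?_⟩, rfl, rfl, key⟩
  · rw [hh.t, Category.assoc, g.hom_t, ← Category.assoc, ← tmap_comp, Category.assoc, Γ.e_t,
      Category.comp_id]
  · have k := hh.restrict (tmap Γ.c n)
    rw [← Category.assoc (tmap Γ.c n) (tmap (Γ.t ≫ Γ.e) n), ← tmap_comp, ← Category.assoc Γ.c,
      Γ.c_t, Category.assoc, tmap_comp, Category.assoc] at k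
    exact IsComp.assoc f.mult_left k (hh.restrict (tmap (pullback.snd Γ.t Γ.s) n))
  · have k := g.mult_right.tmap (a := pullback.fst Γ.t Γ.s ≫ Γ.t ≫ Γ.e)
      (b := pullback.snd Γ.t Γ.s) (c := pullback.snd Γ.t Γ.s) (by
        have := id_isComp (pullback.snd Γ.t Γ.s)
        rwa [← pullback.condition_assoc] at this)
    rw [tmap_comp, Category.assoc] at k
    exact (hh.restrict (tmap (pullback.fst Γ.t Γ.s) n)).assoc' key k

/-- The identity transformation. -/
def MultiNat.idn (F : Γ.MultiFunctor n) : Γ.MultiNat n :=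
  ⟨F, F, F.m, F.m_s, F.m_t, F.mult, F.mult⟩

open Classical in
/-- The vertical composition of natural transformations; if they are not composable, the value is
immaterial. -/
noncomputable def MultiNat.cmp (f g : Γ.MultiNat n) : Γ.MultiNat n :=
  if w : f.G = g.F then (exists_mult f g w).choose else f

section

variable {f g : Γ.MultiNat n}

theorem MultiNat.cmp_F (w : f.G = g.F) : (f.cmp g).F = f.F := by
  rw [cmp, dif_pos w]
  exact (exists_mult f g w).choose_spec.1

theorem MultiNat.cmp_G (w : f.G = g.F) : (f.cmp g).G = g.G := by
  rw [cmp, dif_pos w]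
  exact (exists_mult f g w).choose_spec.2.1

theorem MultiNat.mult_cmp (w : f.G = g.F) : Γ.Mult f.hom g.hom (f.cmp g).hom := by
  rw [cmp, dif_pos w]
  exact (exists_mult f g w).choose_spec.2.2

theorem MultiNat.eq_cmp {h : Γ.MultiNat n} (w : f.G = g.F) (hF : h.F = f.F) (hG : h.G = g.G)
    (H : Γ.Mult f.hom g.hom h.hom) : h = f.cmp g :=
  MultiNat.ext (hF.trans (cmp_F w).symm) (hG.trans (cmp_G w).symm) (H.unique (mult_cmp w))

theorem MultiNat.component_cmp {h : tpow Γ.O n ⟶ Γ.M} (w : f.G = g.F)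
    (H : Γ.IsComp f.component g.component h) : (f.cmp g).component = h :=
  (mult_cmp w).component.unique H

end

end

variable [MonoidalCategory B] [SymmetricCategory B]

open Operad

variable (Γ) in
/-- The endomorphism operad of a category object, as an operad in categories. -/
noncomputable abbrev catOperad : CatOperad.{v} where
  Ob := Γ.functorOperad
  Mor := Γ.natOperad
  src := ⟨fun f => f.F, fun _ _ => rfl, rfl, fun _ _ => rfl⟩
  tgt := ⟨fun f => f.G, fun _ _ => rfl, rfl, fun _ _ => rfl⟩
  idn := ⟨fun F => MultiNat.idn F, fun _ _ => rfl, rfl, fun _ _ => rfl⟩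
  cmp f g := MultiNat.cmp f g
  src_idn _ := rfl
  tgt_idn _ := rfl
  src_cmp w := MultiNat.cmp_F w
  tgt_cmp w := MultiNat.cmp_G w
  idn_cmp f := (MultiNat.eq_cmp (f := MultiNat.idn f.F) (g := f) (h := f) rfl rfl rfl
    (MultiNat.mult_left f)).symm
  cmp_idn f := (MultiNat.eq_cmp (f := f) (g := MultiNat.idn f.G) (h := f) rfl rfl rfl
    (MultiNat.mult_right f)).symm
  cmp_assoc {_ f g h} w w' := by
    have h1 := (MultiNat.cmp_G w).trans w'
    have h2 := w.trans (MultiNat.cmp_F w').symm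
    exact MultiNat.ext
      (((MultiNat.cmp_F h1).trans (MultiNat.cmp_F w)).trans (MultiNat.cmp_F h2).symm)
      ((MultiNat.cmp_G h1).trans ((MultiNat.cmp_G h2).trans (MultiNat.cmp_G w')).symm)
      ((MultiNat.mult_cmp w).assoc (MultiNat.mult_cmp h1) (MultiNat.mult_cmp w')
        (MultiNat.mult_cmp h2))
  comp_cmp w w' := MultiNat.eq_cmp
    (congrArg₂ Γ.functorOperad.comp w (funext w'))
    (congrArg₂ Γ.functorOperad.comp (MultiNat.cmp_F w) (funext fun i => MultiNat.cmp_F (w' i)))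
    (congrArg₂ Γ.functorOperad.comp (MultiNat.cmp_G w) (funext fun i => MultiNat.cmp_G (w' i)))
    ((MultiNat.mult_cmp w).comp fun i => MultiNat.mult_cmp (w' i))
  act_cmp {_ _} κ {f g} w := MultiNat.eq_cmp
    (congrArg (Γ.functorOperad.act κ) w)
    (congrArg (Γ.functorOperad.act κ) (MultiNat.cmp_F w))
    (congrArg (Γ.functorOperad.act κ) (MultiNat.cmp_G w))
    ((MultiNat.mult_cmp w).act κ)

section

variable {n : ℕ} {k : Fin n → ℕ}

theorem MultiNat.component_comp_idn_left (F : Γ.MultiFunctor n) (g : ∀ i, Γ.MultiNat (k i)) :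
    MultiNat.component (Γ.catOperad.Mor.comp (Γ.catOperad.idn.map F) g) =
      tblock (fun i => (g i).component) ≫ F.m := by
  simp only [component, ← tmap_tblock, Category.assoc]
  rfl

theorem MultiNat.component_comp_idn_right (f : Γ.MultiNat n) (G : ∀ i, Γ.MultiFunctor (k i)) :
    MultiNat.component (Γ.catOperad.Mor.comp f (fun i => Γ.catOperad.idn.map (G i))) =
      tblock (fun i => (G i).o) ≫ f.component := by
  change tmap Γ.e _ ≫ tblock (fun i => (G i).m) ≫ f.hom =
    tblock (fun i => (G i).o) ≫ tmap Γ.e n ≫ f.hom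
  rw [reassoc_of% @tblock_comp_tmap, reassoc_of% @tmap_tblock]
  simp only [MultiFunctor.e_m]

theorem MultiNat.component_act {m : ℕ} (κ : Fin n ≃ Fin m) (f : Γ.MultiNat n) :
    MultiNat.component (Γ.catOperad.Mor.act κ f) = tperm Γ.O κ ≫ f.component := by
  change tmap Γ.e m ≫ tperm Γ.M κ ≫ f.hom = tperm Γ.O κ ≫ tmap Γ.e n ≫ f.hom
  rw [reassoc_of% @tmap_tperm]

theorem MultiNat.isHom_ext {f g : Γ.MultiNat n} {x y : Γ.MultiFunctor n}
    (hf : Γ.catOperad.IsHom f x y) (hg : Γ.catOperad.IsHom g x y)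
    (h : f.component = g.component) : f = g :=
  MultiNat.ext_component (hf.src.trans hg.src.symm) (hf.tgt.trans hg.tgt.symm) h

theorem MultiNat.IsHom.component_cmp {f g : Γ.MultiNat n} {x y z : Γ.MultiFunctor n}
    (hf : Γ.catOperad.IsHom f x y) (hg : Γ.catOperad.IsHom g y z) {h : tpow Γ.O n ⟶ Γ.M}
    (H : Γ.IsComp f.component g.component h) :
    MultiNat.component (Γ.catOperad.cmp f g) = h :=
  MultiNat.component_cmp (hf.tgt.trans hg.src.symm) H

/-- A natural transformation with invertible components is invertible. -/
theorem MultiNat.exists_isInv (f : Γ.MultiNat n) (h : Γ.IsIsoValued f.component) :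
    ∃ g, Γ.catOperad.IsInv f g := by
  obtain ⟨b, h1, h2⟩ := h
  have hs := h2.s
  have ht := h1.t
  simp only [Category.assoc, Γ.e_s, Γ.e_t, Category.comp_id] at hs ht
  rw [f.component_t] at hs
  rw [f.component_s] at ht
  obtain ⟨p, hp⟩ := exists_isComp (Γ := Γ) (f := tmap Γ.s n ≫ b) (g := f.F.m) (by
    rw [Category.assoc, ← ht, f.F.m_s])
  have H3 : Γ.IsComp (tmap Γ.s n ≫ b) f.hom f.G.m := by
    have k := h2.restrict (tmap Γ.s n)
    rw [← Category.assoc f.component, f.component_t, ← Category.assoc, ← f.G.m_s,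
      Category.assoc] at k
    exact k.assoc (id_isComp f.G.m) f.component_isComp
  have H4 := hp.assoc' H3 f.isComp_component
  have H5 : Γ.IsComp f.G.m (tmap Γ.t n ≫ b) p := by
    have k := h1.restrict (tmap Γ.t n)
    rw [← Category.assoc f.component, f.component_s, ← Category.assoc, ← f.F.m_t, ← hp.t,
      Category.assoc] at k
    exact H4.assoc' (isComp_id p) k
  obtain ⟨g, g1, g2, g3⟩ := exists_multiNat f.G f.F b hs.symm ht.symm ⟨p, hp, H5⟩
  have hf : Γ.catOperad.IsHom f f.F f.G := ⟨rfl, rfl⟩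
  have hg : Γ.catOperad.IsHom g f.G f.F := ⟨g1, g2⟩
  refine ⟨g, hg, ?_, ?_⟩
  · refine MultiNat.isHom_ext (hf.cmp hg) (CatOperad.isHom_idn _) ?_
    refine (IsHom.component_cmp hf hg (g3 ▸ h1)).trans ?_
    rw [← Category.assoc, f.component_s]
    exact f.F.e_m.symm
  · refine MultiNat.isHom_ext (hg.cmp hf) (CatOperad.isHom_idn _) ?_
    refine (IsHom.component_cmp hg hf (g3 ▸ h2)).trans ?_
    rw [← Category.assoc, f.component_t]
    exact f.G.e_m.symm

end

end CatObj

/-! ### Enhanced lax algebras as lax maps into the endomorphism operad -/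

section

open Operad CatObj

namespace EnhancedLaxAlgebra

variable {B : Type u} [Category.{v} B] [MonoidalCategory B] [SymmetricCategory B] [HasPullbacks B]
  {C : Operad.{w}} {Γ : CatObj B} (L : EnhancedLaxAlgebra C Γ)

/-- The internal functor by which an operation of `C` acts. -/
def multiFunctor {n : ℕ} (μ : C.Ops n) : Γ.MultiFunctor n where
  o := L.opO μ
  m := L.opM μ
  m_s := L.opM_s μ
  m_t := L.opM_t μ
  e_m := L.opM_e μ
  mult := L.opM_c μ

theorem exists_compHom {n : ℕ} {k : Fin n → ℕ} (μ : C.Ops n) (ν : ∀ i, C.Ops (k i)) :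
    ∃ f : Γ.MultiNat (∑ i, k i),
      f.F = Γ.functorOperad.comp (L.multiFunctor μ) (fun i => L.multiFunctor (ν i)) ∧
      f.G = L.multiFunctor (C.comp μ ν) ∧ f.component = L.compHom μ ν :=
  exists_multiNat _ _ _ (L.compHom_s μ ν) (L.compHom_t μ ν) (L.compHom_natural μ ν)

theorem exists_oneHom :
    ∃ f : Γ.MultiNat 1, f.F = L.multiFunctor C.one ∧ f.G = Γ.functorOperad.one ∧
      f.component = L.oneHom :=
  exists_multiNat _ _ _ L.oneHom_s (L.oneHom_t.trans (tone_hom _).symm) (by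
    obtain ⟨h, h1, h2⟩ := L.oneHom_natural
    rw [← tone_hom] at h1
    exact ⟨h, h1, h2⟩)

theorem exists_actHom {n m : ℕ} (κ : Fin n ≃ Fin m) (μ : C.Ops n) :
    ∃ f : Γ.MultiNat m, f.F = L.multiFunctor (C.act κ μ) ∧
      f.G = Γ.functorOperad.act κ (L.multiFunctor μ) ∧ f.component = L.actHom κ μ :=
  exists_multiNat _ _ _ (L.actHom_s κ μ) (L.actHom_t κ μ) (L.actHom_natural κ μ)

/-- The coherence of composition as a natural transformation. -/
noncomputable def compNat {n : ℕ} {k : Fin n → ℕ} (μ : C.Ops n) (ν : ∀ i, C.Ops (k i)) :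
    Γ.MultiNat (∑ i, k i) := (L.exists_compHom μ ν).choose

/-- The coherence of the unit as a natural transformation. -/
noncomputable def oneNat : Γ.MultiNat 1 := L.exists_oneHom.choose

/-- The coherence of a permutation as a natural transformation. -/
noncomputable def actNat {n m : ℕ} (κ : Fin n ≃ Fin m) (μ : C.Ops n) : Γ.MultiNat m :=
  (L.exists_actHom κ μ).choose

theorem compNat_isHom {n : ℕ} {k : Fin n → ℕ} (μ : C.Ops n) (ν : ∀ i, C.Ops (k i)) :
    Γ.catOperad.IsHom (L.compNat μ ν)
      (Γ.catOperad.Ob.comp (L.multiFunctor μ) (fun i => L.multiFunctor (ν i)))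
      (L.multiFunctor (C.comp μ ν)) :=
  ⟨(L.exists_compHom μ ν).choose_spec.1, (L.exists_compHom μ ν).choose_spec.2.1⟩

theorem compNat_component {n : ℕ} {k : Fin n → ℕ} (μ : C.Ops n) (ν : ∀ i, C.Ops (k i)) :
    (L.compNat μ ν).component = L.compHom μ ν := (L.exists_compHom μ ν).choose_spec.2.2

theorem oneNat_isHom :
    Γ.catOperad.IsHom L.oneNat (L.multiFunctor C.one) Γ.catOperad.Ob.one :=
  ⟨L.exists_oneHom.choose_spec.1, L.exists_oneHom.choose_spec.2.1⟩

theorem oneNat_component : L.oneNat.component = L.oneHom := L.exists_oneHom.choose_spec.2.2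

theorem actNat_isHom {n m : ℕ} (κ : Fin n ≃ Fin m) (μ : C.Ops n) :
    Γ.catOperad.IsHom (L.actNat κ μ) (L.multiFunctor (C.act κ μ))
      (Γ.catOperad.Ob.act κ (L.multiFunctor μ)) :=
  ⟨(L.exists_actHom κ μ).choose_spec.1, (L.exists_actHom κ μ).choose_spec.2.1⟩

theorem actNat_component {n m : ℕ} (κ : Fin n ≃ Fin m) (μ : C.Ops n) :
    (L.actNat κ μ).component = L.actHom κ μ := (L.exists_actHom κ μ).choose_spec.2.2

theorem multiFunctor_act_finCongr {n m : ℕ} (h : n = m) (μ : C.Ops n) :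
    Γ.catOperad.Ob.act (finCongr h) (L.multiFunctor μ) =
      L.multiFunctor (C.act (finCongr h) μ) := by
  subst h
  rw [act_finCongr_rfl, act_finCongr_rfl]

theorem comp_assoc_aux {n : ℕ} {k : Fin n → ℕ} {l : Fin (∑ i, k i) → ℕ} (μ : C.Ops n)
    (ν : ∀ i, C.Ops (k i)) (ρ : ∀ p, C.Ops (l p)) :
    Γ.catOperad.cmp
        (Γ.catOperad.Mor.act (finCongr (sum_sum_blk l))
          (Γ.catOperad.Mor.comp (Γ.catOperad.idn.map (L.multiFunctor μ))
            (fun i => L.compNat (ν i) (fun j => ρ (blk i j)))))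
        (Γ.catOperad.Mor.act (finCongr (sum_sum_blk l))
          (L.compNat μ (fun i => C.comp (ν i) (fun j => ρ (blk i j))))) =
      Γ.catOperad.cmp
        (Γ.catOperad.Mor.comp (L.compNat μ ν) (fun p => Γ.catOperad.idn.map (L.multiFunctor (ρ p))))
        (L.compNat (C.comp μ ν) ρ) := by
  have h1 := ((CatOperad.isHom_idn (E := Γ.catOperad) (L.multiFunctor μ)).comp
    (fun i => L.compNat_isHom (ν i) (fun j => ρ (blk i j)))).act (finCongr (sum_sum_blk l))
  have h2 := (L.compNat_isHom μ (fun i => C.comp (ν i) (fun j => ρ (blk i j)))).act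
    (finCongr (sum_sum_blk l))
  have h3 := (L.compNat_isHom μ ν).comp
    (fun p => CatOperad.isHom_idn (E := Γ.catOperad) (L.multiFunctor (ρ p)))
  have h4 := L.compNat_isHom (C.comp μ ν) ρ
  obtain ⟨h, e1, e2⟩ := L.comp_assoc μ ν ρ
  rw [C.comp_assoc, ← L.multiFunctor_act_finCongr] at h4
  rw [Γ.catOperad.Ob.comp_assoc] at h3
  refine MultiNat.isHom_ext (h1.cmp h2) (h3.cmp h4) ?_
  refine (MultiNat.IsHom.component_cmp h1 h2 (h := h) ?_).trans
    (MultiNat.IsHom.component_cmp h3 h4 ?_).symm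
  · rw [MultiNat.component_act, MultiNat.component_act, MultiNat.component_comp_idn_left]
    simp only [compNat_component]
    rw [tcast_eq] at e1
    exact e1
  · rw [MultiNat.component_comp_idn_right, compNat_component, compNat_component]
    exact e2

theorem act_trans_aux {n m l : ℕ} (κ : Fin n ≃ Fin m) (lam : Fin m ≃ Fin l) (μ : C.Ops n) :
    L.actNat (κ.trans lam) μ =
      Γ.catOperad.cmp (L.actNat lam (C.act κ μ)) (Γ.catOperad.Mor.act lam (L.actNat κ μ)) := by
  have h1 := L.actNat_isHom (κ.trans lam) μ
  have h2 := L.actNat_isHom lam (C.act κ μ)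
  have h3 := (L.actNat_isHom κ μ).act lam
  rw [C.act_trans, Γ.catOperad.Ob.act_trans] at h1
  refine MultiNat.isHom_ext h1 (h2.cmp h3) ((L.actNat_component _ _).trans
    (MultiNat.IsHom.component_cmp h2 h3 ?_).symm)
  rw [MultiNat.component_act, actNat_component, actNat_component]
  exact L.act_trans κ lam μ

theorem comp_act_aux {n m : ℕ} {k k' : Fin m → ℕ} (lam : Fin n ≃ Fin m)
    (κ : ∀ i, Fin (k i) ≃ Fin (k' i)) (μ : C.Ops n) (ν : ∀ i, C.Ops (k i)) :
    Γ.catOperad.cmp (L.compNat (C.act lam μ) (fun i => C.act (κ i) (ν i)))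
        (L.actNat (blockEquiv lam κ) (C.comp μ (fun j => ν (lam j)))) =
      Γ.catOperad.cmp
        (Γ.catOperad.cmp
          (Γ.catOperad.Mor.comp (Γ.catOperad.idn.map (L.multiFunctor (C.act lam μ)))
            (fun i => L.actNat (κ i) (ν i)))
          (Γ.catOperad.Mor.comp (L.actNat lam μ)
            (fun i => Γ.catOperad.idn.map (Γ.catOperad.Ob.act (κ i) (L.multiFunctor (ν i))))))
        (Γ.catOperad.Mor.act (blockEquiv lam κ) (L.compNat μ (fun j => ν (lam j)))) := by
  have h1 := L.compNat_isHom (C.act lam μ) (fun i => C.act (κ i) (ν i))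
  have h2 := L.actNat_isHom (blockEquiv lam κ) (C.comp μ (fun j => ν (lam j)))
  have h3 := (CatOperad.isHom_idn (E := Γ.catOperad) (L.multiFunctor (C.act lam μ))).comp
    (fun i => L.actNat_isHom (κ i) (ν i))
  have h4 := (L.actNat_isHom lam μ).comp (fun i => CatOperad.isHom_idn (E := Γ.catOperad)
    (Γ.catOperad.Ob.act (κ i) (L.multiFunctor (ν i))))
  have h5 := (L.compNat_isHom μ (fun j => ν (lam j))).act (blockEquiv lam κ)
  rw [C.comp_act] at h1
  rw [← Γ.catOperad.Ob.comp_act lam κ (L.multiFunctor μ) (fun i => L.multiFunctor (ν i))] at h5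
  obtain ⟨h, h', e1, e2, e3⟩ := L.comp_act lam κ μ ν
  refine MultiNat.isHom_ext (h1.cmp h2) ((h3.cmp h4).cmp h5) ?_
  refine (MultiNat.IsHom.component_cmp h1 h2 (h := h) ?_).trans
    (MultiNat.IsHom.component_cmp (h3.cmp h4) h5 ?_).symm
  · rw [compNat_component, actNat_component]
    exact e1
  · rw [MultiNat.component_act, MultiNat.IsHom.component_cmp h3 h4 (h := h'), compNat_component]
    · exact e3
    · rw [MultiNat.component_comp_idn_left, MultiNat.component_comp_idn_right]
      simp only [actNat_component]
      exact e2

/-- A lax algebra as a pseudo-map to the endomorphism operad. -/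
noncomputable def laxMap : CatOperad.LaxMap C Γ.catOperad where
  op μ := L.multiFunctor μ
  compHom μ ν := L.compNat μ ν
  oneHom := L.oneNat
  actHom κ μ := L.actNat κ μ
  compHom_isHom := L.compNat_isHom
  oneHom_isHom := L.oneNat_isHom
  actHom_isHom := L.actNat_isHom
  compHom_iso μ ν := MultiNat.exists_isInv _ (by
    rw [compNat_component]
    exact L.compHom_iso μ ν)
  oneHom_iso := MultiNat.exists_isInv _ (by
    rw [oneNat_component]
    exact L.oneHom_iso)
  actHom_iso κ μ := MultiNat.exists_isInv _ (by
    rw [actNat_component]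
    exact L.actHom_iso κ μ)
  comp_assoc := L.comp_assoc_aux
  one_comp {n} μ := by
    have h1 := L.compNat_isHom C.one (fun _ => μ)
    have h2 := L.oneNat_isHom.comp
      (fun _ : Fin 1 => CatOperad.isHom_idn (E := Γ.catOperad) (L.multiFunctor μ))
    rw [C.one_comp, ← L.multiFunctor_act_finCongr, ← Γ.catOperad.Ob.one_comp] at h1
    refine MultiNat.isHom_ext h1 h2 ?_
    refine Eq.trans ?_ (MultiNat.component_comp_idn_right _ _).symm
    rw [compNat_component, oneNat_component]
    exact L.one_comp μ
  comp_one {n} μ := by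
    have h1 := L.compNat_isHom μ (fun _ => C.one)
    have h2 := (CatOperad.isHom_idn (E := Γ.catOperad) (L.multiFunctor μ)).comp
      (fun _ => L.oneNat_isHom)
    rw [C.comp_one, ← L.multiFunctor_act_finCongr, ← Γ.catOperad.Ob.comp_one] at h1
    refine MultiNat.isHom_ext h1 h2 ?_
    refine Eq.trans ?_ (MultiNat.component_comp_idn_left _ _).symm
    rw [compNat_component, oneNat_component]
    exact L.comp_one μ
  act_refl μ := by
    have h1 := L.actNat_isHom (Equiv.refl _) μ
    rw [C.act_refl, Γ.catOperad.Ob.act_refl] at h1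
    refine MultiNat.isHom_ext h1 (CatOperad.isHom_idn _) ?_
    rw [actNat_component, L.act_refl]
    exact (L.opM_e μ).symm
  act_trans := L.act_trans_aux
  comp_act := L.comp_act_aux

end EnhancedLaxAlgebra

end

section

open Operad CatObj

namespace CatObj

variable {B : Type u} [Category.{v} B] [HasPullbacks B] (Γ : CatObj B)

/-! ### Chains in category objects -/

/-- The composite of the morphisms from the `i`-th to the `j`-th object of a chain. -/
noncomputable def arrow {k : ℕ} (i j : Fin (k + 1)) (h : i ≤ j) : Γ.chainObj k ⟶ Γ.M :=
  ((Γ.toChain (𝟙 (Γ.chainObj k))).map (homOfLE h)).1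

section

variable {k : ℕ}

theorem arrow_isComp {i j l : Fin (k + 1)} (h : i ≤ j) (h' : j ≤ l) :
    Γ.IsComp (Γ.arrow i j h) (Γ.arrow j l h') (Γ.arrow i l (h.trans h')) :=
  ⟨((Γ.toChain (𝟙 (Γ.chainObj k))).map (homOfLE h)).2.2.trans
      ((Γ.toChain (𝟙 (Γ.chainObj k))).map (homOfLE h')).2.1.symm,
    congrArg Subtype.val
      ((Γ.toChain (𝟙 (Γ.chainObj k))).map_comp (homOfLE h) (homOfLE h')).symm⟩

theorem arrow_self (i : Fin (k + 1)) : Γ.arrow i i le_rfl = Γ.vert i ≫ Γ.e :=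
  (congrArg Subtype.val ((Γ.toChain (𝟙 (Γ.chainObj k))).map_id i)).trans
    (congrArg (· ≫ Γ.e) (Category.id_comp (Γ.vert i)))

theorem arrow_succ (i : Fin k) : Γ.arrow i.castSucc i.succ i.castSucc_le_succ = Γ.arr i :=
  (Γ.toChain_map (𝟙 _) i).trans (Category.id_comp _)

theorem nerve_map_vert {Δ Δ' : SimplexCategoryᵒᵖ} (θ : Δ ⟶ Δ') (i : Fin (Δ'.unop.len + 1)) :
    Γ.nerve.map θ ≫ Γ.vert i = Γ.vert (θ.unop.toOrderHom i) :=
  (Γ.ofChain_vert _ i).trans (Category.id_comp _)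

theorem nerve_map_arr {Δ Δ' : SimplexCategoryᵒᵖ} (θ : Δ ⟶ Δ') (i : Fin Δ'.unop.len) :
    Γ.nerve.map θ ≫ Γ.arr i = Γ.arrow (θ.unop.toOrderHom i.castSucc)
      (θ.unop.toOrderHom i.succ) (θ.unop.toOrderHom.monotone i.castSucc_le_succ) :=
  Γ.ofChain_arr _ i

theorem exists_one : ∃ p : Γ.M ⟶ Γ.chainObj 1, p ≫ Γ.arr 0 = 𝟙 _ := by
  obtain ⟨g, -, h⟩ := Γ.exists_lift (k := 1) ![Γ.s, Γ.t] ![𝟙 _] (fun i => by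
    obtain rfl := Subsingleton.elim i 0
    exact Category.id_comp _) (fun i => by
    obtain rfl := Subsingleton.elim i 0
    exact Category.id_comp _)
  exact ⟨g, h 0⟩

/-- The isomorphism between morphisms and chains of length one. -/
noncomputable def one : Γ.M ⟶ Γ.chainObj 1 := Γ.exists_one.choose

theorem one_arr : Γ.one ≫ Γ.arr 0 = 𝟙 _ := Γ.exists_one.choose_spec

theorem chainObj_one_ext {T : B} {g h : T ⟶ Γ.chainObj 1} (w : g ≫ Γ.arr 0 = h ≫ Γ.arr 0) :
    g = h := by
  have hs := congrArg (· ≫ Γ.s) w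
  have ht := congrArg (· ≫ Γ.t) w
  simp only [Category.assoc, arr_s, arr_t] at hs ht
  refine Γ.chainObj_ext (fun i => ?_) (fun i => ?_)
  · fin_cases i
    · exact hs
    · exact ht
  · obtain rfl := Subsingleton.elim i 0
    exact w

theorem arr_one : Γ.arr 0 ≫ Γ.one = 𝟙 _ := by
  apply Γ.chainObj_one_ext
  rw [Category.assoc, one_arr, Category.comp_id, Category.id_comp]

theorem idChain_eq : Γ.idChain = Γ.e ≫ Γ.one := by
  apply Γ.chainObj_one_ext
  rw [Category.assoc, one_arr, Category.comp_id]
  exact Γ.ofChain_arr _ 0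

/-- The chain of length two formed by the universal composable pair. -/
theorem exists_two : ∃ p : pullback Γ.t Γ.s ⟶ Γ.chainObj 2,
    p ≫ Γ.arr 0 = pullback.fst Γ.t Γ.s ∧ p ≫ Γ.arr 1 = pullback.snd Γ.t Γ.s := by
  obtain ⟨g, -, h⟩ := Γ.exists_lift (k := 2)
    ![pullback.fst Γ.t Γ.s ≫ Γ.s, pullback.fst Γ.t Γ.s ≫ Γ.t, pullback.snd Γ.t Γ.s ≫ Γ.t]
    ![pullback.fst Γ.t Γ.s, pullback.snd Γ.t Γ.s] (fun i => by
      fin_cases i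
      · rfl
      · exact pullback.condition.symm) (fun i => by
      fin_cases i <;> rfl)
  exact ⟨g, h 0, h 1⟩

end

section

variable {Γ} [MonoidalCategory B] {n : ℕ}

/-- A sequence of natural transformations `F 0 ⟶ F 1 ⟶ ⋯ ⟶ F k` takes tuples of chains of length `k`
to chains of length `k`. -/
theorem exists_chainAct {k : ℕ} (F : Fin (k + 1) → Γ.MultiFunctor n) (a : Fin k → Γ.MultiNat n)
    (hF : ∀ i, (a i).F = F i.castSucc) (hG : ∀ i, (a i).G = F i.succ) :
    ∃ g : tpow (Γ.chainObj k) n ⟶ Γ.chainObj k,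
      (∀ i, g ≫ Γ.vert i = tmap (Γ.vert i) n ≫ (F i).o) ∧
      ∀ i, g ≫ Γ.arr i = tmap (Γ.arr i) n ≫ (a i).hom :=
  Γ.exists_lift _ _
    (fun i => by rw [Category.assoc, MultiNat.hom_s, ← Category.assoc, ← tmap_comp, arr_s, hF])
    (fun i => by rw [Category.assoc, MultiNat.hom_t, ← Category.assoc, ← tmap_comp, arr_t, hG])

end

end CatObj

namespace EnhancedLaxAlgebra

variable {B : Type u} [Category.{v} B] [MonoidalCategory B] [SymmetricCategory B] [HasPullbacks B]
  {C : Operad.{w}} {Γ : CatObj B} (L : EnhancedLaxAlgebra C Γ)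

/-! ### The canonical algebra structure on the nerve -/

/-- The internal functor obtained by carrying out a formal composition. -/
noncomputable def strictFun {n : ℕ} (σ : (free C).Ops n) : Γ.MultiFunctor n :=
  L.laxMap.strictOb σ

/-- The internal natural isomorphism between the results of carrying out two formal compositions
with the same image in `C`. -/
noncomputable def strictNat {n : ℕ} (σ τ : (free C).Ops n) : Γ.MultiNat n :=
  L.laxMap.strictMor σ τ

section

variable {n : ℕ} {σ τ ρ : (free C).Ops n}

theorem strictNat_F (h : (freeCounit C).map σ = (freeCounit C).map τ) :
    (L.strictNat σ τ).F = L.strictFun σ := (L.laxMap.strictMor_isHom h).src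

theorem strictNat_G (h : (freeCounit C).map σ = (freeCounit C).map τ) :
    (L.strictNat σ τ).G = L.strictFun τ := (L.laxMap.strictMor_isHom h).tgt

theorem strictNat_self (σ : (free C).Ops n) : L.strictNat σ σ = MultiNat.idn (L.strictFun σ) :=
  L.laxMap.strictMor_self σ

theorem strictNat_mult (h : (freeCounit C).map σ = (freeCounit C).map τ)
    (h' : (freeCounit C).map τ = (freeCounit C).map ρ) :
    Γ.Mult (L.strictNat σ τ).hom (L.strictNat τ ρ).hom (L.strictNat σ ρ).hom := by
  have := MultiNat.mult_cmp ((L.strictNat_G h).trans (L.strictNat_F h').symm)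
  have e : (L.strictNat σ τ).cmp (L.strictNat τ ρ) = L.strictNat σ ρ := L.laxMap.strictMor_cmp h h'
  rwa [e] at this

theorem strictNat_comp {k : Fin n → ℕ} {σ' τ' : ∀ i, (free C).Ops (k i)}
    (h : (freeCounit C).map σ = (freeCounit C).map τ)
    (h' : ∀ i, (freeCounit C).map (σ' i) = (freeCounit C).map (τ' i)) :
    (L.strictNat ((free C).comp σ σ') ((free C).comp τ τ')).hom =
      tblock (fun i => (L.strictNat (σ' i) (τ' i)).hom) ≫ (L.strictNat σ τ).hom :=
  congrArg MultiNat.hom (L.laxMap.strictMor_comp h h')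

theorem strictNat_act {m : ℕ} (κ : Fin n ≃ Fin m)
    (h : (freeCounit C).map σ = (freeCounit C).map τ) :
    (L.strictNat ((free C).act κ σ) ((free C).act κ τ)).hom =
      tperm Γ.M κ ≫ (L.strictNat σ τ).hom :=
  congrArg MultiNat.hom (L.laxMap.strictMor_act κ h)

theorem strictFun_comp {k : Fin n → ℕ} (σ : (free C).Ops n) (σ' : ∀ i, (free C).Ops (k i)) :
    L.strictFun ((free C).comp σ σ') =
      Γ.functorOperad.comp (L.strictFun σ) (fun i => L.strictFun (σ' i)) :=
  L.laxMap.strictObMap.map_comp σ σ'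

theorem strictFun_act {m : ℕ} (κ : Fin n ≃ Fin m) (σ : (free C).Ops n) :
    L.strictFun ((free C).act κ σ) = Γ.functorOperad.act κ (L.strictFun σ) :=
  L.laxMap.strictObMap.map_act κ σ

theorem strictFun_one : L.strictFun (free C).one = Γ.functorOperad.one :=
  L.laxMap.strictObMap.map_one

theorem strictFun_gen (μ : C.Ops n) : L.strictFun (gen μ) = L.multiFunctor μ :=
  L.laxMap.strictOb_gen μ

end

theorem exists_act {n k : ℕ} (c : Fin (k + 1) ⥤ Coh C n) :
    ∃ g : tpow (Γ.chainObj k) n ⟶ Γ.chainObj k,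
      (∀ i, g ≫ Γ.vert i = tmap (Γ.vert i) n ≫ (L.strictFun (c.obj i).op).o) ∧
      ∀ i : Fin k, g ≫ Γ.arr i = tmap (Γ.arr i) n ≫
        (L.strictNat (c.obj i.castSucc).op (c.obj i.succ).op).hom :=
  exists_chainAct _ (fun i : Fin k => L.strictNat (c.obj i.castSucc).op (c.obj i.succ).op)
    (fun i => L.strictNat_F (Coh.image_eq (c.map (homOfLE i.castSucc_le_succ))))
    (fun i => L.strictNat_G (Coh.image_eq (c.map (homOfLE i.castSucc_le_succ))))

/-- The action of a chain of formal operations on tuples of chains. -/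
noncomputable def chainAct {n k : ℕ} (c : Fin (k + 1) ⥤ Coh C n) :
    tpow (Γ.chainObj k) n ⟶ Γ.chainObj k := (L.exists_act c).choose

section

variable {n k : ℕ} (c : Fin (k + 1) ⥤ Coh C n)

theorem chainAct_vert (i : Fin (k + 1)) :
    L.chainAct c ≫ Γ.vert i = tmap (Γ.vert i) n ≫ (L.strictFun (c.obj i).op).o :=
  (L.exists_act c).choose_spec.1 i

theorem chainAct_arr (i : Fin k) :
    L.chainAct c ≫ Γ.arr i = tmap (Γ.arr i) n ≫
      (L.strictNat (c.obj i.castSucc).op (c.obj i.succ).op).hom :=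
  (L.exists_act c).choose_spec.2 i

theorem chainAct_arrow_self (i : Fin (k + 1)) :
    L.chainAct c ≫ Γ.arrow i i le_rfl = tmap (Γ.arrow i i le_rfl) n ≫
      (L.strictNat (c.obj i).op (c.obj i).op).hom := by
  rw [arrow_self, ← Category.assoc, chainAct_vert, strictNat_self, Category.assoc, tmap_comp,
    Category.assoc, ← MultiFunctor.e_m]
  rfl

theorem chainAct_arrow (i j : Fin (k + 1)) (h : i ≤ j) :
    L.chainAct c ≫ Γ.arrow i j h = tmap (Γ.arrow i j h) n ≫
      (L.strictNat (c.obj i).op (c.obj j).op).hom := by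
  induction j using Fin.induction with
  | zero =>
    obtain rfl := Fin.le_zero_iff.1 h
    exact L.chainAct_arrow_self c 0
  | succ j ih =>
    rcases h.eq_or_lt with rfl | h'
    · exact L.chainAct_arrow_self c _
    · have h1 : i ≤ j.castSucc := Fin.le_castSucc_iff.2 h'
      have h2 := (Γ.arrow_isComp h1 j.castSucc_le_succ).restrict (L.chainAct c)
      rw [ih h1, arrow_succ, chainAct_arr, ← arrow_succ] at h2
      exact h2.unique ((L.strictNat_mult (Coh.image_eq (c.map (homOfLE h1)))
        (Coh.image_eq (c.map (homOfLE j.castSucc_le_succ)))).tmap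
        (Γ.arrow_isComp h1 j.castSucc_le_succ))

end

/-- The canonical algebra structure on the nerve. -/
noncomputable def nerveAlgebra : EnhancedSimplicialAlgebra (Operad.bar C) Γ.nerve where
  alg Δ :=
    { act := fun {n} (c : Fin (Δ.unop.len + 1) ⥤ Coh C n) => L.chainAct c
      act_one := by
        refine Γ.chainObj_ext (fun i => ?_) (fun i => ?_)
        · refine (L.chainAct_vert _ i).trans ?_
          refine (congrArg (_ ≫ ·) (congrArg MultiFunctor.o L.strictFun_one)).trans ?_
          exact (tmap_tone _).trans (congrArg (· ≫ _) (tone_hom _))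
        · refine (L.chainAct_arr _ i).trans ?_
          refine (congrArg (_ ≫ ·) (congrArg MultiNat.hom
            ((L.strictNat_self _).trans (congrArg MultiNat.idn L.strictFun_one)))).trans ?_
          exact (tmap_tone _).trans (congrArg (· ≫ _) (tone_hom _))
      act_comp := fun {n k} c d => by
        refine Γ.chainObj_ext (fun i => ?_) (fun i => ?_)
        · refine (L.chainAct_vert _ i).trans ?_
          refine (congrArg (_ ≫ ·) (congrArg MultiFunctor.o (L.strictFun_comp _ _))).trans ?_
          refine Eq.trans ?_ (Category.assoc _ _ _).symm
          refine Eq.trans ?_ (congrArg (_ ≫ ·) (L.chainAct_vert c i)).symm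
          refine ((Category.assoc _ _ _).symm.trans
            (congrArg (· ≫ _) (tmap_tblock _ _))).trans ?_
          refine Eq.trans ?_ (Category.assoc _ _ _)
          refine congrArg (· ≫ _) ?_
          refine Eq.trans ?_ (tblock_comp_tmap _ _).symm
          exact congrArg tblock (funext fun j => (L.chainAct_vert (d j) i).symm)
        · refine (L.chainAct_arr _ i).trans ?_
          refine (congrArg (_ ≫ ·) (L.strictNat_comp
            (Coh.image_eq (c.map (homOfLE i.castSucc_le_succ)))
            (fun j => Coh.image_eq ((d j).map (homOfLE i.castSucc_le_succ))))).trans ?_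
          refine Eq.trans ?_ (Category.assoc _ _ _).symm
          refine Eq.trans ?_ (congrArg (_ ≫ ·) (L.chainAct_arr c i)).symm
          refine ((Category.assoc _ _ _).symm.trans
            (congrArg (· ≫ _) (tmap_tblock _ _))).trans ?_
          refine Eq.trans ?_ (Category.assoc _ _ _)
          refine congrArg (· ≫ _) ?_
          refine Eq.trans ?_ (tblock_comp_tmap _ _).symm
          exact congrArg tblock (funext fun j => (L.chainAct_arr (d j) i).symm)
      act_act := fun {n m} κ c => by
        refine Γ.chainObj_ext (fun i => ?_) (fun i => ?_)
        · refine (L.chainAct_vert _ i).trans ?_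
          refine (congrArg (_ ≫ ·) (congrArg MultiFunctor.o (L.strictFun_act κ _))).trans ?_
          refine Eq.trans ?_ (Category.assoc _ _ _).symm
          refine Eq.trans ?_ (congrArg (_ ≫ ·) (L.chainAct_vert c i)).symm
          exact (reassoc_of% (tmap_tperm (Γ.vert i) κ)) _
        · refine (L.chainAct_arr _ i).trans ?_
          refine (congrArg (_ ≫ ·) (L.strictNat_act κ
            (Coh.image_eq (c.map (homOfLE i.castSucc_le_succ))))).trans ?_
          refine Eq.trans ?_ (Category.assoc _ _ _).symm
          refine Eq.trans ?_ (congrArg (_ ≫ ·) (L.chainAct_arr c i)).symm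
          exact (reassoc_of% (tmap_tperm (Γ.arr i) κ)) _ }
  act_map {Δ Δ'} θ {n} c := by
    refine Γ.chainObj_ext (fun i => ?_) (fun i => ?_)
    · refine (Category.assoc _ _ _).trans ((congrArg (_ ≫ ·) (Γ.nerve_map_vert θ i)).trans ?_)
      refine (L.chainAct_vert c _).trans ?_
      refine Eq.trans ?_ (Category.assoc _ _ _).symm
      refine Eq.trans ?_ (congrArg (_ ≫ ·) (L.chainAct_vert _ i)).symm
      refine Eq.trans ?_ (Category.assoc _ _ _)
      refine congrArg (· ≫ _) ?_
      exact (congrArg (tmap · n) (Γ.nerve_map_vert θ i)).symm.trans (tmap_comp _ _ _)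
    · refine (Category.assoc _ _ _).trans ((congrArg (_ ≫ ·) (Γ.nerve_map_arr θ i)).trans ?_)
      refine (L.chainAct_arrow c _ _ _).trans ?_
      refine Eq.trans ?_ (Category.assoc _ _ _).symm
      refine Eq.trans ?_ (congrArg (_ ≫ ·) (L.chainAct_arr _ i)).symm
      refine Eq.trans ?_ (Category.assoc _ _ _)
      refine congrArg (· ≫ _) ?_
      exact (congrArg (tmap · n) (Γ.nerve_map_arr θ i)).symm.trans (tmap_comp _ _ _)

end EnhancedLaxAlgebra

end

/-! ### The canonical structure extends the lax structure -/

section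

open Operad CatObj

namespace EnhancedLaxAlgebra

variable {B : Type u} [Category.{v} B] [MonoidalCategory B] [SymmetricCategory B] [HasPullbacks B]
  {C : Operad.{w}} {Γ : CatObj B} (L : EnhancedLaxAlgebra C Γ)

section

variable {n : ℕ} {k : Fin n → ℕ}

theorem strictNat_compHom (μ : C.Ops n) (ν : ∀ i, C.Ops (k i)) :
    (L.strictNat ((free C).comp (gen μ) (fun i => gen (ν i))) (gen (C.comp μ ν))).component =
      L.compHom μ ν :=
  (congrArg MultiNat.component (L.laxMap.strictMor_compHom μ ν)).trans (L.compNat_component μ ν)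

theorem strictNat_oneHom :
    (L.strictNat (gen C.one) (free C).one).component = L.oneHom :=
  (congrArg MultiNat.component L.laxMap.strictMor_oneHom).trans L.oneNat_component

theorem strictNat_actHom {m : ℕ} (κ : Fin n ≃ Fin m) (μ : C.Ops n) :
    (L.strictNat (gen (C.act κ μ)) ((free C).act κ (gen μ))).component = L.actHom κ μ :=
  (congrArg MultiNat.component (L.laxMap.strictMor_actHom κ μ)).trans (L.actNat_component κ μ)

theorem chainAct_edge {σ τ : Coh C n} (f : σ ⟶ τ) :
    tmap Γ.idChain n ≫ L.chainAct (ComposableArrows.mk₁ f) ≫ Γ.arr (k := 1) 0 =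
      (L.strictNat σ.op τ.op).component := by
  refine (congrArg (_ ≫ ·) (L.chainAct_arr _ 0)).trans ?_
  rw [← Category.assoc, ← tmap_comp, idChain_eq, Category.assoc, one_arr, Category.comp_id]
  rfl

end

theorem isCanonical_nerveAlgebra : IsCanonicalEnhanced L L.nerveAlgebra where
  act_gen_vert _ _ μ i := (L.chainAct_vert _ i).trans
    (congrArg (fun F => tmap (Γ.vert i) _ ≫ MultiFunctor.o F) (L.strictFun_gen μ))
  act_gen_arr _ _ μ i := (L.chainAct_arr _ i).trans
    (congrArg (fun f => tmap (Γ.arr i) _ ≫ MultiNat.hom f) ((L.strictNat_self _).trans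
      (congrArg MultiNat.idn (L.strictFun_gen μ))))
  act_compHom μ ν := (L.chainAct_edge _).trans (L.strictNat_compHom μ ν)
  act_oneHom := (L.chainAct_edge _).trans L.strictNat_oneHom
  act_actHom κ μ := (L.chainAct_edge _).trans (L.strictNat_actHom κ μ)

end EnhancedLaxAlgebra

/-! ### Uniqueness of the algebra structure on the nerve -/

namespace EnhancedSimplicialAlgebra

variable {B : Type u} [Category.{v} B] [MonoidalCategory B] [SymmetricCategory B] [HasPullbacks B]
  {C : Operad.{w}} {Γ : CatObj B} (A : EnhancedSimplicialAlgebra (Operad.bar C) Γ.nerve)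

/-- The action of a chain in the coherence category on tuples of chains in `Γ`. -/
noncomputable def chainAct {n k : ℕ} (c : Fin (k + 1) ⥤ Coh C n) :
    tpow (Γ.chainObj k) n ⟶ Γ.chainObj k :=
  (A.alg (op (SimplexCategory.mk k))).act c

/-- The action of a morphism of the coherence category on tuples of morphisms of `Γ`. -/
noncomputable def edgeAct {n : ℕ} {σ τ : Coh C n} (f : σ ⟶ τ) : tpow Γ.M n ⟶ Γ.M :=
  tmap Γ.one n ≫ A.chainAct (ComposableArrows.mk₁ f) ≫ Γ.arr 0

section

variable {n k : ℕ}

theorem act_edge {σ τ : Coh C n} (f : σ ⟶ τ) :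
    A.chainAct (ComposableArrows.mk₁ f) = tmap (Γ.arr 0) n ≫ A.edgeAct f ≫ Γ.one := by
  have h1 : tmap (Γ.arr (k := 1) 0) n ≫ tmap Γ.one n = 𝟙 _ := by
    rw [← tmap_comp, arr_one, tmap_id]
  rw [edgeAct, Category.assoc, Category.assoc, arr_one, reassoc_of% h1, Category.comp_id]

theorem act_arrow (c : Fin (k + 1) ⥤ Coh C n) (i j : Fin (k + 1)) (h : i ≤ j) :
    A.chainAct c ≫ Γ.arrow i j h =
      tmap (Γ.arrow i j h) n ≫ A.edgeAct (c.map (homOfLE h)) := by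
  let θ : op (SimplexCategory.mk k) ⟶ op (SimplexCategory.mk 1) :=
    (SimplexCategory.mkOfLe i j h).op
  have e : ((Operad.bar C).map θ).map c = edge (c.map (homOfLE h)) := by
    refine Coh.chain_ext fun x => ?_
    fin_cases x <;> rfl
  obtain ⟨r, e1, e2⟩ : ∃ r : Γ.chainObj k ⟶ Γ.chainObj 1, r ≫ Γ.arr 0 = Γ.arrow i j h ∧
      A.chainAct c ≫ r = tmap r n ≫ A.chainAct (ComposableArrows.mk₁ (c.map (homOfLE h))) :=
    ⟨Γ.nerve.map θ, Γ.nerve_map_arr θ 0,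
      (A.act_map θ c).trans (congrArg (fun x => _ ≫ (A.alg _).act x) e)⟩
  rw [← e1, reassoc_of% e2, act_edge]
  simp only [Category.assoc, one_arr, Category.comp_id]
  rw [tmap_comp, Category.assoc]

theorem act_arr (c : Fin (k + 1) ⥤ Coh C n) (i : Fin k) :
    A.chainAct c ≫ Γ.arr i =
      tmap (Γ.arr i) n ≫ A.edgeAct (c.map (homOfLE i.castSucc_le_succ)) := by
  rw [← arrow_succ, act_arrow]

theorem act_vert (c : Fin (k + 1) ⥤ Coh C n) (i : Fin (k + 1)) :
    A.chainAct c ≫ Γ.vert i =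
      tmap (Γ.vert i) n ≫ tmap Γ.e n ≫ A.edgeAct (𝟙 (c.obj i)) ≫ Γ.s := by
  have h := congrArg (· ≫ Γ.s) (A.act_arrow c i i le_rfl)
  rw [Category.assoc, arrow_self, Category.assoc, Γ.e_s, Category.comp_id, tmap_comp] at h
  exact h.trans (by simp only [Category.assoc]; rfl)

/-- An algebra structure on the nerve is determined by the action of the morphisms of the coherence
categories on tuples of morphisms. -/
theorem ext_edgeAct {A' : EnhancedSimplicialAlgebra (Operad.bar C) Γ.nerve}
    (h : ∀ {n : ℕ} {σ τ : Coh C n} (f : σ ⟶ τ), A.edgeAct f = A'.edgeAct f) : A = A' := by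
  refine EnhancedSimplicialAlgebra.ext (funext fun Δ => ?_)
  refine EnhancedAlgebra.ext (funext fun n => funext fun c => ?_)
  induction Δ using Opposite.rec with | _ Δ => ?_
  induction Δ using SimplexCategory.rec with | _ k => ?_
  refine Γ.chainObj_ext (fun i => ?_) (fun i => ?_)
  · exact (A.act_vert c i).trans ((congrArg (fun x => _ ≫ _ ≫ x ≫ _) (h _)).trans
      (A'.act_vert c i).symm)
  · exact (A.act_arr c i).trans ((congrArg (_ ≫ ·) (h _)).trans (A'.act_arr c i).symm)

/-- The compatibility of the action of chains of length two with faces. -/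
theorem edgeAct_mult {σ τ ρ : Coh C n} (f : σ ⟶ τ) (g : τ ⟶ ρ) :
    Γ.Mult (A.edgeAct f) (A.edgeAct g) (A.edgeAct (f ≫ g)) := by
  obtain ⟨p, h1, h2⟩ := Γ.exists_two
  let c : Fin 3 ⥤ Coh C n := ComposableArrows.mk₂ f g
  have e1 : p ≫ Γ.arrow 0 1 (Fin.zero_le _) = pullback.fst Γ.t Γ.s :=
    (congrArg (p ≫ ·) (Γ.arrow_succ (0 : Fin 2))).trans h1
  have e2 : p ≫ Γ.arrow 1 2 (by decide) = pullback.snd Γ.t Γ.s :=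
    (congrArg (p ≫ ·) (Γ.arrow_succ (1 : Fin 2))).trans h2
  have H := Γ.arrow_isComp (k := 2) (i := 0) (j := 1) (l := 2) (Fin.zero_le _) (by decide)
  have e3 : p ≫ Γ.arrow 0 2 (Fin.zero_le _) = Γ.c := by
    have := H.restrict p
    rw [e1, e2] at this
    exact this.unique c_isComp
  have K := H.restrict (tmap p n ≫ A.chainAct c)
  have key : ∀ (i j : Fin 3) (h : i ≤ j),
      (tmap p n ≫ A.chainAct c) ≫ Γ.arrow i j h =
        tmap (p ≫ Γ.arrow i j h) n ≫ A.edgeAct (c.map (homOfLE h)) := fun i j h => by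
    rw [tmap_comp, Category.assoc, Category.assoc, ← A.act_arrow c i j h]
  rw [key, key, key, e1, e2, e3] at K
  exact K

theorem edgeAct_comp {k : Fin n → ℕ} {σ τ : Coh C n} (f : σ ⟶ τ) {σ' τ' : ∀ i, Coh C (k i)}
    (f' : ∀ i, σ' i ⟶ τ' i)
    (g : (⟨(free C).comp σ.op fun i => (σ' i).op⟩ : Coh C _) ⟶
      ⟨(free C).comp τ.op fun i => (τ' i).op⟩) :
    A.edgeAct g = tblock (fun i => A.edgeAct (f' i)) ≫ A.edgeAct f := by
  have e : edge g = (diagrams C (Fin 2)).comp (edge f)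
      (fun i => edge (f' i)) := by
    refine Coh.chain_ext fun x => ?_
    fin_cases x <;> rfl
  have h1 : tmap Γ.one n ≫ tmap (Γ.arr (k := 1) 0) n = 𝟙 _ := by
    rw [← tmap_comp, one_arr, tmap_id]
  have h2 : ∀ m, tmap Γ.one m ≫ tmap (Γ.arr (k := 1) 0) m = 𝟙 _ := fun m => by
    rw [← tmap_comp, one_arr, tmap_id]
  have h3 : A.chainAct (ComposableArrows.mk₁ g) =
      tblock (fun i => A.chainAct (ComposableArrows.mk₁ (f' i))) ≫
        A.chainAct (ComposableArrows.mk₁ f) :=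
    (congrArg A.chainAct e).trans
      ((A.alg (op (SimplexCategory.mk 1))).act_comp (edge f) (fun i => edge (f' i)))
  rw [edgeAct, h3, A.act_edge f, funext fun i => A.act_edge (f' i)]
  have h4 : tblock (fun i => tmap (Γ.arr (k := 1) 0) (k i) ≫ A.edgeAct (f' i) ≫ Γ.one) =
      tmap (Γ.arr (k := 1) 0) _ ≫ tblock (fun i => A.edgeAct (f' i)) ≫ tmap Γ.one n := by
    rw [tblock_comp_tmap, tmap_tblock]
  rw [h4]
  simp only [Category.assoc]
  rw [reassoc_of% h2, reassoc_of% h1, one_arr, Category.comp_id]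

theorem edgeAct_act {m : ℕ} (κ : Fin n ≃ Fin m) {σ τ : Coh C n} (f : σ ⟶ τ)
    (g : (⟨(free C).act κ σ.op⟩ : Coh C _) ⟶ ⟨(free C).act κ τ.op⟩) :
    A.edgeAct g = tperm Γ.M κ ≫ A.edgeAct f := by
  have e : edge g = (diagrams C (Fin 2)).act κ (edge f) := by
    refine Coh.chain_ext fun x => ?_
    fin_cases x <;> rfl
  have h : A.chainAct (ComposableArrows.mk₁ g) =
      tperm _ κ ≫ A.chainAct (ComposableArrows.mk₁ f) :=
    (congrArg A.chainAct e).trans ((A.alg (op (SimplexCategory.mk 1))).act_act κ (edge f))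
  rw [edgeAct, h, edgeAct, Category.assoc, reassoc_of% @tmap_tperm]

theorem edgeAct_one (g : (⟨(free C).one⟩ : Coh C 1) ⟶ ⟨(free C).one⟩) :
    A.edgeAct g = (tone Γ.M).hom := by
  have e : edge g = (diagrams C (Fin 2)).one := by
    refine Coh.chain_ext fun x => ?_
    fin_cases x <;> rfl
  have h : A.chainAct (ComposableArrows.mk₁ g) = (tone (Γ.chainObj 1)).hom :=
    (congrArg A.chainAct e).trans
      ((A.alg (op (SimplexCategory.mk 1))).act_one.trans (tone_hom _).symm)
  rw [edgeAct, h, ← tmap_tone, ← Category.assoc, ← tmap_comp, one_arr, tmap_id, Category.id_comp]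

end

end EnhancedSimplicialAlgebra

namespace IsCanonicalEnhanced

variable {B : Type u} [Category.{v} B] [MonoidalCategory B] [SymmetricCategory B] [HasPullbacks B]
  {C : Operad.{w}} {Γ : CatObj B} {L : EnhancedLaxAlgebra C Γ}
  {A : EnhancedSimplicialAlgebra (Operad.bar C) Γ.nerve}

theorem edgeAct_gen (H : IsCanonicalEnhanced L A) {n : ℕ} (μ : C.Ops n) :
    A.edgeAct (𝟙 (Coh.gen μ)) = L.opM μ := by
  have e : edge (𝟙 (Coh.gen μ)) = constGen (op (SimplexCategory.mk 1)) μ := by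
    refine Coh.chain_ext fun x => ?_
    fin_cases x <;> rfl
  have h : A.chainAct (ComposableArrows.mk₁ (𝟙 (Coh.gen μ))) ≫ Γ.arr 0 =
      tmap (Γ.arr 0) n ≫ L.opM μ :=
    (congrArg (A.chainAct · ≫ _) e).trans (H.act_gen_arr (op (SimplexCategory.mk 1)) μ 0)
  rw [EnhancedSimplicialAlgebra.edgeAct, h, ← Category.assoc, ← tmap_comp, one_arr, tmap_id,
    Category.id_comp]

/-- By multiplicativity it suffices to know the action of the generators. -/
theorem edgeAct_id (H : IsCanonicalEnhanced L A) {n : ℕ} (σ : (free C).Ops n) :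
    A.edgeAct (𝟙 (⟨σ⟩ : Coh C n)) = (L.strictFun σ).m := by
  induction σ using free_induction with
  | gen μ => exact (H.edgeAct_gen μ).trans (congrArg MultiFunctor.m (L.strictFun_gen μ)).symm
  | one => exact (A.edgeAct_one _).trans (congrArg MultiFunctor.m L.strictFun_one).symm
  | comp σ τ hσ hτ =>
    rw [A.edgeAct_comp (𝟙 (⟨σ⟩ : Coh C _)) (fun i => 𝟙 (⟨τ i⟩ : Coh C _)), hσ, funext hτ]
    exact (congrArg MultiFunctor.m (L.strictFun_comp σ τ)).symm
  | act κ σ hσ =>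
    rw [A.edgeAct_act κ (𝟙 (⟨σ⟩ : Coh C _)), hσ]
    exact (congrArg MultiFunctor.m (L.strictFun_act κ σ)).symm

/-- A morphism which acts on identities by the components of the canonical transformation acts on
all morphisms by it, since it factors through the action of the identity of its source. -/
theorem edgeAct_eq_of_component (H : IsCanonicalEnhanced L A) {n : ℕ} {σ τ : Coh C n} (f : σ ⟶ τ)
    (h : tmap Γ.idChain n ≫ (A.alg (op (SimplexCategory.mk 1))).act (edge f) ≫
      Γ.arr (k := 1) 0 = (L.strictNat σ.op τ.op).component) :
    A.edgeAct f = (L.strictNat σ.op τ.op).hom := by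
  have h1 := (A.edgeAct_mult (𝟙 σ) f).right_id
  rw [H.edgeAct_id, Category.id_comp, tmap_comp, Category.assoc] at h1
  have h2 := (L.strictNat σ.op τ.op).isComp_component
  rw [L.strictNat_F (Coh.image_eq f), ← h, idChain_eq, tmap_comp, Category.assoc] at h2
  exact h1.unique h2

/-- In an algebra which extends the lax structure, every morphism of the coherence categories acts
by the canonical transformation. -/
theorem edgeAct_eq (H : IsCanonicalEnhanced L A) {n : ℕ} {σ τ : Coh C n} (f : σ ⟶ τ) :
    A.edgeAct f = (L.strictNat σ.op τ.op).hom := by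
  have hid : ∀ {n : ℕ} (σ : (free C).Ops n),
      A.edgeAct (𝟙 (⟨σ⟩ : Coh C n)) = (L.strictNat σ σ).hom := fun σ =>
    (H.edgeAct_id σ).trans (congrArg MultiNat.hom (L.strictNat_self σ)).symm
  suffices h : ∀ {n : ℕ} (σ τ : (free C).Ops n), (freeCounit C).map σ = (freeCounit C).map τ →
      ∃ f : (⟨σ⟩ : Coh C n) ⟶ ⟨τ⟩, A.edgeAct f = (L.strictNat σ τ).hom by
    obtain ⟨f', h'⟩ := h σ.op τ.op (Coh.image_eq f)
    rwa [Subsingleton.elim f f']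
  refine fun σ τ h => coh_induction (Q := fun {n} σ τ => ∃ f : (⟨σ⟩ : Coh C n) ⟶ ⟨τ⟩,
    A.edgeAct f = (L.strictNat σ τ).hom) ?_ ?_ ?_ ?_ ?_ ?_ ?_ ?_ σ τ h
  · rintro n σ τ ⟨f, hf⟩
    have e := Coh.image_eq f
    refine ⟨Coh.homMk e.symm, ?_⟩
    -- The action of the inverse and the inverse transformation are both inverse to that of `f`.
    have h1 := A.edgeAct_mult (Coh.homMk e.symm) f
    have h2 := A.edgeAct_mult (Coh.homMk e.symm) (𝟙 (⟨σ⟩ : Coh C _))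
    rw [Subsingleton.elim (Coh.homMk e.symm ≫ f) (𝟙 _), hid, hf] at h1
    rw [hid, Category.comp_id] at h2
    exact (h1.assoc (L.strictNat_mult rfl e.symm) (L.strictNat_mult e e.symm) h2).symm
  · rintro n σ τ ρ ⟨f, hf⟩ ⟨g, hg⟩
    refine ⟨f ≫ g, ?_⟩
    have h1 := A.edgeAct_mult f g
    rw [hf, hg] at h1
    exact h1.unique (L.strictNat_mult (Coh.image_eq f) (Coh.image_eq g))
  · rintro n k σ τ σ' τ' ⟨f, hf⟩ ih'
    choose f' hf' using ih'
    have e := Coh.image_eq f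
    have e' := fun i => Coh.image_eq (f' i)
    refine ⟨Coh.homMk (((freeCounit C).map_comp _ _).trans
      ((congrArg₂ C.comp e (funext e')).trans ((freeCounit C).map_comp _ _).symm)), ?_⟩
    rw [A.edgeAct_comp f f', hf, funext hf', L.strictNat_comp e e']
  · rintro n m κ σ τ ⟨f, hf⟩
    have e := Coh.image_eq f
    refine ⟨Coh.homMk (((freeCounit C).map_act _ _).trans
      ((congrArg (C.act κ) e).trans ((freeCounit C).map_act _ _).symm)), ?_⟩
    rw [A.edgeAct_act κ f, hf, L.strictNat_act κ e]
  · exact fun μ => ⟨𝟙 _, hid _⟩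
  · intro n k μ ν
    exact ⟨Coh.compHom μ ν, H.edgeAct_eq_of_component _
      ((H.act_compHom μ ν).trans (L.strictNat_compHom μ ν).symm)⟩
  · exact ⟨Coh.oneHom C, H.edgeAct_eq_of_component _ (H.act_oneHom.trans L.strictNat_oneHom.symm)⟩
  · intro n m κ μ
    exact ⟨Coh.actHom κ μ, H.edgeAct_eq_of_component _
      ((H.act_actHom κ μ).trans (L.strictNat_actHom κ μ).symm)⟩

theorem eq_nerveAlgebra (H : IsCanonicalEnhanced L A) : A = L.nerveAlgebra :=
  A.ext_edgeAct fun f => (H.edgeAct_eq f).trans (L.isCanonical_nerveAlgebra.edgeAct_eq f).symm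

end IsCanonicalEnhanced

theorem existsUnique_isCanonicalEnhanced {B : Type u} [Category.{v} B] [MonoidalCategory B]
    [SymmetricCategory B] [HasPullbacks B] {C : Operad.{w}} {Γ : CatObj B}
    (L : EnhancedLaxAlgebra C Γ) :
    ∃! A : EnhancedSimplicialAlgebra (Operad.bar C) Γ.nerve, IsCanonicalEnhanced L A :=
  ⟨L.nerveAlgebra, L.isCanonical_nerveAlgebra, fun _ H => H.eq_nerveAlgebra⟩

end

/-! ### Naturality in the lax algebra and simplicial lax algebras -/

section

open Operad CatObj

namespace LaxPair

variable {B : Type u} [Category.{v} B] [MonoidalCategory B] [SymmetricCategory B] [HasPullbacks B]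
  {P Q : LaxPair.{w} B} (a : P ⟶ Q)

/-- A morphism of lax algebras commutes with formal compositions on objects. -/
theorem strictFun_o {n : ℕ} (σ : (free P.C).Ops n) :
    (P.L.strictFun σ).o ≫ a.F.o = tmap a.F.o n ≫ (Q.L.strictFun ((freeMap a.f).map σ)).o := by
  induction σ using free_induction with
  | gen μ =>
    exact (congrArg (fun x => MultiFunctor.o x ≫ _) (P.L.strictFun_gen μ)).trans
      ((a.opO μ).trans (congrArg (fun x => _ ≫ MultiFunctor.o x) (Q.L.strictFun_gen _)).symm)
  | one =>
    rw [(freeMap a.f).map_one, P.L.strictFun_one, Q.L.strictFun_one]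
    exact (tmap_tone _).symm
  | comp σ τ hσ hτ =>
    rw [(freeMap a.f).map_comp, P.L.strictFun_comp, Q.L.strictFun_comp]
    change (_ ≫ _) ≫ _ = _ ≫ tblock _ ≫ _
    rw [Category.assoc, hσ, reassoc_of% @tblock_comp_tmap, reassoc_of% @tmap_tblock, funext hτ]
  | act κ σ hσ =>
    rw [(freeMap a.f).map_act, P.L.strictFun_act, Q.L.strictFun_act]
    change (_ ≫ _) ≫ _ = _ ≫ tperm _ _ ≫ _
    rw [Category.assoc, hσ, reassoc_of% @tmap_tperm]

/-- A morphism of lax algebras commutes with formal compositions on morphisms. -/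
theorem strictFun_m {n : ℕ} (σ : (free P.C).Ops n) :
    (P.L.strictFun σ).m ≫ a.F.m = tmap a.F.m n ≫ (Q.L.strictFun ((freeMap a.f).map σ)).m := by
  induction σ using free_induction with
  | gen μ =>
    exact (congrArg (fun x => MultiFunctor.m x ≫ _) (P.L.strictFun_gen μ)).trans
      ((a.opM μ).trans (congrArg (fun x => _ ≫ MultiFunctor.m x) (Q.L.strictFun_gen _)).symm)
  | one =>
    rw [(freeMap a.f).map_one, P.L.strictFun_one, Q.L.strictFun_one]
    exact (tmap_tone _).symm
  | comp σ τ hσ hτ =>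
    rw [(freeMap a.f).map_comp, P.L.strictFun_comp, Q.L.strictFun_comp]
    change (_ ≫ _) ≫ _ = _ ≫ tblock _ ≫ _
    rw [Category.assoc, hσ, reassoc_of% @tblock_comp_tmap, reassoc_of% @tmap_tblock, funext hτ]
  | act κ σ hσ =>
    rw [(freeMap a.f).map_act, P.L.strictFun_act, Q.L.strictFun_act]
    change (_ ≫ _) ≫ _ = _ ≫ tperm _ _ ≫ _
    rw [Category.assoc, hσ, reassoc_of% @tmap_tperm]

theorem freeMap_image {n : ℕ} {σ τ : (free P.C).Ops n}
    (h : (freeCounit P.C).map σ = (freeCounit P.C).map τ) :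
    (freeCounit Q.C).map ((freeMap a.f).map σ) = (freeCounit Q.C).map ((freeMap a.f).map τ) := by
  rw [freeCounit_freeMap, freeCounit_freeMap, h]

section

variable {n : ℕ} {σ τ ρ : (free P.C).Ops n}

theorem strictNat_mult_map (h : (freeCounit P.C).map σ = (freeCounit P.C).map τ)
    (h' : (freeCounit P.C).map τ = (freeCounit P.C).map ρ) :
    P.Γ.Mult ((P.L.strictNat σ τ).hom ≫ a.F.m) ((P.L.strictNat τ ρ).hom ≫ a.F.m)
      ((P.L.strictNat σ ρ).hom ≫ a.F.m) := by
  have := a.F.isComp (P.L.strictNat_mult h h')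
  simpa only [Mult, Category.assoc] using this

theorem strictNat_map_mult (h : (freeCounit P.C).map σ = (freeCounit P.C).map τ)
    (h' : (freeCounit P.C).map τ = (freeCounit P.C).map ρ) :
    P.Γ.Mult (tmap a.F.m n ≫ (Q.L.strictNat ((freeMap a.f).map σ) ((freeMap a.f).map τ)).hom)
      (tmap a.F.m n ≫ (Q.L.strictNat ((freeMap a.f).map τ) ((freeMap a.f).map ρ)).hom)
      (tmap a.F.m n ≫ (Q.L.strictNat ((freeMap a.f).map σ) ((freeMap a.f).map ρ)).hom) := by
  have := (Q.L.strictNat_mult (freeMap_image a h) (freeMap_image a h')).tmap a.F.c_m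
  simpa only [Mult, tmap_comp, Category.assoc] using this

end

/-- The compatibility of a morphism of lax algebras with a canonical transformation can be checked
on components. -/
theorem strictNat_of_component {n : ℕ} {σ τ : (free P.C).Ops n}
    (h : (freeCounit P.C).map σ = (freeCounit P.C).map τ)
    (H : (P.L.strictNat σ τ).component ≫ a.F.m = tmap a.F.o n ≫
      (Q.L.strictNat ((freeMap a.f).map σ) ((freeMap a.f).map τ)).component) :
    (P.L.strictNat σ τ).hom ≫ a.F.m = tmap a.F.m n ≫
      (Q.L.strictNat ((freeMap a.f).map σ) ((freeMap a.f).map τ)).hom := by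
  have h1 := a.F.isComp (P.L.strictNat σ τ).isComp_component
  rw [Category.assoc, H, P.L.strictNat_F h, strictFun_m, ← Category.assoc (tmap P.Γ.t n),
    ← tmap_comp, ← a.F.m_t, tmap_comp, Category.assoc] at h1
  have h2 := (Q.L.strictNat ((freeMap a.f).map σ)
    ((freeMap a.f).map τ)).isComp_component.restrict (tmap a.F.m n)
  rw [Q.L.strictNat_F (freeMap_image a h)] at h2
  exact h1.unique h2

theorem strictNat_self_map {n : ℕ} (σ : (free P.C).Ops n) :
    (P.L.strictNat σ σ).hom ≫ a.F.m = tmap a.F.m n ≫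
      (Q.L.strictNat ((freeMap a.f).map σ) ((freeMap a.f).map σ)).hom := by
  rw [P.L.strictNat_self, Q.L.strictNat_self]
  exact strictFun_m a σ

/-- A morphism of lax algebras commutes with the canonical transformations between formal
compositions. -/
theorem strictNat_hom {n : ℕ} {σ τ : (free P.C).Ops n}
    (h : (freeCounit P.C).map σ = (freeCounit P.C).map τ) :
    (P.L.strictNat σ τ).hom ≫ a.F.m = tmap a.F.m n ≫
      (Q.L.strictNat ((freeMap a.f).map σ) ((freeMap a.f).map τ)).hom := by
  refine (coh_induction (Q := fun {n} σ τ => (freeCounit P.C).map σ = (freeCounit P.C).map τ ∧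
    (P.L.strictNat σ τ).hom ≫ a.F.m = tmap a.F.m n ≫
      (Q.L.strictNat ((freeMap a.f).map σ) ((freeMap a.f).map τ)).hom)
    ?_ ?_ ?_ ?_ ?_ ?_ ?_ ?_ σ τ h).2
  · rintro n σ τ ⟨e, ih⟩
    refine ⟨e.symm, ?_⟩
    have h1 := strictNat_mult_map a e.symm e
    have h2 := strictNat_mult_map a e.symm (Eq.refl ((freeCounit P.C).map σ))
    rw [ih, strictNat_self_map] at h1
    rw [strictNat_self_map] at h2
    exact (h1.assoc (strictNat_map_mult a rfl e.symm) (strictNat_map_mult a e e.symm) h2).symm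
  · rintro n σ τ ρ ⟨e, ih⟩ ⟨e', ih'⟩
    refine ⟨e.trans e', ?_⟩
    have h1 := strictNat_mult_map a e e'
    rw [ih, ih'] at h1
    exact h1.unique (strictNat_map_mult a e e')
  · rintro n k σ τ σ' τ' ⟨e, ih⟩ ih'
    choose e' ih' using ih'
    refine ⟨((freeCounit P.C).map_comp _ _).trans
      ((congrArg₂ P.C.comp e (funext e')).trans ((freeCounit P.C).map_comp _ _).symm), ?_⟩
    rw [(freeMap a.f).map_comp, (freeMap a.f).map_comp, P.L.strictNat_comp e e',
      Q.L.strictNat_comp (freeMap_image a e) (fun i => freeMap_image a (e' i)), Category.assoc, ih,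
      reassoc_of% @tblock_comp_tmap, reassoc_of% @tmap_tblock, funext ih']
  · rintro n m κ σ τ ⟨e, ih⟩
    refine ⟨((freeCounit P.C).map_act _ _).trans
      ((congrArg (P.C.act κ) e).trans ((freeCounit P.C).map_act _ _).symm), ?_⟩
    rw [(freeMap a.f).map_act, (freeMap a.f).map_act, P.L.strictNat_act κ e,
      Q.L.strictNat_act κ (freeMap_image a e), Category.assoc, ih, reassoc_of% @tmap_tperm]
  · exact fun μ => ⟨rfl, strictNat_self_map a _⟩
  · intro n k μ ν
    refine ⟨Coh.image_eq (Coh.compHom μ ν), strictNat_of_component a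
      (Coh.image_eq (Coh.compHom μ ν)) ?_⟩
    have e : (freeMap a.f).map (gen (P.C.comp μ ν)) =
        gen (Q.C.comp (a.f.map μ) (fun i => a.f.map (ν i))) := congrArg gen (a.f.map_comp μ ν)
    rw [P.L.strictNat_compHom, (freeMap a.f).map_comp, e]
    exact (a.compHom μ ν).trans (congrArg (_ ≫ ·) (Q.L.strictNat_compHom _ _)).symm
  · refine ⟨Coh.image_eq (Coh.oneHom P.C), strictNat_of_component a
      (Coh.image_eq (Coh.oneHom P.C)) ?_⟩
    have e : (freeMap a.f).map (gen P.C.one) = gen Q.C.one := congrArg gen a.f.map_one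
    rw [P.L.strictNat_oneHom, (freeMap a.f).map_one, e]
    exact a.oneHom.trans (congrArg (_ ≫ ·) Q.L.strictNat_oneHom).symm
  · intro n m κ μ
    refine ⟨Coh.image_eq (Coh.actHom κ μ), strictNat_of_component a
      (Coh.image_eq (Coh.actHom κ μ)) ?_⟩
    have e : (freeMap a.f).map (gen (P.C.act κ μ)) = gen (Q.C.act κ (a.f.map μ)) :=
      congrArg gen (a.f.map_act κ μ)
    rw [P.L.strictNat_actHom, (freeMap a.f).map_act, e]
    exact (a.actHom κ μ).trans (congrArg (_ ≫ ·) (Q.L.strictNat_actHom _ _)).symm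

theorem chainAct_chainMap {n k : ℕ} (c : Fin (k + 1) ⥤ Coh P.C n) :
    P.L.chainAct c ≫ chainMap a.F k =
      tmap (chainMap a.F k) n ≫ Q.L.chainAct (c ⋙ cohMap a.f n) := by
  refine Q.Γ.chainObj_ext (fun i => ?_) (fun i => ?_)
  · rw [Category.assoc, chainMap_vert, ← Category.assoc, P.L.chainAct_vert, Category.assoc,
      strictFun_o, Category.assoc, Q.L.chainAct_vert, ← Category.assoc, ← Category.assoc,
      ← tmap_comp, ← tmap_comp, chainMap_vert]
    rfl
  · rw [Category.assoc, chainMap_arr, ← Category.assoc, P.L.chainAct_arr, Category.assoc,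
      strictNat_hom a (Coh.image_eq (c.map (homOfLE i.castSucc_le_succ))), Category.assoc,
      Q.L.chainAct_arr, ← Category.assoc, ← Category.assoc, ← tmap_comp, ← tmap_comp, chainMap_arr]
    rfl

end LaxPair

section

variable {B : Type u} [Category.{v} B] [MonoidalCategory B] [SymmetricCategory B] [HasPullbacks B]

/-- The algebra structure on the diagonal of the nerves of a simplicial lax algebra. -/
noncomputable def nerveDiagAlgebra (G : SimplicialObject (LaxPair.{w} B)) :
    EnhancedSimplicialAlgebra (Operad.barDiag (G ⋙ LaxPair.operad B)) (nerveDiag G) where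
  alg Δ := (G.obj Δ).L.nerveAlgebra.alg Δ
  act_map {Δ Δ'} θ {n} c := by
    change (G.obj Δ).L.chainAct c ≫ chainMap (G.map θ).F Δ.unop.len ≫ (G.obj Δ').Γ.nerve.map θ =
      tmap (chainMap (G.map θ).F Δ.unop.len ≫ (G.obj Δ').Γ.nerve.map θ) n ≫ _
    refine (Category.assoc _ _ _).symm.trans
      ((congrArg (· ≫ _) (LaxPair.chainAct_chainMap (G.map θ) c)).trans ?_)
    refine (Category.assoc _ _ _).trans (Eq.trans ?_ (congrArg (· ≫ _) (tmap_comp _ _ _)).symm)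
    refine Eq.trans ?_ (Category.assoc _ _ _).symm
    exact congrArg (_ ≫ ·) ((G.obj Δ').L.nerveAlgebra.act_map θ (c ⋙ cohMap (G.map θ).f n))

theorem existsUnique_nerveDiag (G : SimplicialObject (LaxPair.{w} B)) :
    ∃! A : EnhancedSimplicialAlgebra (Operad.barDiag (G ⋙ LaxPair.operad B)) (nerveDiag G),
      ∀ (Δ : SimplexCategoryᵒᵖ)
        (A' : EnhancedSimplicialAlgebra (Operad.bar (G.obj Δ).C) (G.obj Δ).Γ.nerve),
        IsCanonicalEnhanced (G.obj Δ).L A' → A.alg Δ = A'.alg Δ := by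
  refine ⟨nerveDiagAlgebra G, fun Δ A' H => ?_, fun A H => ?_⟩
  · rw [H.eq_nerveAlgebra]
    rfl
  · exact EnhancedSimplicialAlgebra.ext
      (funext fun Δ => H Δ _ (G.obj Δ).L.isCanonical_nerveAlgebra)

end

end

/-! ### Operations on sets and on arrows of categories -/

section

open Operad

/-- The endomorphism operad of a set. -/
def setEndOperad (X : Type u) : Operad.{u} where
  Ops n := (Fin n → X) → X
  act κ f := fun x => f (fun i => x (κ i))
  one := fun x => x 0
  comp f g := fun x => f (fun i => g i (fun j => x (blk i j)))
  act_refl _ := rfl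
  act_trans _ _ _ := rfl
  one_comp f := funext fun x => congrArg f (funext fun j => congrArg x (blk_fin_one _ 0 j))
  comp_one f := funext fun x => congrArg f (funext fun i => congrArg x (blk_one_fin _ i 0))
  comp_assoc f g h := funext fun x => congrArg f <| funext fun i => congrArg (g i) <|
    funext fun j => congrArg (h (blk i j)) <| funext fun q =>
      (congrArg x (cast_blk_blk _ i j q)).symm
  comp_act lam κ f g := funext fun x => congrArg f <| funext fun j => congrArg (g (lam j)) <|
    funext fun p => (congrArg x (blockEquiv_blk lam κ j p)).symm

variable {Γ : Type u} [Category.{v} Γ]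

/-- `f` and `g` are composable and `h` is their composite (`f` first). -/
inductive ArrowComp : Arrow Γ → Arrow Γ → Arrow Γ → Prop
  | mk {x y z : Γ} (f : x ⟶ y) (g : y ⟶ z) :
    ArrowComp (Arrow.mk f) (Arrow.mk g) (Arrow.mk (f ≫ g))

namespace ArrowComp

variable {f g h a b c : Arrow Γ}

theorem exists_eq (H : ArrowComp f g h) : ∃ (x y z : Γ) (a : x ⟶ y) (b : y ⟶ z),
    f = Arrow.mk a ∧ g = Arrow.mk b ∧ h = Arrow.mk (a ≫ b) := by
  cases H with | mk a b => exact ⟨_, _, _, a, b, rfl, rfl, rfl⟩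

theorem w (H : ArrowComp f g h) : f.right = g.left := by cases H; rfl

theorem left (H : ArrowComp f g h) : h.left = f.left := by cases H; rfl

theorem right (H : ArrowComp f g h) : h.right = g.right := by cases H; rfl

theorem of_eq {x y y' z : Γ} (f : x ⟶ y) (e : y = y') (g : y' ⟶ z) :
    ArrowComp (Arrow.mk f) (Arrow.mk g) (Arrow.mk (f ≫ eqToHom e ≫ g)) := by
  subst e
  rw [eqToHom_refl, Category.id_comp]
  exact mk f g

theorem exists_of_eq (e : f.right = g.left) : ∃ h, ArrowComp f g h := ⟨_, of_eq f.hom e g.hom⟩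

theorem unique {h' : Arrow Γ} (H : ArrowComp f g h) (H' : ArrowComp f g h') : h = h' := by
  cases H
  cases H'
  rfl

theorem assoc (H₁ : ArrowComp f g a) (H₂ : ArrowComp a h b) (H₃ : ArrowComp g h c) :
    ArrowComp f c b := by
  cases H₁ with | mk f g => ?_
  cases H₂ with | mk _ h => ?_
  cases H₃
  rw [Category.assoc]
  exact mk _ _

theorem assoc' (H₁ : ArrowComp f g a) (H₂ : ArrowComp f c b) (H₃ : ArrowComp g h c) :
    ArrowComp a h b := by
  cases H₁ with | mk f g => ?_
  cases H₃ with | mk _ h => ?_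
  cases H₂
  rw [← Category.assoc]
  exact mk _ _

theorem comp_id (f : Arrow Γ) : ArrowComp f (Arrow.mk (𝟙 f.right)) f := by
  have := mk f.hom (𝟙 f.right)
  rwa [Category.comp_id] at this

theorem id_comp (f : Arrow Γ) : ArrowComp (Arrow.mk (𝟙 f.left)) f f := by
  have := mk (𝟙 f.left) f.hom
  rwa [Category.id_comp] at this

theorem id_id (x : Γ) : ArrowComp (Arrow.mk (𝟙 x)) (Arrow.mk (𝟙 x)) (Arrow.mk (𝟙 x)) :=
  comp_id (Arrow.mk (𝟙 x))

end ArrowComp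

variable (Γ) in
/-- The set of operations on tuples of arrows. -/
abbrev ArrowOp (n : ℕ) := (Fin n → Arrow Γ) → Arrow Γ

/-- The relation `Ω(f g) = Φ(f) Ψ(g)` between operations on tuples of arrows, for composable
tuples `f` and `g`. -/
def ArrowOp.Mult {n : ℕ} (Φ Ψ Ω : ArrowOp Γ n) : Prop :=
  ∀ ⦃f g h : Fin n → Arrow Γ⦄, (∀ i, ArrowComp (f i) (g i) (h i)) → ArrowComp (Φ f) (Ψ g) (Ω h)

namespace ArrowOp

variable {n : ℕ} {Φ Ψ Ω Φ' Ω' A D D' : ArrowOp Γ n}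

theorem Mult.comp (H : Mult Φ Ψ Ω) {k : Fin n → ℕ} {φ ψ ω : ∀ i, ArrowOp Γ (k i)}
    (h : ∀ i, Mult (φ i) (ψ i) (ω i)) :
    Mult ((setEndOperad (Arrow Γ)).comp Φ φ) ((setEndOperad (Arrow Γ)).comp Ψ ψ)
      ((setEndOperad (Arrow Γ)).comp Ω ω) :=
  fun _ _ _ w => H fun i => h i fun j => w (blk i j)

theorem Mult.act (H : Mult Φ Ψ Ω) {m : ℕ} (κ : Fin n ≃ Fin m) :
    Mult ((setEndOperad (Arrow Γ)).act κ Φ) ((setEndOperad (Arrow Γ)).act κ Ψ)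
      ((setEndOperad (Arrow Γ)).act κ Ω) :=
  fun _ _ _ w => H fun i => w (κ i)

theorem mult_one : Mult (setEndOperad (Arrow Γ)).one (setEndOperad (Arrow Γ)).one
    (setEndOperad (Arrow Γ)).one :=
  fun _ _ _ w => w 0

/-- The tuple of identities of a tuple of objects. -/
abbrev ids (x : Fin n → Γ) (i : Fin n) : Arrow Γ := Arrow.mk (𝟙 (x i))

theorem Mult.right_id (H : Mult Φ Ψ Ω) (f : Fin n → Arrow Γ) :
    ArrowComp (Φ f) (Ψ (ids fun i => (f i).right)) (Ω f) :=
  H fun i => ArrowComp.comp_id (f i)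

theorem Mult.left_id (H : Mult Φ Ψ Ω) (f : Fin n → Arrow Γ) :
    ArrowComp (Φ (ids fun i => (f i).left)) (Ψ f) (Ω f) :=
  H fun i => ArrowComp.id_comp (f i)

theorem Mult.component (H : Mult Φ Ψ Ω) (x : Fin n → Γ) :
    ArrowComp (Φ (ids x)) (Ψ (ids x)) (Ω (ids x)) :=
  H fun i => ArrowComp.id_id (x i)

theorem Mult.unique (H : Mult Φ Ψ Ω) (H' : Mult Φ Ψ Ω') : Ω = Ω' :=
  funext fun f => (H.right_id f).unique (H'.right_id f)

theorem Mult.assoc (H₁ : Mult Φ Ψ A) (H₂ : Mult A Ω D) (H₃ : Mult Ψ Ω Φ') (H₄ : Mult Φ Φ' D') :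
    D = D' :=
  funext fun f =>
    ((H₁.right_id f).assoc (H₂.right_id f) (H₃.component _)).unique (H₄.right_id f)

end ArrowOp

open ArrowOp

/-! ### The endomorphism operad of an ordinary category -/

variable (Γ) in
/-- A functor `Γ^n → Γ`, given by its effects on objects and on arrows. -/
@[ext]
structure ArrowFunctor (n : ℕ) where
  /-- the map on objects -/
  o : (Fin n → Γ) → Γ
  /-- the map on arrows -/
  m : ArrowOp Γ n
  m_left : ∀ f, (m f).left = o fun i => (f i).left
  m_right : ∀ f, (m f).right = o fun i => (f i).right
  m_id : ∀ x, m (ids x) = Arrow.mk (𝟙 (o x))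
  mult : Mult m m m

variable (Γ) in
/-- A natural transformation between functors `Γ^n → Γ`, given by the operation `hom` which takes
the tuple of arrows `f : x ⟶ y` to the diagonal `F x ⟶ G y` of the naturality square. -/
@[ext]
structure ArrowNat (n : ℕ) where
  /-- the source -/
  F : ArrowFunctor Γ n
  /-- the target -/
  G : ArrowFunctor Γ n
  /-- the diagonals of the naturality squares -/
  hom : ArrowOp Γ n
  hom_left : ∀ f, (hom f).left = F.o fun i => (f i).left
  hom_right : ∀ f, (hom f).right = G.o fun i => (f i).right
  mult_left : Mult F.m hom hom
  mult_right : Mult hom G.m hom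

variable (Γ) in
/-- The operad of functors `Γ^n → Γ`. -/
abbrev arrowFunctorOperad : Operad.{max u v} where
  Ops := ArrowFunctor Γ
  act κ F :=
    { o := (setEndOperad Γ).act κ F.o
      m := (setEndOperad (Arrow Γ)).act κ F.m
      m_left := fun _ => F.m_left _
      m_right := fun _ => F.m_right _
      m_id := fun _ => F.m_id _
      mult := F.mult.act κ }
  one :=
    { o := (setEndOperad Γ).one
      m := (setEndOperad (Arrow Γ)).one
      m_left := fun _ => rfl
      m_right := fun _ => rfl
      m_id := fun _ => rfl
      mult := mult_one }
  comp F G :=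
    { o := (setEndOperad Γ).comp F.o (fun i => (G i).o)
      m := (setEndOperad (Arrow Γ)).comp F.m (fun i => (G i).m)
      m_left := fun _ => (F.m_left _).trans (congrArg F.o (funext fun i => (G i).m_left _))
      m_right := fun _ => (F.m_right _).trans (congrArg F.o (funext fun i => (G i).m_right _))
      m_id := fun _ => (congrArg F.m (funext fun i => (G i).m_id _)).trans (F.m_id _)
      mult := F.mult.comp fun i => (G i).mult }
  act_refl _ := rfl
  act_trans _ _ _ := rfl
  one_comp F := ArrowFunctor.ext ((setEndOperad Γ).one_comp F.o)
    ((setEndOperad (Arrow Γ)).one_comp F.m)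
  comp_one F := ArrowFunctor.ext ((setEndOperad Γ).comp_one F.o)
    ((setEndOperad (Arrow Γ)).comp_one F.m)
  comp_assoc F G H := ArrowFunctor.ext
    ((setEndOperad Γ).comp_assoc F.o (fun i => (G i).o) (fun p => (H p).o))
    ((setEndOperad (Arrow Γ)).comp_assoc F.m (fun i => (G i).m) (fun p => (H p).m))
  comp_act lam κ F G := ArrowFunctor.ext
    ((setEndOperad Γ).comp_act lam κ F.o (fun i => (G i).o))
    ((setEndOperad (Arrow Γ)).comp_act lam κ F.m (fun i => (G i).m))

variable (Γ) in
/-- The operad of natural transformations between functors `Γ^n → Γ`. -/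
abbrev arrowNatOperad : Operad.{max u v} where
  Ops := ArrowNat Γ
  act κ f :=
    { F := (arrowFunctorOperad Γ).act κ f.F
      G := (arrowFunctorOperad Γ).act κ f.G
      hom := (setEndOperad (Arrow Γ)).act κ f.hom
      hom_left := fun _ => f.hom_left _
      hom_right := fun _ => f.hom_right _
      mult_left := f.mult_left.act κ
      mult_right := f.mult_right.act κ }
  one :=
    { F := (arrowFunctorOperad Γ).one
      G := (arrowFunctorOperad Γ).one
      hom := (setEndOperad (Arrow Γ)).one
      hom_left := fun _ => rfl
      hom_right := fun _ => rfl
      mult_left := mult_one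
      mult_right := mult_one }
  comp f g :=
    { F := (arrowFunctorOperad Γ).comp f.F (fun i => (g i).F)
      G := (arrowFunctorOperad Γ).comp f.G (fun i => (g i).G)
      hom := (setEndOperad (Arrow Γ)).comp f.hom (fun i => (g i).hom)
      hom_left := fun _ => (f.hom_left _).trans (congrArg f.F.o (funext fun i => (g i).hom_left _))
      hom_right := fun _ =>
        (f.hom_right _).trans (congrArg f.G.o (funext fun i => (g i).hom_right _))
      mult_left := f.mult_left.comp fun i => (g i).mult_left
      mult_right := f.mult_right.comp fun i => (g i).mult_right }
  act_refl _ := rfl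
  act_trans _ _ _ := rfl
  one_comp f := ArrowNat.ext ((arrowFunctorOperad Γ).one_comp _)
    ((arrowFunctorOperad Γ).one_comp _) ((setEndOperad (Arrow Γ)).one_comp f.hom)
  comp_one f := ArrowNat.ext ((arrowFunctorOperad Γ).comp_one _)
    ((arrowFunctorOperad Γ).comp_one _) ((setEndOperad (Arrow Γ)).comp_one f.hom)
  comp_assoc f g h := ArrowNat.ext
    ((arrowFunctorOperad Γ).comp_assoc f.F (fun i => (g i).F) (fun p => (h p).F))
    ((arrowFunctorOperad Γ).comp_assoc f.G (fun i => (g i).G) (fun p => (h p).G))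
    ((setEndOperad (Arrow Γ)).comp_assoc f.hom (fun i => (g i).hom) (fun p => (h p).hom))
  comp_act lam κ f g := ArrowNat.ext
    ((arrowFunctorOperad Γ).comp_act lam κ f.F (fun i => (g i).F))
    ((arrowFunctorOperad Γ).comp_act lam κ f.G (fun i => (g i).G))
    ((setEndOperad (Arrow Γ)).comp_act lam κ f.hom (fun i => (g i).hom))

namespace ArrowNat

variable {n : ℕ}

/-- The identity transformation. -/
def idn (F : ArrowFunctor Γ n) : ArrowNat Γ n :=
  ⟨F, F, F.m, F.m_left, F.m_right, F.mult, F.mult⟩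

/-- The component at a tuple of objects: the value at the tuple of identities. -/
def component (f : ArrowNat Γ n) (x : Fin n → Γ) : Arrow Γ := f.hom (ids x)

theorem arrowComp_component (f : ArrowNat Γ n) (a : Fin n → Arrow Γ) :
    ArrowComp (f.F.m a) (f.component fun i => (a i).right) (f.hom a) :=
  f.mult_left.right_id a

/-- A natural transformation is determined by its components. -/
theorem ext_component {f g : ArrowNat Γ n} (hF : f.F = g.F) (hG : f.G = g.G)
    (h : ∀ x, f.component x = g.component x) : f = g := by
  refine ArrowNat.ext hF hG (funext fun a => ?_)
  have h1 := f.arrowComp_component a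
  rw [hF, h] at h1
  exact h1.unique (g.arrowComp_component a)

/-- The composite of two transformations takes `f : x ⟶ y` to the composite of the diagonal of the
first at `f` with the component of the second at `y`. -/
theorem exists_mult (f g : ArrowNat Γ n) (w : f.G = g.F) :
    ∃ h : ArrowNat Γ n, h.F = f.F ∧ h.G = g.G ∧ Mult f.hom g.hom h.hom := by
  choose h hh using fun a : Fin n → Arrow Γ => ArrowComp.exists_of_eq (f := f.hom a)
    (g := g.component fun i => (a i).right)
      ((f.hom_right a).trans ((congrArg (fun F => F.o fun i => (a i).right) w).trans
        (g.hom_left (ids fun i => (a i).right)).symm))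
  have key : Mult f.hom g.hom h := fun a b c H => by
    have h1 := f.mult_right H
    rw [w] at h1
    have h3 := hh c
    rw [funext fun i => (H i).right] at h3
    exact h1.assoc h3 (g.arrowComp_component b)
  refine ⟨⟨f.F, g.G, h, fun a => ?_, fun a => ?_, fun a b c H => ?_, fun a b c H => ?_⟩,
    rfl, rfl, key⟩
  · exact (hh a).left.trans (f.hom_left a)
  · exact (hh a).right.trans (g.hom_right _)
  · have h3 := hh c
    rw [funext fun i => (H i).right] at h3
    exact (f.mult_left H).assoc h3 (hh b)
  · have k := g.mult_right.left_id b
    rw [← funext fun i => (H i).w] at k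
    exact (hh a).assoc' (key H) k

open Classical in
/-- The vertical composition of natural transformations; if they are not composable, the value is
immaterial. -/
noncomputable def cmp (f g : ArrowNat Γ n) : ArrowNat Γ n :=
  if w : f.G = g.F then (exists_mult f g w).choose else f

variable {f g : ArrowNat Γ n}

theorem cmp_F (w : f.G = g.F) : (f.cmp g).F = f.F := by
  rw [cmp, dif_pos w]
  exact (exists_mult f g w).choose_spec.1

theorem cmp_G (w : f.G = g.F) : (f.cmp g).G = g.G := by
  rw [cmp, dif_pos w]
  exact (exists_mult f g w).choose_spec.2.1

theorem mult_cmp (w : f.G = g.F) : Mult f.hom g.hom (f.cmp g).hom := by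
  rw [cmp, dif_pos w]
  exact (exists_mult f g w).choose_spec.2.2

theorem eq_cmp {h : ArrowNat Γ n} (w : f.G = g.F) (hF : h.F = f.F) (hG : h.G = g.G)
    (H : Mult f.hom g.hom h.hom) : h = f.cmp g :=
  ArrowNat.ext (hF.trans (cmp_F w).symm) (hG.trans (cmp_G w).symm) (H.unique (mult_cmp w))

end ArrowNat

variable (Γ) in
/-- The endomorphism operad of a category, as an operad in categories. -/
noncomputable abbrev arrowOperad : CatOperad.{max u v} where
  Ob := arrowFunctorOperad Γ
  Mor := arrowNatOperad Γ
  src := ⟨fun f => f.F, fun _ _ => rfl, rfl, fun _ _ => rfl⟩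
  tgt := ⟨fun f => f.G, fun _ _ => rfl, rfl, fun _ _ => rfl⟩
  idn := ⟨fun F => ArrowNat.idn F, fun _ _ => rfl, rfl, fun _ _ => rfl⟩
  cmp f g := ArrowNat.cmp f g
  src_idn _ := rfl
  tgt_idn _ := rfl
  src_cmp w := ArrowNat.cmp_F w
  tgt_cmp w := ArrowNat.cmp_G w
  idn_cmp f := (ArrowNat.eq_cmp (f := ArrowNat.idn f.F) (g := f) (h := f) rfl rfl rfl
    (ArrowNat.mult_left f)).symm
  cmp_idn f := (ArrowNat.eq_cmp (f := f) (g := ArrowNat.idn f.G) (h := f) rfl rfl rfl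
    (ArrowNat.mult_right f)).symm
  cmp_assoc {_ f g h} w w' := by
    have h1 := (ArrowNat.cmp_G w).trans w'
    have h2 := w.trans (ArrowNat.cmp_F w').symm
    exact ArrowNat.ext
      (((ArrowNat.cmp_F h1).trans (ArrowNat.cmp_F w)).trans (ArrowNat.cmp_F h2).symm)
      ((ArrowNat.cmp_G h1).trans ((ArrowNat.cmp_G h2).trans (ArrowNat.cmp_G w')).symm)
      ((ArrowNat.mult_cmp w).assoc (ArrowNat.mult_cmp h1) (ArrowNat.mult_cmp w')
        (ArrowNat.mult_cmp h2))
  comp_cmp w w' := ArrowNat.eq_cmp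
    (congrArg₂ (arrowFunctorOperad Γ).comp w (funext w'))
    (congrArg₂ (arrowFunctorOperad Γ).comp (ArrowNat.cmp_F w)
      (funext fun i => ArrowNat.cmp_F (w' i)))
    (congrArg₂ (arrowFunctorOperad Γ).comp (ArrowNat.cmp_G w)
      (funext fun i => ArrowNat.cmp_G (w' i)))
    ((ArrowNat.mult_cmp w).comp fun i => ArrowNat.mult_cmp (w' i))
  act_cmp {_ _} κ {f g} w := ArrowNat.eq_cmp
    (congrArg ((arrowFunctorOperad Γ).act κ) w)
    (congrArg ((arrowFunctorOperad Γ).act κ) (ArrowNat.cmp_F w))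
    (congrArg ((arrowFunctorOperad Γ).act κ) (ArrowNat.cmp_G w))
    ((ArrowNat.mult_cmp w).act κ)

namespace ArrowNat

variable {n : ℕ}

theorem isHom_ext {f g : ArrowNat Γ n} {x y : ArrowFunctor Γ n}
    (hf : (arrowOperad Γ).IsHom f x y) (hg : (arrowOperad Γ).IsHom g x y)
    (h : ∀ x, f.component x = g.component x) : f = g :=
  ArrowNat.ext_component (hf.src.trans hg.src.symm) (hf.tgt.trans hg.tgt.symm) h

theorem component_cmp {f g : ArrowNat Γ n} {x y z : ArrowFunctor Γ n}
    (hf : (arrowOperad Γ).IsHom f x y) (hg : (arrowOperad Γ).IsHom g y z) {t : Fin n → Γ}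
    {h : Arrow Γ} (H : ArrowComp (f.component t) (g.component t) h) :
    ((arrowOperad Γ).cmp f g).component t = h :=
  ((mult_cmp (hf.tgt.trans hg.src.symm)).component t).unique H

end ArrowNat

/-- A functor as an operation on arrows. -/
def ArrowFunctor.ofFunctor {n : ℕ} (F : (Fin n → Γ) ⥤ Γ) : ArrowFunctor Γ n where
  o x := F.obj x
  m f := Arrow.mk (F.map (X := fun i => (f i).left) (Y := fun i => (f i).right)
    (fun i => (f i).hom))
  m_left _ := rfl
  m_right _ := rfl
  m_id x := congrArg Arrow.mk (F.map_id x)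
  mult f g h H := by
    choose x y z a b hf hg hh using fun i => (H i).exists_eq
    obtain rfl := funext hf
    obtain rfl := funext hg
    obtain rfl := funext hh
    have := ArrowComp.mk (F.map (X := x) (Y := y) a) (F.map (X := y) (Y := z) b)
    rwa [← F.map_comp] at this

/-- A natural transformation as an operation on arrows. -/
def ArrowNat.ofNatTrans {n : ℕ} {F G : (Fin n → Γ) ⥤ Γ} (α : F ⟶ G) : ArrowNat Γ n where
  F := ArrowFunctor.ofFunctor F
  G := ArrowFunctor.ofFunctor G
  hom f := Arrow.mk (F.map (X := fun i => (f i).left) (Y := fun i => (f i).right)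
    (fun i => (f i).hom) ≫ α.app _)
  hom_left _ := rfl
  hom_right _ := rfl
  mult_left f g h H := by
    have e : (fun i => (h i).right) = fun i => (g i).right := funext fun i => (H i).right
    have h1 := (ArrowFunctor.ofFunctor F).mult H
    have h2 := ArrowComp.mk (F.map (X := fun i => (h i).left) (Y := fun i => (h i).right)
      (fun i => (h i).hom)) (α.app _)
    rw [congrArg (fun x => Arrow.mk (α.app x)) e] at h2
    exact h1.assoc h2 (ArrowComp.mk _ _)
  mult_right f g h H := by
    have e : (fun i => (h i).left) = fun i => (f i).left := funext fun i => (H i).left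
    have h1 := (ArrowFunctor.ofFunctor G).mult H
    have h2 := ArrowComp.mk (α.app _) (G.map (X := fun i => (h i).left)
      (Y := fun i => (h i).right) (fun i => (h i).hom))
    rw [← α.naturality, congrArg (fun x => Arrow.mk (α.app x)) e] at h2
    have h3 := ArrowComp.mk (α.app _) (G.map (X := fun i => (f i).left)
      (Y := fun i => (f i).right) (fun i => (f i).hom))
    rw [← α.naturality] at h3
    exact h3.assoc' h2 h1

theorem ArrowNat.component_ofNatTrans {n : ℕ} {F G : (Fin n → Γ) ⥤ Γ} (α : F ⟶ G)
    (x : Fin n → Γ) : (ArrowNat.ofNatTrans α).component x = Arrow.mk (α.app x) := by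
  have : F.map (X := x) (Y := x) (fun i => 𝟙 (x i)) = 𝟙 _ := F.map_id x
  change Arrow.mk (F.map (X := x) (Y := x) (fun i => 𝟙 (x i)) ≫ α.app x) = _
  rw [this, Category.id_comp]

theorem ArrowNat.isHom_ofNatTrans {n : ℕ} {F G : (Fin n → Γ) ⥤ Γ} (α : F ⟶ G) :
    (arrowOperad Γ).IsHom (ArrowNat.ofNatTrans α) (ArrowFunctor.ofFunctor F)
      (ArrowFunctor.ofFunctor G) := ⟨rfl, rfl⟩

theorem ArrowNat.isInv_ofNatTrans {n : ℕ} {F G : (Fin n → Γ) ⥤ Γ} (α : F ≅ G) :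
    (arrowOperad Γ).IsInv (ArrowNat.ofNatTrans α.hom) (ArrowNat.ofNatTrans α.inv) := by
  have aux : ∀ {F G : (Fin n → Γ) ⥤ Γ} (α : F ≅ G),
      (arrowOperad Γ).cmp (ArrowNat.ofNatTrans α.hom) (ArrowNat.ofNatTrans α.inv) =
        (arrowOperad Γ).idn.map (ArrowFunctor.ofFunctor F) := fun {F G} α => by
    refine ArrowNat.isHom_ext ((isHom_ofNatTrans α.hom).cmp (isHom_ofNatTrans α.inv))
      (CatOperad.isHom_idn _) fun x => ?_
    refine (component_cmp (isHom_ofNatTrans α.hom) (isHom_ofNatTrans α.inv)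
      (h := Arrow.mk (𝟙 (F.obj x))) ?_).trans ((ArrowFunctor.ofFunctor F).m_id x).symm
    rw [component_ofNatTrans, component_ofNatTrans, ← Iso.hom_inv_id_app α x]
    exact ArrowComp.mk _ _
  exact ⟨isHom_ofNatTrans α.inv, aux α, aux α.symm⟩

end

/-! ### Lax algebras as lax maps into the endomorphism operad -/

section

open Operad ArrowOp

variable {Γ : Type u} [Category.{v} Γ]

namespace ArrowNat

variable {n : ℕ} {k : Fin n → ℕ}

theorem component_comp_idn_left (F : ArrowFunctor Γ n) (g : ∀ i, ArrowNat Γ (k i))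
    (x : Fin (∑ i, k i) → Γ) :
    ((arrowOperad Γ).Mor.comp ((arrowOperad Γ).idn.map F) g).component x =
      F.m fun i => (g i).component fun j => x (blk i j) := rfl

theorem component_comp_idn_right (f : ArrowNat Γ n) (G : ∀ i, ArrowFunctor Γ (k i))
    (x : Fin (∑ i, k i) → Γ) :
    ((arrowOperad Γ).Mor.comp f (fun i => (arrowOperad Γ).idn.map (G i))).component x =
      f.component fun i => (G i).o fun j => x (blk i j) :=
  congrArg f.hom (funext fun i => (G i).m_id _)

theorem component_act {m : ℕ} (κ : Fin n ≃ Fin m) (f : ArrowNat Γ n) (x : Fin m → Γ) :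
    ((arrowOperad Γ).Mor.act κ f).component x = f.component fun i => x (κ i) := rfl

end ArrowNat

namespace LaxAlgebra

open ArrowNat

variable {C : Operad.{w}} (L : LaxAlgebra C Γ)

/-- The functor by which an operation of `C` acts. -/
def arrowFunctor {n : ℕ} (μ : C.Ops n) : ArrowFunctor Γ n := ArrowFunctor.ofFunctor (L.op μ)

section

variable {n : ℕ} {k : Fin n → ℕ}

/-- The coherence of composition as an operation on arrows. -/
def compNat (μ : C.Ops n) (ν : ∀ i, C.Ops (k i)) : ArrowNat Γ (∑ i, k i) :=
  ofNatTrans (L.compIso μ ν).hom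

/-- The coherence of the unit as an operation on arrows. -/
def oneNat : ArrowNat Γ 1 := ofNatTrans L.oneIso.hom

/-- The coherence of a permutation as an operation on arrows. -/
def actNat {m : ℕ} (κ : Fin n ≃ Fin m) (μ : C.Ops n) : ArrowNat Γ m :=
  ofNatTrans (L.actIso κ μ).hom

theorem compNat_isHom (μ : C.Ops n) (ν : ∀ i, C.Ops (k i)) :
    (arrowOperad Γ).IsHom (L.compNat μ ν)
      ((arrowOperad Γ).Ob.comp (L.arrowFunctor μ) (fun i => L.arrowFunctor (ν i)))
      (L.arrowFunctor (C.comp μ ν)) :=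
  isHom_ofNatTrans (L.compIso μ ν).hom

theorem oneNat_isHom :
    (arrowOperad Γ).IsHom L.oneNat (L.arrowFunctor C.one) (arrowOperad Γ).Ob.one :=
  isHom_ofNatTrans L.oneIso.hom

theorem actNat_isHom {m : ℕ} (κ : Fin n ≃ Fin m) (μ : C.Ops n) :
    (arrowOperad Γ).IsHom (L.actNat κ μ) (L.arrowFunctor (C.act κ μ))
      ((arrowOperad Γ).Ob.act κ (L.arrowFunctor μ)) :=
  isHom_ofNatTrans (L.actIso κ μ).hom

theorem compNat_component (μ : C.Ops n) (ν : ∀ i, C.Ops (k i)) (x : Fin (∑ i, k i) → Γ) :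
    (L.compNat μ ν).component x = Arrow.mk ((L.compIso μ ν).hom.app x) :=
  component_ofNatTrans _ x

theorem oneNat_component (x : Fin 1 → Γ) :
    L.oneNat.component x = Arrow.mk (L.oneIso.hom.app x) :=
  component_ofNatTrans _ x

theorem actNat_component {m : ℕ} (κ : Fin n ≃ Fin m) (μ : C.Ops n) (x : Fin m → Γ) :
    (L.actNat κ μ).component x = Arrow.mk ((L.actIso κ μ).hom.app x) :=
  component_ofNatTrans _ x

theorem arrowFunctor_act_finCongr {m : ℕ} (h : n = m) (μ : C.Ops n) :
    (arrowOperad Γ).Ob.act (finCongr h) (L.arrowFunctor μ) =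
      L.arrowFunctor (C.act (finCongr h) μ) := by
  subst h
  rw [act_finCongr_rfl, act_finCongr_rfl]

end

theorem comp_assoc_aux {n : ℕ} {k : Fin n → ℕ} {l : Fin (∑ i, k i) → ℕ} (μ : C.Ops n)
    (ν : ∀ i, C.Ops (k i)) (ρ : ∀ p, C.Ops (l p)) :
    (arrowOperad Γ).cmp
        ((arrowOperad Γ).Mor.act (finCongr (sum_sum_blk l))
          ((arrowOperad Γ).Mor.comp ((arrowOperad Γ).idn.map (L.arrowFunctor μ))
            (fun i => L.compNat (ν i) (fun j => ρ (blk i j)))))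
        ((arrowOperad Γ).Mor.act (finCongr (sum_sum_blk l))
          (L.compNat μ (fun i => C.comp (ν i) (fun j => ρ (blk i j))))) =
      (arrowOperad Γ).cmp
        ((arrowOperad Γ).Mor.comp (L.compNat μ ν)
          (fun p => (arrowOperad Γ).idn.map (L.arrowFunctor (ρ p))))
        (L.compNat (C.comp μ ν) ρ) := by
  have h1 := ((CatOperad.isHom_idn (E := arrowOperad Γ) (L.arrowFunctor μ)).comp
    (fun i => L.compNat_isHom (ν i) (fun j => ρ (blk i j)))).act (finCongr (sum_sum_blk l))
  have h2 := (L.compNat_isHom μ (fun i => C.comp (ν i) (fun j => ρ (blk i j)))).act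
    (finCongr (sum_sum_blk l))
  have h3 := (L.compNat_isHom μ ν).comp
    (fun p => CatOperad.isHom_idn (E := arrowOperad Γ) (L.arrowFunctor (ρ p)))
  have h4 := L.compNat_isHom (C.comp μ ν) ρ
  rw [C.comp_assoc, ← L.arrowFunctor_act_finCongr] at h4
  rw [(arrowOperad Γ).Ob.comp_assoc] at h3
  refine isHom_ext (h1.cmp h2) (h3.cmp h4) fun x => ?_
  refine (component_cmp h1 h2 ?_).trans ((L.comp_assoc μ ν ρ x).trans
    (component_cmp h3 h4 ?_).symm)
  · rw [component_act, component_act, component_comp_idn_left, compNat_component,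
      funext fun i => L.compNat_component (ν i) (fun j => ρ (blk i j)) _]
    exact ArrowComp.mk _ _
  · rw [component_comp_idn_right, compNat_component, compNat_component]
    exact ArrowComp.mk _ _

theorem act_trans_aux {n m l : ℕ} (κ : Fin n ≃ Fin m) (lam : Fin m ≃ Fin l) (μ : C.Ops n) :
    L.actNat (κ.trans lam) μ =
      (arrowOperad Γ).cmp (L.actNat lam (C.act κ μ))
        ((arrowOperad Γ).Mor.act lam (L.actNat κ μ)) := by
  have h1 := L.actNat_isHom (κ.trans lam) μ
  have h2 := L.actNat_isHom lam (C.act κ μ)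
  have h3 := (L.actNat_isHom κ μ).act lam
  rw [C.act_trans, (arrowOperad Γ).Ob.act_trans] at h1
  refine isHom_ext h1 (h2.cmp h3) fun x => (L.actNat_component _ _ x).trans
    ((L.act_trans κ lam μ x).trans (component_cmp h2 h3 ?_).symm)
  rw [component_act, actNat_component, actNat_component]
  exact ArrowComp.mk _ _

theorem comp_act_aux {n m : ℕ} {k k' : Fin m → ℕ} (lam : Fin n ≃ Fin m)
    (κ : ∀ i, Fin (k i) ≃ Fin (k' i)) (μ : C.Ops n) (ν : ∀ i, C.Ops (k i)) :
    (arrowOperad Γ).cmp (L.compNat (C.act lam μ) (fun i => C.act (κ i) (ν i)))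
        (L.actNat (blockEquiv lam κ) (C.comp μ (fun j => ν (lam j)))) =
      (arrowOperad Γ).cmp
        ((arrowOperad Γ).cmp
          ((arrowOperad Γ).Mor.comp ((arrowOperad Γ).idn.map (L.arrowFunctor (C.act lam μ)))
            (fun i => L.actNat (κ i) (ν i)))
          ((arrowOperad Γ).Mor.comp (L.actNat lam μ)
            (fun i => (arrowOperad Γ).idn.map
              ((arrowOperad Γ).Ob.act (κ i) (L.arrowFunctor (ν i))))))
        ((arrowOperad Γ).Mor.act (blockEquiv lam κ) (L.compNat μ (fun j => ν (lam j)))) := by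
  have h1 := L.compNat_isHom (C.act lam μ) (fun i => C.act (κ i) (ν i))
  have h2 := L.actNat_isHom (blockEquiv lam κ) (C.comp μ (fun j => ν (lam j)))
  have h3 := (CatOperad.isHom_idn (E := arrowOperad Γ) (L.arrowFunctor (C.act lam μ))).comp
    (fun i => L.actNat_isHom (κ i) (ν i))
  have h4 := (L.actNat_isHom lam μ).comp (fun i => CatOperad.isHom_idn (E := arrowOperad Γ)
    ((arrowOperad Γ).Ob.act (κ i) (L.arrowFunctor (ν i))))
  have h5 := (L.compNat_isHom μ (fun j => ν (lam j))).act (blockEquiv lam κ)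
  rw [C.comp_act] at h1
  rw [← (arrowOperad Γ).Ob.comp_act lam κ (L.arrowFunctor μ) (fun i => L.arrowFunctor (ν i))] at h5
  refine isHom_ext (h1.cmp h2) ((h3.cmp h4).cmp h5) fun x => ?_
  refine (component_cmp h1 h2 ?_).trans ((congrArg Arrow.mk (L.comp_act lam κ μ ν x)).trans
    (component_cmp (h3.cmp h4) h5 ?_).symm)
  · rw [compNat_component, actNat_component]
    exact ArrowComp.of_eq _ _ _
  · rw [component_act, compNat_component, component_cmp h3 h4
      (h := Arrow.mk ((L.op (C.act lam μ)).map (fun i => (L.actIso (κ i) (ν i)).hom.app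
          (fun p => x (blk i p))) ≫
        (L.actIso lam μ).hom.app (fun i => (L.op (ν i)).obj (fun p => x (blk i (κ i p))))))]
    · rw [← Category.assoc]
      exact ArrowComp.of_eq _ _ _
    · rw [component_comp_idn_left, component_comp_idn_right, actNat_component,
        funext fun i => L.actNat_component (κ i) (ν i) _]
      exact ArrowComp.mk _ _

/-- A lax algebra as a pseudo-map to the endomorphism operad. -/
noncomputable def laxMap : CatOperad.LaxMap C (arrowOperad Γ) where
  op μ := L.arrowFunctor μ
  compHom μ ν := L.compNat μ ν
  oneHom := L.oneNat
  actHom κ μ := L.actNat κ μ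
  compHom_isHom := L.compNat_isHom
  oneHom_isHom := L.oneNat_isHom
  actHom_isHom := L.actNat_isHom
  compHom_iso μ ν := ⟨_, isInv_ofNatTrans (L.compIso μ ν)⟩
  oneHom_iso := ⟨_, isInv_ofNatTrans L.oneIso⟩
  actHom_iso κ μ := ⟨_, isInv_ofNatTrans (L.actIso κ μ)⟩
  comp_assoc := L.comp_assoc_aux
  one_comp {n} μ := by
    have h1 := L.compNat_isHom C.one (fun _ => μ)
    have h2 := L.oneNat_isHom.comp
      (fun _ : Fin 1 => CatOperad.isHom_idn (E := arrowOperad Γ) (L.arrowFunctor μ))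
    rw [C.one_comp, ← L.arrowFunctor_act_finCongr, ← (arrowOperad Γ).Ob.one_comp] at h1
    refine isHom_ext h1 h2 fun x => ?_
    rw [component_comp_idn_right, compNat_component, oneNat_component]
    exact L.one_comp μ x
  comp_one {n} μ := by
    have h1 := L.compNat_isHom μ (fun _ => C.one)
    have h2 := (CatOperad.isHom_idn (E := arrowOperad Γ) (L.arrowFunctor μ)).comp
      (fun _ => L.oneNat_isHom)
    rw [C.comp_one, ← L.arrowFunctor_act_finCongr, ← (arrowOperad Γ).Ob.comp_one] at h1
    refine isHom_ext h1 h2 fun x => ?_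
    rw [component_comp_idn_left, compNat_component, funext fun i => L.oneNat_component _]
    exact L.comp_one μ x
  act_refl μ := by
    have h1 := L.actNat_isHom (Equiv.refl _) μ
    rw [C.act_refl, (arrowOperad Γ).Ob.act_refl] at h1
    refine isHom_ext h1 (CatOperad.isHom_idn _) fun x => ?_
    rw [actNat_component, L.act_refl]
    exact ((L.arrowFunctor μ).m_id x).symm
  act_trans := L.act_trans_aux
  comp_act := L.comp_act_aux

end LaxAlgebra

end

section

open Operad ArrowOp

variable {Γ : Type u} [Category.{v} Γ]

/-! ### Chains of arrows -/

section

variable {k : ℕ}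

/-- The composite of the morphisms from the `i`-th to the `j`-th object of a chain. -/
def chainArrow (x : Fin (k + 1) ⥤ Γ) (i j : Fin (k + 1)) (h : i ≤ j) : Arrow Γ :=
  Arrow.mk (x.map (homOfLE h))

theorem arrowComp_chainArrow (x : Fin (k + 1) ⥤ Γ) {i j l : Fin (k + 1)} (h : i ≤ j) (h' : j ≤ l) :
    ArrowComp (chainArrow x i j h) (chainArrow x j l h') (chainArrow x i l (h.trans h')) := by
  have := ArrowComp.mk (x.map (homOfLE h)) (x.map (homOfLE h'))
  rwa [← x.map_comp] at this

theorem chainArrow_self (x : Fin (k + 1) ⥤ Γ) (i : Fin (k + 1)) :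
    chainArrow x i i le_rfl = Arrow.mk (𝟙 (x.obj i)) := congrArg Arrow.mk (x.map_id i)

theorem ext_chainArrow {x y : Fin (k + 1) ⥤ Γ}
    (h : ∀ i j h, chainArrow x i j h = chainArrow y i j h) : x = y :=
  Functor.hext (fun i => congrArg (fun a : Arrow Γ => a.left) (h i i le_rfl))
    (fun i j f => congr_arg_heq (fun a : Arrow Γ => a.hom) (h i j (leOfHom f)))

/-- Construction of a chain from the composites of its morphisms. -/
theorem exists_chainArrow_eq (o : Fin (k + 1) → Γ) (m : ∀ i j : Fin (k + 1), i ≤ j → Arrow Γ)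
    (hl : ∀ i j h, (m i j h).left = o i) (hr : ∀ i j h, (m i j h).right = o j)
    (hid : ∀ i, m i i le_rfl = Arrow.mk (𝟙 (o i)))
    (hcomp : ∀ i j l h h', ArrowComp (m i j h) (m j l h') (m i l (h.trans h'))) :
    ∃ x : Fin (k + 1) ⥤ Γ, ∀ i j h, chainArrow x i j h = m i j h := by
  have key : ∀ i j h, ∃ f : o i ⟶ o j, Arrow.mk f = m i j h := fun i j h => by
    have e1 := hl i j h
    have e2 := hr i j h
    generalize m i j h = a at e1 e2
    generalize o i = p at e1
    generalize o j = q at e2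
    subst e1 e2
    exact ⟨a.hom, rfl⟩
  choose f hf using key
  refine ⟨{ obj := o
            map := fun {i j} h => f i j (leOfHom h)
            map_id := fun i => Arrow.mk_injective _ _ ((hf _ _ _).trans (hid i))
            map_comp := fun {i j l} h h' => Arrow.mk_injective _ _ ?_ }, fun i j h => hf i j h⟩
  have h1 := hcomp i j l (leOfHom h) (leOfHom h')
  rw [← hf, ← hf] at h1
  exact (hf _ _ _).trans (h1.unique (ArrowComp.mk _ _))

/-- An arrow, as a chain of length one. -/
def chainOne (a : Arrow Γ) : Fin 2 ⥤ Γ := ComposableArrows.mk₁ a.hom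

theorem chainOne_chainArrow (x : Fin 2 ⥤ Γ) : chainOne (chainArrow x 0 1 (Fin.zero_le _)) = x := by
  obtain ⟨_, _, f, rfl⟩ := ComposableArrows.mk₁_surjective x
  rfl

end

/-! ### The canonical algebra structure on the nerve of an ordinary category -/

namespace LaxAlgebra

variable {C : Operad.{w}} (L : LaxAlgebra C Γ)

/-- The functor obtained by carrying out a formal composition. -/
noncomputable def strictFun {n : ℕ} (σ : (free C).Ops n) : ArrowFunctor Γ n :=
  L.laxMap.strictOb σ

/-- The natural isomorphism between the results of carrying out two formal compositions with the
same image in `C`. -/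
noncomputable def strictNat {n : ℕ} (σ τ : (free C).Ops n) : ArrowNat Γ n :=
  L.laxMap.strictMor σ τ

section

variable {n : ℕ} {σ τ ρ : (free C).Ops n}

theorem strictNat_F (h : (freeCounit C).map σ = (freeCounit C).map τ) :
    (L.strictNat σ τ).F = L.strictFun σ := (L.laxMap.strictMor_isHom h).src

theorem strictNat_G (h : (freeCounit C).map σ = (freeCounit C).map τ) :
    (L.strictNat σ τ).G = L.strictFun τ := (L.laxMap.strictMor_isHom h).tgt

theorem strictNat_self (σ : (free C).Ops n) : L.strictNat σ σ = ArrowNat.idn (L.strictFun σ) :=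
  L.laxMap.strictMor_self σ

theorem strictNat_mult (h : (freeCounit C).map σ = (freeCounit C).map τ)
    (h' : (freeCounit C).map τ = (freeCounit C).map ρ) :
    Mult (L.strictNat σ τ).hom (L.strictNat τ ρ).hom (L.strictNat σ ρ).hom := by
  have := ArrowNat.mult_cmp ((L.strictNat_G h).trans (L.strictNat_F h').symm)
  have e : (L.strictNat σ τ).cmp (L.strictNat τ ρ) = L.strictNat σ ρ := L.laxMap.strictMor_cmp h h'
  rwa [e] at this

theorem strictNat_comp {k : Fin n → ℕ} {σ' τ' : ∀ i, (free C).Ops (k i)}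
    (h : (freeCounit C).map σ = (freeCounit C).map τ)
    (h' : ∀ i, (freeCounit C).map (σ' i) = (freeCounit C).map (τ' i)) :
    (L.strictNat ((free C).comp σ σ') ((free C).comp τ τ')).hom =
      (setEndOperad (Arrow Γ)).comp (L.strictNat σ τ).hom
        (fun i => (L.strictNat (σ' i) (τ' i)).hom) :=
  congrArg ArrowNat.hom (L.laxMap.strictMor_comp h h')

theorem strictNat_act {m : ℕ} (κ : Fin n ≃ Fin m)
    (h : (freeCounit C).map σ = (freeCounit C).map τ) :
    (L.strictNat ((free C).act κ σ) ((free C).act κ τ)).hom =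
      (setEndOperad (Arrow Γ)).act κ (L.strictNat σ τ).hom :=
  congrArg ArrowNat.hom (L.laxMap.strictMor_act κ h)

theorem strictFun_comp {k : Fin n → ℕ} (σ : (free C).Ops n) (σ' : ∀ i, (free C).Ops (k i)) :
    L.strictFun ((free C).comp σ σ') =
      (arrowFunctorOperad Γ).comp (L.strictFun σ) (fun i => L.strictFun (σ' i)) :=
  L.laxMap.strictObMap.map_comp σ σ'

theorem strictFun_act {m : ℕ} (κ : Fin n ≃ Fin m) (σ : (free C).Ops n) :
    L.strictFun ((free C).act κ σ) = (arrowFunctorOperad Γ).act κ (L.strictFun σ) :=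
  L.laxMap.strictObMap.map_act κ σ

theorem strictFun_one : L.strictFun (free C).one = (arrowFunctorOperad Γ).one :=
  L.laxMap.strictObMap.map_one

theorem strictFun_gen (μ : C.Ops n) : L.strictFun (gen μ) = L.arrowFunctor μ :=
  L.laxMap.strictOb_gen μ

end

/-- The chain obtained from the images `μ i j` under the transformations `S (c i) ⟶ S (c j)` of the
arrows from the `i`-th to the `j`-th objects of the given chains. -/
theorem exists_act {n k : ℕ} (c : Fin (k + 1) ⥤ Coh C n) (a : Fin n → (Fin (k + 1) ⥤ Γ)) :
    ∃ x : Fin (k + 1) ⥤ Γ, ∀ i j h, chainArrow x i j h =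
      (L.strictNat (c.obj i).op (c.obj j).op).hom (fun t => chainArrow (a t) i j h) := by
  have e : ∀ {i j : Fin (k + 1)} (_ : i ≤ j), (freeCounit C).map (c.obj i).op =
    (freeCounit C).map (c.obj j).op := fun h => Coh.image_eq (c.map (homOfLE h))
  refine exists_chainArrow_eq (fun i => (L.strictFun (c.obj i).op).o fun t => (a t).obj i) _
    (fun i j h => ?_) (fun i j h => ?_) (fun i => ?_)
    (fun i j l h h' => L.strictNat_mult (e h) (e h') fun t => arrowComp_chainArrow (a t) h h')
  · rw [ArrowNat.hom_left, L.strictNat_F (e h)]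
    rfl
  · rw [ArrowNat.hom_right, L.strictNat_G (e h)]
    rfl
  · rw [strictNat_self, funext fun t => chainArrow_self (a t) i]
    exact ArrowFunctor.m_id _ _

/-- The action of a chain of formal operations on tuples of chains. -/
noncomputable def chainAct {n k : ℕ} (c : Fin (k + 1) ⥤ Coh C n) (a : Fin n → (Fin (k + 1) ⥤ Γ)) :
    Fin (k + 1) ⥤ Γ := (L.exists_act c a).choose

theorem chainAct_arrow {n k : ℕ} (c : Fin (k + 1) ⥤ Coh C n) (a : Fin n → (Fin (k + 1) ⥤ Γ))
    (i j : Fin (k + 1)) (h : i ≤ j) : chainArrow (L.chainAct c a) i j h =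
      (L.strictNat (c.obj i).op (c.obj j).op).hom (fun t => chainArrow (a t) i j h) :=
  (L.exists_act c a).choose_spec i j h

theorem comp_chainAct {n k k' : ℕ} (F : Fin (k' + 1) ⥤ Fin (k + 1)) (c : Fin (k + 1) ⥤ Coh C n)
    (a : Fin n → (Fin (k + 1) ⥤ Γ)) :
    F ⋙ L.chainAct c a = L.chainAct (F ⋙ c) (fun t => F ⋙ a t) :=
  ext_chainArrow fun i j h => (L.chainAct_arrow c a _ _ (leOfHom (F.map (homOfLE h)))).trans
    (L.chainAct_arrow (F ⋙ c) (fun t => F ⋙ a t) i j h).symm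

/-- The canonical algebra structure on the nerve. -/
noncomputable def nerveAlgebra : SimplicialAlgebra (Operad.bar C) (nerve Γ) where
  alg Δ :=
    { act := fun {n} (c : Fin (Δ.unop.len + 1) ⥤ Coh C n) => L.chainAct c
      act_one := fun x => ext_chainArrow fun i j h => (L.chainAct_arrow _ x i j h).trans <|
        congrArg (fun f : ArrowNat Γ 1 => f.hom fun t => chainArrow (x t) i j h)
          ((L.strictNat_self _).trans (congrArg ArrowNat.idn L.strictFun_one))
      act_comp := fun c d x => ext_chainArrow fun i j h => (L.chainAct_arrow _ x i j h).trans <|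
        (congrFun (L.strictNat_comp (Coh.image_eq (c.map (homOfLE h)))
          (fun t => Coh.image_eq ((d t).map (homOfLE h)))) _).trans <|
        Eq.symm <| (L.chainAct_arrow c _ i j h).trans <|
          congrArg (ArrowNat.hom _) (funext fun t => L.chainAct_arrow (d t) _ i j h)
      act_act := fun κ c x => ext_chainArrow fun i j h =>
        (L.chainAct_arrow _ x i j h).trans <|
          (congrFun (L.strictNat_act κ (Coh.image_eq (c.map (homOfLE h)))) _).trans
            (L.chainAct_arrow c _ i j h).symm }
  map_act {_ _} θ {_} c x := L.comp_chainAct (SimplexCategory.toCat.map θ.unop).toFunctor c x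

section

variable {n : ℕ} {k : Fin n → ℕ}

theorem strictNat_compHom (μ : C.Ops n) (ν : ∀ i, C.Ops (k i)) (x : Fin (∑ i, k i) → Γ) :
    (L.strictNat ((free C).comp (gen μ) (fun i => gen (ν i))) (gen (C.comp μ ν))).component x =
      Arrow.mk ((L.compIso μ ν).hom.app x) :=
  (congrArg (ArrowNat.component · x) (L.laxMap.strictMor_compHom μ ν)).trans
    (L.compNat_component μ ν x)

theorem strictNat_oneHom (x : Fin 1 → Γ) :
    (L.strictNat (gen C.one) (free C).one).component x = Arrow.mk (L.oneIso.hom.app x) :=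
  (congrArg (ArrowNat.component · x) L.laxMap.strictMor_oneHom).trans (L.oneNat_component x)

theorem strictNat_actHom {m : ℕ} (κ : Fin n ≃ Fin m) (μ : C.Ops n) (x : Fin m → Γ) :
    (L.strictNat (gen (C.act κ μ)) ((free C).act κ (gen μ))).component x =
      Arrow.mk ((L.actIso κ μ).hom.app x) :=
  (congrArg (ArrowNat.component · x) (L.laxMap.strictMor_actHom κ μ)).trans
    (L.actNat_component κ μ x)

theorem chainAct_edge {σ τ : Coh C n} (f : σ ⟶ τ) (x : Fin n → Γ) :
    L.chainAct (ComposableArrows.mk₁ f) (fun i => ComposableArrows.mk₁ (𝟙 (x i))) =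
      chainOne ((L.strictNat σ.op τ.op).component x) :=
  (chainOne_chainArrow _).symm.trans (congrArg chainOne (L.chainAct_arrow _ _ 0 1 (Fin.zero_le _)))

end

theorem isCanonical_nerveAlgebra : IsCanonical L L.nerveAlgebra where
  act_gen _ _ μ a := ext_chainArrow fun i j h => (L.chainAct_arrow _ a i j h).trans <|
    congrArg (fun f => ArrowNat.hom f fun t => chainArrow (a t) i j h)
      ((L.strictNat_self _).trans (congrArg ArrowNat.idn (L.strictFun_gen μ)))
  act_compHom μ ν x := (L.chainAct_edge _ x).trans (congrArg chainOne (L.strictNat_compHom μ ν x))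
  act_oneHom x := (L.chainAct_edge _ x).trans (congrArg chainOne (L.strictNat_oneHom x))
  act_actHom κ μ x := (L.chainAct_edge _ x).trans (congrArg chainOne (L.strictNat_actHom κ μ x))

end LaxAlgebra

/-! ### Uniqueness of the algebra structure on the nerve of an ordinary category -/

namespace SimplicialAlgebra

variable {C : Operad.{w}} (A : SimplicialAlgebra (Operad.bar C) (nerve Γ))

/-- The action of a chain in the coherence category on tuples of chains in `Γ`. -/
def chainAct {n k : ℕ} (c : Fin (k + 1) ⥤ Coh C n) (a : Fin n → (Fin (k + 1) ⥤ Γ)) :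
    Fin (k + 1) ⥤ Γ :=
  (A.alg (op (SimplexCategory.mk k))).act c a

/-- The action of a morphism of the coherence category on tuples of arrows of `Γ`. -/
def edgeAct {n : ℕ} {σ τ : Coh C n} (f : σ ⟶ τ) : ArrowOp Γ n :=
  fun a =>
    chainArrow (A.chainAct (ComposableArrows.mk₁ f) fun t => chainOne (a t)) 0 1 (Fin.zero_le _)

section

variable {n k : ℕ}

theorem act_edge {σ τ : Coh C n} (f : σ ⟶ τ) (a : Fin n → (Fin 2 ⥤ Γ)) :
    A.chainAct (ComposableArrows.mk₁ f) a =
      chainOne (A.edgeAct f fun t => chainArrow (a t) 0 1 (Fin.zero_le _)) := by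
  rw [edgeAct, chainOne_chainArrow, funext fun t => chainOne_chainArrow (a t)]

theorem act_arrow (c : Fin (k + 1) ⥤ Coh C n) (a : Fin n → (Fin (k + 1) ⥤ Γ))
    (i j : Fin (k + 1)) (h : i ≤ j) : chainArrow (A.chainAct c a) i j h =
      A.edgeAct (c.map (homOfLE h)) (fun t => chainArrow (a t) i j h) := by
  let θ : op (SimplexCategory.mk k) ⟶ op (SimplexCategory.mk 1) :=
    (SimplexCategory.mkOfLe i j h).op
  have e : ((Operad.bar C).map θ).map c = edge (c.map (homOfLE h)) := by
    refine Coh.chain_ext fun x => ?_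
    fin_cases x <;> rfl
  have e' : ∀ t, (nerve Γ).map θ (a t) = chainOne (chainArrow (a t) i j h) := fun t =>
    (chainOne_chainArrow _).symm
  have h1 := (A.map_act θ c a).trans ((congrArg (fun y => (A.alg _).act y _) e).trans
    (congrArg ((A.alg _).act _) (funext e')))
  exact congrArg (fun x => chainArrow (k := 1) x 0 1 (Fin.zero_le _)) h1

/-- An algebra structure on the nerve is determined by the action of the morphisms of the coherence
categories on tuples of arrows. -/
theorem ext_edgeAct {A' : SimplicialAlgebra (Operad.bar C) (nerve Γ)}
    (h : ∀ {n : ℕ} {σ τ : Coh C n} (f : σ ⟶ τ), A.edgeAct f = A'.edgeAct f) : A = A' := by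
  refine SimplicialAlgebra.ext (funext fun Δ => ?_)
  refine OperadAlgebra.ext (funext fun n => funext fun c => funext fun a => ?_)
  induction Δ using Opposite.rec with | _ Δ => ?_
  induction Δ using SimplexCategory.rec with | _ k => ?_
  refine ext_chainArrow fun i j hij => ?_
  exact (A.act_arrow c a i j hij).trans ((congrFun (h _) _).trans
    (A'.act_arrow c a i j hij).symm)

/-- The compatibility of the action of chains of length two with faces. -/
theorem edgeAct_mult {σ τ ρ : Coh C n} (f : σ ⟶ τ) (g : τ ⟶ ρ) :
    Mult (A.edgeAct f) (A.edgeAct g) (A.edgeAct (f ≫ g)) := by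
  intro a b d H
  choose x y z p q ha hb hd using fun i => (H i).exists_eq
  obtain rfl := funext ha
  obtain rfl := funext hb
  obtain rfl := funext hd
  let c : Fin 3 ⥤ Coh C n := ComposableArrows.mk₂ f g
  let r : Fin n → (Fin 3 ⥤ Γ) := fun t => ComposableArrows.mk₂ (p t) (q t)
  have K := arrowComp_chainArrow (k := 2) (A.chainAct c r) (i := 0) (j := 1) (l := 2)
    (Fin.zero_le _) (by decide)
  rw [act_arrow, act_arrow, act_arrow] at K
  exact K

theorem edgeAct_comp {k : Fin n → ℕ} {σ τ : Coh C n} (f : σ ⟶ τ) {σ' τ' : ∀ i, Coh C (k i)}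
    (f' : ∀ i, σ' i ⟶ τ' i)
    (g : (⟨(free C).comp σ.op fun i => (σ' i).op⟩ : Coh C _) ⟶
      ⟨(free C).comp τ.op fun i => (τ' i).op⟩) :
    A.edgeAct g = (setEndOperad (Arrow Γ)).comp (A.edgeAct f) (fun i => A.edgeAct (f' i)) := by
  have e : edge g = (diagrams C (Fin 2)).comp (edge f)
      (fun i => edge (f' i)) := by
    refine Coh.chain_ext fun x => ?_
    fin_cases x <;> rfl
  funext a
  have h3 : A.chainAct (ComposableArrows.mk₁ g) (fun t => chainOne (a t)) =
      A.chainAct (ComposableArrows.mk₁ f)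
        (fun i => A.chainAct (ComposableArrows.mk₁ (f' i)) fun j => chainOne (a (blk i j))) :=
    (congrArg (A.chainAct · _) e).trans
      ((A.alg (op (SimplexCategory.mk 1))).act_comp (edge f) (fun i => edge (f' i)) _)
  rw [edgeAct, h3, A.act_edge f]
  rfl

theorem edgeAct_act {m : ℕ} (κ : Fin n ≃ Fin m) {σ τ : Coh C n} (f : σ ⟶ τ)
    (g : (⟨(free C).act κ σ.op⟩ : Coh C _) ⟶ ⟨(free C).act κ τ.op⟩) :
    A.edgeAct g = (setEndOperad (Arrow Γ)).act κ (A.edgeAct f) := by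
  have e : edge g = (diagrams C (Fin 2)).act κ (edge f) := by
    refine Coh.chain_ext fun x => ?_
    fin_cases x <;> rfl
  funext a
  have h : A.chainAct (ComposableArrows.mk₁ g) (fun t => chainOne (a t)) =
      A.chainAct (ComposableArrows.mk₁ f) (fun j => chainOne (a (κ j))) :=
    (congrArg (A.chainAct · _) e).trans
      ((A.alg (op (SimplexCategory.mk 1))).act_act κ (edge f) _)
  rw [edgeAct, h]
  rfl

theorem edgeAct_one (g : (⟨(free C).one⟩ : Coh C 1) ⟶ ⟨(free C).one⟩) :
    A.edgeAct g = (setEndOperad (Arrow Γ)).one := by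
  have e : edge g = (diagrams C (Fin 2)).one := by
    refine Coh.chain_ext fun x => ?_
    fin_cases x <;> rfl
  funext a
  have h : A.chainAct (ComposableArrows.mk₁ g) (fun t => chainOne (a t)) = chainOne (a 0) :=
    (congrArg (A.chainAct · _) e).trans ((A.alg (op (SimplexCategory.mk 1))).act_one _)
  rw [edgeAct, h]
  rfl

end

end SimplicialAlgebra

namespace IsCanonical

variable {C : Operad.{w}} {L : LaxAlgebra C Γ} {A : SimplicialAlgebra (Operad.bar C) (nerve Γ)}

theorem edgeAct_gen (H : IsCanonical L A) {n : ℕ} (μ : C.Ops n) :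
    A.edgeAct (𝟙 (Coh.gen μ)) = (L.arrowFunctor μ).m := by
  have e : edge (𝟙 (Coh.gen μ)) = constGen (op (SimplexCategory.mk 1)) μ := by
    refine Coh.chain_ext fun x => ?_
    fin_cases x <;> rfl
  funext a
  have h : A.chainAct (ComposableArrows.mk₁ (𝟙 (Coh.gen μ))) (fun t => chainOne (a t)) =
      Functor.pi' (fun t => chainOne (a t)) ⋙ L.op μ :=
    (congrArg (A.chainAct · _) e).trans (H.act_gen (op (SimplexCategory.mk 1)) μ _)
  rw [SimplicialAlgebra.edgeAct, h]
  rfl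

/-- By multiplicativity it suffices to know the action of the generators. -/
theorem edgeAct_id (H : IsCanonical L A) {n : ℕ} (σ : (free C).Ops n) :
    A.edgeAct (𝟙 (⟨σ⟩ : Coh C n)) = (L.strictFun σ).m := by
  induction σ using free_induction with
  | gen μ => exact (H.edgeAct_gen μ).trans (congrArg ArrowFunctor.m (L.strictFun_gen μ)).symm
  | one => exact (A.edgeAct_one _).trans (congrArg ArrowFunctor.m L.strictFun_one).symm
  | comp σ τ hσ hτ =>
    rw [A.edgeAct_comp (𝟙 (⟨σ⟩ : Coh C _)) (fun i => 𝟙 (⟨τ i⟩ : Coh C _)), hσ, funext hτ]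
    exact (congrArg ArrowFunctor.m (L.strictFun_comp σ τ)).symm
  | act κ σ hσ =>
    rw [A.edgeAct_act κ (𝟙 (⟨σ⟩ : Coh C _)), hσ]
    exact (congrArg ArrowFunctor.m (L.strictFun_act κ σ)).symm

/-- A morphism which acts on identities by the components of the canonical transformation acts on
all arrows by it, since it factors through the action of the identity of its source. -/
theorem edgeAct_eq_of_component (H : IsCanonical L A) {n : ℕ} {σ τ : Coh C n} (f : σ ⟶ τ)
    {X Y : (Fin n → Γ) → Γ} {g : ∀ x, X x ⟶ Y x}
    (h : ∀ x : Fin n → Γ, (A.alg (op (SimplexCategory.mk 1))).act (edge f)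
      (fun i => ComposableArrows.mk₁ (𝟙 (x i))) = ComposableArrows.mk₁ (g x))
    (h' : ∀ x, (L.strictNat σ.op τ.op).component x = Arrow.mk (g x)) :
    A.edgeAct f = (L.strictNat σ.op τ.op).hom := by
  funext a
  have h1 := (A.edgeAct_mult (𝟙 σ) f).right_id a
  rw [H.edgeAct_id, Category.id_comp] at h1
  have h2 := (L.strictNat σ.op τ.op).arrowComp_component a
  have h3 : A.edgeAct f (ids fun i => (a i).right) = Arrow.mk (g fun i => (a i).right) :=
    congrArg (fun x => chainArrow (k := 1) x 0 1 (Fin.zero_le _)) (h fun i => (a i).right)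
  rw [L.strictNat_F (Coh.image_eq f), h', ← h3] at h2
  exact h1.unique h2

/-- In an algebra which extends the lax structure, every morphism of the coherence categories acts
by the canonical transformation. -/
theorem edgeAct_eq (H : IsCanonical L A) {n : ℕ} {σ τ : Coh C n} (f : σ ⟶ τ) :
    A.edgeAct f = (L.strictNat σ.op τ.op).hom := by
  have hid : ∀ {n : ℕ} (σ : (free C).Ops n),
      A.edgeAct (𝟙 (⟨σ⟩ : Coh C n)) = (L.strictNat σ σ).hom := fun σ =>
    (H.edgeAct_id σ).trans (congrArg ArrowNat.hom (L.strictNat_self σ)).symm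
  suffices h : ∀ {n : ℕ} (σ τ : (free C).Ops n), (freeCounit C).map σ = (freeCounit C).map τ →
      ∃ f : (⟨σ⟩ : Coh C n) ⟶ ⟨τ⟩, A.edgeAct f = (L.strictNat σ τ).hom by
    obtain ⟨f', h'⟩ := h σ.op τ.op (Coh.image_eq f)
    rwa [Subsingleton.elim f f']
  refine fun σ τ h => coh_induction (Q := fun {n} σ τ => ∃ f : (⟨σ⟩ : Coh C n) ⟶ ⟨τ⟩,
    A.edgeAct f = (L.strictNat σ τ).hom) ?_ ?_ ?_ ?_ ?_ ?_ ?_ ?_ σ τ h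
  · rintro n σ τ ⟨f, hf⟩
    have e := Coh.image_eq f
    refine ⟨Coh.homMk e.symm, ?_⟩
    -- The action of the inverse and the inverse transformation are both inverse to that of `f`.
    have h1 := A.edgeAct_mult (Coh.homMk e.symm) f
    have h2 := A.edgeAct_mult (Coh.homMk e.symm) (𝟙 (⟨σ⟩ : Coh C _))
    rw [Subsingleton.elim (Coh.homMk e.symm ≫ f) (𝟙 _), hid, hf] at h1
    rw [hid, Category.comp_id] at h2
    exact (h1.assoc (L.strictNat_mult rfl e.symm) (L.strictNat_mult e e.symm) h2).symm
  · rintro n σ τ ρ ⟨f, hf⟩ ⟨g, hg⟩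
    refine ⟨f ≫ g, ?_⟩
    have h1 := A.edgeAct_mult f g
    rw [hf, hg] at h1
    exact h1.unique (L.strictNat_mult (Coh.image_eq f) (Coh.image_eq g))
  · rintro n k σ τ σ' τ' ⟨f, hf⟩ ih'
    choose f' hf' using ih'
    have e := Coh.image_eq f
    have e' := fun i => Coh.image_eq (f' i)
    refine ⟨Coh.homMk (((freeCounit C).map_comp _ _).trans
      ((congrArg₂ C.comp e (funext e')).trans ((freeCounit C).map_comp _ _).symm)), ?_⟩
    rw [A.edgeAct_comp f f', hf, funext hf', L.strictNat_comp e e']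
  · rintro n m κ σ τ ⟨f, hf⟩
    have e := Coh.image_eq f
    refine ⟨Coh.homMk (((freeCounit C).map_act _ _).trans
      ((congrArg (C.act κ) e).trans ((freeCounit C).map_act _ _).symm)), ?_⟩
    rw [A.edgeAct_act κ f, hf, L.strictNat_act κ e]
  · exact fun μ => ⟨𝟙 _, hid _⟩
  · intro n k μ ν
    exact ⟨Coh.compHom μ ν, H.edgeAct_eq_of_component _ (H.act_compHom μ ν)
      (L.strictNat_compHom μ ν)⟩
  · exact ⟨Coh.oneHom C, H.edgeAct_eq_of_component _ H.act_oneHom L.strictNat_oneHom⟩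
  · intro n m κ μ
    exact ⟨Coh.actHom κ μ, H.edgeAct_eq_of_component _ (H.act_actHom κ μ)
      (L.strictNat_actHom κ μ)⟩

theorem eq_nerveAlgebra (H : IsCanonical L A) : A = L.nerveAlgebra :=
  A.ext_edgeAct fun f => (H.edgeAct_eq f).trans (L.isCanonical_nerveAlgebra.edgeAct_eq f).symm

end IsCanonical

theorem existsUnique_isCanonical {C : Operad.{w}} (L : LaxAlgebra C Γ) :
    ∃! A : SimplicialAlgebra (Operad.bar C) (nerve Γ), IsCanonical L A :=
  ⟨L.nerveAlgebra, L.isCanonical_nerveAlgebra, fun _ H => H.eq_nerveAlgebra⟩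

end

/-! ### Points of geometric realizations -/

namespace SSet

variable {X Y : SSet.{u}}

variable (X) in
/-- The unit of the adjunction between geometric realizations and singular simplicial sets. -/
noncomputable def singularUnit : X ⟶ TopCat.toSSet.obj (SSet.toTop.obj X) := sSetTopAdj.unit.app X

/-- The point of the geometric realization with given barycentric coordinates in a simplex. -/
noncomputable def point {Δ : SimplexCategory} (x : X.obj (op Δ))
    (t : _root_.stdSimplex ℝ (Fin (Δ.len + 1))) : SSet.toTop.obj X :=
  TopCat.toSSetObjEquiv _ _ ((singularUnit X).app (op Δ) x) t

theorem continuous_point {Δ : SimplexCategory} (x : X.obj (op Δ)) : Continuous (point x) :=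
  (TopCat.toSSetObjEquiv _ _ ((singularUnit X).app (op Δ) x)).continuous

theorem point_map {Δ Δ' : SimplexCategory} (θ : Δ' ⟶ Δ) (x : X.obj (op Δ))
    (t : _root_.stdSimplex ℝ (Fin (Δ'.len + 1))) :
    point (X.map θ.op x) t = point x (stdSimplex.map θ t) := by
  have h := NatTrans.naturality_apply (singularUnit X) θ.op x
  rw [point, h, point]
  exact TopCat.toSSetObjEquiv_naturality_apply θ _ t

theorem toTop_map_point (f : X ⟶ Y) {Δ : SimplexCategory} (x : X.obj (op Δ))
    (t : _root_.stdSimplex ℝ (Fin (Δ.len + 1))) :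
    SSet.toTop.map f (point x t) = point (f.app _ x) t :=
  (congrArg (fun g : X ⟶ TopCat.toSSet.obj (SSet.toTop.obj Y) =>
    TopCat.toSSetObjEquiv _ _ (g.app (op Δ) x) t) (sSetTopAdj.unit.naturality f)).symm

/-- A map out of a geometric realization is given by compatible maps on the simplices. -/
theorem exists_point_eq {Z : TopCat.{u}} (g : X ⟶ TopCat.toSSet.obj Z) :
    ∃ f : SSet.toTop.obj X ⟶ Z, ∀ {Δ : SimplexCategory} (x : X.obj (op Δ)) t,
      f (point x t) = TopCat.toSSetObjEquiv _ _ (g.app _ x) t := by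
  refine ⟨(sSetTopAdj.homEquiv _ _).symm g, fun {Δ} x t => ?_⟩
  have h : sSetTopAdj.unit.app X ≫ TopCat.toSSet.map ((sSetTopAdj.homEquiv _ _).symm g) = g :=
    (sSetTopAdj.homEquiv_unit _ _ _).symm.trans ((sSetTopAdj.homEquiv _ _).apply_symm_apply g)
  conv_rhs => rw [← h]
  rfl

theorem hom_ext_point {Z : TopCat.{u}} {f g : SSet.toTop.obj X ⟶ Z}
    (h : ∀ {Δ : SimplexCategory} (x : X.obj (op Δ)) t, f (point x t) = g (point x t)) : f = g := by
  refine (sSetTopAdj.homEquiv _ _).injective (NatTrans.ext (funext fun Δ => ?_))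
  ext x
  refine (TopCat.toSSetObjEquiv _ _).injective (ContinuousMap.ext fun t => ?_)
  rw [sSetTopAdj.homEquiv_unit, sSetTopAdj.homEquiv_unit]
  exact h (Δ := Δ.unop) x t

/-- A point depends only on the face spanned by the vertices with nonzero coordinates: it may be
transported along a map of vertices which is monotone on these. -/
theorem point_eq_of_support {Δ Δ' : SimplexCategory} (x : X.obj (op Δ)) (y : X.obj (op Δ'))
    (t : _root_.stdSimplex ℝ (Fin (Δ.len + 1))) (φ : Fin (Δ.len + 1) → Fin (Δ'.len + 1))
    (hφ : ∀ i j, i ≤ j → t i ≠ 0 → t j ≠ 0 → φ i ≤ φ j)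
    (h : ∀ (Δ'' : SimplexCategory) (r : Δ'' ⟶ Δ) (r' : Δ'' ⟶ Δ'), (∀ i, t (r i) ≠ 0) →
      (∀ i, r' i = φ (r i)) → X.map r.op x = X.map r'.op y) :
    point x t = point y (stdSimplex.map φ t) := by
  classical
  let S := Finset.univ.filter (fun i => t i ≠ 0)
  have hS : S.Nonempty := by
    by_contra hS
    have h1 : ∑ i, t i = 1 := t.2.2
    have h2 : ∑ i, t i = 0 := Finset.sum_eq_zero fun i _ => by
      by_contra h3
      exact hS ⟨i, Finset.mem_filter.2 ⟨Finset.mem_univ _, h3⟩⟩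
    exact zero_ne_one (h2.symm.trans h1)
  obtain ⟨c, hc⟩ := Nat.exists_eq_succ_of_ne_zero (Finset.card_pos.2 hS).ne'
  let o := S.orderEmbOfFin hc
  have ho : ∀ i, t (o i) ≠ 0 := fun i => (Finset.mem_filter.1 (S.orderEmbOfFin_mem hc i)).2
  let r : SimplexCategory.mk c ⟶ Δ := SimplexCategory.Hom.mk o.toOrderHom
  let r' : SimplexCategory.mk c ⟶ Δ' :=
    SimplexCategory.Hom.mk ⟨fun i => φ (o i), fun i j hij => hφ _ _ (o.monotone hij) (ho i) (ho j)⟩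
  have hsum : ∀ f : Fin (Δ.len + 1) → ℝ, (∀ i, t i = 0 → f i = 0) → ∑ i, f (o i) = ∑ i, f i := by
    intro f hf
    rw [← Finset.sum_image (f := f) (s := Finset.univ) (g := o) (fun _ _ _ _ h => o.injective h),
      Finset.image_orderEmbOfFin_univ]
    refine Finset.sum_subset (Finset.subset_univ _) fun i _ hi => hf i ?_
    by_contra h3
    exact hi (Finset.mem_filter.2 ⟨Finset.mem_univ _, h3⟩)
  let t' : _root_.stdSimplex ℝ (Fin (c + 1)) :=
    ⟨fun i => t (o i), fun i => t.2.1 _, (hsum t fun _ h => h).trans t.2.2⟩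
  have ht : t = stdSimplex.map r t' := by
    ext i
    rw [stdSimplex.map_coe, FunOnFinite.linearMap_apply_apply, Finset.sum_filter]
    refine Eq.trans ?_ (hsum (fun j => if j = i then t j else 0) fun j hj => by simp [hj]).symm
    simp
  have e : X.map r.op x = X.map r'.op y := h _ r r' ho fun _ => rfl
  rw [ht, ← point_map, e, point_map, stdSimplex.map_comp_apply]
  rfl

end SSet

/-! ### The prism over a simplex -/

namespace Prism

section

variable {k : ℕ} (t : stdSimplex ℝ (Fin (k + 1))) (s : ℝ)

/-- The part of the weight `t i` lying below `s`, when the interval `[0, 1]` is divided into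
consecutive intervals of lengths `t 0, …, t k`. -/
def lower (i : Fin (k + 1)) : ℝ :=
  min s (∑ j with j ≤ i, t j) - min s (∑ j with j < i, t j)

theorem sum_le_eq (i : Fin (k + 1)) :
    ∑ j with j ≤ i, t j = t i + ∑ j with j < i, t j := by
  have : Finset.univ.filter (fun j => j ≤ i) = insert i (Finset.univ.filter (fun j => j < i)) := by
    ext j
    simp [le_iff_eq_or_lt]
  rw [this, Finset.sum_insert (by simp)]

variable {t s}

theorem lower_nonneg (i : Fin (k + 1)) : 0 ≤ lower t s i := by
  have h1 := sum_le_eq t i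
  have h2 : 0 ≤ t i := t.2.1 i
  rw [lower, sub_nonneg]
  exact min_le_min_left _ (by linarith)

theorem lower_le (i : Fin (k + 1)) : lower t s i ≤ t i := by
  have h1 := sum_le_eq t i
  have h2 : 0 ≤ t i := t.2.1 i
  rw [lower, h1]
  rcases le_total s (∑ j with j < i, t j) with h | h
  · rw [min_eq_left h]
    linarith [min_le_left s (t i + ∑ j with j < i, t j)]
  · rw [min_eq_right h]
    linarith [min_le_right s (t i + ∑ j with j < i, t j)]

theorem lt_of_lower_ne_zero {i : Fin (k + 1)} (h : lower t s i ≠ 0) : ∑ j with j < i, t j < s := by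
  by_contra h'
  have h1 := sum_le_eq t i
  have h2 : 0 ≤ t i := t.2.1 i
  exact h (by rw [lower, min_eq_left (by linarith), min_eq_left (by linarith), sub_self])

theorem lt_of_sub_lower_ne_zero {i : Fin (k + 1)} (h : t i - lower t s i ≠ 0) :
    s < ∑ j with j ≤ i, t j := by
  by_contra h'
  have h1 := sum_le_eq t i
  have h2 : 0 ≤ t i := t.2.1 i
  exact h (by rw [lower, min_eq_right (by linarith), min_eq_right (by linarith)]; linarith)

/-- An initial segment of the vertices has total lower weight equal to the part of its total weight
below `s`. -/
theorem sum_lower (hs : 0 ≤ s) (D : Finset (Fin (k + 1))) :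
    (∀ i ∈ D, ∀ j ≤ i, j ∈ D) → ∑ i ∈ D, lower t s i = min s (∑ i ∈ D, t i) := by
  induction D using Finset.induction_on_max with
  | empty => simp [hs]
  | insert m D hm ih =>
    intro hD
    have e1 : D = Finset.univ.filter (fun j => j < m) := by
      ext j
      refine ⟨fun hj => by simpa using hm j hj, fun hj => ?_⟩
      have hj' : j < m := by simpa using hj
      exact (Finset.mem_insert.1 (hD m (Finset.mem_insert_self _ _) j hj'.le)).resolve_left hj'.ne
    have hmD : m ∉ D := fun h => (hm m h).false
    have ih' := ih fun i hi j hj => by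
      rw [e1] at hi ⊢
      simp only [Finset.mem_filter, Finset.mem_univ, true_and] at hi ⊢
      exact hj.trans_lt hi
    rw [Finset.sum_insert hmD, Finset.sum_insert hmD, ih', lower, sum_le_eq, e1]
    ring

theorem sum_lower_fiber (hs : 0 ≤ s) {l : ℕ} (θ : Fin (k + 1) →o Fin (l + 1)) (i : Fin (l + 1)) :
    ∑ j with θ j = i, lower t s j = lower (stdSimplex.map θ t) s i := by
  have h1 : ∀ P : Fin (l + 1) → Prop, ∀ [DecidablePred P], ∀ f : Fin (k + 1) → ℝ,
      ∑ a with P a, ∑ j with θ j = a, f j = ∑ j with P (θ j), f j := fun P _ f => by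
    rw [← Finset.sum_fiberwise_of_maps_to (s := Finset.univ.filter fun j => P (θ j))
      (t := Finset.univ.filter P) (g := θ) (fun j hj => by simpa using hj)]
    refine Finset.sum_congr rfl fun a ha => Finset.sum_congr ?_ fun _ _ => rfl
    have ha' : P a := by simpa using ha
    ext j
    simp only [Finset.mem_filter, Finset.mem_univ, true_and]
    exact ⟨fun h => ⟨h ▸ ha', h⟩, fun h => h.2⟩
  have h2 : ∀ P : Fin (l + 1) → Prop, ∀ [DecidablePred P], (∀ a, P a → ∀ b ≤ a, P b) →
      min s (∑ a with P a, stdSimplex.map θ t a) = ∑ j with P (θ j), lower t s j :=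
    fun P _ hP => by
    rw [sum_lower hs]
    · rw [← h1 P]
      simp only [stdSimplex.map_coe, FunOnFinite.linearMap_apply_apply]
    · intro a ha b hb
      simp only [Finset.mem_filter, Finset.mem_univ, true_and] at ha ⊢
      exact hP _ ha _ (θ.monotone hb)
  rw [lower, h2 (· ≤ i) (fun a ha b hb => hb.trans ha),
    h2 (· < i) (fun a ha b hb => hb.trans_lt ha)]
  have h3 : Finset.univ.filter (fun j => θ j ≤ i) =
      Finset.univ.filter (fun j => θ j = i) ∪ Finset.univ.filter (fun j => θ j < i) := by
    ext j
    simp [le_iff_eq_or_lt]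
  rw [h3, Finset.sum_union]
  · ring
  · rw [Finset.disjoint_filter]
    exact fun j _ h h' => h'.ne h

variable (t s) in
/-- The weights of a point of the prism: every weight `t i` is divided into the part below `s` and
the part above `s`. -/
def weight : stdSimplex ℝ (Fin (k + 1) × Fin 2) :=
  ⟨fun p => if p.2 = 0 then lower t s p.1 else t p.1 - lower t s p.1, fun p => by
    dsimp only
    split_ifs
    · exact lower_nonneg _
    · exact sub_nonneg.2 (lower_le _), by
    rw [Fintype.sum_prod_type]
    simp only [Fin.sum_univ_two]
    refine Eq.trans (Finset.sum_congr rfl fun i _ => ?_) t.2.2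
    simp [show ∀ x : stdSimplex ℝ (Fin (k + 1)), x.1 i = x i from fun _ => rfl]⟩

theorem weight_zero (i : Fin (k + 1)) : weight t s (i, 0) = lower t s i := rfl

theorem weight_one (i : Fin (k + 1)) : weight t s (i, 1) = t i - lower t s i := rfl

/-- The vertices with nonzero weights form a chain. -/
theorem snd_le_of_weight_ne_zero {p q : Fin (k + 1) × Fin 2} (hpq : p.1 < q.1)
    (hp : weight t s p ≠ 0) (hq : weight t s q ≠ 0) : p.2 ≤ q.2 := by
  by_contra h
  obtain ⟨i, a⟩ := p
  obtain ⟨j, b⟩ := q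
  obtain ⟨rfl, rfl⟩ : a = 1 ∧ b = 0 := by
    dsimp only at h
    omega
  have h1 := lt_of_sub_lower_ne_zero hp
  have h2 := lt_of_lower_ne_zero hq
  have h3 : ∑ l with l ≤ i, t l ≤ ∑ l with l < j, t l :=
    Finset.sum_le_sum_of_subset_of_nonneg (fun l hl => by
      simp only [Finset.mem_filter, Finset.mem_univ, true_and] at hl ⊢
      exact hl.trans_lt hpq) fun l _ _ => t.2.1 l
  exact absurd (h1.trans_le h3) (lt_asymm h2)

theorem map_fst_weight : stdSimplex.map Prod.fst (weight t s) = t := by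
  ext i
  rw [stdSimplex.map_coe, FunOnFinite.linearMap_apply_apply, Finset.sum_filter,
    Fintype.sum_prod_type]
  simp [Fin.sum_univ_two, weight_zero, weight_one, Finset.sum_add_distrib]

/-- The weights of a prism are compatible with degeneracies and faces, because the vertices
with the same image under a monotone map occupy adjacent intervals. -/
theorem map_weight (hs : 0 ≤ s) {l : ℕ} (θ : Fin (k + 1) →o Fin (l + 1)) :
    stdSimplex.map (Prod.map θ id) (weight t s) = weight (stdSimplex.map θ t) s := by
  ext ⟨i, a⟩
  have h : ∀ f : Fin (k + 1) × Fin 2 → ℝ, ∑ p with Prod.map θ id p = (i, a), f p =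
      ∑ j with θ j = i, f (j, a) := fun f => by
    rw [Finset.sum_filter, Fintype.sum_prod_type, Finset.sum_filter]
    refine Finset.sum_congr rfl fun j _ => ?_
    simp [Prod.ext_iff, ite_and]
  rw [stdSimplex.map_coe, FunOnFinite.linearMap_apply_apply, h]
  fin_cases a
  · exact sum_lower_fiber hs θ i
  · refine Eq.trans (Finset.sum_sub_distrib _ _) ?_
    refine (congrArg₂ _ ?_ (sum_lower_fiber hs θ i)).trans (weight_one i).symm
    rw [stdSimplex.map_coe, FunOnFinite.linearMap_apply_apply]

theorem weight_at_zero (i : Fin (k + 1)) : weight t 0 (i, 0) = 0 := by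
  rw [weight_zero, lower, min_eq_left, min_eq_left, sub_self]
  all_goals exact Finset.sum_nonneg fun j _ => t.2.1 j

theorem weight_at_one (i : Fin (k + 1)) : weight t 1 (i, 1) = 0 := by
  have h : ∀ S : Finset (Fin (k + 1)), ∑ j ∈ S, t j ≤ 1 := fun S =>
    (Finset.sum_le_sum_of_subset_of_nonneg (Finset.subset_univ S) fun l _ _ => t.2.1 l).trans_eq
      t.2.2
  rw [weight_one, lower, min_eq_right (h _), min_eq_right (h _), sum_le_eq]
  ring

end

theorem continuous_weight (k : ℕ) :
    Continuous fun p : stdSimplex ℝ (Fin (k + 1)) × ℝ => weight p.1 p.2 := by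
  have h : ∀ S : Finset (Fin (k + 1)),
      Continuous fun p : stdSimplex ℝ (Fin (k + 1)) × ℝ => ∑ j ∈ S, p.1 j := fun S =>
    continuous_finsetSum _ fun j _ => (continuous_apply j).comp
      (continuous_subtype_val.comp continuous_fst)
  have h' : ∀ i : Fin (k + 1),
      Continuous fun p : stdSimplex ℝ (Fin (k + 1)) × ℝ => lower p.1 p.2 i := fun i =>
    (continuous_snd.min (h _)).sub (continuous_snd.min (h _))
  refine Continuous.subtype_mk (continuous_pi fun p => ?_) _
  obtain ⟨i, a⟩ := p
  fin_cases a
  · exact h' i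
  · exact ((continuous_apply i).comp (continuous_subtype_val.comp continuous_fst)).sub (h' i)

/-- The lexicographic order on the vertices of the prism. -/
def vertexEquiv (k : ℕ) : Fin (k + 1) × Fin 2 ≃ Fin (2 * k + 1 + 1) :=
  finProdFinEquiv.trans (finCongr (by ring))

theorem vertexEquiv_val {k : ℕ} (p : Fin (k + 1) × Fin 2) :
    (vertexEquiv k p : ℕ) = p.2 + 2 * p.1 := rfl

theorem fst_le_of_vertexEquiv_le {k : ℕ} {p q : Fin (k + 1) × Fin 2}
    (h : vertexEquiv k p ≤ vertexEquiv k q) : p.1 ≤ q.1 := by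
  rw [Fin.le_def, vertexEquiv_val, vertexEquiv_val] at h
  rw [Fin.le_def]
  omega

theorem snd_le_of_vertexEquiv_le {k : ℕ} {t : stdSimplex ℝ (Fin (k + 1))} {s : ℝ}
    {p q : Fin (k + 1) × Fin 2} (h : vertexEquiv k p ≤ vertexEquiv k q) (hp : weight t s p ≠ 0)
    (hq : weight t s q ≠ 0) : p.2 ≤ q.2 := by
  rcases (fst_le_of_vertexEquiv_le h).eq_or_lt with h' | h'
  · rw [Fin.le_def, vertexEquiv_val, vertexEquiv_val, h'] at h
    rw [Fin.le_def]
    omega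
  · exact snd_le_of_weight_ne_zero h' hp hq

theorem vertexEquiv_mono {k : ℕ} {p q : Fin (k + 1) × Fin 2} (h : p.1 ≤ q.1) (h' : p.2 ≤ q.2) :
    vertexEquiv k p ≤ vertexEquiv k q := by
  rw [Fin.le_def, vertexEquiv_val, vertexEquiv_val]
  rw [Fin.le_def] at h h'
  omega

end Prism

/-! ### Homotopies of geometric realizations -/

namespace Prism

/-- The projection from the vertices of the prism, in lexicographic order, to the vertices of the
simplex. -/
def proj (Δ : SimplexCategory) : SimplexCategory.mk (2 * Δ.len + 1) ⟶ Δ :=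
  SimplexCategory.Hom.mk ⟨fun j => ((vertexEquiv Δ.len).symm j).1, fun i j h =>
    fst_le_of_vertexEquiv_le (by simpa using h)⟩

/-- The end of the prism on which a vertex lies. -/
def side (k : ℕ) (j : Fin (2 * k + 1 + 1)) : Fin 2 := ((vertexEquiv k).symm j).2

/-- The weights of a point of the prism, indexed by the vertices in lexicographic order. -/
noncomputable def coords {k : ℕ} (t : stdSimplex ℝ (Fin (k + 1))) (s : ℝ) :
    stdSimplex ℝ (Fin (2 * k + 1 + 1)) :=
  stdSimplex.map (vertexEquiv k) (weight t s)

theorem coords_apply {k : ℕ} (t : stdSimplex ℝ (Fin (k + 1))) (s : ℝ)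
    (j : Fin (2 * k + 1 + 1)) : coords t s j = weight t s ((vertexEquiv k).symm j) := by
  rw [coords, stdSimplex.map_coe, FunOnFinite.linearMap_apply_apply, Finset.sum_filter,
    Finset.sum_eq_single ((vertexEquiv k).symm j)]
  · simp
  · intro p _ hp
    exact if_neg fun h => hp ((Equiv.eq_symm_apply _).2 h)
  · simp

end Prism

namespace SSet

open Prism

/-- A homotopy between the identity and `p ≫ i`, where `i` is a section of `p`. For a simplex `x`,
a sequence `q` of vertices of `x` and a sequence `ε` of elements of `{0, 1}`, it provides a simplex
whose `j`-th vertex is that of `x`, respectively of `(p ≫ i) x`, according to `ε j`. Since `ε` need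
not be monotone, this is more than a simplicial homotopy. -/
structure PrismHomotopy {X Y : SSet.{u}} (p : X ⟶ Y) (i : Y ⟶ X) where
  /-- the simplex with given vertices -/
  H : ∀ {Δ Δ' : SimplexCategory} (_ : Δ' ⟶ Δ) (_ : Fin (Δ'.len + 1) → Fin 2),
    X.obj (op Δ) → X.obj (op Δ')
  map_H : ∀ {Δ Δ' Δ'' : SimplexCategory} (θ : Δ'' ⟶ Δ') (q : Δ' ⟶ Δ)
    (ε : Fin (Δ'.len + 1) → Fin 2) (x : X.obj (op Δ)),
    X.map θ.op (H q ε x) = H (θ ≫ q) (fun j => ε (θ j)) x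
  H_map : ∀ {Δ Δ' Δ'' : SimplexCategory} (θ : Δ' ⟶ Δ) (q : Δ'' ⟶ Δ')
    (ε : Fin (Δ''.len + 1) → Fin 2) (x : X.obj (op Δ)),
    H q ε (X.map θ.op x) = H (q ≫ θ) ε x
  H_zero : ∀ {Δ Δ' : SimplexCategory} (q : Δ' ⟶ Δ) (x : X.obj (op Δ)),
    H q (fun _ => 0) x = X.map q.op (i.app _ (p.app _ x))
  H_one : ∀ {Δ Δ' : SimplexCategory} (q : Δ' ⟶ Δ) (x : X.obj (op Δ)),
    H q (fun _ => 1) x = X.map q.op x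

namespace PrismHomotopy

variable {X Y : SSet.{u}} {p : X ⟶ Y} {i : Y ⟶ X} (h : PrismHomotopy p i)

/-- The homotopy on the points of a simplex. -/
noncomputable def path {Δ : SimplexCategory} (x : X.obj (op Δ))
    (t : _root_.stdSimplex ℝ (Fin (Δ.len + 1))) (s : ℝ) : SSet.toTop.obj X :=
  point (h.H (proj Δ) (side Δ.len) x) (coords t s)

theorem path_map {Δ Δ' : SimplexCategory} (θ : Δ' ⟶ Δ) (x : X.obj (op Δ))
    (t : _root_.stdSimplex ℝ (Fin (Δ'.len + 1))) {s : ℝ} (hs : 0 ≤ s) :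
    h.path (X.map θ.op x) t s = h.path x (stdSimplex.map θ t) s := by
  let φ : Fin (2 * Δ'.len + 1 + 1) → Fin (2 * Δ.len + 1 + 1) := fun j =>
    vertexEquiv Δ.len (Prod.map θ id ((vertexEquiv Δ'.len).symm j))
  have e : stdSimplex.map φ (coords t s) = coords (stdSimplex.map θ t) s := by
    have mw : stdSimplex.map (Prod.map θ id) (weight t s) = weight (stdSimplex.map θ t) s :=
      map_weight hs (SimplexCategory.Hom.toOrderHom θ)
    rw [coords, coords, stdSimplex.map_comp_apply, ← mw, stdSimplex.map_comp_apply]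
    congr 1
    funext j
    simp [φ]
  rw [path, h.H_map, path, ← e]
  refine point_eq_of_support _ _ _ φ (fun a b hab ha hb => ?_) fun Δ'' r r' _ hr' => ?_
  · rw [coords_apply] at ha hb
    have hab' : vertexEquiv Δ'.len ((vertexEquiv Δ'.len).symm a) ≤
      vertexEquiv Δ'.len ((vertexEquiv Δ'.len).symm b) := by simpa using hab
    have h2 := snd_le_of_vertexEquiv_le hab' ha hb
    exact vertexEquiv_mono ((SimplexCategory.Hom.toOrderHom θ).monotone
      (fst_le_of_vertexEquiv_le hab')) h2
  · have hv : ∀ j, (vertexEquiv Δ.len).symm (r' j) =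
        Prod.map θ id ((vertexEquiv Δ'.len).symm (r j)) := fun j => by
      rw [hr', Equiv.symm_apply_apply]
    have e1 : r ≫ proj Δ' ≫ θ = r' ≫ proj Δ := by
      ext j : 3
      exact congrArg Prod.fst (hv j).symm
    have e2 : (fun j => side Δ'.len (r j)) = fun j => side Δ.len (r' j) :=
      funext fun j => congrArg Prod.snd (hv j).symm
    rw [h.map_H, h.map_H, e1, e2]

/-- If only vertices on one end of the prism have nonzero weights, the homotopy is at the
corresponding end. -/
theorem path_eq_of_support {Δ : SimplexCategory} (x y : X.obj (op Δ))
    (t : _root_.stdSimplex ℝ (Fin (Δ.len + 1))) {s : ℝ} (c : Fin 2)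
    (hc : ∀ p, weight t s p ≠ 0 → p.2 = c)
    (hy : ∀ {Δ' : SimplexCategory} (q : Δ' ⟶ Δ), h.H q (fun _ => c) x = X.map q.op y) :
    h.path x t s = point y t := by
  let φ : Fin (2 * Δ.len + 1 + 1) → Fin (Δ.len + 1) := fun j => ((vertexEquiv Δ.len).symm j).1
  have e : stdSimplex.map φ (coords t s) = t := by
    refine Eq.trans ?_ (map_fst_weight (t := t) (s := s))
    rw [coords, stdSimplex.map_comp_apply]
    congr 1
    funext j
    simp [φ]
  conv_rhs => rw [← e]
  refine point_eq_of_support _ _ _ φ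
    (fun a b hab _ _ => fst_le_of_vertexEquiv_le (by simpa using hab)) fun Δ'' r r' hr hr' => ?_
  have e1 : r ≫ proj Δ = r' := by
    ext j : 3
    exact (hr' j).symm
  have e2 : (fun j => side Δ.len (r j)) = fun _ => c := funext fun j => by
    refine hc _ ?_
    rw [← coords_apply]
    exact hr j
  rw [h.map_H, e1, e2, hy]

theorem path_zero {Δ : SimplexCategory} (x : X.obj (op Δ))
    (t : _root_.stdSimplex ℝ (Fin (Δ.len + 1))) : h.path x t 0 = point x t :=
  h.path_eq_of_support x x t 1 (fun ⟨a, c⟩ hp => by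
    fin_cases c
    · exact absurd (weight_at_zero a) hp
    · rfl) fun q => h.H_one q x

theorem path_one {Δ : SimplexCategory} (x : X.obj (op Δ))
    (t : _root_.stdSimplex ℝ (Fin (Δ.len + 1))) :
    h.path x t 1 = point (i.app _ (p.app _ x)) t :=
  h.path_eq_of_support x _ t 0 (fun ⟨a, c⟩ hp => by
    fin_cases c
    · rfl
    · exact absurd (weight_at_one a) hp) fun q => h.H_zero q x

/-- The homotopy on the points of a simplex, as a continuous map. -/
noncomputable def pathMap {Δ : SimplexCategory} (x : X.obj (op Δ)) :
    C(_root_.stdSimplex ℝ (Fin (Δ.len + 1)) × ℝ, SSet.toTop.obj X) where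
  toFun a := h.path x a.1 a.2
  continuous_toFun :=
    (continuous_point _).comp ((stdSimplex.continuous_map _).comp (continuous_weight _))

variable (X) in
/-- The space of paths in the geometric realization. -/
noncomputable abbrev pathSpace : TopCat.{u} := TopCat.of C(unitInterval, SSet.toTop.obj X)

/-- The family of paths over a simplex. -/
noncomputable def paths {Δ : SimplexCategory} (x : X.obj (op Δ)) :
    C(_root_.stdSimplex ℝ (Fin (Δ.len + 1)), C(unitInterval, SSet.toTop.obj X)) :=
  ContinuousMap.curry (ContinuousMap.comp (h.pathMap x)
    ((ContinuousMap.id _).prodMap ⟨fun s : unitInterval => (s : ℝ), continuous_subtype_val⟩))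

/-- The homotopy, as a map to the singular simplicial set of the space of paths. -/
noncomputable def toPaths : X ⟶ TopCat.toSSet.obj (pathSpace X) where
  app Δ := ↾fun x => (TopCat.toSSetObjEquiv (pathSpace X) Δ).symm (h.paths (Δ := Δ.unop) x)
  naturality Δ Δ' θ := by
    ext x
    refine (TopCat.toSSetObjEquiv (pathSpace X) Δ').injective (ContinuousMap.ext fun t =>
      ContinuousMap.ext fun s => ?_)
    exact h.path_map θ.unop x t s.2.1

/-- The homotopy is obtained from a map to the space of paths, since maps out of a geometric
realization are given by their restrictions to simplices. -/
theorem homotopic (h : PrismHomotopy p i) : ContinuousMap.Homotopic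
    (((SSet.toTop.map i).hom).comp ((SSet.toTop.map p).hom)) (ContinuousMap.id _) := by
  obtain ⟨f, hf⟩ := exists_point_eq h.toPaths
  have hf' : ∀ {Δ : SimplexCategory} (x : X.obj (op Δ)) t (s : unitInterval),
      f (point x t) s = h.path x t s := fun x t s => congrArg (fun g => g s) (hf x t)
  have e : ∀ s : unitInterval, Continuous fun a => f a s := fun s =>
    (continuous_eval_const s).comp f.hom.continuous
  have h0 : TopCat.ofHom ⟨fun a => f a 0, e 0⟩ = 𝟙 (SSet.toTop.obj X) :=
    hom_ext_point fun x t => (hf' x t 0).trans (h.path_zero x t)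
  have h1 : TopCat.ofHom ⟨fun a => f a 1, e 1⟩ = SSet.toTop.map p ≫ SSet.toTop.map i :=
    hom_ext_point fun x t => (hf' x t 1).trans ((h.path_one x t).trans
      ((toTop_map_point i _ t).symm.trans
        (congrArg (SSet.toTop.map i) (toTop_map_point p x t).symm)))
  refine ContinuousMap.Homotopic.symm ⟨⟨⟨fun a => f a.2 a.1, ?_⟩, fun a => ?_, fun a => ?_⟩⟩
  · exact continuous_eval.comp ((f.hom.continuous.comp continuous_snd).prodMk continuous_fst)
  · exact ConcreteCategory.congr_hom h0 a
  · exact ConcreteCategory.congr_hom h1 a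

theorem isEquivalence (h : PrismHomotopy p i) (hi : i ≫ p = 𝟙 Y) : IsEquivalence p :=
  ⟨{  toFun := (SSet.toTop.map p).hom
      invFun := (SSet.toTop.map i).hom
      left_inv := h.homotopic
      right_inv := by
        have e : SSet.toTop.map i ≫ SSet.toTop.map p = 𝟙 _ := by
          rw [← Functor.map_comp, hi, CategoryTheory.Functor.map_id]
        have e' : ((SSet.toTop.map p).hom).comp ((SSet.toTop.map i).hom) = ContinuousMap.id _ :=
          congrArg TopCat.Hom.hom e
        rw [e'] }, rfl⟩

end PrismHomotopy

end SSet

/-! ### Simplicial sets of tuples in fibers -/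

namespace SSet

/-- A simplicial set `X` whose simplices are the tuples of vertices, in a simplicial set `O` over
`Y`, with the same image in `Y`. -/
structure IsFiberTuples {X Y O : SSet.{u}} (p : X ⟶ Y) (π : O ⟶ Y)
    (v : ∀ {Δ : SimplexCategory}, X.obj (op Δ) → Fin (Δ.len + 1) → O.obj (op Δ)) : Prop where
  map : ∀ {Δ Δ' : SimplexCategory} (θ : Δ' ⟶ Δ) (x : X.obj (op Δ)) (j : Fin (Δ'.len + 1)),
    v (X.map θ.op x) j = O.map θ.op (v x (θ j))
  proj_eq : ∀ {Δ : SimplexCategory} (x : X.obj (op Δ)) (j : Fin (Δ.len + 1)),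
    π.app _ (v x j) = p.app _ x
  inj : ∀ {Δ : SimplexCategory} {x y : X.obj (op Δ)}, (∀ j, v x j = v y j) → x = y
  surj : ∀ {Δ : SimplexCategory} (y : Y.obj (op Δ)) (f : Fin (Δ.len + 1) → O.obj (op Δ)),
    (∀ j, π.app _ (f j) = y) → ∃ x, ∀ j, v x j = f j

namespace IsFiberTuples

variable {X Y O : SSet.{u}} {p : X ⟶ Y} {π : O ⟶ Y}
  {v : ∀ {Δ : SimplexCategory}, X.obj (op Δ) → Fin (Δ.len + 1) → O.obj (op Δ)}

theorem exists_section (h : IsFiberTuples p π v) {g : Y ⟶ O} (hg : g ≫ π = 𝟙 Y) :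
    ∃ i : Y ⟶ X, ∀ {Δ : SimplexCategory} (y : Y.obj (op Δ)) j, v (i.app _ y) j = g.app _ y := by
  choose i hi using fun (Δ : SimplexCategory) (y : Y.obj (op Δ)) =>
    h.surj y (fun _ => g.app _ y) fun _ => ConcreteCategory.congr_hom (NatTrans.congr_app hg _) y
  refine ⟨{ app := fun Δ => ↾(fun y => i Δ.unop y), naturality := fun Δ Δ' θ => ?_ },
    fun y j => hi _ y j⟩
  ext y
  refine h.inj (Δ := Δ'.unop) fun j => ?_
  refine (hi Δ'.unop _ j).trans (Eq.trans ?_ (h.map θ.unop (i Δ.unop y) j).symm)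
  rw [hi]
  exact NatTrans.naturality_apply g θ y

/-- The simplex whose vertices are the given ones or the values of the section: any choice is
allowed, since all have the same image. -/
theorem exists_prism (h : IsFiberTuples p π v) {g : Y ⟶ O} (hg : g ≫ π = 𝟙 Y)
    {Δ Δ' : SimplexCategory} (q : Δ' ⟶ Δ) (ε : Fin (Δ'.len + 1) → Fin 2) (x : X.obj (op Δ)) :
    ∃ y : X.obj (op Δ'), ∀ j, v y j =
      if ε j = 0 then O.map q.op (g.app _ (p.app _ x)) else O.map q.op (v x (q j)) := by
  refine h.surj (Y.map q.op (p.app _ x)) _ fun j => ?_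
  have hπ : ∀ z : O.obj (op Δ), π.app _ (O.map q.op z) = Y.map q.op (π.app _ z) := fun z =>
    NatTrans.naturality_apply π q.op z
  split_ifs
  · rw [hπ]
    exact congrArg (Y.map q.op) (ConcreteCategory.congr_hom (NatTrans.congr_app hg _) _)
  · rw [hπ, h.proj_eq]

/-- The homotopy replaces the vertices of a simplex one by one by the values of the section `g`. -/
theorem isEquivalence (h : IsFiberTuples p π v) {g : Y ⟶ O} (hg : g ≫ π = 𝟙 Y) :
    IsEquivalence p := by
  obtain ⟨i, hi⟩ := h.exists_section hg
  have hgp : ∀ {Δ : SimplexCategory} (y : Y.obj (op Δ)), π.app _ (g.app _ y) = y := fun y =>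
    ConcreteCategory.congr_hom (NatTrans.congr_app hg _) y
  have hip : i ≫ p = 𝟙 Y := by
    ext Δ y
    refine (h.proj_eq (Δ := Δ.unop) (i.app _ y) 0).symm.trans ?_
    rw [hi (Δ := Δ.unop)]
    exact hgp (Δ := Δ.unop) y
  have hO : ∀ {Δ Δ' Δ'' : SimplexCategory} (θ : Δ'' ⟶ Δ') (q : Δ' ⟶ Δ) (x : O.obj (op Δ)),
      O.map θ.op (O.map q.op x) = O.map (θ ≫ q).op x := fun θ q x =>
    (ConcreteCategory.congr_hom (O.map_comp q.op θ.op) x).symm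
  choose H hH using fun (Δ Δ' : SimplexCategory) (q : Δ' ⟶ Δ) ε x => h.exists_prism hg q ε x
  have K : PrismHomotopy p i :=
    { H := fun q ε x => H _ _ q ε x
      map_H := fun θ q ε x => h.inj fun j => by
        rw [h.map, hH, hH]
        split_ifs
        · rw [hO]
        · rw [hO]
          rfl
      H_map := fun θ q ε x => h.inj fun j => by
        have e : p.app _ (X.map θ.op x) = Y.map θ.op (p.app _ x) :=
          NatTrans.naturality_apply p θ.op x
        have e' : ∀ y, g.app _ (Y.map θ.op y) = O.map θ.op (g.app _ y) := fun y =>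
          NatTrans.naturality_apply g θ.op y
        rw [hH, hH, e, e', h.map, hO, hO]
        rfl
      H_zero := fun q x => h.inj fun j => by
        rw [hH, h.map, hi]
        simp
      H_one := fun q x => h.inj fun j => by
        rw [hH, h.map]
        simp }
  exact K.isEquivalence hip

end IsFiberTuples

end SSet

/-! ### The projection from `C̄` to `C` -/

namespace Operad

/-- Formal operations, in each simplicial degree. -/
def freeOps (C : SimplicialObject Operad.{w}) (n : ℕ) : SSet.{w} where
  obj Δ := (free (C.obj Δ)).Ops n
  map θ := ↾fun σ => (freeMap (C.map θ)).map σ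
  map_id Δ := by
    ext σ
    exact Subtype.ext ((congrArg (fun F => σ.1.mapOps F) (C.map_id Δ)).trans (Tree.mapOps_id σ.1))
  map_comp θ θ' := by
    ext σ
    exact Subtype.ext ((congrArg (fun F => σ.1.mapOps F) (C.map_comp θ θ')).trans
      (Tree.mapOps_comp _ _ σ.1))

/-- The image of formal operations, in each simplicial degree. -/
noncomputable def freeOpsImage (C : SimplicialObject Operad.{w}) (n : ℕ) :
    freeOps C n ⟶ C ⋙ opsFunctor n where
  app Δ := ↾fun σ => (freeCounit (C.obj Δ)).map σ
  naturality _ _ θ := by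
    ext σ
    exact freeCounit_freeMap (C.map θ) σ

/-- The generators, in each simplicial degree. -/
def freeOpsGen (C : SimplicialObject Operad.{w}) (n : ℕ) : C ⋙ opsFunctor n ⟶ freeOps C n where
  app Δ := ↾fun μ => gen (C := C.obj Δ) μ
  naturality _ _ _ := rfl

theorem freeOpsGen_freeOpsImage (C : SimplicialObject Operad.{w}) (n : ℕ) :
    freeOpsGen C n ≫ freeOpsImage C n = 𝟙 _ := by
  ext Δ μ
  exact freeCounit_gen (C := C.obj Δ) μ

theorem exists_chain {C : Operad.{w}} {n k : ℕ} (μ : C.Ops n) (f : Fin (k + 1) → (free C).Ops n)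
    (hf : ∀ j, (freeCounit C).map (f j) = μ) :
    ∃ c : Fin (k + 1) ⥤ Coh C n, ∀ j, (c.obj j).op = f j :=
  ⟨{ obj := fun j => ⟨f j⟩
     map := fun {i j} _ => Coh.homMk ((hf i).trans (hf j).symm) }, fun _ => rfl⟩

theorem image_eq_zero {C : Operad.{w}} {n k : ℕ} (c : Fin (k + 1) ⥤ Coh C n) (j : Fin (k + 1)) :
    (c.obj j).image = (c.obj 0).image :=
  (Coh.image_eq (c.map (homOfLE (Fin.zero_le j)))).symm

theorem isEquivalence_barDiagProj (C : SimplicialObject Operad.{w}) (n : ℕ) :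
    IsEquivalence (Functor.whiskerRight (Operad.barDiagProj C) (Operad.opsFunctor n)) :=
  SSet.IsFiberTuples.isEquivalence (π := freeOpsImage C n)
    (v := fun {Δ} (c : Fin (Δ.len + 1) ⥤ Coh (C.obj (op Δ)) n) j => (c.obj j).op)
    { map := fun _ _ _ => rfl
      proj_eq := fun c j => image_eq_zero (C := C.obj _) c j
      inj := fun h => Coh.chain_ext (C := C.obj _) h
      surj := fun μ f hf => exists_chain (C := C.obj _) μ f hf }
    (freeOpsGen_freeOpsImage C n)

theorem isEquivalence_barProj (C : Operad.{w}) (n : ℕ) :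
    IsEquivalence (Functor.whiskerRight (Operad.barProj C) (Operad.opsFunctor n)) :=
  SSet.IsFiberTuples.isEquivalence (O := (Functor.const _).obj ((free C).Ops n))
    (π := { app := fun _ => ↾fun σ => (freeCounit C).map σ })
    (g := { app := fun _ => ↾fun μ => gen μ })
    (v := fun {Δ} (c : Fin (Δ.len + 1) ⥤ Coh C n) j => (c.obj j).op)
    { map := fun _ _ _ => rfl
      proj_eq := fun c j => image_eq_zero (C := C) c j
      inj := fun h => Coh.chain_ext (C := C) h
      surj := fun μ f hf => exists_chain (C := C) μ f hf }
    (by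
      ext Δ μ
      exact freeCounit_gen μ)

end Operad

theorem mainTheorem8 :
    (∀ (C : Operad.{w}) (n : ℕ),
      Operad.bar C ⋙ Operad.opsFunctor n = nerve (Operad.Coh C n) ∧
      IsEquivalence (Functor.whiskerRight (Operad.barProj C) (Operad.opsFunctor n))) ∧
    (∀ (C : SimplicialObject Operad.{w}) (n : ℕ),
      IsEquivalence (Functor.whiskerRight (Operad.barDiagProj C) (Operad.opsFunctor n))) ∧
    (∀ (C : Operad.{w}) (Γ : Type u) [Category.{v} Γ] (L : LaxAlgebra C Γ),
      ∃! A : SimplicialAlgebra (Operad.bar C) (nerve Γ), IsCanonical L A) ∧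
    (∀ (B : Type u) [Category.{v} B] [MonoidalCategory B] [SymmetricCategory B] [HasPullbacks B],
      (∀ (C : Operad.{w}) (Γ : CatObj B) (L : EnhancedLaxAlgebra C Γ),
        ∃! A : EnhancedSimplicialAlgebra (Operad.bar C) Γ.nerve, IsCanonicalEnhanced L A) ∧
      (∀ G : SimplicialObject (LaxPair.{w} B),
        ∃! A : EnhancedSimplicialAlgebra (Operad.barDiag (G ⋙ LaxPair.operad B)) (nerveDiag G),
          ∀ (Δ : SimplexCategoryᵒᵖ)
            (A' : EnhancedSimplicialAlgebra (Operad.bar (G.obj Δ).C) (G.obj Δ).Γ.nerve),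
            IsCanonicalEnhanced (G.obj Δ).L A' → A.alg Δ = A'.alg Δ)) := by
  refine ⟨fun C n => ⟨Operad.bar_comp_opsFunctor n, Operad.isEquivalence_barProj C n⟩,
    fun C n => Operad.isEquivalence_barDiagProj C n,
    fun C Γ _ L => existsUnique_isCanonical L, fun B _ _ _ _ =>
      ⟨fun C Γ L => existsUnique_isCanonicalEnhanced L, fun G => existsUnique_nerveDiag G⟩⟩
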